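/- **Setting.** Let $M$ be a compact connected smooth Riemannian manifold (without boundary) with Riemannian distance $d(\cdot,\cdot)$, let $r\ge 1$ be an integer, and let $C^r(M,\mathbb K)$, $\mathbb K\in\{\mathbb R,\mathbb C\}$, carry the $C^r$ norm $\|g\|_r=\max_{s\le r}\|D^s g\|_0$, where the derivatives are read in a fixed finite family of smooth charts and $\|\cdot\|_0$ is the maximum of the sup norms over fixed compact subsets of the chart domains that cover $M$. Fix integers $0\le q<\deg$ and reals $\sigma>1$, $L\ge 1$, $\varepsilon_\phi>0$, $\varepsilon'_\phi>0$ with $$e^{\varepsilon_\phi}\,\frac{qL^r+(\deg-q)\sigma^{-1}}{\deg}<1 .$$ Let $\mathcal F^r$ be a family of $C^r$ local diffeomorphisms $f:M\to M$, with the $C^r$ topology, such that every point has exactly $\deg$ preimages under $f$ and there are a continuous function $x\mapsto L_f(x)$ such that every $x\in M$ has an open neighbourhood $U_x$ on which $f$ is injective and $d(y,z)\le L_f(x)\,d(f(y),f(z))$ for $y,z\in U_x$, and an open set $\mathcal A_f\subset M$, with * (H1) $L_f(x)\le L$ for $x\in\mathcal A_f$ and $L_f(x)<\sigma^{-1}$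 for $x\notin\mathcal A_f$; * (H2) $M$ has a finite cover by open sets on which $f$ is injective, at most $q$ of which suffice to cover $\mathcal A_f$. Let $\mathcal W^r\subset C^r(M,\mathbb R)$ be a family of potentials with * (P') $\sup\phi-\inf\phi<\varepsilon_\phi$ and $\|D^s\phi\|_0<\varepsilon'_\phi$ for $1\le s\le r$. For $(f,\phi)\in\mathcal F^r\times\mathcal W^r$ put $\mathcal L_{f,\phi}g(x)=\sum_{f(y)=x}e^{\phi(y)}g(y)$. A *random perturbation* of $(f,\phi)\in\mathcal F^r\times\mathcal W^r$ is a family $(\theta_\varepsilon)_{0<\varepsilon\le1}$ of Borel probability measures on $\mathcal F^r\times\mathcal W^r$ for which there are neighbourhoods $V_\varepsilon$ of $(f,\phi)$ in $\mathcal F^r\times\mathcal W^r$, $0<\varepsilon\le 1$, increasing in $\varepsilon$, with $\operatorname{supp}\theta_\varepsilon\subset V_\varepsilon$, $\bigcap_{\varepsilon}V_\varepsilon=\{(f,\phi)\}$, and such that every neighbourhood of $(f,\phi)$ contains some $V_\varepsilon$. The integrated operator is $\mathcal L_\varepsilon g(x)=\int \mathcal L_{\tilde f,\tilde\phi}g(x)\,d\theta_\varepsilon(\tilde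 f,\tilde\phi)$. An operator $\mathcal L$ has the *spectral gap property* on $C^r$ with leading eigenvalue $\lambda>0$ if it is bounded on $C^r(M,\mathbb C)$, its spectrum there is $\{\lambda\}\cup\Sigma_1$ with $\Sigma_1\subset\{|z|\le\rho\}$ for some $\rho<\lambda$, and the eigenspace of $\lambda$ is one-dimensional. Its leading eigenfunction $h\in C^r(M,\mathbb R)$, $\mathcal L h=\lambda h$, is normalized by $\int h\,d\nu=1$, where $\nu$ is a Borel probability measure on $M$ with $\int\mathcal L g\,d\nu=\lambda\int g\,d\nu$ for all continuous $g$. **Theorem (random spectral stability).** Let $(\theta_\varepsilon)_{0<\varepsilon\le 1}$ be any random perturbation of $(f,\phi)\in\mathcal F^r\times\mathcal W^r$. Then there is $\varepsilon_0\in(0,1]$, which can be taken equal to $1$ if $\mathcal F^r\times\mathcal W^r$ is compact, such that the following hold. 1. $\mathcal L_{f,\phi}$ has the spectral gap property on $C^r$, with a leading eigenvalue $\lambda$ and a normalized leading eigenfunction $h$. For every $0<\varepsilon\le\varepsilon_0$ the operator $\mathcal L_\varepsilon$ is well defined (for every continuous $g$ and every $x$ the integrand is $\theta_\varepsilon$-integrable,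 and $\mathcal L_\varepsilon g$ is continuous), and it has the spectral gap property on $C^r$, with a leading eigenvalue $\lambda_\varepsilon$ and a normalized leading eigenfunction $h_\varepsilon$. 2. As $\varepsilon\to0$, $\lambda_\varepsilon\to\lambda$ and $h_\varepsilon\to h$ in $C^r(M,\mathbb R)$. 3. $\lambda_\varepsilon$ and $h_\varepsilon$ (in $C^r(M,\mathbb R)$) vary continuously with the noise: at every $\varepsilon\in(0,\varepsilon_0]$ at which $\varepsilon\mapsto\theta_\varepsilon$ (restricted to $(0,\varepsilon_0]$) is continuous in the weak$^*$ topology, $\varepsilon\mapsto\lambda_\varepsilon$ and $\varepsilon\mapsto h_\varepsilon$ are continuous. -/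

import Mathlib

open Set Filter Topology MeasureTheory
open scoped Manifold ContDiff Bundle

namespace RandomSpectral

noncomputable section

/-- The model space `ℝᵐ`. -/
abbrev Eu (m : ℕ) : Type := EuclideanSpace ℝ (Fin m)

/-- A finite family of smooth charts of `M` together with compact subsets of their domains that
cover `M`; it serves to write down a norm of `C^r(M)`. -/
structure ChartCover (m : ℕ) (M : Type*) [TopologicalSpace M] [ChartedSpace (Eu m) M] where
  N : ℕ
  chart : Fin N → OpenPartialHomeomorph M (Eu m)
  K : Fin N → Set M
  chart_mem : ∀ i, chart i ∈ IsManifold.maximalAtlas (𝓡 m) ∞ M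
  isCompact_K : ∀ i, IsCompact (K i)
  K_subset : ∀ i, K i ⊆ (chart i).source
  cover : (⋃ i, K i) = univ

section Functions

variable {m : ℕ} {M : Type*} [TopologicalSpace M] [ChartedSpace (Eu m) M]

/-- A compact manifold has a chart cover. -/
theorem ChartCover.nonempty [CompactSpace M] [T2Space M] [IsManifold (𝓡 m) ∞ M] :
    Nonempty (ChartCover m M) := by
  have h : ∀ x : M, ∃ K : Set M, IsCompact K ∧ K ∈ 𝓝 x ∧ K ⊆ (chartAt (Eu m) x).source := by
    intro x
    obtain ⟨K, hK, h1, h2⟩ := local_compact_nhds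
      ((chartAt (Eu m) x).open_source.mem_nhds (mem_chart_source (Eu m) x))
    exact ⟨K, h2, hK, h1⟩
  choose K hK hKn hKs using h
  obtain ⟨t, -, ht⟩ := isCompact_univ.elim_nhds_subcover K (fun x _ => hKn x)
  refine ⟨⟨t.card, fun i => chartAt (Eu m) (t.equivFin.symm i : M),
    fun i => K (t.equivFin.symm i : M),
    fun i => IsManifold.chart_mem_maximalAtlas _, fun i => hK _, fun i => hKs _, ?_⟩⟩
  refine eq_univ_of_forall fun x => ?_
  obtain ⟨y, hy, hx⟩ := mem_iUnion₂.1 (ht (mem_univ x))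
  exact mem_iUnion.2 ⟨t.equivFin ⟨y, hy⟩, by simpa using hx⟩

/-- The vector space of `C^r` functions `M → 𝕜`, where `𝕜` is `ℝ` or `ℂ`. -/
def crSubmodule (m : ℕ) (M : Type*) [TopologicalSpace M] [ChartedSpace (Eu m) M] (r : ℕ)
    (𝕜 : Type) [RCLike 𝕜] : Submodule 𝕜 (M → 𝕜) where
  carrier := {g | ContMDiff (𝓡 m) 𝓘(ℝ, 𝕜) r g}
  add_mem' := fun hf hg => ContMDiff.add hf hg
  zero_mem' := contMDiff_const
  smul_mem' := fun c _ hf =>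
    ContDiff.comp_contMDiff
      (g := fun z : 𝕜 => c * z) (contDiff_const.mul contDiff_id) hf

/-- The space `C^r(M, 𝕜)`, which is normed below by means of the chart cover `𝔠`. -/
def CrFun (_𝔠 : ChartCover m M) (r : ℕ) (𝕜 : Type) [RCLike 𝕜] : Type _ :=
  crSubmodule m M r 𝕜

namespace CrFun

variable {𝔠 : ChartCover m M} {r : ℕ} {𝕜 : Type} [RCLike 𝕜]

instance : AddCommGroup (CrFun 𝔠 r 𝕜) := inferInstanceAs (AddCommGroup (crSubmodule m M r 𝕜))

instance : Module 𝕜 (CrFun 𝔠 r 𝕜) := inferInstanceAs (Module 𝕜 (crSubmodule m M r 𝕜))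

instance : CoeFun (CrFun 𝔠 r 𝕜) (fun _ => M → 𝕜) := ⟨fun g => g.1⟩

theorem contDiffAt_chart (g : CrFun 𝔠 r 𝕜) (i : Fin 𝔠.N) {x : M}
    (hx : x ∈ (𝔠.chart i).source) :
    ContDiffAt ℝ r (g ∘ (𝔠.chart i).symm) (𝔠.chart i x) := by
  have h1 : ContMDiffOn (𝓡 m) (𝓡 m) ∞ (𝔠.chart i).symm (𝔠.chart i).target :=
    contMDiffOn_symm_of_mem_maximalAtlas (𝔠.chart_mem i)
  have h2 : ContMDiffAt (𝓡 m) (𝓡 m) r (𝔠.chart i).symm (𝔠.chart i x) :=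
    ((h1 _ ((𝔠.chart i).map_source hx)).contMDiffAt
      ((𝔠.chart i).open_target.mem_nhds ((𝔠.chart i).map_source hx))).of_le
      (by exact_mod_cast le_top)
  exact (ContMDiffAt.comp _ (g.2 _) h2).contDiffAt

/-- The `s`-th derivative of `g`, read in the `i`-th chart, at a point of the `i`-th compact set. -/
def derivAt (g : CrFun 𝔠 r 𝕜) (i : Fin 𝔠.N) (s : ℕ) (x : M) :
    ContinuousMultilinearMap ℝ (fun _ : Fin s => Eu m) 𝕜 :=
  iteratedFDeriv ℝ s (g ∘ (𝔠.chart i).symm) (𝔠.chart i x)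

theorem continuousOn_derivAt (g : CrFun 𝔠 r 𝕜) (i : Fin 𝔠.N) {s : ℕ} (hs : s ≤ r) :
    ContinuousOn (g.derivAt i s) (𝔠.K i) := by
  intro x hx
  have hx' := 𝔠.K_subset i hx
  have h1 : ContinuousAt (iteratedFDeriv ℝ s (g ∘ (𝔠.chart i).symm)) (𝔠.chart i x) :=
    ((g.contDiffAt_chart i hx').iteratedFDeriv_right
      (m := 0) (i := s) (by simpa using hs)).continuousAt
  exact (ContinuousAt.comp h1 ((𝔠.chart i).continuousAt hx')).continuousWithinAt

instance (i : Fin 𝔠.N) : CompactSpace (𝔠.K i) := isCompact_iff_compactSpace.1 (𝔠.isCompact_K i)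

/-- The continuous functions on the `i`-th compact set with values in the `s`-linear maps; with the
sup norm. -/
def Jet (𝔠 : ChartCover m M) (𝕜 : Type) [RCLike 𝕜] (i : Fin 𝔠.N) (s : ℕ) : Type _ :=
  C(𝔠.K i, ContinuousMultilinearMap ℝ (fun _ : Fin s => Eu m) 𝕜)

instance (i : Fin 𝔠.N) (s : ℕ) : NormedAddCommGroup (Jet 𝔠 𝕜 i s) :=
  inferInstanceAs (NormedAddCommGroup
    C(𝔠.K i, ContinuousMultilinearMap ℝ (fun _ : Fin s => Eu m) 𝕜))

instance (i : Fin 𝔠.N) (s : ℕ) : NormedSpace 𝕜 (Jet 𝔠 𝕜 i s) :=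
  inferInstanceAs (NormedSpace 𝕜
    C(𝔠.K i, ContinuousMultilinearMap ℝ (fun _ : Fin s => Eu m) 𝕜))

/-- The `s`-th derivative on the `i`-th compact set of the cover, `s ≤ r`. -/
def jet (i : Fin 𝔠.N) (s : Fin (r + 1)) : CrFun 𝔠 r 𝕜 →ₗ[𝕜] Jet 𝔠 𝕜 i s where
  toFun g := ⟨fun x => g.derivAt i s x, continuousOn_iff_continuous_domRestrict.1
    (g.continuousOn_derivAt i (Nat.lt_succ_iff.1 s.2))⟩
  map_add' g h := by
    refine ContinuousMap.ext fun x => ?_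
    have hs : ((s : ℕ) : WithTop ℕ∞) ≤ r := by exact_mod_cast Nat.lt_succ_iff.1 s.2
    exact iteratedFDeriv_add_apply
      ((g.contDiffAt_chart i (𝔠.K_subset i x.2)).of_le hs)
      ((h.contDiffAt_chart i (𝔠.K_subset i x.2)).of_le hs)
  map_smul' c g := by
    refine ContinuousMap.ext fun x => ?_
    have hs : ((s : ℕ) : WithTop ℕ∞) ≤ r := by exact_mod_cast Nat.lt_succ_iff.1 s.2
    exact iteratedFDeriv_const_smul_apply
      ((g.contDiffAt_chart i (𝔠.K_subset i x.2)).of_le hs)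

/-- All derivatives up to order `r`. -/
def fullJet : CrFun 𝔠 r 𝕜 →ₗ[𝕜] (∀ i : Fin 𝔠.N, ∀ s : Fin (r + 1), Jet 𝔠 𝕜 i s) :=
  LinearMap.pi fun i => LinearMap.pi fun s => jet i s

theorem fullJet_injective :
    Function.Injective (fullJet (𝔠 := 𝔠) (r := r) (𝕜 := 𝕜)) := by
  intro g h hgh
  apply Subtype.ext
  funext x
  obtain ⟨i, hi⟩ := mem_iUnion.1 (𝔠.cover.symm ▸ mem_univ x : x ∈ ⋃ i, 𝔠.K i)
  have h1 : g.derivAt i 0 x = h.derivAt i 0 x :=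
    ContinuousMap.congr_fun (congrFun (congrFun hgh i) 0) (⟨x, hi⟩ : 𝔠.K i)
  have h2 := DFunLike.congr_fun h1 0
  simpa [derivAt, (𝔠.chart i).left_inv (𝔠.K_subset i hi)] using h2

/-- The `C^r` norm: the maximum over `i` and `s ≤ r` of the supremum over `K i` of the norm of the
`s`-th derivative in the `i`-th chart. -/
instance : NormedAddCommGroup (CrFun 𝔠 r 𝕜) :=
  NormedAddCommGroup.induced _ _ (fullJet (𝔠 := 𝔠) (r := r) (𝕜 := 𝕜)) fullJet_injective

instance : NormedSpace 𝕜 (CrFun 𝔠 r 𝕜) :=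
  NormedSpace.induced 𝕜 _ _ (fullJet (𝔠 := 𝔠) (r := r) (𝕜 := 𝕜))

/-- `‖D^s g‖₀`, the sup norm of the `s`-th derivative. -/
def derivNorm (g : CrFun 𝔠 r 𝕜) (s : Fin (r + 1)) : ℝ := ‖fun i => jet i s g‖

end CrFun

end Functions

section Maps

/-- The `C^r` maps `M → M`. -/
def CrMap (m : ℕ) (M : Type*) [TopologicalSpace M] [ChartedSpace (Eu m) M] (r : ℕ) : Type _ :=
  {f : M → M // ContMDiff (𝓡 m) (𝓡 m) r f}

variable {m : ℕ} {M : Type*} [TopologicalSpace M] [ChartedSpace (Eu m) M] {r : ℕ}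

namespace CrMap

instance : CoeFun (CrMap m M r) (fun _ => M → M) := ⟨fun f => f.1⟩

/-- The maps `g` with `g(K)` inside the domain of the chart `e'` and whose derivatives of order at
most `r`, read in the charts `e` and `e'`, are `δ`-close on `K` to those of `f`. -/
def basicNhd (f : CrMap m M r) (e e' : OpenPartialHomeomorph M (Eu m)) (K : Set M) (δ : ℝ) :
    Set (CrMap m M r) :=
  {g | MapsTo g K e'.source ∧ ∀ s : ℕ, s ≤ r → ∀ x ∈ K,
    ‖iteratedFDeriv ℝ s (e' ∘ g ∘ e.symm) (e x)
      - iteratedFDeriv ℝ s (e' ∘ f ∘ e.symm) (e x)‖ < δ}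

/-- The `C^r` topology on the space of `C^r` maps. -/
instance : TopologicalSpace (CrMap m M r) :=
  TopologicalSpace.generateFrom
    {U | ∃ (f : CrMap m M r) (e e' : OpenPartialHomeomorph M (Eu m)) (K : Set M) (δ : ℝ),
      e ∈ IsManifold.maximalAtlas (𝓡 m) ∞ M ∧ e' ∈ IsManifold.maximalAtlas (𝓡 m) ∞ M ∧
      IsCompact K ∧ K ⊆ e.source ∧ MapsTo f K e'.source ∧ 0 < δ ∧ U = basicNhd f e e' K δ}

end CrMap

variable {𝔠 : ChartCover m M}

/-- The space of pairs `ℱ × 𝒲`, with the product of the `C^r` topologies and its Borel sets. -/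
def Param (ℱ : Set (CrMap m M r)) (𝒲 : Set (CrFun 𝔠 r ℝ)) : Type _ := ℱ × 𝒲

namespace Param

variable {ℱ : Set (CrMap m M r)} {𝒲 : Set (CrFun 𝔠 r ℝ)}

instance : TopologicalSpace (Param ℱ 𝒲) := inferInstanceAs (TopologicalSpace (ℱ × 𝒲))

instance : MeasurableSpace (Param ℱ 𝒲) := borel _

instance : BorelSpace (Param ℱ 𝒲) := ⟨rfl⟩

/-- The map of a pair. -/
def map (p : Param ℱ 𝒲) : M → M := p.1.1.1

/-- The potential of a pair. -/
def pot (p : Param ℱ 𝒲) : M → ℝ := p.2.1.1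

end Param

/-- The transfer operator, `(ℒ_{f,φ} g)(x) = ∑_{f(y) = x} e^{φ(y)} g(y)`. -/
def transfer {𝕜 : Type} [RCLike 𝕜] (f : M → M) (φ : M → ℝ) (g : M → 𝕜) (x : M) : 𝕜 :=
  ∑ᶠ y ∈ f ⁻¹' {x}, ((Real.exp (φ y) : ℝ) : 𝕜) * g y

/-- The transfer operator integrated with respect to a measure on the space of pairs. -/
def integratedTransfer {𝕜 : Type} [RCLike 𝕜] {ℱ : Set (CrMap m M r)} {𝒲 : Set (CrFun 𝔠 r ℝ)}
    (θ : Measure (Param ℱ 𝒲)) (g : M → 𝕜) (x : M) : 𝕜 :=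
  ∫ p, transfer p.map p.pot g x ∂θ

/-- A random perturbation of `p₀ = (f, φ)`: probability measures `θ ε`, `0 < ε ≤ 1`, with supports
in neighbourhoods `V ε` of `p₀` that decrease to `p₀` as `ε` decreases to `0`. -/
def IsRandomPerturbation {ℱ : Set (CrMap m M r)} {𝒲 : Set (CrFun 𝔠 r ℝ)} (p₀ : Param ℱ 𝒲)
    (θ : ℝ → ProbabilityMeasure (Param ℱ 𝒲)) : Prop :=
  ∃ V : ℝ → Set (Param ℱ 𝒲),
    (∀ ε ∈ Ioc (0 : ℝ) 1, V ε ∈ 𝓝 p₀) ∧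
    MonotoneOn V (Ioc 0 1) ∧
    (∀ ε ∈ Ioc (0 : ℝ) 1, (θ ε : Measure (Param ℱ 𝒲)).support ⊆ V ε) ∧
    (⋂ ε ∈ Ioc (0 : ℝ) 1, V ε) = {p₀} ∧
    ∀ U ∈ 𝓝 p₀, ∃ ε ∈ Ioc (0 : ℝ) 1, V ε ⊆ U

end Maps

/-- Conditions (H1) and (H2) for a map `f` all of whose points have `d` preimages, with the
constants `σ`, `L` and `q`. -/
structure IsAdmissibleMap {M : Type*} [MetricSpace M] (d q : ℕ) (σ L : ℝ) (f : M → M) : Prop where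
  degree : ∀ x, (f ⁻¹' {x}).ncard = d
  h1h2 : ∃ (Lf : M → ℝ) (A : Set M) (𝒰 𝒱 : Finset (Set M)),
    Continuous Lf ∧
    (∀ x, ∃ U, IsOpen U ∧ x ∈ U ∧ InjOn f U ∧
      ∀ y ∈ U, ∀ z ∈ U, dist y z ≤ Lf x * dist (f y) (f z)) ∧
    IsOpen A ∧ (∀ x ∈ A, Lf x ≤ L) ∧ (∀ x ∉ A, Lf x < σ⁻¹) ∧
    (∀ U ∈ 𝒰, IsOpen U ∧ InjOn f U) ∧ (⋃ U ∈ 𝒰, U) = univ ∧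
    𝒱 ⊆ 𝒰 ∧ 𝒱.card ≤ q ∧ A ⊆ ⋃ U ∈ 𝒱, U

section Stability

variable {m : ℕ} {M : Type*} [TopologicalSpace M] [ChartedSpace (Eu m) M] {𝔠 : ChartCover m M}
  {r : ℕ}

/-- Condition (P') with the constants `εφ` and `εφ'`. -/
def IsAdmissiblePotential (εφ εφ' : ℝ) (φ : CrFun 𝔠 r ℝ) : Prop :=
  (⨆ x, φ x) - (⨅ x, φ x) < εφ ∧ ∀ s : Fin (r + 1), 1 ≤ (s : ℕ) → φ.derivNorm s < εφ'

/-- The spectral gap property with leading eigenvalue `l`: the spectrum is `{l} ∪ Σ₁` with `Σ₁` in a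
disc of radius smaller than `l`, and the eigenspace of `l` is one-dimensional. -/
def HasSpectralGap {X : Type*} [NormedAddCommGroup X] [NormedSpace ℂ X] (T : X →L[ℂ] X)
    (l : ℝ) : Prop :=
  0 < l ∧
  (∃ S : Set ℂ, spectrum ℂ T = {(l : ℂ)} ∪ S ∧ ∃ ρ < l, ∀ z ∈ S, ‖z‖ ≤ ρ) ∧
  Module.finrank ℂ (Module.End.eigenspace (T : X →ₗ[ℂ] X) (l : ℂ)) = 1

variable [MeasurableSpace M]

/-- The operator `P`, given pointwise on real and complex functions (`Pℝ`, `Pℂ`), defines a bounded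
operator of the complex Banach space `C^r(M, ℂ)` with the spectral gap property, with leading
eigenvalue `l`, and `h ∈ C^r(M, ℝ)` is its leading eigenfunction, normalized by `∫ h dν = 1`, where
`ν` is the probability measure with `P^* ν = l ν`. -/
def HasLeadingData (Pℝ : (M → ℝ) → M → ℝ) (Pℂ : (M → ℂ) → M → ℂ) (l : ℝ)
    (h : CrFun 𝔠 r ℝ) : Prop :=
  (∃ T : CrFun 𝔠 r ℂ →L[ℂ] CrFun 𝔠 r ℂ,
    (∀ (g : CrFun 𝔠 r ℂ) (x : M), T g x = Pℂ g x) ∧ HasSpectralGap T l) ∧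
  (∀ x, Pℝ h x = l * h x) ∧
  ∃ ν : Measure M, IsProbabilityMeasure ν ∧
    (∀ g : C(M, ℝ), Continuous (Pℝ g) ∧ ∫ x, Pℝ g x ∂ν = l * ∫ x, g x ∂ν) ∧
    ∫ x, h x ∂ν = 1

/-- `C^r`-spectral stability of `p₀ = (f, φ)` under `θ`, for the noise levels `0 < ε ≤ ε₀`. -/
def HasSpectralStability {ℱ : Set (CrMap m M r)} {𝒲 : Set (CrFun 𝔠 r ℝ)} (p₀ : Param ℱ 𝒲)
    (θ : ℝ → ProbabilityMeasure (Param ℱ 𝒲)) (ε₀ : ℝ) : Prop :=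
  ∃ (l₀ : ℝ) (h₀ : CrFun 𝔠 r ℝ) (l : ℝ → ℝ) (h : ℝ → CrFun 𝔠 r ℝ),
    HasLeadingData (transfer p₀.map p₀.pot) (transfer p₀.map p₀.pot) l₀ h₀ ∧
    (∀ ε ∈ Ioc 0 ε₀,
      (∀ (g : C(M, ℝ)) (x : M),
        Integrable (fun p : Param ℱ 𝒲 => transfer p.map p.pot g x) (θ ε : Measure _)) ∧
      HasLeadingData (integratedTransfer (θ ε : Measure (Param ℱ 𝒲)))
        (integratedTransfer (θ ε : Measure (Param ℱ 𝒲))) (l ε) (h ε)) ∧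
    Tendsto l (𝓝[>] 0) (𝓝 l₀) ∧
    Tendsto h (𝓝[>] 0) (𝓝 h₀) ∧
    ∀ ε ∈ Ioc 0 ε₀, ContinuousWithinAt θ (Ioc 0 ε₀) ε →
      ContinuousWithinAt l (Ioc 0 ε₀) ε ∧ ContinuousWithinAt h (Ioc 0 ε₀) ε

end Stability

end

end RandomSpectral

set_option linter.unusedSectionVars false

/-! Single inverse branches need not contract, since `L ≥ 1`; what contracts is the sum over a
fibre. By (H1) and (H2) the local Lipschitz constants `ℓ` of the inverse branches satisfy `∑ ℓ ^ s ≤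
κ := q L^r + (d - q) σ⁻¹` over every fibre, for `1 ≤ s ≤ r`, and the hypothesis says that `ρ :=
e^{εφ} κ / d < 1`. As the distance of `M` is a length distance, the fibres over `x` and `y` can be
matched with total distance at most `κ d(x, y)`, up to an arbitrarily small error
(`IsLengthManifold.hasPairing`).

Divide the integrated operator by `mass = ∫ d e^{min φ} dθ`. The quotient `T` is positive, has `T 1
≥ 1`, contracts Lipschitz constants by `ρ` up to a multiple of the sup norm, and satisfies a
one-sided comparison between different points (`IsOscContracting`). None of the constants depends on
`θ`. Iterating the comparison gives a Harnack inequality for `T ^ n 1`, and a Doeblin type bound: if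
`T ^ k u`, with `u ≥ 0`, is large at one point, it is bounded below everywhere. So the oscillation
of `T ^ n g / T ^ n 1` tends to zero, for Lipschitz `g` at a uniform rate. The limit is a positive
functional, that is, an eigenmeasure `ν` with eigenvalue `l ≥ 1`; the functions `l ^ n` and `T ^ n
1` are comparable, and `l⁻ⁿ T ^ n g` tends to zero uniformly if `∫ g dν = 0`
(`exists_eigenmeasure`).

The derivative of order `s` of a branch term is the pullback of the derivative of order `s` of `g`,
plus terms with lower derivatives of `g`. Measured on vectors of metric length one, this gives
Lasota–Yorke inequalities with the same factor `ρ` for all orders `1 ≤ s ≤ r`, and by induction on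
`s` the sup norm decay becomes decay in `C^r` (`exists_norm_pow_le`). Once some iterate, divided by
the power of `l`, halves the norm on the kernel of `ν`, there is a spectral gap
(`hasSpectralGap_of_contracting`), and the leading eigenfunction is the limit of `l⁻ⁿ Tⁿ 1` at a
uniform geometric rate (`exists_fixed_of_contracting`).

For stability only strong continuity of the operators is used. Weak convergence of the measures
gives strong convergence of the integrated operators, because `C^r(M)` is separable
(`tendsto_bochner_integral_of_ae`). The uniform comparison of `T ^ n 1` with `l ^ n` and the uniform
rate towards `h` then yield convergence of `l` and of `h`. So both are continuous functions of the
measure, on the set of measures that satisfy a fixed bound. The unperturbed operator is the one of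
the Dirac measure at `p₀`, to which `θ ε` converges, so the limit `ε → 0` and the continuity in the
noise are instances of one statement. The required bound holds near `p₀`, which determines `ε₀`; if
the family is compact it holds everywhere and `ε₀ = 1`. -/

namespace RandomSpectral

section

/-! ### Positive operators on `C(X)`: iterated comparison and the Harnack inequality -/

section PositiveOperators

variable {X : Type*} [MetricSpace X] [CompactSpace X]

/-- Positive operators `T` on `C(X)` with `T 1 ≥ 1` that contract Lipschitz constants by `ρ`, up to
a multiple of the sup norm, and that satisfy the corresponding one-sided comparison inequality. -/
structure IsOscContracting (ρ b : ℝ) (T : Module.End ℝ C(X, ℝ)) : Prop where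
  nonneg : ∀ u : C(X, ℝ), (∀ x, 0 ≤ u x) → ∀ x, 0 ≤ T u x
  one_le : ∀ x, 1 ≤ T 1 x
  compare : ∀ (u v : C(X, ℝ)) (B a U s : ℝ), (∀ x, 0 ≤ u x) → (∀ x, 0 ≤ v x) → 0 ≤ B → 0 ≤ a →
    0 < s → (∀ x, u x ≤ U) → (∀ x y, u x ≤ B * v y + a * dist x y) →
    ∀ x y, T u x ≤ Real.exp s * B * T v y + ρ * (a + b * U / s) * dist x y
  lip : ∀ (u : C(X, ℝ)) (a U : ℝ), 0 ≤ a → (∀ x y, |u x - u y| ≤ a * dist x y) →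
    (∀ x, |u x| ≤ U) → ∀ x y, |T u x - T u y| ≤ ρ * (a + b * U) * dist x y

namespace IsOscContracting

variable {ρ b : ℝ} {T : Module.End ℝ C(X, ℝ)}

theorem mono (hT : IsOscContracting ρ b T) {u v : C(X, ℝ)} (h : ∀ x, u x ≤ v x) (x : X) :
    T u x ≤ T v x := by
  have := hT.nonneg (v - u) (fun x => by simpa using h x) x
  simpa using this

theorem pow_nonneg (hT : IsOscContracting ρ b T) (n : ℕ) {u : C(X, ℝ)} (h : ∀ x, 0 ≤ u x) (x : X) :
    0 ≤ (T ^ n) u x := by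
  induction n generalizing x with
  | zero => simpa using h x
  | succ n ih => rw [pow_succ', Module.End.mul_apply]; exact hT.nonneg _ ih x

theorem pow_mono (hT : IsOscContracting ρ b T) (n : ℕ) {u v : C(X, ℝ)} (h : ∀ x, u x ≤ v x)
    (x : X) : (T ^ n) u x ≤ (T ^ n) v x := by
  have := hT.pow_nonneg n (u := v - u) (fun x => by simpa using h x) x
  simpa using this

theorem one_le_pow (hT : IsOscContracting ρ b T) (n : ℕ) (x : X) : 1 ≤ (T ^ n) 1 x := by
  induction n generalizing x with
  | zero => simp
  | succ n ih =>
    rw [pow_succ', Module.End.mul_apply]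
    exact (hT.one_le x).trans (hT.mono (u := 1) ih x)

theorem pow_one_le_succ (hT : IsOscContracting ρ b T) (n : ℕ) (x : X) :
    (T ^ n) 1 x ≤ (T ^ (n + 1)) 1 x := by
  rw [pow_succ, Module.End.mul_apply]
  exact hT.pow_mono n hT.one_le x

theorem norm_pow_one_mono (hT : IsOscContracting ρ b T) : Monotone fun n : ℕ => ‖(T ^ n) 1‖ := by
  refine monotone_nat_of_le_succ fun n => ?_
  refine (ContinuousMap.norm_le _ (norm_nonneg _)).2 fun x => ?_
  rw [Real.norm_of_nonneg (zero_le_one.trans (hT.one_le_pow n x))]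
  exact (hT.pow_one_le_succ n x).trans ((Real.le_norm_self _).trans (ContinuousMap.norm_coe_le_norm _ x))

/-- The exponents spent at successive applications of `T` form a geometric sequence: `s` at the last
one, `s (1 + ρ) / 2` at the one before, and so on; their sum is at most `s * 2 / (1 - ρ)`, which is
`s * S`. A smaller exponent costs a factor `2 / (1 + ρ)` in the additive term, but `T` contracts
this term by `ρ`, and `ρ * 2 / (1 + ρ) < 1`. The constant `K` is the fixed point of the resulting
recursion, `ρ (2 K / (1 + ρ) + b) = K`. -/
theorem pow_compare (hT : IsOscContracting ρ b T) (hρ : 0 < ρ) (hρ1 : ρ < 1) (hb : 0 ≤ b) :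
    ∃ K S : ℝ, 0 ≤ K ∧ 0 < S ∧ K = ρ * b * (1 + ρ) / (1 - ρ) ∧ S = 2 / (1 - ρ) ∧
    ∀ (u : C(X, ℝ)) (a : ℝ) (Z : ℕ → ℝ), 0 ≤ a → (∀ x, 0 ≤ u x) →
    (∀ x y, |u x - u y| ≤ a * dist x y) → Monotone Z → (∀ k x, (T ^ k) u x ≤ Z k) →
    ∀ (k : ℕ) (s : ℝ), 0 < s → ∀ x y,
      (T ^ k) u x ≤ Real.exp (s * S) * (T ^ k) u y + (ρ ^ k * a + K / s * Z k) * dist x y := by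
  have h1 : 0 < 1 - ρ := by linarith
  refine ⟨_, _, by positivity, by positivity, rfl, rfl, ?_⟩
  intro u a Z ha hu hLip hZ huZ k
  set K := ρ * b * (1 + ρ) / (1 - ρ) with hK
  have hK0 : 0 ≤ K := by positivity
  have hKeq : ρ * (K * (2 / (1 + ρ)) + b) = K := by
    rw [hK]
    have h2 : 1 - ρ ≠ 0 := h1.ne'
    field_simp
    ring
  induction k with
  | zero =>
    intro s hs x y
    have hZ0 : 0 ≤ Z 0 := (hu x).trans (by simpa using huZ 0 x)
    have h2 := (abs_le.1 (hLip x y)).2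
    have h3 : u y ≤ Real.exp (s * (2 / (1 - ρ))) * u y :=
      le_mul_of_one_le_left (hu y) (Real.one_le_exp (by positivity))
    have h4 : 0 ≤ K / s * Z 0 * dist x y := by positivity
    simp only [pow_zero, Module.End.one_apply, one_mul]
    nlinarith
  | succ k ih =>
    intro s hs x y
    -- The earlier iterates get the smaller exponent; the last application of `T` spends the full
    -- `s`.
    have hs' : 0 < s * ((1 + ρ) / 2) := by positivity
    have hZ0 : 0 ≤ Z k := (hT.pow_nonneg k hu x).trans (huZ k x)
    have key := hT.compare ((T ^ k) u) ((T ^ k) u) _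
      (ρ ^ k * a + K / (s * ((1 + ρ) / 2)) * Z k) (Z k) s (hT.pow_nonneg k hu)
      (hT.pow_nonneg k hu) (Real.exp_pos _).le (by positivity) hs (huZ k)
      (ih _ hs') x y
    rw [pow_succ', Module.End.mul_apply]
    refine key.trans ?_
    rw [← Real.exp_add]
    have e1 : s + s * ((1 + ρ) / 2) * (2 / (1 - ρ)) = s * (2 / (1 - ρ)) := by
      field_simp; ring
    rw [e1]
    gcongr
    have e2 : ρ * (ρ ^ k * a + K / (s * ((1 + ρ) / 2)) * Z k + b * Z k / s)
        = ρ ^ (k + 1) * a + ρ * (K * (2 / (1 + ρ)) + b) / s * Z k := by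
      field_simp; ring
    rw [e2, hKeq]
    gcongr
    exact hZ (Nat.le_succ k)

/-- Compare a maximum point `z` of `T ^ n 1` with an arbitrary point `y`. The choice of `s` makes
the additive error at most half of the maximum, so it is absorbed on the left. Since `T 1 ≥ 1`, the
norms of `T ^ n 1` increase with `n`, as `pow_compare` requires of `Z`. The constant depends only on
`ρ`, `b` and the diameter. -/
theorem exists_harnack (X : Type*) [MetricSpace X] [CompactSpace X] {ρ : ℝ} (b : ℝ) (hρ : 0 < ρ)
    (hρ1 : ρ < 1) (hb : 0 ≤ b) :
    ∃ H : ℝ, 1 ≤ H ∧ ∀ T : Module.End ℝ C(X, ℝ), IsOscContracting ρ b T →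
      ∀ (n : ℕ) (x y : X), (T ^ n) 1 x ≤ H * (T ^ n) 1 y := by
  obtain ⟨D, hD⟩ := (Metric.isBounded_iff.1 (isCompact_univ (X := X)).isBounded)
  set K := ρ * b * (1 + ρ) / (1 - ρ) with hK
  set S := 2 / (1 - ρ) with hS
  set s := 2 * (K * |D|) + 1 with hs
  have h1 : 0 < 1 - ρ := by linarith
  have hK0 : 0 ≤ K := by positivity
  have hs0 : 0 < s := by positivity
  refine ⟨2 * Real.exp (s * S), ?_, fun T hT n x y => ?_⟩
  · have := Real.one_le_exp (x := s * S) (by positivity)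
    linarith
  obtain ⟨_, _, -, -, rfl, rfl, h⟩ := hT.pow_compare hρ hρ1 hb
  rw [← hK, ← hS] at h
  have hcoe : ∀ (k : ℕ) (z : X), (T ^ k) 1 z ≤ ‖(T ^ k) 1‖ := fun k z =>
    (Real.le_norm_self _).trans (ContinuousMap.norm_coe_le_norm _ z)
  obtain ⟨z, -, hz⟩ := isCompact_univ.exists_isMaxOn (s := (univ : Set X)) ⟨x, mem_univ x⟩
    ((T ^ n) 1).continuous.continuousOn
  have hnorm : ‖(T ^ n) 1‖ = (T ^ n) 1 z := by
    refine le_antisymm ((ContinuousMap.norm_le _ (zero_le_one.trans (hT.one_le_pow n z))).2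
      fun w => ?_) (hcoe n z)
    rw [Real.norm_of_nonneg (zero_le_one.trans (hT.one_le_pow n w))]
    exact hz (mem_univ w)
  have h2 := h 1 0 (fun k => ‖(T ^ k) 1‖) le_rfl (by simp) (by simp) hT.norm_pow_one_mono hcoe n s
    hs0 z y
  have h3 : dist z y ≤ |D| := (hD (mem_univ _) (mem_univ _)).trans (le_abs_self D)
  have h4 : (ρ ^ n * 0 + K / s * ‖(T ^ n) 1‖) * dist z y ≤ ‖(T ^ n) 1‖ / 2 := by
    have h5 : K / s * dist z y ≤ 1 / 2 := by
      rw [div_mul_eq_mul_div, div_le_iff₀ hs0]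
      have := mul_le_mul_of_nonneg_left h3 hK0
      linarith
    nlinarith [norm_nonneg ((T ^ n) 1)]
  have h6 : (T ^ n) 1 x ≤ (T ^ n) 1 z := hz (mem_univ x)
  nlinarith

end IsOscContracting

end PositiveOperators

end

section

/-! ### Uniform decay of the oscillation of `T ^ n g / T ^ n 1` -/

section PositiveOperators

variable {X : Type*} [MetricSpace X] [CompactSpace X]

/-- `g` is bounded by `N` and `N`-Lipschitz. -/
def LipBound (g : C(X, ℝ)) (N : ℝ) : Prop :=
  (∀ x, |g x| ≤ N) ∧ ∀ x y, |g x - g y| ≤ N * dist x y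

/-- Stone–Weierstrass: the Lipschitz functions form a subalgebra, and it separates points because it
contains the distances to points. -/
theorem exists_lipBound_near (g : C(X, ℝ)) {η : ℝ} (hη : 0 < η) :
    ∃ (g' : C(X, ℝ)) (N : ℝ), LipBound g' N ∧ ∀ x, |g' x - g x| < η := by
  let A : Subalgebra ℝ C(X, ℝ) :=
    { carrier := {g | ∃ a : ℝ, 0 ≤ a ∧ ∀ x y, |g x - g y| ≤ a * dist x y}
      mul_mem' := by
        rintro f g ⟨a, ha, hf⟩ ⟨b, hb, hg⟩
        refine ⟨‖f‖ * b + a * ‖g‖, by positivity, fun x y => ?_⟩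
        have h1 := f.norm_coe_le_norm x
        have h2 := g.norm_coe_le_norm y
        rw [Real.norm_eq_abs] at h1 h2
        calc |(f * g) x - (f * g) y| = |f x * (g x - g y) + (f x - f y) * g y| := by
              simp only [ContinuousMap.mul_apply]; ring_nf
          _ ≤ |f x| * |g x - g y| + |f x - f y| * |g y| := by
              rw [← abs_mul, ← abs_mul]; exact abs_add_le _ _
          _ ≤ ‖f‖ * (b * dist x y) + (a * dist x y) * ‖g‖ := by
              gcongr
              exacts [hg x y, hf x y]
          _ = _ := by ring
      add_mem' := by
        rintro f g ⟨a, ha, hf⟩ ⟨b, hb, hg⟩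
        refine ⟨a + b, by positivity, fun x y => ?_⟩
        calc |(f + g) x - (f + g) y| = |(f x - f y) + (g x - g y)| := by
              simp only [ContinuousMap.add_apply]; ring_nf
          _ ≤ |f x - f y| + |g x - g y| := abs_add_le _ _
          _ ≤ _ := by linarith [hf x y, hg x y]
      algebraMap_mem' := fun c => ⟨0, le_rfl, by simp⟩ }
  have hsep : A.SeparatesPoints := by
    intro x y hxy
    refine ⟨fun z => dist x z, ⟨⟨fun z => dist x z, by fun_prop⟩, ⟨1, zero_le_one, fun z w => ?_⟩,
      rfl⟩, by simpa using hxy⟩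
    rw [one_mul]
    simpa [dist_comm] using abs_dist_sub_le z w x
  obtain ⟨⟨g', a, ha, hg'⟩, h⟩ :=
    ContinuousMap.exists_mem_subalgebra_near_continuousMap_of_separatesPoints A hsep g η hη
  refine ⟨g', max a ‖g'‖, ⟨fun x => (g'.norm_coe_le_norm x).trans (le_max_right _ _),
    fun x y => (hg' x y).trans (by gcongr; exact le_max_left _ _)⟩, fun x => ?_⟩
  exact ((g' - g).norm_coe_le_norm x).trans_lt h

/-- The bounds `m` and `M` for the quotient of `T ^ n g` by `T ^ n 1`. -/
def Squeezed (T : Module.End ℝ C(X, ℝ)) (g : C(X, ℝ)) (n : ℕ) (m M : ℝ) : Prop :=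
  ∀ x, m * (T ^ n) 1 x ≤ (T ^ n) g x ∧ (T ^ n) g x ≤ M * (T ^ n) 1 x

namespace IsOscContracting

variable {ρ b : ℝ} {T : Module.End ℝ C(X, ℝ)}

theorem pow_one_pos (hT : IsOscContracting ρ b T) (n : ℕ) (x : X) : 0 < (T ^ n) 1 x :=
  zero_lt_one.trans_le (hT.one_le_pow n x)

theorem pow_one_le_norm (n : ℕ) (x : X) : (T ^ n) 1 x ≤ ‖(T ^ n) 1‖ :=
  (Real.le_norm_self _).trans (ContinuousMap.norm_coe_le_norm _ x)

theorem abs_pow_le (hT : IsOscContracting ρ b T) {g : C(X, ℝ)} {N : ℝ} (h : ∀ x, |g x| ≤ N) (n : ℕ)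
    (x : X) : |(T ^ n) g x| ≤ N * (T ^ n) 1 x := by
  rw [abs_le]
  constructor
  · have := hT.pow_mono n (u := (-N) • 1) (v := g) (fun y => by simpa using (abs_le.1 (h y)).1) x
    simpa using this
  · have := hT.pow_mono n (u := g) (v := N • 1) (fun y => by simpa using (abs_le.1 (h y)).2) x
    simpa using this

theorem squeezed_succ (hT : IsOscContracting ρ b T) {g : C(X, ℝ)} {n : ℕ} {m M : ℝ}
    (h : Squeezed T g n m M) : Squeezed T g (n + 1) m M := by
  intro x
  rw [pow_succ', Module.End.mul_apply, Module.End.mul_apply]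
  constructor
  · have := hT.mono (u := m • (T ^ n) 1) (v := (T ^ n) g) (fun y => by simpa using (h y).1) x
    simpa using this
  · have := hT.mono (u := (T ^ n) g) (v := M • (T ^ n) 1) (fun y => by simpa using (h y).2) x
    simpa using this

theorem squeezed_of_le (hT : IsOscContracting ρ b T) {g : C(X, ℝ)} {n n' : ℕ} {m M : ℝ}
    (h : Squeezed T g n m M) (hn : n ≤ n') : Squeezed T g n' m M :=
  Nat.le_induction h (fun _ _ h => hT.squeezed_succ h) n' hn

/-- The factor `c = 1 + b / (1 - ρ)` is chosen so that `ρ (c + b) ≤ c`. With this, the Lipschitz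
bound propagates relative to `‖T ^ n 1‖`, which does not decrease. -/
theorem pow_lip (hT : IsOscContracting ρ b T) (hρ : 0 < ρ) (hρ1 : ρ < 1) (hb : 0 ≤ b)
    {g : C(X, ℝ)} {N : ℝ} (hN : 0 ≤ N) (hg : LipBound g N) (n : ℕ) (x y : X) :
    |(T ^ n) g x - (T ^ n) g y| ≤ (1 + b / (1 - ρ)) * N * ‖(T ^ n) 1‖ * dist x y := by
  have h1 : 0 < 1 - ρ := by linarith
  induction n generalizing x y with
  | zero =>
    have : Nonempty X := ⟨x⟩
    simp only [pow_zero, Module.End.one_apply, norm_one, mul_one]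
    refine (hg.2 x y).trans ?_
    gcongr
    refine le_mul_of_one_le_left hN ?_
    have : 0 ≤ b / (1 - ρ) := by positivity
    linarith
  | succ n ih =>
    rw [pow_succ', Module.End.mul_apply]
    have hU : ∀ z, |(T ^ n) g z| ≤ N * ‖(T ^ n) 1‖ := fun z =>
      (hT.abs_pow_le hg.1 n z).trans (by gcongr; exact pow_one_le_norm n z)
    refine (hT.lip _ _ _ (by positivity) ih hU x y).trans ?_
    refine mul_le_mul_of_nonneg_right ?_ dist_nonneg
    have h2 : ‖(T ^ n) 1‖ ≤ ‖(T ^ (n + 1)) 1‖ := hT.norm_pow_one_mono (Nat.le_succ n)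
    have h3 : ρ * (1 + b / (1 - ρ) + b) ≤ 1 + b / (1 - ρ) := by
      have e : 1 + b / (1 - ρ) - ρ * (1 + b / (1 - ρ) + b) = (1 - ρ) + b * (1 - ρ) := by
        field_simp; ring
      nlinarith
    calc ρ * ((1 + b / (1 - ρ)) * N * ‖(T ^ n) 1‖ + b * (N * ‖(T ^ n) 1‖))
        = ρ * (1 + b / (1 - ρ) + b) * (N * ‖(T ^ n) 1‖) := by ring
      _ ≤ (1 + b / (1 - ρ)) * (N * ‖(T ^ (n + 1)) 1‖) := by gcongr
      _ = _ := by rw [pow_succ']; ring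

/-- The Doeblin step. If `T ^ k u` reaches half of its a priori maximum at `z`, the comparison of
`z` with `y` carries this to every `y`: for large `s` the additive term takes at most half of the
value at `z`, so a quarter of the a priori maximum remains, divided by the factor `e^{sS}`. What is
left is the initial Lipschitz constant, damped by `ρ ^ k`. -/
theorem exists_lower_bound (X : Type*) [MetricSpace X] [CompactSpace X] {ρ : ℝ} (b : ℝ) (hρ : 0 < ρ)
    (hρ1 : ρ < 1) (hb : 0 ≤ b) : ∃ β D : ℝ, 0 < β ∧ β < 1 ∧ 0 ≤ D ∧
      ∀ T : Module.End ℝ C(X, ℝ), IsOscContracting ρ b T → ∀ (u : C(X, ℝ)) (a δ : ℝ) (n k : ℕ) (z : X),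
      0 ≤ a → 0 ≤ δ → (∀ x, 0 ≤ u x) → (∀ x, u x ≤ δ * (T ^ n) 1 x) →
      (∀ x y, |u x - u y| ≤ a * dist x y) → δ * ‖(T ^ (n + k)) 1‖ ≤ 2 * (T ^ k) u z →
      ∀ y, β * δ * ‖(T ^ (n + k)) 1‖ - D * ρ ^ k * a ≤ (T ^ k) u y := by
  obtain ⟨D, hD⟩ := (Metric.isBounded_iff.1 (isCompact_univ (X := X)).isBounded)
  set K := ρ * b * (1 + ρ) / (1 - ρ) with hK
  set S := 2 / (1 - ρ) with hS
  set s := 4 * (K * |D|) + 1 with hs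
  have h1 : 0 < 1 - ρ := by linarith
  have hK0 : 0 ≤ K := by positivity
  have hs0 : 0 < s := by positivity
  have hE : 1 ≤ Real.exp (s * S) := Real.one_le_exp (by positivity)
  refine ⟨(4 * Real.exp (s * S))⁻¹, |D|, by positivity, inv_lt_one_of_one_lt₀ (by linarith),
    abs_nonneg D, fun T hT u a δ n k z ha hδ hu huδ hLip hz y => ?_⟩
  obtain ⟨_, _, -, -, rfl, rfl, h⟩ := hT.pow_compare hρ hρ1 hb
  rw [← hK, ← hS] at h
  have hZ : ∀ (k : ℕ) (x : X), (T ^ k) u x ≤ δ * ‖(T ^ (n + k)) 1‖ := fun k x => by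
    have h2 := hT.pow_mono k (u := u) (v := δ • (T ^ n) 1) (fun y => by simpa using huδ y) x
    rw [map_smul, ← Module.End.mul_apply, ← pow_add, add_comm k n] at h2
    refine h2.trans ?_
    rw [ContinuousMap.smul_apply, smul_eq_mul]
    gcongr
    exact pow_one_le_norm _ _
  have h2 := h u a (fun k => δ * ‖(T ^ (n + k)) 1‖) ha hu hLip
    (fun i j hij => mul_le_mul_of_nonneg_left (hT.norm_pow_one_mono (by lia)) hδ) hZ k s hs0 z y
  have h3 : dist z y ≤ |D| := (hD (mem_univ _) (mem_univ _)).trans (le_abs_self D)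
  have h5 : K / s * dist z y ≤ 1 / 4 := by
    rw [div_mul_eq_mul_div, div_le_iff₀ hs0]
    have := mul_le_mul_of_nonneg_left h3 hK0
    linarith
  have h6 : 0 ≤ δ * ‖(T ^ (n + k)) 1‖ := by positivity
  have h7 : ρ ^ k * a * dist z y ≤ |D| * ρ ^ k * a := by
    calc ρ ^ k * a * dist z y ≤ ρ ^ k * a * |D| := by gcongr
      _ = _ := by ring
  have h8 : δ * ‖(T ^ (n + k)) 1‖ / 4 - |D| * ρ ^ k * a ≤ Real.exp (s * S) * (T ^ k) u y := by
    nlinarith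
  have h9 : 0 ≤ |D| * ρ ^ k * a := by positivity
  have h10 : Real.exp (s * S) * ((4 * Real.exp (s * S))⁻¹ * δ * ‖(T ^ (n + k)) 1‖ - |D| * ρ ^ k * a)
      ≤ Real.exp (s * S) * (T ^ k) u y := by
    refine le_trans ?_ h8
    have e : Real.exp (s * S) * ((4 * Real.exp (s * S))⁻¹ * δ * ‖(T ^ (n + k)) 1‖)
        = δ * ‖(T ^ (n + k)) 1‖ / 4 := by
      field_simp
    rw [mul_sub, e]
    nlinarith
  exact le_of_mul_le_mul_left h10 (Real.exp_pos _)

/-- Apply the Doeblin step to `u = T ^ n g - m T ^ n 1 ≥ 0`. The Lipschitz constant of `u` is at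
most a multiple of `N ‖T ^ n 1‖`, so the error relative to `T ^ (n + k) 1` is at most a multiple of
`ρ ^ k N`. -/
theorem exists_improved_lower_bound (X : Type*) [MetricSpace X] [CompactSpace X] {ρ : ℝ} (b : ℝ)
    (hρ : 0 < ρ) (hρ1 : ρ < 1) (hb : 0 ≤ b) : ∃ β C : ℝ, 0 < β ∧ β < 1 ∧ 0 ≤ C ∧
      ∀ T : Module.End ℝ C(X, ℝ), IsOscContracting ρ b T → ∀ (g : C(X, ℝ)) (N m M : ℝ) (n k : ℕ)
      (z : X), LipBound g N → |m| ≤ N → Squeezed T g n m M →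
      (M - m) * ‖(T ^ (n + k)) 1‖ ≤ 2 * ((T ^ (n + k)) g z - m * (T ^ (n + k)) 1 z) →
      ∀ y, (m + β * (M - m) - C * ρ ^ k * N) * (T ^ (n + k)) 1 y ≤ (T ^ (n + k)) g y := by
  obtain ⟨β, D, hβ, hβ1, hD, H⟩ := exists_lower_bound X b hρ hρ1 hb
  have h1 : 0 < 1 - ρ := by linarith
  refine ⟨β, D * (2 * (1 + b / (1 - ρ))), hβ, hβ1, by positivity,
    fun T hT g N m M n k z hg hm hsq hz y => ?_⟩
  have hN : 0 ≤ N := (abs_nonneg m).trans hm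
  have : Nonempty X := ⟨y⟩
  have hmM : m ≤ M := le_of_mul_le_mul_right ((hsq y).1.trans (hsq y).2) (hT.pow_one_pos n y)
  have h1b : LipBound (1 : C(X, ℝ)) 1 := ⟨by simp, by simp⟩
  have hu : (T ^ k) ((T ^ n) g - m • (T ^ n) 1) = (T ^ (n + k)) g - m • (T ^ (n + k)) 1 := by
    rw [map_sub, map_smul, ← Module.End.mul_apply, ← Module.End.mul_apply, ← pow_add, add_comm k n]
  have hLip : ∀ x y, |((T ^ n) g - m • (T ^ n) 1) x - ((T ^ n) g - m • (T ^ n) 1) y|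
      ≤ 2 * (1 + b / (1 - ρ)) * N * ‖(T ^ n) 1‖ * dist x y := fun x y => by
    have h2 := hT.pow_lip hρ hρ1 hb hN hg n x y
    have h3 := hT.pow_lip hρ hρ1 hb zero_le_one h1b n x y
    calc |((T ^ n) g - m • (T ^ n) 1) x - ((T ^ n) g - m • (T ^ n) 1) y|
        = |((T ^ n) g x - (T ^ n) g y) - m * ((T ^ n) 1 x - (T ^ n) 1 y)| := by
          simp only [ContinuousMap.sub_apply, ContinuousMap.smul_apply, smul_eq_mul]; ring_nf
      _ ≤ |(T ^ n) g x - (T ^ n) g y| + |m| * |(T ^ n) 1 x - (T ^ n) 1 y| := by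
          rw [← abs_mul]; exact abs_sub _ _
      _ ≤ (1 + b / (1 - ρ)) * N * ‖(T ^ n) 1‖ * dist x y
          + N * ((1 + b / (1 - ρ)) * 1 * ‖(T ^ n) 1‖ * dist x y) := by gcongr
      _ = _ := by ring
  have key := H T hT ((T ^ n) g - m • (T ^ n) 1) (2 * (1 + b / (1 - ρ)) * N * ‖(T ^ n) 1‖) (M - m)
    n k z (by positivity) (by linarith) (fun x => by simpa using (hsq x).1)
    (fun x => by
      have := (hsq x).2
      simp only [ContinuousMap.sub_apply, ContinuousMap.smul_apply, smul_eq_mul]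
      linarith) hLip (by rw [hu]; simpa using hz) y
  rw [hu] at key
  simp only [ContinuousMap.sub_apply, ContinuousMap.smul_apply, smul_eq_mul] at key
  have hy := hT.pow_one_pos (n + k) y
  -- If the gain is negative, the old lower bound suffices. If not, `‖T ^ (n + k) 1‖` may be
  -- replaced by the smaller value at `y`.
  by_cases hneg : β * (M - m) - D * (2 * (1 + b / (1 - ρ))) * ρ ^ k * N ≤ 0
  · have h2 := ((hT.squeezed_of_le hsq (Nat.le_add_right n k)) y).1
    nlinarith
  · have h3 : ‖(T ^ n) 1‖ ≤ ‖(T ^ (n + k)) 1‖ := hT.norm_pow_one_mono (Nat.le_add_right n k)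
    have h4 := pow_one_le_norm (T := T) (n + k) y
    have h5 : D * ρ ^ k * (2 * (1 + b / (1 - ρ)) * N * ‖(T ^ n) 1‖)
        ≤ D * (2 * (1 + b / (1 - ρ))) * ρ ^ k * N * ‖(T ^ (n + k)) 1‖ := by
      calc _ = D * (2 * (1 + b / (1 - ρ))) * ρ ^ k * N * ‖(T ^ n) 1‖ := by ring
        _ ≤ _ := by gcongr
    have h6 := mul_le_mul_of_nonneg_left h4 (not_le.1 hneg).le
    linarith

theorem squeezed_neg {g : C(X, ℝ)} {n : ℕ} {m M : ℝ} (h : Squeezed T g n m M) :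
    Squeezed T (-g) n (-M) (-m) := by
  intro x
  simp only [map_neg, ContinuousMap.neg_apply]
  constructor <;> linarith [(h x).1, (h x).2]

/-- At a maximum point of `T ^ (n + k) 1` the quotient lies in the upper or in the lower half of
`[m, M]`. In the first case the lower bound improves; in the second case the same argument for `-g`
lowers the upper bound. Either way the width shrinks by the factor `1 - β`, up to an error. The
`max` and `min` keep the new bounds inside `[-N, N]`. -/
theorem exists_squeezed_step (X : Type*) [MetricSpace X] [CompactSpace X] [Nonempty X] {ρ : ℝ}
    (b : ℝ) (hρ : 0 < ρ) (hρ1 : ρ < 1) (hb : 0 ≤ b) : ∃ β C : ℝ, 0 < β ∧ β < 1 ∧ 0 ≤ C ∧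
      ∀ T : Module.End ℝ C(X, ℝ), IsOscContracting ρ b T → ∀ (g : C(X, ℝ)) (N m M : ℝ) (n k : ℕ),
      LipBound g N → |m| ≤ N → |M| ≤ N → Squeezed T g n m M →
      ∃ m' M', |m'| ≤ N ∧ |M'| ≤ N ∧ Squeezed T g (n + k) m' M' ∧
        M' - m' ≤ (1 - β) * (M - m) + C * ρ ^ k * N := by
  obtain ⟨β, C, hβ, hβ1, hC, H⟩ := exists_improved_lower_bound X b hρ hρ1 hb
  refine ⟨β, C, hβ, hβ1, hC, fun T hT g N m M n k hg hm hM hsq => ?_⟩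
  have hsq' := hT.squeezed_of_le hsq (Nat.le_add_right n k)
  obtain ⟨z, -, hz⟩ := isCompact_univ.exists_isMaxOn (s := (univ : Set X)) univ_nonempty
    ((T ^ (n + k)) 1).continuous.continuousOn
  have hnorm : ‖(T ^ (n + k)) 1‖ ≤ (T ^ (n + k)) 1 z := by
    refine (ContinuousMap.norm_le _ (hT.pow_one_pos _ z).le).2 fun w => ?_
    rw [Real.norm_of_nonneg (hT.pow_one_pos _ w).le]
    exact hz (mem_univ w)
  have hmM : m ≤ M := le_of_mul_le_mul_right ((hsq z).1.trans (hsq z).2) (hT.pow_one_pos n z)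
  have hzp := hT.pow_one_pos (n + k) z
  have h1 := mul_le_mul_of_nonneg_left hnorm (sub_nonneg.2 hmM)
  rw [abs_le] at hm hM
  rcases le_total (M + m) (2 * ((T ^ (n + k)) g z / (T ^ (n + k)) 1 z)) with h | h
  · have h2 := H T hT g N m M n k z hg (abs_le.2 hm) hsq (by
      have : (M + m) * (T ^ (n + k)) 1 z ≤ 2 * (T ^ (n + k)) g z := by
        rwa [← mul_div_assoc, le_div_iff₀ hzp] at h
      linarith)
    have h3 : m + β * (M - m) - C * ρ ^ k * N ≤ M :=
      le_of_mul_le_mul_right ((h2 z).trans (hsq' z).2) hzp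
    refine ⟨max m (m + β * (M - m) - C * ρ ^ k * N), M, ?_, abs_le.2 hM, fun x =>
      ⟨?_, (hsq' x).2⟩, ?_⟩
    · exact abs_le.2 ⟨hm.1.trans (le_max_left _ _), (max_le hmM h3).trans hM.2⟩
    · rcases max_cases m (m + β * (M - m) - C * ρ ^ k * N) with h4 | h4 <;> rw [h4.1]
      exacts [(hsq' x).1, h2 x]
    · linarith [le_max_right m (m + β * (M - m) - C * ρ ^ k * N)]
  · have hg' : LipBound (-g) N := ⟨fun x => by simpa using hg.1 x, fun x y => by
      have := hg.2 y x
      rw [dist_comm] at this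
      simp only [ContinuousMap.neg_apply]
      rwa [show -g x - -g y = g y - g x by ring]⟩
    have h2 := H T hT (-g) N (-M) (-m) n k z hg' (by rw [abs_neg]; exact abs_le.2 hM)
      (squeezed_neg hsq) (by
      have : 2 * (T ^ (n + k)) g z ≤ (M + m) * (T ^ (n + k)) 1 z := by
        rwa [← mul_div_assoc, div_le_iff₀ hzp] at h
      simp only [map_neg, ContinuousMap.neg_apply]
      linarith)
    simp only [map_neg, ContinuousMap.neg_apply] at h2
    have h3 : m ≤ M - β * (M - m) + C * ρ ^ k * N :=
      le_of_mul_le_mul_right (((hsq' z).1).trans (by linarith [h2 z])) hzp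
    refine ⟨m, min M (M - β * (M - m) + C * ρ ^ k * N), abs_le.2 hm, ?_, fun x =>
      ⟨(hsq' x).1, ?_⟩, ?_⟩
    · exact abs_le.2 ⟨hm.1.trans (le_min hmM h3), (min_le_left _ _).trans hM.2⟩
    · rcases min_cases M (M - β * (M - m) + C * ρ ^ k * N) with h4 | h4 <;> rw [h4.1]
      · exact (hsq' x).2
      · linarith [h2 x]
    · linarith [min_le_right M (M - β * (M - m) + C * ρ ^ k * N)]

/-- Iterate the step in blocks of fixed length `k`. The number `n₀` is chosen before `T` and `g`;
this uniformity is what the stability statements rest on. -/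
theorem exists_squeezed (X : Type*) [MetricSpace X] [CompactSpace X] [Nonempty X] {ρ : ℝ}
    (b : ℝ) (hρ : 0 < ρ) (hρ1 : ρ < 1) (hb : 0 ≤ b) {η : ℝ} (hη : 0 < η) : ∃ n₀ : ℕ,
      ∀ T : Module.End ℝ C(X, ℝ), IsOscContracting ρ b T → ∀ (g : C(X, ℝ)) (N : ℝ),
      LipBound g N → ∃ m M, M - m ≤ η * N ∧ ∀ n, n₀ ≤ n → Squeezed T g n m M := by
  obtain ⟨β, C, hβ, hβ1, hC, H⟩ := exists_squeezed_step X b hρ hρ1 hb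
  -- With an error of at most `(β η / 2) N` per block, the recursion for the width has the fixed
  -- point `(η / 2) N`. Then `j` blocks bring the remaining geometric term below `(η / 2) N`.
  obtain ⟨k, hk⟩ := ((tendsto_pow_atTop_nhds_zero_of_lt_one hρ.le hρ1).const_mul C).eventually_lt_const
    (show C * 0 < β * η / 2 by rw [mul_zero]; positivity) |>.exists
  obtain ⟨j, hj⟩ := ((tendsto_pow_atTop_nhds_zero_of_lt_one (by linarith : 0 ≤ 1 - β)
    (by linarith)).mul_const 2).eventually_lt_const
    (show 0 * 2 < η / 2 by rw [zero_mul]; positivity) |>.exists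
  refine ⟨j * k, fun T hT g N hg => ?_⟩
  have hN : 0 ≤ N := (abs_nonneg _).trans (hg.1 (Classical.arbitrary X))
  have main : ∀ i : ℕ, ∃ m M, |m| ≤ N ∧ |M| ≤ N ∧ Squeezed T g (i * k) m M ∧
      M - m ≤ (1 - β) ^ i * (2 * N) + η / 2 * N := by
    intro i
    induction i with
    | zero =>
      refine ⟨-N, N, by rw [abs_neg, abs_of_nonneg hN], by rw [abs_of_nonneg hN], fun x => ?_, ?_⟩
      · simpa [abs_le] using hg.1 x
      · have : 0 ≤ η / 2 * N := by positivity
        linarith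
    | succ i ih =>
      obtain ⟨m, M, hm, hM, hsq, hle⟩ := ih
      obtain ⟨m', M', hm', hM', hsq', hle'⟩ := H T hT g N m M (i * k) k hg hm hM hsq
      refine ⟨m', M', hm', hM', by rwa [Nat.succ_mul], hle'.trans ?_⟩
      have h1 := mul_le_mul_of_nonneg_left hle (by linarith : 0 ≤ 1 - β)
      have h2 := mul_le_mul_of_nonneg_right hk.le hN
      rw [pow_succ]
      linarith
  obtain ⟨m, M, -, -, hsq, hle⟩ := main j
  refine ⟨m, M, ?_, fun n hn => hT.squeezed_of_le hsq hn⟩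
  have := mul_le_mul_of_nonneg_right hj.le hN
  linarith

end IsOscContracting

end PositiveOperators

end

section

/-! ### The eigenmeasure and the leading eigenvalue -/

section PositiveOperators

open CompactlySupported

variable {X : Type*} [MetricSpace X] [CompactSpace X]

/-- The Riesz representation theorem on a compact metric space. -/
theorem exists_measure_of_positive [MeasurableSpace X] [BorelSpace X]
    (l : C(X, ℝ) →ₗ[ℝ] ℝ) (hl : ∀ u : C(X, ℝ), (∀ x, 0 ≤ u x) → 0 ≤ l u) (h1 : l 1 = 1) :
    ∃ ν : Measure X, IsProbabilityMeasure ν ∧ ∀ u : C(X, ℝ), ∫ x, u x ∂ν = l u := by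
  let l' : C_c(X, ℝ) →ₚ[ℝ] ℝ := PositiveLinearMap.mk₀
    { toFun := fun f => l f.toContinuousMap
      map_add' := fun f g => l.map_add f.toContinuousMap g.toContinuousMap
      map_smul' := fun c f => l.map_smul c f.toContinuousMap }
    (fun f hf => hl _ fun x => hf x)
  have key : ∀ u : C(X, ℝ), ∫ x, u x ∂(RealRMK.rieszMeasure l') = l u := fun u =>
    RealRMK.integral_rieszMeasure l' (CompactlySupportedContinuousMap.continuousMapEquiv u)
  refine ⟨RealRMK.rieszMeasure l', ⟨?_⟩, key⟩
  have h2 := key 1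
  rw [h1] at h2
  simp only [ContinuousMap.one_apply, integral_const, smul_eq_mul, mul_one] at h2
  rw [measureReal_def, ENNReal.toReal_eq_one_iff] at h2
  exact h2

namespace IsOscContracting

variable {ρ b : ℝ} {T : Module.End ℝ C(X, ℝ)}

theorem exists_eventually_squeezed [Nonempty X] (hT : IsOscContracting ρ b T) (hρ : 0 < ρ)
    (hρ1 : ρ < 1) (hb : 0 ≤ b) (g : C(X, ℝ)) {η : ℝ} (hη : 0 < η) :
    ∃ m M n₀, M - m ≤ η ∧ ∀ n, n₀ ≤ n → Squeezed T g n m M := by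
  obtain ⟨g', N, hg', hgg'⟩ := exists_lipBound_near g (show 0 < η / 4 by positivity)
  have hN : 0 ≤ N := (abs_nonneg _).trans (hg'.1 (Classical.arbitrary X))
  obtain ⟨n₀, h⟩ := exists_squeezed X b hρ hρ1 hb (show 0 < η / (2 * (N + 1)) by positivity)
  obtain ⟨m, M, hmM, hsq⟩ := h T hT g' N hg'
  refine ⟨m - η / 4, M + η / 4, n₀, ?_, fun n hn x => ?_⟩
  · have : η / (2 * (N + 1)) * N ≤ η / 2 := by
      rw [div_mul_eq_mul_div, div_le_div_iff₀ (by positivity) (by positivity)]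
      nlinarith
    linarith
  · have h1 := hT.abs_pow_le (g := g' - g) (fun y => (hgg' y).le) n x
    rw [map_sub, ContinuousMap.sub_apply, abs_le] at h1
    constructor <;> linarith [(hsq n hn x).1, (hsq n hn x).2]

/-- By squeezing, the quotients `T ^ n g / T ^ n 1` at any two points and at any two late times
differ by little. So they are Cauchy and the limit does not depend on the point; linearity passes to
the limit. -/
theorem exists_functional [Nonempty X] (hT : IsOscContracting ρ b T) (hρ : 0 < ρ)
    (hρ1 : ρ < 1) (hb : 0 ≤ b) : ∃ l : C(X, ℝ) →ₗ[ℝ] ℝ,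
      ∀ g x, Tendsto (fun n : ℕ => (T ^ n) g x / (T ^ n) 1 x) atTop (𝓝 (l g)) := by
  have hlim : ∀ g : C(X, ℝ), ∃ c : ℝ, ∀ x,
      Tendsto (fun n : ℕ => (T ^ n) g x / (T ^ n) 1 x) atTop (𝓝 c) := by
    intro g
    have hdist : ∀ η : ℝ, 0 < η → ∃ n₀, ∀ n, n₀ ≤ n → ∀ n', n₀ ≤ n' → ∀ x y,
        dist ((T ^ n) g x / (T ^ n) 1 x) ((T ^ n') g y / (T ^ n') 1 y) ≤ η := by
      intro η hη
      obtain ⟨m, M, n₀, hmM, hsq⟩ := hT.exists_eventually_squeezed hρ hρ1 hb g hη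
      have hI : ∀ n, n₀ ≤ n → ∀ x, (T ^ n) g x / (T ^ n) 1 x ∈ Icc m M := fun n hn x =>
        ⟨(le_div_iff₀ (hT.pow_one_pos n x)).2 (hsq n hn x).1,
          (div_le_iff₀ (hT.pow_one_pos n x)).2 (hsq n hn x).2⟩
      exact ⟨n₀, fun n hn n' hn' x y =>
        (Real.dist_le_of_mem_Icc (hI n hn x) (hI n' hn' y)).trans hmM⟩
    obtain ⟨x₀⟩ := ‹Nonempty X›
    have hc : CauchySeq fun n : ℕ => (T ^ n) g x₀ / (T ^ n) 1 x₀ := by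
      refine Metric.cauchySeq_iff.2 fun η hη => ?_
      obtain ⟨n₀, h⟩ := hdist (η / 2) (by positivity)
      exact ⟨n₀, fun n hn n' hn' => (h n hn n' hn' x₀ x₀).trans_lt (by linarith)⟩
    obtain ⟨c, hc⟩ := cauchySeq_tendsto_of_complete hc
    refine ⟨c, fun x => hc.congr_dist ?_⟩
    refine Metric.tendsto_atTop.2 fun η hη => ?_
    obtain ⟨n₀, h⟩ := hdist (η / 2) (by positivity)
    refine ⟨n₀, fun n hn => ?_⟩
    rw [Real.dist_0_eq_abs, abs_of_nonneg dist_nonneg]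
    exact (h n hn n hn x₀ x).trans_lt (by linarith)
  choose l hl using hlim
  have x₀ := Classical.arbitrary X
  refine ⟨{ toFun := l, map_add' := fun g g' => ?_, map_smul' := fun c g => ?_ }, hl⟩
  · refine tendsto_nhds_unique (hl _ x₀) (((hl g x₀).add (hl g' x₀)).congr fun n => ?_)
    rw [map_add, ContinuousMap.add_apply, add_div]
  · refine tendsto_nhds_unique (hl _ x₀) (((hl g x₀).const_mul c).congr fun n => ?_)
    rw [map_smul, ContinuousMap.smul_apply, smul_eq_mul, mul_div_assoc]

end IsOscContracting

/-- Conformal measure, leading eigenvalue and uniform convergence for oscillation contracting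
operators. -/
theorem exists_eigenmeasure (X : Type*) [MetricSpace X] [CompactSpace X] [Nonempty X]
    [MeasurableSpace X] [BorelSpace X] {ρ : ℝ} (b : ℝ) (hρ : 0 < ρ) (hρ1 : ρ < 1) (hb : 0 ≤ b) :
    ∃ (H : ℝ) (n₀ : ℝ → ℕ), 1 ≤ H ∧ ∀ T : Module.End ℝ C(X, ℝ), IsOscContracting ρ b T →
      ∃ (l : ℝ) (ν : Measure X), 1 ≤ l ∧ IsProbabilityMeasure ν ∧
        (∀ g : C(X, ℝ), ∫ x, T g x ∂ν = l * ∫ x, g x ∂ν) ∧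
        (∀ (n : ℕ) (x : X), l ^ n ≤ H * (T ^ n) 1 x ∧ (T ^ n) 1 x ≤ H * l ^ n) ∧
        ∀ η, 0 < η → ∀ (g : C(X, ℝ)) (N : ℝ), LipBound g N → ∫ x, g x ∂ν = 0 →
          ∀ n, n₀ η ≤ n → ∀ x, |(T ^ n) g x| ≤ η * N * l ^ n := by
  obtain ⟨H, hH, hHarnack⟩ := IsOscContracting.exists_harnack X b hρ hρ1 hb
  have hH0 : 0 < H := by linarith
  -- The division by `H` pays for the later replacement of `T ^ n 1` by `H l ^ n`.
  have hsq := fun η : Ioi (0 : ℝ) => IsOscContracting.exists_squeezed X b hρ hρ1 hb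
    (η := η / H) (div_pos η.2 hH0)
  choose n₀ hn₀ using hsq
  refine ⟨H, fun η => if h : 0 < η then n₀ ⟨η, h⟩ else 0, hH, fun T hT => ?_⟩
  obtain ⟨f, hf⟩ := hT.exists_functional hρ hρ1 hb
  have x₀ := Classical.arbitrary X
  have hf1 : f 1 = 1 := by
    refine tendsto_nhds_unique (hf 1 x₀) ?_
    exact tendsto_const_nhds.congr fun n => (div_self (hT.pow_one_pos n x₀).ne').symm
  have hfpos : ∀ u : C(X, ℝ), (∀ x, 0 ≤ u x) → 0 ≤ f u := fun u hu =>
    ge_of_tendsto' (hf u x₀) fun n => div_nonneg (hT.pow_nonneg n hu x₀) (hT.pow_one_pos n x₀).le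
  -- `T ^ n (T u) / T ^ n 1` is the product of `T ^ n (T 1) / T ^ n 1` and `T ^ (n + 1) u / T ^ (n +
  -- 1) 1`. Thus `f` is an eigenfunctional with eigenvalue `f (T 1)`.
  have hfT : ∀ u, f (T u) = f (T 1) * f u := by
    intro u
    refine tendsto_nhds_unique (hf (T u) x₀) ?_
    refine ((hf (T 1) x₀).mul ((hf u x₀).comp (tendsto_add_atTop_nat 1))).congr fun n => ?_
    have h1 := (hT.pow_one_pos n x₀).ne'
    have h2 := (hT.pow_one_pos (n + 1) x₀).ne'
    simp only [Function.comp]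
    rw [← Module.End.mul_apply, ← pow_succ, ← Module.End.mul_apply, ← pow_succ]
    field_simp
  have hfTn : ∀ (n : ℕ) u, f ((T ^ n) u) = f (T 1) ^ n * f u := by
    intro n u
    induction n with
    | zero => simp
    | succ n ih => rw [pow_succ', Module.End.mul_apply, hfT, ih]; ring
  have hfle : ∀ u v : C(X, ℝ), (∀ x, u x ≤ v x) → f u ≤ f v := fun u v h => by
    have := hfpos (v - u) fun x => by simpa using h x
    rw [map_sub] at this
    linarith
  obtain ⟨ν, hν, hνf⟩ := exists_measure_of_positive f hfpos hf1
  -- Apply the positive functional `f` to the Harnack inequality, with one of the two points fixed;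
  -- `f (T ^ n 1) = f (T 1) ^ n`.
  have hbounds : ∀ (n : ℕ) (x : X), f (T 1) ^ n ≤ H * (T ^ n) 1 x ∧
      (T ^ n) 1 x ≤ H * f (T 1) ^ n := by
    intro n x
    have h0 := hfTn n 1
    rw [hf1, mul_one] at h0
    constructor
    · have := hfle ((T ^ n) 1) ((H * (T ^ n) 1 x) • 1) fun y => by simpa using hHarnack T hT n y x
      rw [map_smul, hf1, h0] at this
      simpa using this
    · have := hfle (((T ^ n) 1 x) • 1) (H • (T ^ n) 1) fun y => by simpa using hHarnack T hT n x y
      rw [map_smul, map_smul, hf1, h0] at this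
      simpa using this
  refine ⟨f (T 1), ν, ?_, hν, fun g => by rw [hνf, hνf, hfT], hbounds, ?_⟩
  · have := hfle 1 (T 1) fun x => by simpa using hT.one_le x
    rwa [hf1] at this
  · intro η hη g N hg hg0 n hn x
    replace hn : n₀ ⟨η, hη⟩ ≤ n := by simpa [hη] using hn
    have hN : 0 ≤ N := (abs_nonneg _).trans (hg.1 x)
    obtain ⟨m, M, hmM, hsq⟩ := hn₀ ⟨η, hη⟩ T hT g N hg
    rw [hνf] at hg0
    have hln : 0 < f (T 1) ^ n := by
      have := (hbounds n x).2
      have := hT.pow_one_pos n x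
      by_contra h
      nlinarith
    -- Applying `f` to the squeeze and using `f g = 0` shows that `m ≤ 0 ≤ M`. So both `|m|` and
    -- `|M|` are at most the width `M - m`.
    have h1 := hfle (m • (T ^ n) 1) ((T ^ n) g) fun y => by simpa using (hsq n hn y).1
    have h2 := hfle ((T ^ n) g) (M • (T ^ n) 1) fun y => by simpa using (hsq n hn y).2
    rw [map_smul, hfTn, hfTn, hg0, hf1, mul_zero, mul_one, smul_eq_mul] at h1 h2
    have hm : m ≤ 0 := by by_contra h; nlinarith
    have hM : 0 ≤ M := by by_contra h; nlinarith
    have hpos := hT.pow_one_pos n x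
    have hx := hsq n hn x
    have h3 : |(T ^ n) g x| ≤ η / H * N * (T ^ n) 1 x := by
      rw [abs_le]
      constructor <;> nlinarith
    refine h3.trans ?_
    calc η / H * N * (T ^ n) 1 x ≤ η / H * N * (H * f (T 1) ^ n) := by
          gcongr; exact (hbounds n x).2
      _ = _ := by field_simp

end PositiveOperators

end

section

/-! ### From contraction on the kernel of a functional to a spectral gap -/

section SpectralGap

variable {X : Type*} [NormedAddCommGroup X] [NormedSpace ℂ X] [CompleteSpace X]

/-- Because `T P = l P` and `P² = P`, one has `z - T = (z - (T - l P)) (1 - (l / z) P)`, and the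
last factor has the inverse `1 + (l / (z - l)) P`. -/
theorem isUnit_sub_of_isUnit_sub_complement {A : Type*} [Ring A] [Algebra ℂ A] {T P : A} {l z : ℂ}
    (hTP : T * P = l • P) (hP : P * P = P) (hz : z ≠ 0) (hzl : z ≠ l)
    (h : IsUnit (algebraMap ℂ A z - (T - l • P))) : IsUnit (algebraMap ℂ A z - T) := by
  have hzl' : z - l ≠ 0 := sub_ne_zero.2 hzl
  have h1 : (1 - (l / z) • P) * (1 + (l / (z - l)) • P) = 1 := by
    have : l / (z - l) - l / z - (l / z) * (l / (z - l)) = 0 := by field_simp; ring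
    calc (1 - (l / z) • P) * (1 + (l / (z - l)) • P)
        = 1 + (l / (z - l) - l / z - (l / z) * (l / (z - l))) • P := by
          simp only [sub_mul, mul_add, one_mul, mul_one, smul_mul_smul_comm, hP]
          module
      _ = 1 := by rw [this]; simp
  have h2 : (1 + (l / (z - l)) • P) * (1 - (l / z) • P) = 1 := by
    have : l / (z - l) - l / z - (l / z) * (l / (z - l)) = 0 := by field_simp; ring
    calc (1 + (l / (z - l)) • P) * (1 - (l / z) • P)
        = 1 + (l / (z - l) - l / z - (l / z) * (l / (z - l))) • P := by
          simp only [mul_sub, add_mul, one_mul, mul_one, smul_mul_smul_comm, hP]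
          module
      _ = 1 := by rw [this]; simp
  have h3 : IsUnit (1 - (l / z) • P) := ⟨⟨_, _, h1, h2⟩, rfl⟩
  have h4 : algebraMap ℂ A z - T
      = (algebraMap ℂ A z - (T - l • P)) * (1 - (l / z) • P) := by
    rw [Algebra.algebraMap_eq_smul_one]
    simp only [sub_mul, mul_sub, one_mul, mul_one, hP, smul_mul_assoc, mul_smul_comm, hTP]
    rw [sub_self, sub_zero, smul_smul, div_mul_cancel₀ _ hz]
    module
  rw [h4]
  exact h.mul h3

/-- Let `P = f ⊗ h` be the projection onto the line of `h` along the kernel of `f`, and `R = T - l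
P`. Then `R ^ n = T ^ n (1 - P)` for `n ≥ 1`, and a high power of `R` has norm at most half of the
same power of `l`. So the spectrum of `R` lies in a smaller disc, and outside that disc the spectrum
of `T` can contain only `l`. An eigenvector for `l` in the kernel of `f` would contradict the
contraction, so the eigenspace is a line. -/
theorem hasSpectralGap_of_contracting {T : X →L[ℂ] X} {l : ℝ} (hl : 0 < l) {h : X} (f : X →L[ℂ] ℂ)
    (hTh : T h = (l : ℂ) • h) (hfT : ∀ g, f (T g) = l * f g) (hfh : f h = 1) {N : ℕ} (hN : 0 < N)
    (hcontr : ∀ g, f g = 0 → ‖(T ^ N) g‖ ≤ l ^ N / 2 * ‖g‖) : HasSpectralGap T l := by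
  have hh : h ≠ 0 := by rintro rfl; simp at hfh
  have : Nontrivial X := ⟨h, 0, hh⟩
  set P : X →L[ℂ] X := f.smulRight h with hPdef
  have hPa : ∀ g, P g = f g • h := fun g => rfl
  have hTP : T * P = (l : ℂ) • P := by
    ext g
    simp only [mul_apply_eq_comp, hPa, map_smul, hTh, smul_apply]
    exact smul_comm _ _ _
  have hPP : P * P = P := by
    ext g
    simp [hPa, hfh]
  have hker : ∀ (j : ℕ) g, f g = 0 → f ((T ^ N) g) = 0 ∧
      ‖(T ^ (N * j)) g‖ ≤ (l ^ N / 2) ^ j * ‖g‖ := by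
    have hf : ∀ (n : ℕ) g, f g = 0 → f ((T ^ n) g) = 0 := by
      intro n g hg
      induction n with
      | zero => simpa
      | succ n ih => rw [pow_succ', mul_apply_eq_comp, hfT, ih, mul_zero]
    intro j g hg
    refine ⟨hf N g hg, ?_⟩
    induction j generalizing g with
    | zero => simp
    | succ j ih =>
      rw [Nat.mul_succ, pow_add, mul_apply_eq_comp]
      refine (ih _ (hf N g hg)).trans ?_
      rw [pow_succ, mul_assoc]
      gcongr
      exact hcontr g hg
  refine ⟨hl, ⟨spectrum ℂ T \ {(l : ℂ)}, ?_, ?_⟩, ?_⟩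
  · rw [union_sdiff_self, eq_comm, union_eq_right, singleton_subset_iff]
    intro hu
    have h0 : (algebraMap ℂ (X →L[ℂ] X) l - T) h = 0 := by
      simp [Algebra.algebraMap_eq_smul_one, hTh]
    obtain ⟨u, hu⟩ := hu
    have h1 := congrArg (fun S : X →L[ℂ] X => S h) u.inv_mul
    simp only [mul_apply_eq_comp, one_apply_eq_self] at h1
    rw [hu, h0, map_zero] at h1
    exact hh h1.symm
  · set R := T - (l : ℂ) • P with hR
    have hRpow : ∀ (n : ℕ) g, (R ^ (n + 1)) g = (T ^ (n + 1)) (g - f g • h) := by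
      intro n
      induction n with
      | zero =>
        intro g
        simp only [hR, zero_add, pow_one, sub_apply,
          smul_apply, hPa, map_sub, map_smul, hTh]
        rw [smul_comm]
      | succ n ih =>
        intro g
        have h0 : f (R g) = 0 := by
          simp [hR, hPa, hfT, hfh]
        rw [pow_succ, mul_apply_eq_comp, ih, h0, zero_smul, sub_zero,
          pow_succ T (n + 1), mul_apply_eq_comp]
        congr 1
        simp only [hR, sub_apply,
          smul_apply, hPa, map_sub, map_smul, hTh]
        rw [smul_comm]
    -- The norm of `1 - P` is not controlled, so the block of length `N` is repeated until the
    -- factor `2⁻ʲ` absorbs it.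
    obtain ⟨j, hj, hj1⟩ := (((tendsto_pow_atTop_nhds_zero_of_lt_one (by norm_num : (0 : ℝ) ≤ 1 / 2)
      (by norm_num)).mul_const ‖(1 : X →L[ℂ] X) - P‖).eventually_lt_const
      (show 0 * ‖(1 : X →L[ℂ] X) - P‖ < 1 / 2 by norm_num)).and (eventually_ge_atTop 1) |>.exists
    have hNj : 0 < N * j := Nat.mul_pos hN hj1
    have hnorm : ‖R ^ (N * j)‖ ≤ l ^ (N * j) / 2 := by
      refine ContinuousLinearMap.opNorm_le_bound _ (by positivity) fun g => ?_
      obtain ⟨n, hn⟩ := Nat.exists_eq_succ_of_ne_zero hNj.ne'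
      have h1 : f (g - f g • h) = 0 := by simp [hfh]
      have h2 := (hker j _ h1).2
      rw [hn] at h2 ⊢
      rw [hRpow]
      refine h2.trans ?_
      have h3 : ‖g - f g • h‖ ≤ ‖(1 : X →L[ℂ] X) - P‖ * ‖g‖ :=
        ((1 : X →L[ℂ] X) - P).le_opNorm g
      calc (l ^ N / 2) ^ j * ‖g - f g • h‖
          ≤ (l ^ N / 2) ^ j * (‖(1 : X →L[ℂ] X) - P‖ * ‖g‖) := by gcongr
        _ = l ^ (N * j) * ((1 / 2) ^ j * ‖(1 : X →L[ℂ] X) - P‖) * ‖g‖ := by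
            rw [div_pow, pow_mul, one_div, inv_pow]; ring
        _ ≤ l ^ (N * j) * (1 / 2) * ‖g‖ := by gcongr
        _ = _ := by rw [← hn]; ring
    set c : ℝ := (1 / 2 : ℝ) ^ ((N * j : ℕ) : ℝ)⁻¹ with hc
    have hc0 : 0 < c := by positivity
    have hc1 : c < 1 := Real.rpow_lt_one (by norm_num) (by norm_num) (by positivity)
    have hcpow : c ^ (N * j) = 1 / 2 := Real.rpow_inv_natCast_pow (by norm_num) hNj.ne'
    refine ⟨l * c, by nlinarith, fun z hz => ?_⟩
    by_contra! hzc
    refine hz.1 (isUnit_sub_of_isUnit_sub_complement (T := T) hTP hPP ?_ hz.2 ?_)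
    · rintro rfl
      rw [norm_zero] at hzc
      nlinarith
    · by_contra hzR
      have h1 : z ^ (N * j) ∈ spectrum ℂ (R ^ (N * j)) :=
        spectrum.pow_mem_pow R (N * j) hzR
      have h2 := spectrum.norm_le_norm_of_mem h1
      rw [norm_pow] at h2
      have h3 : (l * c) ^ (N * j) < ‖z‖ ^ (N * j) := pow_lt_pow_left₀ hzc (by positivity) hNj.ne'
      rw [mul_pow, hcpow] at h3
      linarith
  · refine finrank_eq_one (⟨h, Module.End.mem_eigenspace_iff.2 hTh⟩ :
      Module.End.eigenspace (T : X →ₗ[ℂ] X) (l : ℂ)) (fun h0 => hh (congrArg Subtype.val h0)) ?_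
    · rintro ⟨g, hg⟩
      rw [Module.End.mem_eigenspace_iff] at hg
      refine ⟨f g, Subtype.ext ?_⟩
      change f g • h = g
      have hg' : T g = (l : ℂ) • g := hg
      set w := g - f g • h with hw
      have hTw : T w = (l : ℂ) • w := by
        rw [hw, map_sub, map_smul, hTh, hg', smul_sub, smul_comm]
      have hpow : ∀ n : ℕ, (T ^ n) w = (l : ℂ) ^ n • w := by
        intro n
        induction n with
        | zero => simp
        | succ n ih =>
          rw [pow_succ, mul_apply_eq_comp, hTw, map_smul, ih, smul_smul]; ring_nf
      have h1 := hcontr w (by simp [hw, hfh])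
      rw [hpow, norm_smul, norm_pow, Complex.norm_real, Real.norm_of_nonneg hl.le] at h1
      have h2 : 0 < l ^ N := by positivity
      have h3 : ‖w‖ = 0 := by
        by_contra h4
        have : 0 < ‖w‖ := lt_of_le_of_ne (norm_nonneg _) (Ne.symm h4)
        nlinarith
      exact (sub_eq_zero.1 (norm_eq_zero.1 h3)).symm

/-- Since `f` is invariant, `e - A e` lies in its kernel, so the increments `A ^ n e - A ^ (n + 1)
e` decay geometrically. The rate depends only on `K`, `E` and `N`, which are given before `A`, `f`
and `e`. -/
theorem exists_fixed_of_contracting {𝕜 : Type*} [RCLike 𝕜] {X : Type*} [NormedAddCommGroup X]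
    [NormedSpace 𝕜 X] [CompleteSpace X] {K E : ℝ} {N : ℕ} (hN : 0 < N) (hK : 0 ≤ K) (hE : 0 ≤ E) :
    ∃ C c : ℝ, 0 ≤ C ∧ 0 ≤ c ∧ c < 1 ∧ ∀ (A : X →L[𝕜] X) (f : X →L[𝕜] 𝕜) (e : X), ‖A‖ ≤ K →
      ‖e‖ ≤ E → f e = 1 → (∀ g, f (A g) = f g) → (∀ g, f g = 0 → ‖(A ^ N) g‖ ≤ 1 / 2 * ‖g‖) →
      ∃ h, A h = h ∧ f h = 1 ∧ ∀ n : ℕ, ‖(A ^ n) e - h‖ ≤ C * c ^ n := by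
  set K' := max K 1 with hK'
  set c : ℝ := (1 / 2 : ℝ) ^ (N : ℝ)⁻¹ with hc
  have hc0 : 0 < c := by positivity
  have hc1 : c < 1 := Real.rpow_lt_one (by norm_num) (by norm_num) (by positivity)
  have hcpow : c ^ N = 1 / 2 := Real.rpow_inv_natCast_pow (by norm_num) hN.ne'
  have hK1 : 1 ≤ K' := le_max_right _ _
  -- The factor `K' ^ N` bounds an incomplete block, the 2 comes from `c ^ (n % N) ≥ 1 / 2`, `(1 +
  -- K) E` bounds `e - A e`, and `1 / (1 - c)` sums the geometric series.
  refine ⟨2 * K' ^ N * ((1 + K) * E) / (1 - c), c, ?_, hc0.le, hc1, ?_⟩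
  · have : 0 < 1 - c := by linarith
    positivity
  intro A f e hA he hfe hfA hcontr
  have hf : ∀ (n : ℕ) g, f ((A ^ n) g) = f g := by
    intro n g
    induction n with
    | zero => simp
    | succ n ih => rw [pow_succ', mul_apply_eq_comp, hfA, ih]
  have hpowK : ∀ i, i ≤ N → ∀ g, ‖(A ^ i) g‖ ≤ K' ^ N * ‖g‖ := by
    intro i hi g
    have h1 : ∀ i : ℕ, ‖(A ^ i) g‖ ≤ K' ^ i * ‖g‖ := by
      intro i
      induction i with
      | zero => simp
      | succ i ih =>
        rw [pow_succ', mul_apply_eq_comp, pow_succ', mul_assoc]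
        exact (A.le_of_opNorm_le (hA.trans (le_max_left _ _)) _).trans (by gcongr)
    exact (h1 i).trans (by gcongr)
  have hpowN : ∀ (j : ℕ) g, f g = 0 → ‖(A ^ (N * j)) g‖ ≤ (1 / 2) ^ j * ‖g‖ := by
    intro j
    induction j with
    | zero => simp
    | succ j ih =>
      intro g hg
      rw [Nat.mul_succ, pow_add, mul_apply_eq_comp]
      refine (ih _ ((hf N g).trans hg)).trans ?_
      rw [pow_succ, mul_assoc]
      gcongr
      exact hcontr g hg
  have hdecay : ∀ (n : ℕ) g, f g = 0 → ‖(A ^ n) g‖ ≤ 2 * K' ^ N * c ^ n * ‖g‖ := by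
    intro n g hg
    have hn := Nat.div_add_mod n N
    have hmod := (Nat.mod_lt n hN).le
    have h1 : ‖(A ^ n) g‖ ≤ K' ^ N * ((1 / 2) ^ (n / N) * ‖g‖) := by
      conv_lhs => rw [← hn, add_comm, pow_add, mul_apply_eq_comp]
      exact (hpowK _ hmod _).trans (by gcongr; exact hpowN _ g hg)
    have h2 : (1 / 2 : ℝ) ^ (n / N) ≤ 2 * c ^ n := by
      have h3 : c ^ n = (1 / 2) ^ (n / N) * c ^ (n % N) := by
        conv_lhs => rw [← hn, pow_add, pow_mul, hcpow]
      have h4 : 1 / 2 ≤ c ^ (n % N) := by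
        rw [← hcpow]; exact pow_le_pow_of_le_one hc0.le hc1.le hmod
      have h5 : 0 < (1 / 2 : ℝ) ^ (n / N) := by positivity
      nlinarith
    calc ‖(A ^ n) g‖ ≤ K' ^ N * ((1 / 2) ^ (n / N) * ‖g‖) := h1
      _ ≤ K' ^ N * (2 * c ^ n * ‖g‖) := by gcongr
      _ = _ := by ring
  have hstep : ∀ n : ℕ, dist ((A ^ n) e) ((A ^ (n + 1)) e)
      ≤ 2 * K' ^ N * ((1 + K) * E) * c ^ n := by
    intro n
    rw [dist_eq_norm, pow_succ, mul_apply_eq_comp, ← map_sub]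
    refine (hdecay n _ (by rw [map_sub, hfA, sub_self])).trans ?_
    have : ‖e - A e‖ ≤ (1 + K) * E := by
      refine (norm_sub_le _ _).trans ?_
      have h1 := (A.le_of_opNorm_le hA e).trans (mul_le_mul_of_nonneg_left he hK)
      linarith
    calc 2 * K' ^ N * c ^ n * ‖e - A e‖ ≤ 2 * K' ^ N * c ^ n * ((1 + K) * E) := by gcongr
      _ = _ := by ring
  obtain ⟨h, hh⟩ := cauchySeq_tendsto_of_complete (cauchySeq_of_le_geometric c _ hc1 hstep)
  refine ⟨h, ?_, ?_, fun n => ?_⟩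
  · refine tendsto_nhds_unique ((A.continuous.tendsto h).comp hh) ?_
    refine (hh.comp (tendsto_add_atTop_nat 1)).congr fun n => ?_
    simp only [Function.comp]
    rw [pow_succ', mul_apply_eq_comp]
  · refine tendsto_nhds_unique ((f.continuous.tendsto h).comp hh) ?_
    refine tendsto_const_nhds.congr fun n => ?_
    simp only [Function.comp]
    rw [hf, hfe]
  · rw [← dist_eq_norm]
    refine (dist_le_of_le_geometric_of_tendsto c _ hc1 hstep hh n).trans_eq ?_
    ring

end SpectralGap

end

section

/-! ### Convergence of jets at moving points -/

section Jets

/-- If there are as many blocks as elements, every block is a singleton; as the blocks are ordered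
by their last elements, the enumeration is the identity. It isolates the only term of the Faà di
Bruno formula in which the top derivative of the outer function occurs. -/
theorem orderedFinpartition_eq_atomic {n : ℕ} (c : OrderedFinpartition n) (h : c.length = n) :
    c = OrderedFinpartition.atomic n := by
  have hcard : ∑ m, c.partSize m = n := by
    simpa using Fintype.card_congr c.equivSigma
  have hp : ∀ m, c.partSize m = 1 := by
    have h1 : ∑ _m : Fin c.length, 1 = ∑ m, c.partSize m := by simp [hcard, h]
    intro m
    exact ((Finset.sum_eq_sum_iff_of_le fun i _ => c.partSize_pos i).1 h1 m (Finset.mem_univ m)).symm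
  obtain ⟨length, partSize, hpos, emb, hmono, hpm, hdisj, hcov⟩ := c
  simp only at h hp
  subst h
  obtain rfl : partSize = fun _ => 1 := funext hp
  have h2 : (fun m : Fin length => emb m 0) = id := by
    have h3 := Subsingleton.elim
      (hpm.orderIsoOfSurjective _ (Finite.surjective_of_injective hpm.injective))
      (OrderIso.refl (Fin length))
    exact congrArg (fun e : Fin length ≃o Fin length => (e : Fin length → Fin length)) h3
  obtain rfl : emb = fun m _ => m := by
    funext m i
    rw [Subsingleton.elim i 0]
    exact congrFun h2 m
  rfl

variable {ι : Type*} {E F G : Type*} [NormedAddCommGroup E] [NormedSpace ℝ E]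
  [NormedAddCommGroup F] [NormedSpace ℝ F] [NormedAddCommGroup G] [NormedSpace ℝ G]

/-- Convergence of the derivatives of order at most `r` of `f a` at `z a` to those of `f₀` at
`z₀`. -/
structure JetTendsto (l : Filter ι) (r : ℕ) (f : ι → E → F) (z : ι → E) (f₀ : E → F) (z₀ : E) :
    Prop where
  contDiffAt : ∀ᶠ a in l, ContDiffAt ℝ r (f a) (z a)
  contDiffAt_lim : ContDiffAt ℝ r f₀ z₀
  tendsto : ∀ s ≤ r, Tendsto (fun a => iteratedFDeriv ℝ s (f a) (z a)) l
    (𝓝 (iteratedFDeriv ℝ s f₀ z₀))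

namespace JetTendsto

variable {l : Filter ι} {r : ℕ} {f : ι → E → F} {z : ι → E} {f₀ : E → F} {z₀ : E}

theorem tendsto_value (h : JetTendsto l r f z f₀ z₀) :
    Tendsto (fun a => f a (z a)) l (𝓝 (f₀ z₀)) := by
  have := ((continuousMultilinearCurryFin0 ℝ E F).continuous.tendsto _).comp
    (h.tendsto 0 (Nat.zero_le r))
  simpa [Function.comp_def] using this

theorem congr {f' : ι → E → F} {f₀' : E → F} (h : JetTendsto l r f z f₀ z₀)
    (h1 : ∀ᶠ a in l, f a =ᶠ[𝓝 (z a)] f' a) (h2 : f₀ =ᶠ[𝓝 z₀] f₀') :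
    JetTendsto l r f' z f₀' z₀ where
  contDiffAt := by
    filter_upwards [h1, h.contDiffAt] with a ha hc using hc.congr_of_eventuallyEq ha.symm
  contDiffAt_lim := h.contDiffAt_lim.congr_of_eventuallyEq h2.symm
  tendsto s hs := by
    rw [← (h2.iteratedFDeriv ℝ s).eq_of_nhds]
    refine (h.tendsto s hs).congr' ?_
    filter_upwards [h1] with a ha using (ha.iteratedFDeriv ℝ s).eq_of_nhds

theorem congr_point {z' : ι → E} (h : JetTendsto l r f z f₀ z₀) (hz : ∀ᶠ a in l, z a = z' a) :
    JetTendsto l r f z' f₀ z₀ where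
  contDiffAt := by filter_upwards [h.contDiffAt, hz] with a h1 h2 using h2 ▸ h1
  contDiffAt_lim := h.contDiffAt_lim
  tendsto s hs := (h.tendsto s hs).congr' (by filter_upwards [hz] with a ha using by rw [ha])

theorem of_le {r' : ℕ} (h : JetTendsto l r f z f₀ z₀) (hr : r' ≤ r) :
    JetTendsto l r' f z f₀ z₀ :=
  ⟨h.contDiffAt.mono fun _ ha => ha.of_le (by exact_mod_cast hr),
    h.contDiffAt_lim.of_le (by exact_mod_cast hr), fun s hs => h.tendsto s (hs.trans hr)⟩

theorem const (h : ContDiffAt ℝ r f₀ z₀) (hz : Tendsto z l (𝓝 z₀)) :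
    JetTendsto l r (fun _ => f₀) z f₀ z₀ where
  contDiffAt := hz.eventually (h.eventually (by simp))
  contDiffAt_lim := h
  tendsto s hs := by
    have h1 : ContinuousAt (iteratedFDeriv ℝ s f₀) z₀ :=
      (h.iteratedFDeriv_right (m := 0) (i := s) (by simpa using hs)).continuousAt
    exact h1.tendsto.comp hz

/-- By the Faà di Bruno formula each derivative of a composition is a finite sum of continuous
expressions in the derivatives of the two factors. -/
theorem comp {g : ι → F → G} {g₀ : F → G} (hg : JetTendsto l r g (fun a => f a (z a)) g₀ (f₀ z₀))
    (hf : JetTendsto l r f z f₀ z₀) : JetTendsto l r (fun a => g a ∘ f a) z (g₀ ∘ f₀) z₀ where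
  contDiffAt := by
    filter_upwards [hg.contDiffAt, hf.contDiffAt] with a h1 h2 using h1.comp (z a) h2
  contDiffAt_lim := hg.contDiffAt_lim.comp z₀ hf.contDiffAt_lim
  tendsto s hs := by
    have hs' : (s : WithTop ℕ∞) ≤ r := by exact_mod_cast hs
    rw [iteratedFDeriv_comp hg.contDiffAt_lim hf.contDiffAt_lim hs']
    have key : Tendsto (fun a => (ftaylorSeries ℝ (g a) (f a (z a))).taylorComp
        (ftaylorSeries ℝ (f a) (z a)) s) l
        (𝓝 ((ftaylorSeries ℝ g₀ (f₀ z₀)).taylorComp (ftaylorSeries ℝ f₀ z₀) s)) := by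
      refine tendsto_finsetSum _ fun c _ => ?_
      have h1 := ((c.compAlongOrderedFinpartitionL ℝ E F G).continuous.tendsto _).comp
        (hg.tendsto c.length (c.length_le.trans hs))
      have h2 : Tendsto (fun a => fun m => iteratedFDeriv ℝ (c.partSize m) (f a) (z a)) l
          (𝓝 fun m => iteratedFDeriv ℝ (c.partSize m) f₀ z₀) :=
        tendsto_pi_nhds.2 fun m => hf.tendsto _ ((c.partSize_le m).trans hs)
      exact h1.eval h2
    refine key.congr' ?_
    filter_upwards [hg.contDiffAt, hf.contDiffAt] with a h1 h2
    rw [iteratedFDeriv_comp h1 h2 hs']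

theorem prodMk {g : ι → E → G} {g₀ : E → G} (hf : JetTendsto l r f z f₀ z₀)
    (hg : JetTendsto l r g z g₀ z₀) :
    JetTendsto l r (fun a x => (f a x, g a x)) z (fun x => (f₀ x, g₀ x)) z₀ where
  contDiffAt := by
    filter_upwards [hf.contDiffAt, hg.contDiffAt] with a h1 h2 using h1.prodMk h2
  contDiffAt_lim := hf.contDiffAt_lim.prodMk hg.contDiffAt_lim
  tendsto s hs := by
    have hs' : (s : WithTop ℕ∞) ≤ r := by exact_mod_cast hs
    rw [iteratedFDeriv_prodMk hf.contDiffAt_lim hg.contDiffAt_lim hs']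
    have h1 : Tendsto (fun a => (iteratedFDeriv ℝ s (f a) (z a)).prod
        (iteratedFDeriv ℝ s (g a) (z a))) l
        (𝓝 ((iteratedFDeriv ℝ s f₀ z₀).prod (iteratedFDeriv ℝ s g₀ z₀))) :=
      ((ContinuousMultilinearMap.prodL ℝ (fun _ : Fin s => E) F G).continuous.tendsto
        (_, _)).comp ((hf.tendsto s hs).prodMk_nhds (hg.tendsto s hs))
    refine h1.congr' ?_
    filter_upwards [hf.contDiffAt, hg.contDiffAt] with a h2 h3
    rw [iteratedFDeriv_prodMk h2 h3 hs']

theorem fderiv (h : JetTendsto l (r + 1) f z f₀ z₀) :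
    JetTendsto l r (fun a => fderiv ℝ (f a)) z (fderiv ℝ f₀) z₀ where
  contDiffAt := h.contDiffAt.mono fun a ha => ha.fderiv_right (by simp)
  contDiffAt_lim := h.contDiffAt_lim.fderiv_right (by simp)
  tendsto s hs := by
    have h1 := h.tendsto (s + 1) (by lia)
    simp only [iteratedFDeriv_succ_eq_comp_right, Function.comp_apply] at h1
    have h2 := ((continuousMultilinearCurryRightEquiv' ℝ s E F).continuous.tendsto _).comp h1
    simp only [Function.comp_def, LinearIsometryEquiv.apply_symm_apply] at h2
    exact h2

theorem of_fderiv (h : Tendsto (fun a => f a (z a)) l (𝓝 (f₀ z₀)))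
    (hd : JetTendsto l r (fun a => _root_.fderiv ℝ (f a)) z (_root_.fderiv ℝ f₀) z₀)
    (hc : ∀ᶠ a in l, ContDiffAt ℝ (r + 1 : ℕ) (f a) (z a))
    (hc₀ : ContDiffAt ℝ (r + 1 : ℕ) f₀ z₀) :
    JetTendsto l (r + 1) f z f₀ z₀ where
  contDiffAt := hc
  contDiffAt_lim := hc₀
  tendsto s hs := by
    cases s with
    | zero =>
      simp only [iteratedFDeriv_zero_eq_comp]
      exact ((continuousMultilinearCurryFin0 ℝ E F).symm.continuous.tendsto _).comp h
    | succ s =>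
      simp only [iteratedFDeriv_succ_eq_comp_right, Function.comp_apply]
      exact ((continuousMultilinearCurryRightEquiv' ℝ s E F).symm.continuous.tendsto _).comp
        (hd.tendsto s (by lia))

theorem zero (h : ∀ᶠ a in l, ContDiffAt ℝ (0 : ℕ) (f a) (z a)) (h₀ : ContDiffAt ℝ (0 : ℕ) f₀ z₀)
    (hv : Tendsto (fun a => f a (z a)) l (𝓝 (f₀ z₀))) : JetTendsto l 0 f z f₀ z₀ where
  contDiffAt := h
  contDiffAt_lim := h₀
  tendsto s hs := by
    obtain rfl : s = 0 := by lia
    simp only [iteratedFDeriv_zero_eq_comp]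
    exact ((continuousMultilinearCurryFin0 ℝ E F).symm.continuous.tendsto _).comp hv

/-- The jets of the local inverses depend continuously on the jets of the maps. -/
theorem inverse [CompleteSpace E] {f : ι → E → E} {f₀ : E → E} {g : ι → E → E} {g₀ : E → E}
    (hf : JetTendsto l (r + 1) f z f₀ z₀) (hz : Tendsto z l (𝓝 z₀))
    (hg : ∀ᶠ a in l, ContDiffAt ℝ (r + 1 : ℕ) (g a) (f a (z a)))
    (hg₀ : ContDiffAt ℝ (r + 1 : ℕ) g₀ (f₀ z₀))
    (hfg : ∀ᶠ a in l, f a ∘ g a =ᶠ[𝓝 (f a (z a))] id) (hgf : ∀ᶠ a in l, g a ∘ f a =ᶠ[𝓝 (z a)] id)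
    (hfg₀ : f₀ ∘ g₀ =ᶠ[𝓝 (f₀ z₀)] id) (hgf₀ : g₀ ∘ f₀ =ᶠ[𝓝 z₀] id) :
    JetTendsto l (r + 1) g (fun a => f a (z a)) g₀ (f₀ z₀) := by
  have hval : ∀ {f g : E → E} {z : E}, g ∘ f =ᶠ[𝓝 z] id → g (f z) = z := fun h => h.eq_of_nhds
  -- The identity `Dg = (Df ∘ g)⁻¹` near `f z`, obtained by differentiating both compositions.
  have hder : ∀ {f g : E → E} {z : E}, ContDiffAt ℝ (r + 1 : ℕ) f z →
      ContDiffAt ℝ (r + 1 : ℕ) g (f z) → f ∘ g =ᶠ[𝓝 (f z)] id → g ∘ f =ᶠ[𝓝 z] id →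
      (∃ e : E ≃L[ℝ] E, (e : E →L[ℝ] E) = _root_.fderiv ℝ f z) ∧
      ContinuousLinearMap.inverse ∘ _root_.fderiv ℝ f ∘ g =ᶠ[𝓝 (f z)] _root_.fderiv ℝ g := by
    intro f g z hf hg hfg hgf
    have hgz := hval hgf
    have key : ∀ᶠ w in 𝓝 (f z), ∃ e : E ≃L[ℝ] E, (e : E →L[ℝ] E) = _root_.fderiv ℝ f (g w) ∧
        (e.symm : E →L[ℝ] E) = _root_.fderiv ℝ g w := by
      have hgc : Tendsto g (𝓝 (f z)) (𝓝 z) := by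
        have := hg.continuousAt.tendsto
        rwa [hgz] at this
      have h1 : ∀ᶠ w in 𝓝 (f z), ContDiffAt ℝ (r + 1 : ℕ) g w := hg.eventually (by simp)
      have h2 : ∀ᶠ w in 𝓝 (f z), ContDiffAt ℝ (r + 1 : ℕ) f (g w) :=
        hgc.eventually (hf.eventually (by simp))
      have h3 : ∀ᶠ w in 𝓝 (f z), f ∘ g =ᶠ[𝓝 w] id := hfg.eventually_nhds
      have h4 : ∀ᶠ w in 𝓝 (f z), g ∘ f =ᶠ[𝓝 (g w)] id := hgc.eventually hgf.eventually_nhds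
      filter_upwards [h1, h2, h3, h4] with w h1 h2 h3 h4
      have d1 := (h1.differentiableAt (by simp)).hasFDerivAt
      have d2 := (h2.differentiableAt (by simp)).hasFDerivAt
      have hw : f (g w) = w := h3.eq_of_nhds
      have c1 : (_root_.fderiv ℝ f (g w)).comp (_root_.fderiv ℝ g w)
          = ContinuousLinearMap.id ℝ E :=
        ((d2.comp w d1).congr_of_eventuallyEq h3.symm).unique (hasFDerivAt_id w)
      have d1' : HasFDerivAt g (_root_.fderiv ℝ g w) (f (g w)) := by rwa [hw]
      have c2 : (_root_.fderiv ℝ g w).comp (_root_.fderiv ℝ f (g w))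
          = ContinuousLinearMap.id ℝ E :=
        ((d1'.comp (g w) d2).congr_of_eventuallyEq h4.symm).unique (hasFDerivAt_id (g w))
      exact ⟨ContinuousLinearEquiv.equivOfInverse _ _ (fun x => DFunLike.congr_fun c2 x)
        (fun x => DFunLike.congr_fun c1 x), rfl, rfl⟩
    refine ⟨?_, ?_⟩
    · obtain ⟨e, he, -⟩ := key.self_of_nhds
      exact ⟨e, by rw [he, hgz]⟩
    · filter_upwards [key] with w hw
      obtain ⟨e, he, he'⟩ := hw
      simp only [Function.comp_apply]
      rw [← he, ContinuousLinearMap.inverse_equiv, he']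
  have hd₀ := hder hf.contDiffAt_lim hg₀ hfg₀ hgf₀
  have hd : ∀ᶠ a in l, ContinuousLinearMap.inverse ∘ _root_.fderiv ℝ (f a) ∘ g a
      =ᶠ[𝓝 (f a (z a))] _root_.fderiv ℝ (g a) := by
    filter_upwards [hf.contDiffAt, hg, hfg, hgf] with a h1 h2 h3 h4 using (hder h1 h2 h3 h4).2
  have hzg : ∀ᶠ a in l, z a = g a (f a (z a)) := by
    filter_upwards [hgf] with a ha using (hval ha).symm
  have hz₀ : g₀ (f₀ z₀) = z₀ := hval hgf₀
  have hzero : Tendsto (fun a => g a (f a (z a))) l (𝓝 (g₀ (f₀ z₀))) := by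
    rw [hz₀]
    exact hz.congr' hzg
  -- Bootstrapping: if the jets of order `k` of `g` converge, so do those of `(Df ∘ g)⁻¹ = Dg`, and
  -- hence the jets of order `k + 1` of `g`.
  have main : ∀ k ≤ r + 1, JetTendsto l k g (fun a => f a (z a)) g₀ (f₀ z₀) := by
    intro k
    induction k with
    | zero =>
      intro _
      exact zero (hg.mono fun a ha => ha.of_le (by simp)) (hg₀.of_le (by simp)) hzero
    | succ k ih =>
      intro hk
      have hk' : ((k + 1 : ℕ) : WithTop ℕ∞) ≤ (r + 1 : ℕ) := by exact_mod_cast hk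
      refine of_fderiv hzero ?_ (hg.mono fun a ha => ha.of_le hk') (hg₀.of_le hk')
      have h1 : JetTendsto l k (fun a => _root_.fderiv ℝ (f a)) (fun a => g a (f a (z a)))
          (_root_.fderiv ℝ f₀) (g₀ (f₀ z₀)) := by
        have h2 : JetTendsto l k (fun a => _root_.fderiv ℝ (f a)) z (_root_.fderiv ℝ f₀) z₀ :=
          (hf.of_le hk).fderiv
        rw [hz₀]
        exact h2.congr_point hzg
      have h3 := h1.comp (ih (by lia))
      obtain ⟨e, he⟩ := hd₀.1
      have h4 : JetTendsto l k (fun _ => ContinuousLinearMap.inverse)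
          (fun a => (_root_.fderiv ℝ (f a) ∘ g a) (f a (z a)))
          (ContinuousLinearMap.inverse (R := ℝ) (M := E) (M₂ := E))
          ((_root_.fderiv ℝ f₀ ∘ g₀) (f₀ z₀)) := by
        refine const ?_ h3.tendsto_value
        rw [Function.comp_apply, hz₀, ← he]
        exact contDiffAt_map_inverse e
      exact (h4.comp h3).congr hd hd₀.2
  exact main (r + 1) le_rfl

end JetTendsto

end Jets

end

section

/-! ### The leading term in the derivatives of weighted compositions -/

section LeadingTerm

variable {E F G : Type*} [NormedAddCommGroup E] [NormedSpace ℝ E]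
  [NormedAddCommGroup F] [NormedSpace ℝ F] [NormedAddCommGroup G] [NormedSpace ℝ G]

theorem norm_iteratedFDeriv_smul_le_of_contDiffAt {w : E → ℝ} {g : E → G} {z : E} {s : ℕ}
    (hw : ContDiffAt ℝ s w z) (hg : ContDiffAt ℝ s g z) :
    ‖iteratedFDeriv ℝ s (fun y => w y • g y) z‖ ≤ ∑ i ∈ Finset.range (s + 1),
      (s.choose i : ℝ) * ‖iteratedFDeriv ℝ i w z‖ * ‖iteratedFDeriv ℝ (s - i) g z‖ := by
  obtain ⟨u, hu, huo, hzu⟩ := eventually_nhds_iff.1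
    ((hw.eventually (by simp)).and (hg.eventually (by simp)))
  have := norm_iteratedFDerivWithin_smul_le (s := u) (n := s) (N := s) (x := z)
    (fun x hx => (hu x hx).1.contDiffWithinAt) (fun x hx => (hu x hx).2.contDiffWithinAt)
    huo.uniqueDiffOn hzu le_rfl
  simpa only [iteratedFDerivWithin_of_isOpen _ huo hzu] using this

theorem norm_compAlong_le {Q : FormalMultilinearSeries ℝ F G} {P : FormalMultilinearSeries ℝ E F}
    {s : ℕ} {C b : ℝ} (c : OrderedFinpartition s) (hC : 1 ≤ C) (hP : ∀ k ≤ s, ‖P k‖ ≤ C)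
    (hQ : ‖Q c.length‖ ≤ b) : ‖Q.compAlongOrderedFinpartition P c‖ ≤ b * C ^ s := by
  refine (c.norm_compAlongOrderedFinpartition_le _ _).trans ?_
  have h1 : ∏ i, ‖P (c.partSize i)‖ ≤ C ^ s := by
    calc ∏ i, ‖P (c.partSize i)‖ ≤ ∏ _i : Fin c.length, C :=
          Finset.prod_le_prod (fun _ _ => norm_nonneg _) fun i _ => hP _ (c.partSize_le i)
      _ = C ^ c.length := by simp
      _ ≤ C ^ s := pow_le_pow_right₀ hC c.length_le
  exact mul_le_mul hQ h1 (Finset.prod_nonneg fun _ _ => norm_nonneg _)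
    ((norm_nonneg _).trans hQ)

/-- Up to terms of lower order, the derivative of order `s` of a composition is the pullback of the
derivative of order `s`. -/
theorem iteratedFDeriv_comp_sub_le {g : F → G} {f : E → F} {z : E} {s : ℕ} {C b : ℝ}
    (hg : ContDiffAt ℝ s g (f z)) (hf : ContDiffAt ℝ s f z) (hC : 1 ≤ C) (hb : 0 ≤ b)
    (hfC : ∀ k ≤ s, ‖iteratedFDeriv ℝ k f z‖ ≤ C)
    (hgb : ∀ k < s, ‖iteratedFDeriv ℝ k g (f z)‖ ≤ b) (v : Fin s → E) :
    ‖iteratedFDeriv ℝ s (g ∘ f) z v - iteratedFDeriv ℝ s g (f z) fun i => fderiv ℝ f z (v i)‖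
      ≤ Fintype.card (OrderedFinpartition s) * (b * C ^ s) * ∏ i, ‖v i‖ := by
  classical
  rw [iteratedFDeriv_comp hg hf le_rfl]
  set Q := ftaylorSeries ℝ g (f z)
  set P := ftaylorSeries ℝ f z
  -- The partition into singletons gives the pullback. All other partitions have fewer than `s`
  -- blocks and involve only derivatives of `g` of order below `s`.
  have h1 : Q.taylorComp P s = Q.compAlongOrderedFinpartition P (OrderedFinpartition.atomic s)
      + ∑ c ∈ Finset.univ.erase (OrderedFinpartition.atomic s),
        Q.compAlongOrderedFinpartition P c :=
    (Finset.add_sum_erase _ _ (Finset.mem_univ _)).symm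
  have h2 : Q.compAlongOrderedFinpartition P (OrderedFinpartition.atomic s) v
      = iteratedFDeriv ℝ s g (f z) fun i => fderiv ℝ f z (v i) := by
    rw [FormalMultilinearSeries.compAlongOrderedFinpartition_apply]
    change iteratedFDeriv ℝ s g (f z) (fun i => iteratedFDeriv ℝ 1 f z _) = _
    congr 1
    funext i
    exact iteratedFDeriv_one_apply (𝕜 := ℝ) (f := f) (x := z) (fun _ => v i)
  rw [h1, add_apply, h2, add_sub_cancel_left]
  refine (ContinuousMultilinearMap.le_opNorm _ _).trans ?_
  refine mul_le_mul_of_nonneg_right ?_ (Finset.prod_nonneg fun _ _ => norm_nonneg _)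
  refine (norm_sum_le _ _).trans ?_
  have h3 : ∀ c ∈ Finset.univ.erase (OrderedFinpartition.atomic s),
      ‖Q.compAlongOrderedFinpartition P c‖ ≤ b * C ^ s := fun c hc => by
    refine norm_compAlong_le c hC hfC (hgb _ (lt_of_le_of_ne c.length_le fun h => ?_))
    exact (Finset.mem_erase.1 hc).1 (orderedFinpartition_eq_atomic c h)
  refine (Finset.sum_le_card_nsmul _ _ _ h3).trans ?_
  rw [nsmul_eq_mul]
  refine mul_le_mul_of_nonneg_right ?_ (by positivity)
  exact_mod_cast Finset.card_le_univ _

theorem norm_iteratedFDeriv_comp_le_of_contDiffAt {g : F → G} {f : E → F} {z : E} {s : ℕ} {C b : ℝ}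
    (hg : ContDiffAt ℝ s g (f z)) (hf : ContDiffAt ℝ s f z) (hC : 1 ≤ C)
    (hfC : ∀ k ≤ s, ‖iteratedFDeriv ℝ k f z‖ ≤ C)
    (hgb : ∀ k ≤ s, ‖iteratedFDeriv ℝ k g (f z)‖ ≤ b) :
    ‖iteratedFDeriv ℝ s (g ∘ f) z‖ ≤ Fintype.card (OrderedFinpartition s) * (b * C ^ s) := by
  rw [iteratedFDeriv_comp hg hf le_rfl]
  refine (norm_sum_le _ _).trans ?_
  have h3 : ∀ c ∈ (Finset.univ : Finset (OrderedFinpartition s)),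
      ‖(ftaylorSeries ℝ g (f z)).compAlongOrderedFinpartition (ftaylorSeries ℝ f z) c‖
        ≤ b * C ^ s := fun c _ => norm_compAlong_le c hC hfC (hgb _ c.length_le)
  refine (Finset.sum_le_card_nsmul _ _ _ h3).trans ?_
  rw [nsmul_eq_mul, Finset.card_univ]

/-- The leading term of the derivative of order `s` of a weighted composition. -/
theorem exists_leading_term_bound (E F G : Type*) [NormedAddCommGroup E] [NormedSpace ℝ E]
    [NormedAddCommGroup F] [NormedSpace ℝ F] [NormedAddCommGroup G] [NormedSpace ℝ G]
    (s : ℕ) {C : ℝ} (hC : 1 ≤ C) : ∃ K : ℝ, 0 ≤ K ∧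
      ∀ (w : E → ℝ) (g : F → G) (f : E → F) (z : E) (b : ℝ), ContDiffAt ℝ s w z →
      ContDiffAt ℝ s g (f z) → ContDiffAt ℝ s f z → 0 ≤ b →
      (∀ k ≤ s, ‖iteratedFDeriv ℝ k f z‖ ≤ C) → (∀ k ≤ s, ‖iteratedFDeriv ℝ k w z‖ ≤ C) →
      (∀ k < s, ‖iteratedFDeriv ℝ k g (f z)‖ ≤ b) → ∀ v : Fin s → E,
      ‖iteratedFDeriv ℝ s (fun y => w y • g (f y)) z v
        - w z • iteratedFDeriv ℝ s g (f z) (fun i => fderiv ℝ f z (v i))‖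
        ≤ K * b * ∏ i, ‖v i‖ := by
  set P : ℝ := ∑ k ∈ Finset.range (s + 1), (Fintype.card (OrderedFinpartition k) : ℝ) with hP
  have hP0 : 0 ≤ P := by positivity
  have hPk : ∀ k ≤ s, (Fintype.card (OrderedFinpartition k) : ℝ) ≤ P := fun k hk =>
    Finset.single_le_sum (f := fun k => (Fintype.card (OrderedFinpartition k) : ℝ))
      (fun _ _ => Nat.cast_nonneg _) (Finset.mem_range.2 (by lia))
  refine ⟨C * (P * C ^ s) + 2 ^ s * C * (P * C ^ s), by positivity,
    fun w g f z b hw hg hf hb hfC hwC hgb v => ?_⟩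
  have hgf : ContDiffAt ℝ s (g ∘ f) z := hg.comp z hf
  have hw' : ContDiffAt ℝ s (fun y => w y - w z) z := hw.sub contDiffAt_const
  -- Freezing the weight at `z`: the factor `w - w z` vanishes there, so in the Leibniz formula for
  -- the second summand the derivative of order `s` of `g ∘ f` is multiplied by zero.
  have e : (fun y => w y • g (f y)) = (w z • (g ∘ f)) + fun y => (w y - w z) • (g ∘ f) y := by
    funext y
    simp only [Pi.add_apply, Pi.smul_apply, Function.comp_apply]
    module
  have hvP : 0 ≤ ∏ i, ‖v i‖ := Finset.prod_nonneg fun _ _ => norm_nonneg _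
  have h1 : ‖iteratedFDeriv ℝ s (fun y => (w y - w z) • (g ∘ f) y) z‖
      ≤ 2 ^ s * C * (P * C ^ s) * b := by
    refine (norm_iteratedFDeriv_smul_le_of_contDiffAt hw' hgf).trans ?_
    calc ∑ i ∈ Finset.range (s + 1), (s.choose i : ℝ) * ‖iteratedFDeriv ℝ i (fun y => w y - w z) z‖
          * ‖iteratedFDeriv ℝ (s - i) (g ∘ f) z‖
        ≤ ∑ i ∈ Finset.range (s + 1), (s.choose i : ℝ) * (C * (P * C ^ s) * b) := by
          refine Finset.sum_le_sum fun i hi => ?_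
          have hi' : i ≤ s := by have := Finset.mem_range.1 hi; lia
          rw [mul_assoc]
          refine mul_le_mul_of_nonneg_left ?_ (Nat.cast_nonneg _)
          rcases Nat.eq_zero_or_pos i with rfl | hi0
          · simp only [norm_iteratedFDeriv_zero, sub_self, norm_zero, zero_mul]
            positivity
          · have h2 : iteratedFDeriv ℝ i (fun y => w y - w z) z = iteratedFDeriv ℝ i w z := by
              have hi'' : (i : WithTop ℕ∞) ≤ s := by exact_mod_cast hi'
              have := iteratedFDeriv_sub_apply (hw.of_le hi'')
                (contDiffAt_const (c := w z) (n := (i : WithTop ℕ∞)))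
              rw [iteratedFDeriv_const_of_ne hi0.ne', Pi.zero_apply, sub_zero] at this
              exact this
            rw [h2]
            have h3 := norm_iteratedFDeriv_comp_le_of_contDiffAt (s := s - i) (b := b)
              (hg.of_le (by exact_mod_cast Nat.sub_le s i))
              (hf.of_le (by exact_mod_cast Nat.sub_le s i)) hC (fun k hk => hfC k (by lia))
              (fun k hk => hgb k (by lia))
            calc ‖iteratedFDeriv ℝ i w z‖ * ‖iteratedFDeriv ℝ (s - i) (g ∘ f) z‖
                ≤ C * (P * (b * C ^ s)) := by
                  gcongr
                  · exact hwC i hi'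
                  · refine h3.trans ?_
                    gcongr
                    · exact hPk _ (Nat.sub_le s i)
                    · exact Nat.sub_le s i
              _ = _ := by ring
      _ = 2 ^ s * (C * (P * C ^ s) * b) := by
          rw [← Finset.sum_mul]
          congr 1
          exact_mod_cast Nat.sum_range_choose s
      _ = _ := by ring
  have h2 := iteratedFDeriv_comp_sub_le hg hf hC hb hfC hgb v
  have h0 : ‖w z‖ ≤ C := by simpa using hwC 0 (Nat.zero_le s)
  have e3 : iteratedFDeriv ℝ s (w z • (g ∘ f) + fun y => (w y - w z) • (g ∘ f) y) z
      = w z • iteratedFDeriv ℝ s (g ∘ f) z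
        + iteratedFDeriv ℝ s (fun y => (w y - w z) • (g ∘ f) y) z := by
    rw [← iteratedFDeriv_const_smul_apply (a := w z) hgf]
    exact iteratedFDeriv_add_apply (ContDiffAt.const_smul (w z) hgf) (ContDiffAt.smul hw' hgf)
  rw [e, e3, add_apply, smul_apply]
  have e2 : w z • iteratedFDeriv ℝ s (g ∘ f) z v
      + iteratedFDeriv ℝ s (fun y => (w y - w z) • (g ∘ f) y) z v
      - w z • iteratedFDeriv ℝ s g (f z) (fun i => fderiv ℝ f z (v i))
      = w z • (iteratedFDeriv ℝ s (g ∘ f) z v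
        - iteratedFDeriv ℝ s g (f z) (fun i => fderiv ℝ f z (v i)))
        + iteratedFDeriv ℝ s (fun y => (w y - w z) • (g ∘ f) y) z v := by module
  rw [e2]
  refine (norm_add_le _ _).trans ?_
  rw [norm_smul]
  have h4 := ContinuousMultilinearMap.le_of_opNorm_le h1 v
  have h5 : ‖iteratedFDeriv ℝ s (g ∘ f) z v
      - iteratedFDeriv ℝ s g (f z) (fun i => fderiv ℝ f z (v i))‖
      ≤ P * (b * C ^ s) * ∏ i, ‖v i‖ := h2.trans (by gcongr; exact hPk s le_rfl)
  calc ‖w z‖ * ‖iteratedFDeriv ℝ s (g ∘ f) z v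
      - iteratedFDeriv ℝ s g (f z) (fun i => fderiv ℝ f z (v i))‖
      + ‖iteratedFDeriv ℝ s (fun y => (w y - w z) • (g ∘ f) y) z v‖
      ≤ C * (P * (b * C ^ s) * ∏ i, ‖v i‖) + 2 ^ s * C * (P * C ^ s) * b * ∏ i, ‖v i‖ := by
        gcongr
    _ = _ := by ring

end LeadingTerm

end

section

/-! ### `C^r` functions in arbitrary charts -/

section Functions

variable {m : ℕ} {M : Type*} [TopologicalSpace M] [ChartedSpace (Eu m) M]

theorem contDiffAt_chart_change {e e' : OpenPartialHomeomorph M (Eu m)}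
    (he : e ∈ IsManifold.maximalAtlas (𝓡 m) ∞ M) (he' : e' ∈ IsManifold.maximalAtlas (𝓡 m) ∞ M)
    {x : M} (hx : x ∈ e.source) (hx' : x ∈ e'.source) (r : ℕ) :
    ContDiffAt ℝ r (e' ∘ e.symm) (e x) := by
  have h1 : ContMDiffAt (𝓡 m) (𝓡 m) ∞ e.symm (e x) :=
    (contMDiffOn_symm_of_mem_maximalAtlas he).contMDiffAt
      (e.open_target.mem_nhds (e.map_source hx))
  have h2 : ContMDiffAt (𝓡 m) (𝓡 m) ∞ e' (e.symm (e x)) := by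
    rw [e.left_inv hx]
    exact (contMDiffOn_of_mem_maximalAtlas he').contMDiffAt (e'.open_source.mem_nhds hx')
  exact (h2.comp (e x) h1).contDiffAt.of_le (by exact_mod_cast le_top)

theorem comp_symm_eventuallyEq {X : Type*} (g : M → X) {e e' : OpenPartialHomeomorph M (Eu m)}
    {x : M} (hx : x ∈ e.source) (hx' : x ∈ e'.source) :
    (g ∘ e'.symm) ∘ (e' ∘ e.symm) =ᶠ[𝓝 (e x)] g ∘ e.symm := by
  have h1 : ∀ᶠ w in 𝓝 (e x), e.symm w ∈ e'.source := by
    have := (e.continuousAt_symm (e.map_source hx)).tendsto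
    rw [e.left_inv hx] at this
    exact this.eventually (e'.open_source.mem_nhds hx')
  filter_upwards [h1] with w hw
  simp only [Function.comp_apply]
  rw [e'.left_inv hw]

theorem contDiffAt_comp_symm_of_chart {X : Type*} [NormedAddCommGroup X] [NormedSpace ℝ X]
    {g : M → X} {e e' : OpenPartialHomeomorph M (Eu m)}
    (he : e ∈ IsManifold.maximalAtlas (𝓡 m) ∞ M) (he' : e' ∈ IsManifold.maximalAtlas (𝓡 m) ∞ M)
    {x : M} (hx : x ∈ e.source) (hx' : x ∈ e'.source) {r : ℕ}
    (h : ContDiffAt ℝ r (g ∘ e'.symm) (e' x)) : ContDiffAt ℝ r (g ∘ e.symm) (e x) := by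
  have h1 : ContDiffAt ℝ r (g ∘ e'.symm) ((e' ∘ e.symm) (e x)) := by
    rwa [Function.comp_apply, e.left_inv hx]
  exact (h1.comp (e x) (contDiffAt_chart_change he he' hx hx' r)).congr_of_eventuallyEq
    (comp_symm_eventuallyEq g hx hx').symm

theorem JetTendsto.chart_change {ι : Type*} {l : Filter ι} {r : ℕ} {X : Type*}
    [NormedAddCommGroup X] [NormedSpace ℝ X] {g : ι → M → X} {g₀ : M → X} {x : ι → M} {x₀ : M}
    {e e' : OpenPartialHomeomorph M (Eu m)}
    (he : e ∈ IsManifold.maximalAtlas (𝓡 m) ∞ M) (he' : e' ∈ IsManifold.maximalAtlas (𝓡 m) ∞ M)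
    (hx : x₀ ∈ e.source) (hx' : x₀ ∈ e'.source) (hl : Tendsto x l (𝓝 x₀))
    (h : JetTendsto l r (fun a => g a ∘ e'.symm) (fun a => e' (x a)) (g₀ ∘ e'.symm) (e' x₀)) :
    JetTendsto l r (fun a => g a ∘ e.symm) (fun a => e (x a)) (g₀ ∘ e.symm) (e x₀) := by
  have hxe : ∀ᶠ a in l, x a ∈ e.source := hl.eventually (e.open_source.mem_nhds hx)
  have hxe' : ∀ᶠ a in l, x a ∈ e'.source := hl.eventually (e'.open_source.mem_nhds hx')
  have h1 : JetTendsto l r (fun a => g a ∘ e'.symm) (fun a => (e' ∘ e.symm) (e (x a)))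
      (g₀ ∘ e'.symm) ((e' ∘ e.symm) (e x₀)) := by
    rw [Function.comp_apply, e.left_inv hx]
    refine h.congr_point ?_
    filter_upwards [hxe] with a ha
    rw [Function.comp_apply, e.left_inv ha]
  refine (h1.comp (JetTendsto.const (contDiffAt_chart_change he he' hx hx' r)
    ((e.continuousAt hx).tendsto.comp hl))).congr ?_ (comp_symm_eventuallyEq g₀ hx hx')
  filter_upwards [hxe, hxe'] with a h1 h2 using comp_symm_eventuallyEq (g a) h1 h2

/-- Convergence may be tested on finitely many pieces of the index set. Pieces that do not meet the
filter are vacuous; on the others `NeBot` allows limits to be placed in closed sets. -/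
theorem JetTendsto.of_cover {ι E F J : Type*} [Finite J] [NormedAddCommGroup E] [NormedSpace ℝ E]
    [NormedAddCommGroup F] [NormedSpace ℝ F] {l : Filter ι} {r : ℕ} {f : ι → E → F} {z : ι → E}
    {f₀ : E → F} {z₀ : E} (S : J → Set ι) (hS : ∀ᶠ a in l, ∃ j, a ∈ S j)
    (hc : ContDiffAt ℝ r f₀ z₀)
    (h : ∀ j, NeBot (l ⊓ 𝓟 (S j)) → JetTendsto (l ⊓ 𝓟 (S j)) r f z f₀ z₀) :
    JetTendsto l r f z f₀ z₀ := by
  have hle : l ≤ ⨆ j, l ⊓ 𝓟 (S j) := by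
    intro s hs
    have h1 : ∀ᶠ a in l, ∀ j, a ∈ S j → a ∈ s :=
      eventually_all.2 fun j => eventually_inf_principal.1 (mem_iSup.1 hs j)
    filter_upwards [hS, h1] with a ⟨j, hj⟩ h2 using h2 j hj
  have h' : ∀ j, JetTendsto (l ⊓ 𝓟 (S j)) r f z f₀ z₀ := fun j => by
    rcases eq_or_neBot (l ⊓ 𝓟 (S j)) with h0 | h0
    · rw [h0]
      exact ⟨eventually_bot, hc, fun s _ => tendsto_bot⟩
    · exact h j h0
  refine ⟨?_, hc, fun s hs => ?_⟩
  · exact Eventually.filter_mono hle (eventually_iSup.2 fun j => (h' j).contDiffAt)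
  · exact (tendsto_iSup.2 fun j => (h' j).tendsto s hs).mono_left hle

namespace CrFun

variable {𝔠 : ChartCover m M} {r : ℕ} {𝕜 : Type} [RCLike 𝕜]

theorem contDiffAt_of_mem_maximalAtlas (g : CrFun 𝔠 r 𝕜) {e : OpenPartialHomeomorph M (Eu m)}
    (he : e ∈ IsManifold.maximalAtlas (𝓡 m) ∞ M) {x : M} (hx : x ∈ e.source) :
    ContDiffAt ℝ r (g ∘ e.symm) (e x) := by
  obtain ⟨i, hi⟩ := mem_iUnion.1 (𝔠.cover.symm ▸ mem_univ x : x ∈ ⋃ i, 𝔠.K i)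
  exact contDiffAt_comp_symm_of_chart he (𝔠.chart_mem i) hx (𝔠.K_subset i hi)
    (g.contDiffAt_chart i (𝔠.K_subset i hi))

theorem norm_derivAt_le (g : CrFun 𝔠 r 𝕜) {i : Fin 𝔠.N} {s : ℕ} (hs : s ≤ r) {x : M}
    (hx : x ∈ 𝔠.K i) : ‖g.derivAt i s x‖ ≤ ‖g‖ := by
  have h1 : ‖jet i ⟨s, Nat.lt_succ_of_le hs⟩ g‖ ≤ ‖g‖ :=
    (norm_le_pi_norm (fullJet g i) ⟨s, Nat.lt_succ_of_le hs⟩).trans (norm_le_pi_norm (fullJet g) i)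
  exact (ContinuousMap.norm_coe_le_norm
    (α := 𝔠.K i) (E := ContinuousMultilinearMap ℝ (fun _ : Fin s => Eu m) 𝕜)
    (jet i ⟨s, Nat.lt_succ_of_le hs⟩ g) ⟨x, hx⟩).trans h1

theorem norm_le_of_derivAt (g : CrFun 𝔠 r 𝕜) {C : ℝ} (hC : 0 ≤ C)
    (h : ∀ i, ∀ s ≤ r, ∀ x ∈ 𝔠.K i, ‖g.derivAt i s x‖ ≤ C) : ‖g‖ ≤ C := by
  change ‖fullJet g‖ ≤ C
  refine (pi_norm_le_iff_of_nonneg hC).2 fun i => (pi_norm_le_iff_of_nonneg hC).2 fun s => ?_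
  exact (ContinuousMap.norm_le (α := 𝔠.K i)
    (E := ContinuousMultilinearMap ℝ (fun _ : Fin s => Eu m) 𝕜) _ hC).2
    fun x => h i s (Nat.lt_succ_iff.1 s.2) x x.2

/-- The derivative at a point as a continuous linear map. -/
noncomputable def derivCLM (i : Fin 𝔠.N) {s : ℕ} (hs : s ≤ r) {x : M} (hx : x ∈ 𝔠.K i) :
    CrFun 𝔠 r 𝕜 →L[𝕜] ContinuousMultilinearMap ℝ (fun _ : Fin s => Eu m) 𝕜 :=
  LinearMap.mkContinuous
    { toFun := fun g => g.derivAt i s x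
      map_add' := fun g h => ContinuousMap.congr_fun
        (congrFun (congrFun ((fullJet (𝔠 := 𝔠) (r := r) (𝕜 := 𝕜)).map_add g h) i)
          ⟨s, Nat.lt_succ_of_le hs⟩) (⟨x, hx⟩ : 𝔠.K i)
      map_smul' := fun c g => ContinuousMap.congr_fun
        (congrFun (congrFun ((fullJet (𝔠 := 𝔠) (r := r) (𝕜 := 𝕜)).map_smul c g) i)
          ⟨s, Nat.lt_succ_of_le hs⟩) (⟨x, hx⟩ : 𝔠.K i) }
    1 fun g => by rw [one_mul]; exact g.norm_derivAt_le hs hx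

theorem derivCLM_apply (i : Fin 𝔠.N) {s : ℕ} (hs : s ≤ r) {x : M} (hx : x ∈ 𝔠.K i)
    (g : CrFun 𝔠 r 𝕜) : derivCLM i hs hx g = g.derivAt i s x := rfl

theorem norm_derivAt_zero (g : CrFun 𝔠 r 𝕜) (i : Fin 𝔠.N) {x : M} (hx : x ∈ 𝔠.K i) :
    ‖g.derivAt i 0 x‖ = ‖g x‖ := by
  simp [derivAt, norm_iteratedFDeriv_zero, (𝔠.chart i).left_inv (𝔠.K_subset i hx)]

theorem norm_apply_le (g : CrFun 𝔠 r 𝕜) (x : M) : ‖g x‖ ≤ ‖g‖ := by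
  obtain ⟨i, hi⟩ := mem_iUnion.1 (𝔠.cover.symm ▸ mem_univ x : x ∈ ⋃ i, 𝔠.K i)
  rw [← g.norm_derivAt_zero i hi]
  exact g.norm_derivAt_le (Nat.zero_le r) hi

theorem coe_add (g h : CrFun 𝔠 r 𝕜) : ((g + h : CrFun 𝔠 r 𝕜) : M → 𝕜) = g + h := rfl

theorem coe_smul (c : 𝕜) (g : CrFun 𝔠 r 𝕜) : ((c • g : CrFun 𝔠 r 𝕜) : M → 𝕜) = c • (g : M → 𝕜) := rfl

theorem coe_zero : ((0 : CrFun 𝔠 r 𝕜) : M → 𝕜) = 0 := rfl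

/-- Evaluation at a point. -/
noncomputable def evalCLM (x : M) : CrFun 𝔠 r 𝕜 →L[𝕜] 𝕜 :=
  LinearMap.mkContinuous
    { toFun := fun g => g x
      map_add' := fun _ _ => rfl
      map_smul' := fun _ _ => rfl }
    1 fun g => by rw [one_mul]; exact g.norm_apply_le x

theorem evalCLM_apply (x : M) (g : CrFun 𝔠 r 𝕜) : evalCLM x g = g x := rfl

/-- Convergence in `C^r` implies convergence of the derivatives at moving points in any chart. -/
theorem jetTendsto [T2Space M] {ι : Type*} {l : Filter ι} {g : ι → CrFun 𝔠 r 𝕜}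
    {g₀ : CrFun 𝔠 r 𝕜} (hg : Tendsto g l (𝓝 g₀)) {x : ι → M} {x₀ : M} (hx : Tendsto x l (𝓝 x₀))
    {e : OpenPartialHomeomorph M (Eu m)} (he : e ∈ IsManifold.maximalAtlas (𝓡 m) ∞ M)
    (hxe : x₀ ∈ e.source) :
    JetTendsto l r (fun a => g a ∘ e.symm) (fun a => e (x a)) (g₀ ∘ e.symm) (e x₀) := by
  refine JetTendsto.of_cover (fun j : Fin 𝔠.N => {a | x a ∈ 𝔠.K j})
    (Eventually.of_forall fun a =>
      (mem_iUnion.1 (show x a ∈ ⋃ i, 𝔠.K i by rw [𝔠.cover]; trivial) : ∃ i, x a ∈ 𝔠.K i))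
    (g₀.contDiffAt_of_mem_maximalAtlas he hxe) fun j hj => ?_
  have hx' : Tendsto x (l ⊓ 𝓟 {a | x a ∈ 𝔠.K j}) (𝓝 x₀) := hx.mono_left inf_le_left
  have hK : ∀ᶠ a in l ⊓ 𝓟 {a | x a ∈ 𝔠.K j}, x a ∈ 𝔠.K j :=
    eventually_inf_principal.2 (Eventually.of_forall fun a ha => ha)
  have hx₀ : x₀ ∈ 𝔠.K j := (𝔠.isCompact_K j).isClosed.mem_of_tendsto hx' hK
  have hxs := 𝔠.K_subset j hx₀
  refine JetTendsto.chart_change he (𝔠.chart_mem j) hxe hxs hx' ⟨?_, ?_, fun s hs => ?_⟩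
  · filter_upwards [hK] with a ha using (g a).contDiffAt_chart j (𝔠.K_subset j ha)
  · exact g₀.contDiffAt_chart j hxs
  · have h1 : Tendsto (fun a => g₀.derivAt j s (x a)) (l ⊓ 𝓟 {a | x a ∈ 𝔠.K j})
        (𝓝 (g₀.derivAt j s x₀)) := by
      have h2 : ContinuousAt (iteratedFDeriv ℝ s (g₀ ∘ (𝔠.chart j).symm)) (𝔠.chart j x₀) :=
        ((g₀.contDiffAt_chart j hxs).iteratedFDeriv_right
          (m := 0) (i := s) (by simpa using hs)).continuousAt
      exact h2.tendsto.comp (((𝔠.chart j).continuousAt hxs).tendsto.comp hx')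
    refine h1.congr_dist ?_
    have h3 : Tendsto (fun a => ‖g a - g₀‖) (l ⊓ 𝓟 {a | x a ∈ 𝔠.K j}) (𝓝 0) :=
      (tendsto_iff_norm_sub_tendsto_zero.1 hg).mono_left inf_le_left
    refine squeeze_zero' (Eventually.of_forall fun _ => dist_nonneg) ?_ h3
    filter_upwards [hK] with a ha
    rw [dist_comm, dist_eq_norm]
    change ‖(g a).derivAt j s (x a) - g₀.derivAt j s (x a)‖ ≤ _
    rw [← derivCLM_apply j hs ha, ← derivCLM_apply j hs ha, ← map_sub]
    exact (g a - g₀).norm_derivAt_le hs ha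

end CrFun

end Functions

end

section

/-! ### Completeness and separability of `C^r(M)` -/

section Limits

variable {E F : Type*} [NormedAddCommGroup E] [NormedSpace ℝ E] [NormedAddCommGroup F]
  [NormedSpace ℝ F]

/-- A sequence of `C^r` functions whose derivatives are locally uniformly Cauchy and that converges
pointwise has a `C^r` limit, and the derivatives converge. -/
theorem contDiffOn_of_uniformCauchySeqOnFilter [CompleteSpace F] {r : ℕ} {U : Set E} (hU : IsOpen U)
    {f : ℕ → E → F} {g : E → F} (hf : ∀ n, ContDiffOn ℝ r (f n) U)
    (hc : ∀ s ≤ r, ∀ w ∈ U,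
      UniformCauchySeqOnFilter (fun n => iteratedFDeriv ℝ s (f n)) atTop (𝓝 w))
    (hg : ∀ w ∈ U, Tendsto (fun n => f n w) atTop (𝓝 (g w))) :
    ContDiffOn ℝ r g U ∧ ∀ s ≤ r, ∀ w ∈ U,
      Tendsto (fun n => iteratedFDeriv ℝ s (f n) w) atTop (𝓝 (iteratedFDeriv ℝ s g w)) := by
  -- A limit is chosen for all `s` and `w`, with the dummy value 0 outside the relevant range.
  have hlim : ∀ s w, ∃ p : ContinuousMultilinearMap ℝ (fun _ : Fin s => E) F, s ≤ r → w ∈ U →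
      Tendsto (fun n => iteratedFDeriv ℝ s (f n) w) atTop (𝓝 p) := by
    intro s w
    by_cases h : s ≤ r ∧ w ∈ U
    · have h1 : CauchySeq (fun n => iteratedFDeriv ℝ s (f n) w) := by
        rw [cauchySeq_iff_tendsto, ← prod_atTop_atTop_eq]
        exact fun u hu => (tendsto_id.prodMk tendsto_const_nhds).eventually (hc s h.1 w h.2 u hu)
      obtain ⟨p, hp⟩ := cauchySeq_tendsto_of_complete h1
      exact ⟨p, fun _ _ => hp⟩
    · exact ⟨0, fun h1 h2 => absurd ⟨h1, h2⟩ h⟩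
  choose p hp using hlim
  have hunif : ∀ s ≤ r, ∀ w ∈ U, TendstoUniformlyOnFilter (fun n => iteratedFDeriv ℝ s (f n))
      (p s) atTop (𝓝 w) := fun s hs w hw =>
    (hc s hs w hw).tendstoUniformlyOnFilter_of_tendsto
      (by filter_upwards [hU.mem_nhds hw] with z hz using hp s z hs hz)
  have hdiff : ∀ n, ∀ s < r, ∀ w ∈ U, HasFDerivAt (iteratedFDeriv ℝ s (f n))
      (iteratedFDeriv ℝ (s + 1) (f n) w).curryLeft w := by
    intro n s hs w hw
    have h1 : ContDiffAt ℝ r (f n) w := (hf n).contDiffAt (hU.mem_nhds hw)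
    have h2 : DifferentiableAt ℝ (iteratedFDeriv ℝ s (f n)) w :=
      h1.differentiableAt_iteratedFDeriv (by exact_mod_cast hs)
    convert h2.hasFDerivAt using 1
    rw [iteratedFDeriv_succ_eq_comp_left]
    exact (continuousMultilinearCurryLeftEquiv ℝ (fun _ : Fin (s + 1) => E) F).apply_symm_apply _
  have hT : HasFTaylorSeriesUpToOn r g (fun w s => p s w) U := by
    refine ⟨fun w hw => ?_, fun s hs w hw => ?_, fun s hs w hw => ?_⟩
    · have h1 := ((continuousMultilinearCurryFin0 ℝ E F).continuous.tendsto _).comp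
        (hp 0 w (Nat.zero_le r) hw)
      refine tendsto_nhds_unique h1 ?_
      simpa [Function.comp_def] using hg w hw
    · have hs' : s < r := by exact_mod_cast hs
      refine HasFDerivAt.hasFDerivWithinAt ?_
      refine hasFDerivAt_of_tendstoUniformlyOnFilter (l := atTop)
        (f := fun n => iteratedFDeriv ℝ s (f n))
        (f' := fun n z => (iteratedFDeriv ℝ (s + 1) (f n) z).curryLeft)
        (g' := fun z => (p (s + 1) z).curryLeft) ?_ ?_ ?_
      · have h1 := hunif (s + 1) hs' w hw
        rw [Metric.tendstoUniformlyOnFilter_iff] at h1 ⊢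
        intro ε hε
        filter_upwards [h1 ε hε] with z hz
        exact lt_of_eq_of_lt (LinearIsometryEquiv.dist_map
          (continuousMultilinearCurryLeftEquiv ℝ (fun _ : Fin (s + 1) => E) F) _ _) hz
      · have h1 : ∀ᶠ z : ℕ × E in atTop ×ˢ 𝓝 w, z.2 ∈ U :=
          tendsto_snd.eventually (hU.mem_nhds hw)
        filter_upwards [h1] with z hz using hdiff z.1 s hs' z.2 hz
      · filter_upwards [hU.mem_nhds hw] with z hz using hp s z hs'.le hz
    · have hs' : s ≤ r := by exact_mod_cast hs
      have h1 : TendstoLocallyUniformlyOn (fun n => iteratedFDeriv ℝ s (f n)) (p s) atTop U :=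
        tendstoLocallyUniformlyOn_iff_filter.2 fun z hz =>
          (hunif s hs' z hz).mono_right (nhdsWithin_le_nhds)
      refine h1.continuousOn (Frequently.of_forall fun n z hz => ?_) w hw
      have h2 : ContDiffAt ℝ r (f n) z := (hf n).contDiffAt (hU.mem_nhds hz)
      exact (h2.iteratedFDeriv_right (m := 0) (i := s) (by simpa using hs)
        ).continuousAt.continuousWithinAt
  refine ⟨hT.contDiffOn, fun s hs w hw => ?_⟩
  have h1 := hT.eq_iteratedFDerivWithin_of_uniqueDiffOn (m := s) (by exact_mod_cast hs)
    hU.uniqueDiffOn hw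
  rw [iteratedFDerivWithin_of_isOpen s hU hw] at h1
  exact h1 ▸ hp s w hs hw

theorem finiteDimensional_continuousMultilinearMap [FiniteDimensional ℝ E] [FiniteDimensional ℝ F]
    (s : ℕ) : FiniteDimensional ℝ (ContinuousMultilinearMap ℝ (fun _ : Fin s => E) F) :=
  FiniteDimensional.of_injective
    (ContinuousMultilinearMap.toMultilinearMapLinear :
      ContinuousMultilinearMap ℝ (fun _ : Fin s => E) F →ₗ[ℝ]
        MultilinearMap ℝ (fun _ : Fin s => E) F)
    ContinuousMultilinearMap.toMultilinearMap_injective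

end Limits

namespace CrFun

variable {m : ℕ} {M : Type*} [TopologicalSpace M] [ChartedSpace (Eu m) M]
variable {𝔠 : ChartCover m M} {r : ℕ} {𝕜 : Type} [RCLike 𝕜]

theorem contMDiff_of_contDiffAt_chart [IsManifold (𝓡 m) ∞ M] {X : Type*} [NormedAddCommGroup X]
    [NormedSpace ℝ X] {g : M → X} (𝔠 : ChartCover m M)
    (h : ∀ i, ∀ x ∈ 𝔠.K i, ContDiffAt ℝ r (g ∘ (𝔠.chart i).symm) (𝔠.chart i x)) :
    ContMDiff (𝓡 m) 𝓘(ℝ, X) r g := by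
  intro x
  obtain ⟨i, hi⟩ := mem_iUnion.1 (𝔠.cover.symm ▸ mem_univ x : x ∈ ⋃ i, 𝔠.K i)
  have hs := (𝔠.chart i).open_source.mem_nhds (𝔠.K_subset i hi)
  have h1 : ContMDiffAt (𝓡 m) (𝓡 m) r (𝔠.chart i) x :=
    ((contMDiffOn_of_mem_maximalAtlas (𝔠.chart_mem i)).contMDiffAt hs).of_le
      (by exact_mod_cast le_top)
  refine ((h i x hi).contMDiffAt.comp x h1).congr_of_eventuallyEq ?_
  filter_upwards [hs] with y hy
  simp [(𝔠.chart i).left_inv hy]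

/-- For a Cauchy sequence the differences `u a - u b` tend to zero, so their jets tend to zero also
at moving points. This is local uniform Cauchy convergence of all derivatives on the whole chart
domain, and not only on the compact set, so the pointwise limit is `C^r`. The norm convergence
follows by letting one index tend to infinity. -/
instance [T2Space M] [IsManifold (𝓡 m) ∞ M] : CompleteSpace (CrFun 𝔠 r 𝕜) := by
  refine Metric.complete_of_cauchySeq_tendsto fun u hu => ?_
  have hpt : ∀ x, ∃ y, Tendsto (fun n => u n x) atTop (𝓝 y) := fun x =>
    cauchySeq_tendsto_of_complete
      ((evalCLM (𝔠 := 𝔠) (r := r) (𝕜 := 𝕜) x).uniformContinuous.comp_cauchySeq hu)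
  choose g hg using hpt
  have hsub : Tendsto (fun a : ℕ × ℕ => u a.1 - u a.2) (atTop ×ˢ atTop) (𝓝 0) := by
    rw [prod_atTop_atTop_eq, tendsto_zero_iff_norm_tendsto_zero]
    simpa [dist_eq_norm] using cauchySeq_iff_tendsto_dist_atTop_0.1 hu
  have hmain : ∀ i, ContDiffOn ℝ r (g ∘ (𝔠.chart i).symm) (𝔠.chart i).target ∧
      ∀ s ≤ r, ∀ w ∈ (𝔠.chart i).target,
      Tendsto (fun n => iteratedFDeriv ℝ s (u n ∘ (𝔠.chart i).symm) w) atTop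
        (𝓝 (iteratedFDeriv ℝ s (g ∘ (𝔠.chart i).symm) w)) := by
    intro i
    have hcd : ∀ n, ∀ w ∈ (𝔠.chart i).target, ContDiffAt ℝ r (u n ∘ (𝔠.chart i).symm) w := by
      intro n w hw
      have := (u n).contDiffAt_chart i ((𝔠.chart i).map_target hw)
      rwa [(𝔠.chart i).right_inv hw] at this
    refine contDiffOn_of_uniformCauchySeqOnFilter (𝔠.chart i).open_target
      (fun n w hw => (hcd n w hw).contDiffWithinAt) (fun s hs w hw => ?_) fun w hw => hg _
    have h1 : Tendsto (fun a : (ℕ × ℕ) × Eu m => (𝔠.chart i).symm a.2)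
        ((atTop ×ˢ atTop) ×ˢ 𝓝 w) (𝓝 ((𝔠.chart i).symm w)) :=
      ((𝔠.chart i).continuousAt_symm hw).tendsto.comp tendsto_snd
    have h2 := (jetTendsto (hsub.comp (tendsto_fst (g := 𝓝 w))) h1 (𝔠.chart_mem i)
      ((𝔠.chart i).map_target hw)).tendsto s hs
    have h3 : iteratedFDeriv ℝ s ((0 : CrFun 𝔠 r 𝕜) ∘ (𝔠.chart i).symm)
        (𝔠.chart i ((𝔠.chart i).symm w)) = 0 := by
      rw [coe_zero]
      exact congrFun iteratedFDeriv_fun_zero _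
    rw [h3, Metric.tendsto_nhds] at h2
    intro v hv
    obtain ⟨ε, hε, hεv⟩ := Metric.mem_uniformity_dist.1 hv
    have h4 : ∀ᶠ a : (ℕ × ℕ) × Eu m in (atTop ×ˢ atTop) ×ˢ 𝓝 w, a.2 ∈ (𝔠.chart i).target :=
      tendsto_snd.eventually ((𝔠.chart i).open_target.mem_nhds hw)
    filter_upwards [h2 ε hε, h4] with a ha hat
    rw [dist_zero_right, (𝔠.chart i).right_inv hat] at ha
    refine hεv ?_
    rw [dist_eq_norm, ← iteratedFDeriv_sub_apply ((hcd _ _ hat).of_le (by exact_mod_cast hs))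
      ((hcd _ _ hat).of_le (by exact_mod_cast hs))]
    exact ha
  let G : CrFun 𝔠 r 𝕜 := ⟨g, contMDiff_of_contDiffAt_chart 𝔠 fun i x hx =>
    (hmain i).1.contDiffAt ((𝔠.chart i).open_target.mem_nhds
      ((𝔠.chart i).map_source (𝔠.K_subset i hx)))⟩
  refine ⟨G, Metric.tendsto_atTop.2 fun ε hε => ?_⟩
  obtain ⟨n₀, hn₀⟩ := Metric.cauchySeq_iff.1 hu (ε / 2) (by positivity)
  refine ⟨n₀, fun n hn => lt_of_le_of_lt ?_ (half_lt_self hε)⟩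
  rw [dist_eq_norm]
  refine norm_le_of_derivAt _ (by positivity) fun i s hs x hx => ?_
  have hw := (𝔠.chart i).map_source (𝔠.K_subset i hx)
  have h1 : Tendsto (fun k => (u n - u k).derivAt i s x) atTop (𝓝 ((u n - G).derivAt i s x)) := by
    simp only [← derivCLM_apply i hs hx, map_sub]
    exact tendsto_const_nhds.sub ((hmain i).2 s hs _ hw)
  refine le_of_tendsto h1.norm ?_
  filter_upwards [eventually_ge_atTop n₀] with k hk
  refine (norm_derivAt_le _ hs hx).trans ?_
  rw [← dist_eq_norm]
  exact (hn₀ n hn k hk).le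

/-- The jets embed the space into a finite product of spaces of continuous functions from compact
sets to finite dimensional spaces. Separability makes continuous maps into `C^r(M)` strongly
measurable, so that they can be integrated. -/
instance secondCountable [T2Space M] [SecondCountableTopology M] :
    SecondCountableTopology (CrFun 𝔠 r 𝕜) := by
  have h1 : ∀ i s, SecondCountableTopology (Jet 𝔠 𝕜 i s) := fun i s => by
    have := FiniteDimensional.rclike_to_real (K := 𝕜)
    have := finiteDimensional_continuousMultilinearMap (E := Eu m) (F := 𝕜) s
    have : ProperSpace (ContinuousMultilinearMap ℝ (fun _ : Fin s => Eu m) 𝕜) :=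
      FiniteDimensional.proper ℝ _
    exact inferInstanceAs (SecondCountableTopology
      C(𝔠.K i, ContinuousMultilinearMap ℝ (fun _ : Fin s => Eu m) 𝕜))
  have h2 : Topology.IsInducing (fullJet (𝔠 := 𝔠) (r := r) (𝕜 := 𝕜)) := ⟨rfl⟩
  exact h2.secondCountableTopology

end CrFun

end

section

open scoped ENNReal NNReal

/-! ### The Riemannian distance in charts -/

section Riemann

variable {m : ℕ} {M : Type*} [MetricSpace M] [ChartedSpace (Eu m) M] [IsManifold (𝓡 m) ∞ M]
    [Bundle.RiemannianBundle (fun x : M => TangentSpace (𝓡 m) x)]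
    [IsContMDiffRiemannianBundle (𝓡 m) ∞ (Eu m) (fun x : M => TangentSpace (𝓡 m) x)]
    [IsRiemannianManifold (𝓡 m) M]

omit [IsRiemannianManifold (𝓡 m) M] in
theorem isContinuousRiemannianBundle_tangent :
    IsContinuousRiemannianBundle (Eu m) (fun x : M => TangentSpace (𝓡 m) x) := by
  obtain ⟨g, hg, h⟩ := IsContMDiffRiemannianBundle.exists_contMDiff (IB := 𝓡 m) (n := ∞)
    (F := Eu m) (E := fun x : M => TangentSpace (𝓡 m) x)
  exact ⟨⟨g, hg.continuous, h⟩⟩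

omit [IsRiemannianManifold (𝓡 m) M] in
theorem eventually_enorm_mfderiv_extChartAt_le (x : M) : ∃ C : ℝ≥0, ∀ᶠ y in 𝓝 x,
    ∀ v : TangentSpace (𝓡 m) y,
      @enorm (Eu m) _ (mfderiv (𝓡 m) 𝓘(ℝ, Eu m) (extChartAt (𝓡 m) x) y v) ≤ C * ‖v‖ₑ := by
  have := isContinuousRiemannianBundle_tangent (m := m) (M := M)
  obtain ⟨C, -, hC⟩ := eventually_enorm_mfderiv_extChartAt_lt (𝓡 m) x
  refine ⟨C, ?_⟩
  filter_upwards [hC] with y hy v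
  let := normedAddCommGroupTangentSpaceVectorSpace (E := Eu m) (extChartAt (𝓡 m) x y)
  let := normedSpaceTangentSpaceVectorSpace (E := Eu m) (extChartAt (𝓡 m) x y)
  exact (ContinuousLinearMap.le_opENorm _ v).trans (mul_le_mul_left hy.le _)

omit [IsRiemannianManifold (𝓡 m) M] in
theorem eventually_enorm_mfderivWithin_symm_extChartAt_le (x : M) : ∃ C : ℝ≥0,
    ∀ᶠ y in 𝓝 (extChartAt (𝓡 m) x x), ∀ v : Eu m,
      ‖mfderivWithin 𝓘(ℝ, Eu m) (𝓡 m) (extChartAt (𝓡 m) x).symm (range (𝓡 m)) y v‖ₑ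
        ≤ C * ‖v‖ₑ := by
  have := isContinuousRiemannianBundle_tangent (m := m) (M := M)
  obtain ⟨C, -, hC⟩ := eventually_enorm_mfderivWithin_symm_extChartAt_lt (𝓡 m) x
  refine ⟨C, ?_⟩
  have h1 : range (𝓡 m) = univ := by simp
  rw [h1, nhdsWithin_univ] at hC
  rw [h1]
  filter_upwards [hC] with y hy v
  let := normedAddCommGroupTangentSpaceVectorSpace (E := Eu m) y
  let := normedSpaceTangentSpaceVectorSpace (E := Eu m) y
  exact (ContinuousLinearMap.le_opENorm _ v).trans (mul_le_mul_left hy.le _)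

/-- The segment between the images in the chart is pulled back to a path in `M`; its length is at
most `C` times that of the segment, and it bounds the Riemannian distance. -/
theorem edist_le_of_segment {x a b : M} {C : ℝ≥0} {S : Set (Eu m)} (hS : Convex ℝ S)
    (hST : S ⊆ (extChartAt (𝓡 m) x).target)
    (hSC : ∀ y ∈ S, ∀ v : Eu m,
      ‖mfderivWithin 𝓘(ℝ, Eu m) (𝓡 m) (extChartAt (𝓡 m) x).symm (range (𝓡 m)) y v‖ₑ
        ≤ C * ‖v‖ₑ)
    (ha : a ∈ (chartAt (Eu m) x).source) (hb : b ∈ (chartAt (Eu m) x).source)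
    (haS : extChartAt (𝓡 m) x a ∈ S) (hbS : extChartAt (𝓡 m) x b ∈ S) :
    edist a b ≤ C * edist (extChartAt (𝓡 m) x a) (extChartAt (𝓡 m) x b) := by
  let η := ContinuousAffineMap.lineMap (R := ℝ) (extChartAt (𝓡 m) x a) (extChartAt (𝓡 m) x b)
  set γ := (extChartAt (𝓡 m) x).symm ∘ η
  have hη : Icc 0 1 ⊆ ⇑η ⁻¹' S := by
    simp only [← image_subset_iff, ContinuousAffineMap.coe_lineMap_eq,
     ← segment_eq_image_lineMap, η]
    exact hS.segment_subset haS hbS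
  have η_smooth : ContMDiffOn 𝓘(ℝ, ℝ) 𝓘(ℝ, Eu m) 1 η (Icc 0 1) := by
    apply ContMDiff.contMDiffOn
    rw [contMDiff_iff_contDiff]
    exact ContinuousAffineMap.contDiff _
  have hηT : Icc 0 1 ⊆ ⇑η ⁻¹' (extChartAt (𝓡 m) x).target := hη.trans (preimage_mono hST)
  rw [IsRiemannianManifold.out (I := 𝓡 m) a b]
  have h1 : Manifold.riemannianEDist (𝓡 m) a b ≤ Manifold.pathELength (𝓡 m) γ 0 1 := by
    apply Manifold.riemannianEDist_le_pathELength _ _ _ zero_le_one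
    · exact (contMDiffOn_extChartAt_symm x).comp η_smooth hηT
    · simp only [γ, η, ContinuousAffineMap.coe_lineMap_eq, Function.comp_apply,
        AffineMap.lineMap_apply_zero]
      exact (extChartAt (𝓡 m) x).left_inv (by rwa [extChartAt_source])
    · simp only [γ, η, ContinuousAffineMap.coe_lineMap_eq, Function.comp_apply,
        AffineMap.lineMap_apply_one]
      exact (extChartAt (𝓡 m) x).left_inv (by rwa [extChartAt_source])
  apply h1.trans
  rw [← lintegral_fderiv_lineMap_eq_edist, Manifold.pathELength_eq_lintegral_mfderivWithin_Icc,
    ← lintegral_const_mul' _ _ ENNReal.coe_ne_top]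
  apply setLIntegral_mono' measurableSet_Icc (fun t ht ↦ ?_)
  have h2 : mfderivWithin 𝓘(ℝ, ℝ) (𝓡 m) γ (Icc 0 1) t =
      (mfderivWithin 𝓘(ℝ, Eu m) (𝓡 m) (extChartAt (𝓡 m) x).symm (range (𝓡 m)) (η t)) ∘L
        (mfderivWithin 𝓘(ℝ, ℝ) 𝓘(ℝ, Eu m) η (Icc 0 1) t) := by
    apply mfderivWithin_comp
    · exact mdifferentiableWithinAt_extChartAt_symm (hηT ht)
    · exact η_smooth.mdifferentiableOn one_ne_zero t ht
    · exact hηT.trans (preimage_mono (extChartAt_target_subset_range x))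
    · rw [uniqueMDiffWithinAt_iff_uniqueDiffWithinAt]
      exact uniqueDiffOn_Icc zero_lt_one t ht
  have h3 : mfderivWithin 𝓘(ℝ, ℝ) (𝓡 m) γ (Icc 0 1) t (1 : ℝ) =
      (mfderivWithin 𝓘(ℝ, Eu m) (𝓡 m) (extChartAt (𝓡 m) x).symm (range (𝓡 m)) (η t))
        (fderivWithin ℝ η (Icc 0 1) t 1) := by
    rw [h2, mfderivWithin_eq_fderivWithin]
    rfl
  exact (congrArg enorm h3).trans_le (hSC _ (hη ht) _)

theorem exists_dist_le_extChartAt (x : M) : ∃ C : ℝ≥0, ∀ᶠ p in 𝓝 (x, x),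
    dist p.1 p.2 ≤ C * dist (extChartAt (𝓡 m) x p.1) (extChartAt (𝓡 m) x p.2) := by
  obtain ⟨C, hC⟩ := eventually_enorm_mfderivWithin_symm_extChartAt_le (m := m) x
  refine ⟨C, ?_⟩
  obtain ⟨r, hr, hball⟩ := Metric.mem_nhds_iff.1
    (Filter.inter_mem (extChartAt_target_mem_nhds (I := 𝓡 m) x) hC)
  have h1 : ∀ᶠ a in 𝓝 x, a ∈ (chartAt (Eu m) x).source ∧
      extChartAt (𝓡 m) x a ∈ Metric.ball (extChartAt (𝓡 m) x x) r :=
    Filter.Eventually.and (chart_source_mem_nhds (Eu m) x)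
      ((continuousAt_extChartAt x).eventually (Metric.ball_mem_nhds _ hr))
  filter_upwards [h1.prod_nhds h1] with p hp
  have h2 := edist_le_of_segment (convex_ball (extChartAt (𝓡 m) x x) r)
    (fun y hy => (hball hy).1) (fun y hy => (hball hy).2) hp.1.1 hp.2.1 hp.1.2 hp.2.2
  rw [edist_nndist, edist_nndist] at h2
  exact_mod_cast h2

theorem edist_extChartAt_le_of_path {x : M} {C : ℝ≥0} {γ : ℝ → M} {t₀ t₁ : ℝ} (ht : t₀ ≤ t₁)
    (hγ : ContMDiffOn 𝓘(ℝ, ℝ) (𝓡 m) 1 γ (Icc t₀ t₁))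
    (hs : ∀ t ∈ Icc t₀ t₁, γ t ∈ (chartAt (Eu m) x).source)
    (hC : ∀ t ∈ Icc t₀ t₁, ∀ v : TangentSpace (𝓡 m) (γ t),
      @enorm (Eu m) _ (mfderiv (𝓡 m) 𝓘(ℝ, Eu m) (extChartAt (𝓡 m) x) (γ t) v) ≤ C * ‖v‖ₑ) :
    edist (extChartAt (𝓡 m) x (γ t₁)) (extChartAt (𝓡 m) x (γ t₀))
      ≤ C * Manifold.pathELength (𝓡 m) γ t₀ t₁ := by
  rcases ht.eq_or_lt with rfl | hlt
  · simp
  let γ' := extChartAt (𝓡 m) x ∘ γ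
  have h1 : ContMDiffOn 𝓘(ℝ, ℝ) 𝓘(ℝ, Eu m) 1 γ' (Icc t₀ t₁) :=
    contMDiffOn_extChartAt.comp (I' := 𝓡 m) (t := (chartAt (Eu m) x).source) hγ hs
  rw [edist_eq_enorm_sub]
  calc
    ‖γ' t₁ - γ' t₀‖ₑ
    _ ≤ ∫⁻ t' in Icc t₀ t₁, ‖derivWithin γ' (Icc t₀ t₁) t'‖ₑ := by
      apply enorm_sub_le_lintegral_derivWithin_Icc_of_contDiffOn_Icc _ ht
      rwa [← contMDiffOn_iff_contDiffOn]
    _ ≤ ∫⁻ t' in Icc t₀ t₁, C * ‖mfderivWithin 𝓘(ℝ, ℝ) (𝓡 m) γ (Icc t₀ t₁) t' (1 : ℝ)‖ₑ := by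
      apply setLIntegral_mono' measurableSet_Icc (fun t' ht' ↦ ?_)
      have h2 : mfderivWithin 𝓘(ℝ, ℝ) 𝓘(ℝ, Eu m) γ' (Icc t₀ t₁) t' =
          (mfderiv (𝓡 m) 𝓘(ℝ, Eu m) (extChartAt (𝓡 m) x) (γ t')) ∘L
            (mfderivWithin 𝓘(ℝ, ℝ) (𝓡 m) γ (Icc t₀ t₁) t') := by
        apply mfderiv_comp_mfderivWithin
        · exact mdifferentiableAt_extChartAt (hs t' ht')
        · exact hγ.mdifferentiableOn one_ne_zero _ ht'
        · rw [uniqueMDiffWithinAt_iff_uniqueDiffWithinAt]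
          exact uniqueDiffOn_Icc hlt _ ht'
      have h3 : derivWithin γ' (Icc t₀ t₁) t' =
          mfderiv (𝓡 m) 𝓘(ℝ, Eu m) (extChartAt (𝓡 m) x) (γ t')
            (mfderivWithin 𝓘(ℝ, ℝ) (𝓡 m) γ (Icc t₀ t₁) t' (1 : ℝ)) := by
        rw [← fderivWithin_derivWithin, ← mfderivWithin_eq_fderivWithin, h2]
        rfl
      rw [h3]
      exact hC t' ht' _
    _ = C * Manifold.pathELength (𝓡 m) γ t₀ t₁ := by
      rw [lintegral_const_mul' _ _ ENNReal.coe_ne_top,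
          Manifold.pathELength_eq_lintegral_mfderivWithin_Icc]
      rfl

theorem exists_path_of_dist_lt {x y : M} {r : ℝ} (h : dist x y < r) :
    ∃ γ : ℝ → M, γ 0 = x ∧ γ 1 = y ∧ ContMDiffOn 𝓘(ℝ, ℝ) (𝓡 m) 1 γ (Icc 0 1) ∧
      Manifold.pathELength (𝓡 m) γ 0 1 < ENNReal.ofReal r := by
  have h1 : Manifold.riemannianEDist (𝓡 m) x y < ENNReal.ofReal r := by
    rw [← IsRiemannianManifold.out (I := 𝓡 m) x y, edist_dist]
    exact (ENNReal.ofReal_lt_ofReal_iff_of_nonneg dist_nonneg).2 h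
  exact Manifold.exists_lt_of_riemannianEDist_lt h1

theorem edist_le_pathELength {γ : ℝ → M} (hγ : ContMDiffOn 𝓘(ℝ, ℝ) (𝓡 m) 1 γ (Icc 0 1))
    {s t : ℝ} (hs : 0 ≤ s) (hst : s ≤ t) (ht : t ≤ 1) :
    edist (γ s) (γ t) ≤ Manifold.pathELength (𝓡 m) γ s t := by
  rw [IsRiemannianManifold.out (I := 𝓡 m)]
  exact Manifold.riemannianEDist_le_pathELength (hγ.mono (Icc_subset_Icc hs ht)) rfl rfl hst

/-- A path whose length is close to the distance is mapped to the chart, where its length grows at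
most by `C`. Points within `r / 4` of `x` have distance below `r / 2`, so a nearly minimal path
between them has length below `r / 2` and stays in the ball of radius `r` on which the chart is
controlled. -/
theorem exists_extChartAt_le_dist (x : M) : ∃ C : ℝ≥0, ∀ᶠ p in 𝓝 (x, x),
    dist (extChartAt (𝓡 m) x p.1) (extChartAt (𝓡 m) x p.2) ≤ C * dist p.1 p.2 := by
  obtain ⟨C, hC⟩ := eventually_enorm_mfderiv_extChartAt_le (m := m) x
  refine ⟨C, ?_⟩
  obtain ⟨r, hr, hball⟩ := Metric.mem_nhds_iff.1
    (Filter.inter_mem (chart_source_mem_nhds (Eu m) x) hC)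
  have hr4 : Metric.ball x (r / 4) ∈ 𝓝 x := Metric.ball_mem_nhds _ (by positivity)
  filter_upwards [prod_mem_nhds hr4 hr4] with p hp
  obtain ⟨ha, hb⟩ : dist p.1 x < r / 4 ∧ dist p.2 x < r / 4 := hp
  have hab : dist p.1 p.2 < r / 2 := by
    linarith [dist_triangle_right p.1 p.2 x]
  have key : ∀ u, dist p.1 p.2 < u → u < r / 2 →
      dist (extChartAt (𝓡 m) x p.1) (extChartAt (𝓡 m) x p.2) ≤ C * u := by
    intro u hu hur
    obtain ⟨γ, h0, h1, hγ, hlen⟩ := exists_path_of_dist_lt (m := m) hu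
    have hmem : ∀ t ∈ Icc (0 : ℝ) 1, γ t ∈ Metric.ball x r := by
      intro t ht
      have h2 : edist (γ 0) (γ t) < ENNReal.ofReal (r / 2) :=
        ((edist_le_pathELength hγ le_rfl ht.1 ht.2).trans
          (Manifold.pathELength_mono le_rfl ht.2)).trans_lt
            (hlen.trans_le (ENNReal.ofReal_le_ofReal hur.le))
      rw [edist_dist, ENNReal.ofReal_lt_ofReal_iff (by positivity), h0] at h2
      rw [Metric.mem_ball, dist_comm]
      linarith [dist_triangle_left x (γ t) p.1]
    have h3 := edist_extChartAt_le_of_path (x := x) (C := C) zero_le_one hγ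
      (fun t ht => (hball (hmem t ht)).1) (fun t ht => (hball (hmem t ht)).2)
    rw [h0, h1, edist_comm] at h3
    have h4 := h3.trans (mul_le_mul_right hlen.le _)
    rw [edist_dist, ← ENNReal.ofReal_coe_nnreal, ← ENNReal.ofReal_mul C.coe_nonneg] at h4
    exact (ENNReal.ofReal_le_ofReal_iff (mul_nonneg C.coe_nonneg (dist_nonneg.trans hu.le))).1 h4
  have h5 : Tendsto (fun u : ℝ => C * u) (𝓝[>] (dist p.1 p.2)) (𝓝 (C * dist p.1 p.2)) :=
    ((continuous_const.mul continuous_id).tendsto _).mono_left nhdsWithin_le_nhds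
  refine ge_of_tendsto h5 ?_
  filter_upwards [Ioo_mem_nhdsGT hab] with u hu using key u hu.1 hu.2

/-- Smooth charts are locally bi-Lipschitz. -/
theorem exists_bilipschitz_chart {e : OpenPartialHomeomorph M (Eu m)}
    (he : e ∈ IsManifold.maximalAtlas (𝓡 m) ∞ M) {x : M} (hx : x ∈ e.source) :
    ∃ C : ℝ≥0, ∀ᶠ p in 𝓝 (x, x), dist p.1 p.2 ≤ C * dist (e p.1) (e p.2) ∧
      dist (e p.1) (e p.2) ≤ C * dist p.1 p.2 := by
  obtain ⟨C₁, h1⟩ := exists_dist_le_extChartAt (m := m) x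
  obtain ⟨C₂, h2⟩ := exists_extChartAt_le_dist (m := m) x
  have hc := IsManifold.chart_mem_maximalAtlas (I := 𝓡 m) (n := ∞) x
  have hcx := mem_chart_source (Eu m) x
  obtain ⟨K₁, t₁, ht₁, hK₁⟩ :=
    ((contDiffAt_chart_change hc he hcx hx 1).of_le (by simp)).exists_lipschitzOnWith
  obtain ⟨K₂, t₂, ht₂, hK₂⟩ :=
    ((contDiffAt_chart_change he hc hx hcx 1).of_le (by simp)).exists_lipschitzOnWith
  have ht₁' := ((chartAt (Eu m) x).continuousAt hcx).preimage_mem_nhds ht₁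
  have ht₂' := (e.continuousAt hx).preimage_mem_nhds ht₂
  have hall := Filter.Eventually.and (Filter.Eventually.and
    ((chartAt (Eu m) x).open_source.mem_nhds hcx) (e.open_source.mem_nhds hx))
    (Filter.Eventually.and ht₁' ht₂')
  refine ⟨max (C₁ * K₂) (K₁ * C₂), ?_⟩
  filter_upwards [h1, h2, Filter.Eventually.prod_nhds hall hall] with p hp1 hp2 hp
  obtain ⟨⟨⟨ac, ae⟩, at1, at2⟩, ⟨bc, be⟩, bt1, bt2⟩ := hp
  simp only [extChartAt_coe, modelWithCornersSelf_coe, Function.id_comp] at hp1 hp2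
  have e1 := hK₁.dist_le_mul _ at1 _ bt1
  have e2 := hK₂.dist_le_mul _ at2 _ bt2
  simp only [Function.comp_apply, (chartAt (Eu m) x).left_inv ac, (chartAt (Eu m) x).left_inv bc,
    e.left_inv ae, e.left_inv be] at e1 e2
  have m1 : (C₁ * K₂ : ℝ) ≤ (max (C₁ * K₂) (K₁ * C₂) : ℝ≥0) := by
    exact_mod_cast le_max_left (C₁ * K₂) (K₁ * C₂)
  have m2 : (K₁ * C₂ : ℝ) ≤ (max (C₁ * K₂) (K₁ * C₂) : ℝ≥0) := by
    exact_mod_cast le_max_right (C₁ * K₂) (K₁ * C₂)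
  constructor
  · calc dist p.1 p.2 ≤ C₁ * (K₂ * dist (e p.1) (e p.2)) :=
          hp1.trans (mul_le_mul_of_nonneg_left e2 C₁.coe_nonneg)
      _ = C₁ * K₂ * dist (e p.1) (e p.2) := by ring
      _ ≤ _ := mul_le_mul_of_nonneg_right m1 dist_nonneg
  · calc dist (e p.1) (e p.2) ≤ K₁ * (C₂ * dist p.1 p.2) :=
          e1.trans (mul_le_mul_of_nonneg_left hp2 K₁.coe_nonneg)
      _ = K₁ * C₂ * dist p.1 p.2 := by ring
      _ ≤ _ := mul_le_mul_of_nonneg_right m2 dist_nonneg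

end Riemann

/-- Two points are joined by a chain with small steps whose length is almost their distance. -/
theorem exists_chain (m : ℕ) {M : Type*} [MetricSpace M] [ChartedSpace (Eu m) M]
    [IsManifold (𝓡 m) ∞ M] [Bundle.RiemannianBundle (fun x : M => TangentSpace (𝓡 m) x)]
    [IsContMDiffRiemannianBundle (𝓡 m) ∞ (Eu m) (fun x : M => TangentSpace (𝓡 m) x)]
    [IsRiemannianManifold (𝓡 m) M] (x y : M) {δ η : ℝ} (hδ : 0 < δ) (hη : 0 < η) :
    ∃ (n : ℕ) (c : ℕ → M), c 0 = x ∧ c n = y ∧ (∀ i < n, dist (c i) (c (i + 1)) < δ) ∧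
      ∑ i ∈ Finset.range n, dist (c i) (c (i + 1)) < dist x y + η := by
  obtain ⟨γ, h0, h1, hγ, hlen⟩ := exists_path_of_dist_lt (m := m) (lt_add_of_pos_right (dist x y) hη)
  have huc := isCompact_Icc.uniformContinuousOn_of_continuous hγ.continuousOn
  obtain ⟨τ, hτ, huc⟩ := Metric.uniformContinuousOn_iff.1 huc δ hδ
  obtain ⟨n, hn⟩ := exists_nat_one_div_lt hτ
  have hn0 : (0 : ℝ) < n + 1 := by positivity
  -- Equal parameter steps of size `1 / (n + 1) < τ`. The lengths of the pieces add up to the length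
  -- of the path, so the chain is no longer than the path.
  let t : ℕ → ℝ := fun i => i / (n + 1)
  have ht0 : ∀ i, 0 ≤ t i := fun i => by positivity
  have ht1 : ∀ i ≤ n + 1, t i ≤ 1 := fun i hi => by
    rw [div_le_one hn0]
    exact_mod_cast hi
  have htm : ∀ i, t i ≤ t (i + 1) := fun i => by
    simp only [t]
    gcongr
    simp
  have hadd : ∀ k ≤ n + 1, ∑ i ∈ Finset.range k, edist (γ (t i)) (γ (t (i + 1)))
      ≤ Manifold.pathELength (𝓡 m) γ 0 (t k) := by
    intro k
    induction k with
    | zero => simp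
    | succ k ih =>
      intro hk
      rw [Finset.sum_range_succ, ← Manifold.pathELength_add (ht0 k) (htm k)]
      exact add_le_add (ih (by lia)) (edist_le_pathELength hγ (ht0 k) (htm k) (ht1 _ hk))
  have htn : t (n + 1) = 1 := by
    simp only [t]
    push_cast
    exact div_self hn0.ne'
  refine ⟨n + 1, fun i => γ (t i), by simpa [t] using h0, by simpa [htn] using h1, ?_, ?_⟩
  · intro i hi
    refine huc _ ⟨ht0 i, ht1 i hi.le⟩ _ ⟨ht0 _, ht1 _ hi⟩ ?_
    rw [Real.dist_eq, abs_sub_comm, abs_of_nonneg (sub_nonneg.2 (htm i))]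
    refine lt_of_eq_of_lt ?_ hn
    simp only [t]
    push_cast
    ring
  · have h2 := (hadd (n + 1) le_rfl).trans_lt (htn ▸ hlen)
    rw [ENNReal.lt_ofReal_iff_toReal_lt (ne_top_of_lt h2),
      ENNReal.toReal_sum fun i _ => edist_ne_top _ _] at h2
    simpa [edist_dist] using h2

end

section

/-! ### Length manifolds, Lipschitz bounds and metric unit vectors -/

open scoped ENNReal NNReal

/-- On a compact set, a monotone family of conditions that hold locally holds uniformly. -/
theorem exists_forall_of_eventually {X : Type*} [TopologicalSpace X] {K : Set X} (hK : IsCompact K)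
    {P : ℝ → X → Prop} (hP : ∀ x, Monotone fun C => P C x)
    (h : ∀ x ∈ K, ∃ C, ∀ᶠ z in 𝓝[K] x, P C z) : ∃ C, 0 ≤ C ∧ ∀ x ∈ K, P C x := by
  refine hK.induction_on (p := fun S => ∃ C, 0 ≤ C ∧ ∀ x ∈ S, P C x) ⟨0, le_rfl, by simp⟩ ?_ ?_ ?_
  · rintro s t hst ⟨C, hC, h⟩
    exact ⟨C, hC, fun x hx => h x (hst hx)⟩
  · rintro s t ⟨C, hC, h1⟩ ⟨C', hC', h2⟩
    refine ⟨max C C', le_max_of_le_left hC, ?_⟩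
    rintro x (hx | hx)
    · exact hP x (le_max_left _ _) (h1 x hx)
    · exact hP x (le_max_right _ _) (h2 x hx)
  · intro x hx
    obtain ⟨C, hC⟩ := h x hx
    exact ⟨_, hC, max C 0, le_max_right _ _, fun z hz => hP z (le_max_left _ _) hz⟩

/-- The two properties of the Riemannian distance that are used below: smooth charts are locally
bi-Lipschitz, and points are joined by chains with small steps of almost minimal length. -/
structure IsLengthManifold (m : ℕ) (M : Type*) [MetricSpace M] [ChartedSpace (Eu m) M] : Prop where
  bilipschitz : ∀ e ∈ IsManifold.maximalAtlas (𝓡 m) ∞ M, ∀ x ∈ e.source,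
    ∃ C : ℝ≥0, ∀ᶠ p in 𝓝 (x, x), dist p.1 p.2 ≤ C * dist (e p.1) (e p.2) ∧
      dist (e p.1) (e p.2) ≤ C * dist p.1 p.2
  chain : ∀ (x y : M) (δ η : ℝ), 0 < δ → 0 < η →
    ∃ (n : ℕ) (c : ℕ → M), c 0 = x ∧ c n = y ∧ (∀ i < n, dist (c i) (c (i + 1)) < δ) ∧
      ∑ i ∈ Finset.range n, dist (c i) (c (i + 1)) < dist x y + η

theorem isLengthManifold (m : ℕ) (M : Type*) [MetricSpace M] [ChartedSpace (Eu m) M]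
    [IsManifold (𝓡 m) ∞ M] [Bundle.RiemannianBundle (fun x : M => TangentSpace (𝓡 m) x)]
    [IsContMDiffRiemannianBundle (𝓡 m) ∞ (Eu m) (fun x : M => TangentSpace (𝓡 m) x)]
    [IsRiemannianManifold (𝓡 m) M] : IsLengthManifold m M :=
  ⟨fun _ he _ hx => exists_bilipschitz_chart he hx, fun x y _ _ => exists_chain m x y⟩

namespace IsLengthManifold

variable {m : ℕ} {M : Type*} [MetricSpace M] [ChartedSpace (Eu m) M]

/-- Summing the local bound along a chain of almost minimal length makes it global without loss in
the constant. -/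
theorem norm_sub_le (hM : IsLengthManifold m M) {E : Type*} [SeminormedAddCommGroup E]
    {g : M → E} {C δ : ℝ} (hC : 0 ≤ C) (hδ : 0 < δ)
    (h : ∀ x y, dist x y < δ → ‖g x - g y‖ ≤ C * dist x y) (x y : M) :
    ‖g x - g y‖ ≤ C * dist x y := by
  have key : ∀ η > 0, ‖g x - g y‖ ≤ C * (dist x y + η) := by
    intro η hη
    obtain ⟨n, c, h0, hn, hs, ht⟩ := hM.chain x y δ η hδ hη
    have h1 : ∀ k ≤ n, ‖g (c 0) - g (c k)‖ ≤ C * ∑ i ∈ Finset.range k, dist (c i) (c (i + 1)) := by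
      intro k
      induction k with
      | zero => simp
      | succ k ih =>
        intro hk
        rw [Finset.sum_range_succ, mul_add, ← sub_add_sub_cancel _ (g (c k))]
        exact (norm_add_le _ _).trans (add_le_add (ih (by lia)) (h _ _ (hs k hk)))
    have h2 := h1 n le_rfl
    rw [h0, hn] at h2
    exact h2.trans (mul_le_mul_of_nonneg_left ht.le hC)
  have h3 : Tendsto (fun η : ℝ => C * (dist x y + η)) (𝓝[>] 0) (𝓝 (C * (dist x y + 0))) :=
    ((continuous_const.mul (continuous_const.add continuous_id)).tendsto _).mono_left
      nhdsWithin_le_nhds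
  rw [add_zero] at h3
  refine ge_of_tendsto h3 ?_
  filter_upwards [self_mem_nhdsWithin] with η hη using key η hη

end IsLengthManifold

section Lipschitz

variable {m : ℕ} {M : Type*} [MetricSpace M] [CompactSpace M] [ChartedSpace (Eu m) M]
  [IsManifold (𝓡 m) ∞ M] {𝔠 : ChartCover m M} {r : ℕ} {𝕜 : Type} [RCLike 𝕜]

theorem norm_derivAt_one (g : CrFun 𝔠 r 𝕜) (i : Fin 𝔠.N) (x : M) :
    ‖g.derivAt i 1 x‖ = ‖fderiv ℝ (g ∘ (𝔠.chart i).symm) (𝔠.chart i x)‖ :=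
  norm_iteratedFDeriv_one _

/-- Near `x₀` every point lies in some `K j`, and the chart changes from `e` have bounded
derivatives there. The neighbourhood and the constant are chosen before `g`. -/
theorem exists_norm_fderiv_le (hr : 1 ≤ r) {e : OpenPartialHomeomorph M (Eu m)}
    (he : e ∈ IsManifold.maximalAtlas (𝓡 m) ∞ M) {x₀ : M} (hx₀ : x₀ ∈ e.source) :
    ∃ C, 0 ≤ C ∧ ∀ᶠ z in 𝓝 x₀, ∀ (g : CrFun 𝔠 r 𝕜) (B : ℝ),
      (∀ i, ∀ x ∈ 𝔠.K i, ‖g.derivAt i 1 x‖ ≤ B) → ‖fderiv ℝ (g ∘ e.symm) (e z)‖ ≤ B * C := by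
  have h1 : ∀ j, ∃ C, 0 ≤ C ∧ ∀ᶠ z in 𝓝 x₀, z ∈ 𝔠.K j →
      ‖fderiv ℝ (𝔠.chart j ∘ e.symm) (e z)‖ ≤ C := by
    intro j
    by_cases hj : x₀ ∈ 𝔠.K j
    · have h2 := contDiffAt_chart_change he (𝔠.chart_mem j) hx₀ (𝔠.K_subset j hj) 1
      have h3 : ContinuousAt (fun z => ‖fderiv ℝ (𝔠.chart j ∘ e.symm) (e z)‖) x₀ :=
        (ContinuousAt.comp (f := e) (h2.continuousAt_fderiv (by simp))
          (e.continuousAt hx₀)).norm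
      refine ⟨‖fderiv ℝ (𝔠.chart j ∘ e.symm) (e x₀)‖ + 1, by positivity, ?_⟩
      filter_upwards [h3.eventually_lt_const (lt_add_one _)] with z hz _ using hz.le
    · refine ⟨0, le_rfl, ?_⟩
      filter_upwards [(𝔠.isCompact_K j).isClosed.isOpen_compl.mem_nhds hj] with z hz hz'
      exact absurd hz' hz
  choose C hC0 hC using h1
  refine ⟨∑ j, C j, Finset.sum_nonneg fun j _ => hC0 j, ?_⟩
  filter_upwards [eventually_all.2 hC, e.open_source.mem_nhds hx₀] with z hz hze g B hB
  obtain ⟨j, hj⟩ := mem_iUnion.1 (show z ∈ ⋃ i, 𝔠.K i by rw [𝔠.cover]; trivial)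
  have hjs := 𝔠.K_subset j hj
  have hB0 : 0 ≤ B := (norm_nonneg _).trans (hB j z hj)
  have hr' : ((r : ℕ) : WithTop ℕ∞) ≠ 0 := by exact_mod_cast (by lia : r ≠ 0)
  rw [← (comp_symm_eventuallyEq g hze hjs).fderiv_eq]
  have h4 : (𝔠.chart j ∘ e.symm) (e z) = 𝔠.chart j z := by
    rw [Function.comp_apply, e.left_inv hze]
  rw [fderiv_comp _ (by rw [h4]; exact (g.contDiffAt_chart j hjs).differentiableAt hr')
    ((contDiffAt_chart_change he (𝔠.chart_mem j) hze hjs 1).differentiableAt (by simp)), h4]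
  refine (ContinuousLinearMap.opNorm_comp_le _ _).trans ?_
  rw [← norm_derivAt_one]
  exact mul_le_mul (hB j z hj) ((hz j hj).trans (Finset.single_le_sum (fun j _ => hC0 j)
    (Finset.mem_univ j))) (norm_nonneg _) hB0

/-- The Lipschitz constant of a `C^r` function, `r ≥ 1`, is controlled by its first derivative. -/
theorem exists_lipschitz_bound (hM : IsLengthManifold m M) (𝔠 : ChartCover m M) {r : ℕ}
    (hr : 1 ≤ r) (𝕜 : Type) [RCLike 𝕜] : ∃ K, 0 ≤ K ∧ ∀ (g : CrFun 𝔠 r 𝕜) (B : ℝ), 0 ≤ B →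
      (∀ i, ∀ x ∈ 𝔠.K i, ‖g.derivAt i 1 x‖ ≤ B) → ∀ x y, ‖g x - g y‖ ≤ K * B * dist x y := by
  have hloc : ∀ x₀ : M, ∃ K, ∀ᶠ p in 𝓝 (x₀, x₀), ∀ (g : CrFun 𝔠 r 𝕜) (B : ℝ), 0 ≤ B →
      (∀ i, ∀ x ∈ 𝔠.K i, ‖g.derivAt i 1 x‖ ≤ B) →
        ‖g p.1 - g p.2‖ ≤ K * B * dist p.1 p.2 := by
    intro x₀
    obtain ⟨i, hi⟩ := mem_iUnion.1 (show x₀ ∈ ⋃ i, 𝔠.K i by rw [𝔠.cover]; trivial)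
    have hx₀ := 𝔠.K_subset i hi
    set e := 𝔠.chart i
    have he : e ∈ IsManifold.maximalAtlas (𝓡 m) ∞ M := 𝔠.chart_mem i
    obtain ⟨C₁, hC₁, h1⟩ := exists_norm_fderiv_le (𝔠 := 𝔠) (𝕜 := 𝕜) hr he hx₀
    obtain ⟨C₂, h2⟩ := hM.bilipschitz e he x₀ hx₀
    have h3 : ∀ᶠ w in 𝓝 (e x₀), w ∈ e.target ∧ ∀ (g : CrFun 𝔠 r 𝕜) (B : ℝ),
        (∀ i, ∀ x ∈ 𝔠.K i, ‖g.derivAt i 1 x‖ ≤ B) → ‖fderiv ℝ (g ∘ e.symm) w‖ ≤ B * C₁ := by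
      have h4 : Tendsto e.symm (𝓝 (e x₀)) (𝓝 x₀) := by
        have := (e.continuousAt_symm (e.map_source hx₀)).tendsto
        rwa [e.left_inv hx₀] at this
      filter_upwards [h4.eventually h1, e.open_target.mem_nhds (e.map_source hx₀)] with w hw hwt
      exact ⟨hwt, fun g B hB => by simpa [e.right_inv hwt] using hw g B hB⟩
    obtain ⟨τ, hτ, hball⟩ := Metric.eventually_nhds_iff_ball.1 h3
    have h5 : ∀ᶠ z in 𝓝 x₀, z ∈ e.source ∧ e z ∈ Metric.ball (e x₀) τ :=
      Filter.Eventually.and (e.open_source.mem_nhds hx₀)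
        ((e.continuousAt hx₀).eventually (Metric.ball_mem_nhds _ hτ))
    refine ⟨C₁ * C₂, ?_⟩
    filter_upwards [h2, Filter.Eventually.prod_nhds h5 h5] with p hp hps g B hB0 hB
    have hr' : ((r : ℕ) : WithTop ℕ∞) ≠ 0 := by exact_mod_cast (by lia : r ≠ 0)
    have h6 : ‖(g ∘ e.symm) (e p.1) - (g ∘ e.symm) (e p.2)‖ ≤ B * C₁ * ‖e p.1 - e p.2‖ := by
      refine (convex_ball (e x₀) τ).norm_image_sub_le_of_norm_fderiv_le (𝕜 := ℝ) (fun w hw => ?_)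
        (fun w hw => (hball w hw).2 g B hB) hps.2.2 hps.1.2
      have := (g.contDiffAt_of_mem_maximalAtlas he
        (e.map_target (hball w hw).1)).differentiableAt hr'
      rwa [e.right_inv (hball w hw).1] at this
    simp only [Function.comp_apply, e.left_inv hps.1.1, e.left_inv hps.2.1] at h6
    rw [← dist_eq_norm (e p.1)] at h6
    calc ‖g p.1 - g p.2‖ ≤ B * C₁ * (C₂ * dist p.1 p.2) :=
          h6.trans (mul_le_mul_of_nonneg_left hp.2 (by positivity))
      _ = C₁ * C₂ * B * dist p.1 p.2 := by ring
  obtain ⟨K, hK0, hK⟩ := exists_forall_of_eventually (isCompact_univ (X := M))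
    (P := fun K x => ∀ᶠ p in 𝓝 (x, x), ∀ (g : CrFun 𝔠 r 𝕜) (B : ℝ), 0 ≤ B →
      (∀ i, ∀ x ∈ 𝔠.K i, ‖g.derivAt i 1 x‖ ≤ B) → ‖g p.1 - g p.2‖ ≤ K * B * dist p.1 p.2)
    (fun x C C' hCC h => h.mono fun p hp g B hB0 hB => (hp g B hB0 hB).trans (by gcongr))
    fun x _ => by
      obtain ⟨C, hC⟩ := hloc x
      refine ⟨C, ?_⟩
      rw [nhdsWithin_univ]
      exact (continuous_id.prodMk continuous_id).continuousAt.eventually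
        (eventually_eventually_nhds.2 hC)
  have hunif : ∀ᶠ p in uniformity M, ∀ (g : CrFun 𝔠 r 𝕜) (B : ℝ), 0 ≤ B →
      (∀ i, ∀ x ∈ 𝔠.K i, ‖g.derivAt i 1 x‖ ≤ B) → ‖g p.1 - g p.2‖ ≤ K * B * dist p.1 p.2 := by
    -- By compactness the neighbourhoods of the points of the diagonal combine to a uniform scale
    -- `δ`, from which chains lead to all pairs.
    rw [compactSpace_uniformity, eventually_iSup]
    exact fun x => hK x trivial
  obtain ⟨δ, hδ, hd⟩ := Metric.mem_uniformity_dist.1 hunif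
  exact ⟨K, hK0, fun g B hB0 hB => hM.norm_sub_le (mul_nonneg hK0 hB0) hδ
    fun x y hxy => hd hxy g B hB0 hB⟩

end Lipschitz

section UnitVectors

variable {m : ℕ} {M : Type*} [MetricSpace M] [ChartedSpace (Eu m) M]

/-- The vectors at `x`, read in the chart `e`, of metric length at most `ℓ`. -/
def metricBall (e : OpenPartialHomeomorph M (Eu m)) (x : M) (ℓ : ℝ) : Set (Eu m) :=
  {v | ∀ ℓ' > ℓ, ∀ᶠ t in 𝓝[>] (0 : ℝ), dist x (e.symm (e x + t • v)) ≤ ℓ' * t}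

theorem smul_mem_metricBall {e : OpenPartialHomeomorph M (Eu m)} {x : M} {ℓ c : ℝ} (hc : 0 < c)
    {v : Eu m} (hv : v ∈ metricBall e x ℓ) : c • v ∈ metricBall e x (c * ℓ) := by
  intro ℓ' hℓ'
  have h1 : ℓ' / c > ℓ := by rwa [gt_iff_lt, lt_div_iff₀' hc]
  have h2 : Tendsto (fun t : ℝ => t * c) (𝓝[>] 0) (𝓝[>] 0) := by
    refine tendsto_nhdsWithin_iff.2 ⟨?_, ?_⟩
    · have : Tendsto (fun t : ℝ => t * c) (𝓝 0) (𝓝 (0 * c)) :=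
        (continuous_id.mul continuous_const).tendsto _
      rw [zero_mul] at this
      exact this.mono_left nhdsWithin_le_nhds
    · filter_upwards [self_mem_nhdsWithin] with t ht using mul_pos ht hc
  filter_upwards [h2.eventually (hv _ h1)] with t ht
  rw [smul_smul]
  refine ht.trans_eq ?_
  field_simp

theorem tendsto_add_smul (w v : Eu m) : Tendsto (fun t : ℝ => w + t • v) (𝓝[>] 0) (𝓝 w) := by
  have : Tendsto (fun t : ℝ => w + t • v) (𝓝 0) (𝓝 (w + (0 : ℝ) • v)) :=
    (continuous_const.add (continuous_id.smul continuous_const)).tendsto _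
  rw [zero_smul, add_zero] at this
  exact this.mono_left nhdsWithin_le_nhds

/-- A continuous path in a chart stays in the domain for a short time. -/
theorem tendsto_symm_add_smul {e : OpenPartialHomeomorph M (Eu m)} {x : M} (hx : x ∈ e.source)
    (v : Eu m) : Tendsto (fun t : ℝ => e.symm (e x + t • v)) (𝓝[>] 0) (𝓝 x) := by
  have := (e.continuousAt_symm (e.map_source hx)).tendsto
  rw [e.left_inv hx] at this
  exact this.comp (tendsto_add_smul _ _)

/-- Together with its converse below, this makes the metric unit vectors comparable with the
Euclidean ones. They are defined through distances only, so that a Lipschitz constant of an inverse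
branch acts on them without a loss from the charts. -/
theorem mem_metricBall_of_norm_le {e : OpenPartialHomeomorph M (Eu m)} {x : M} (hx : x ∈ e.source)
    {C : ℝ} (h : ∀ᶠ p in 𝓝 (x, x), dist p.1 p.2 ≤ C * dist (e p.1) (e p.2))
    {v : Eu m} {ℓ : ℝ} (hv : C * ‖v‖ ≤ ℓ) : v ∈ metricBall e x ℓ := by
  intro ℓ' hℓ'
  have h1 : Tendsto (fun t : ℝ => (x, e.symm (e x + t • v))) (𝓝[>] 0) (𝓝 (x, x)) :=
    tendsto_const_nhds.prodMk_nhds (tendsto_symm_add_smul hx v)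
  filter_upwards [h1.eventually h, self_mem_nhdsWithin, (tendsto_add_smul (e x) v).eventually
    (e.open_target.mem_nhds (e.map_source hx))] with t ht ht0 htt
  have ht0' : 0 < t := ht0
  refine ht.trans ?_
  simp only [e.right_inv htt, dist_self_add_right, norm_smul, Real.norm_eq_abs, abs_of_pos ht0']
  nlinarith

theorem norm_le_of_mem_metricBall {e : OpenPartialHomeomorph M (Eu m)} {x : M} (hx : x ∈ e.source)
    {C : ℝ} (hC : 0 ≤ C) (h : ∀ᶠ p in 𝓝 (x, x), dist (e p.1) (e p.2) ≤ C * dist p.1 p.2)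
    {v : Eu m} {ℓ : ℝ} (hv : v ∈ metricBall e x ℓ) : ‖v‖ ≤ C * ℓ := by
  have h1 : Tendsto (fun t : ℝ => (x, e.symm (e x + t • v))) (𝓝[>] 0) (𝓝 (x, x)) :=
    tendsto_const_nhds.prodMk_nhds (tendsto_symm_add_smul hx v)
  have key : ∀ ℓ' > ℓ, ‖v‖ ≤ C * ℓ' := by
    intro ℓ' hℓ'
    have hpos : ∀ᶠ t in 𝓝[>] (0 : ℝ), t ∈ Ioi (0 : ℝ) := self_mem_nhdsWithin
    obtain ⟨t, ht, ht0, htt, ht'⟩ := ((h1.eventually h).and (hpos.and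
      (((tendsto_add_smul (e x) v).eventually (e.open_target.mem_nhds (e.map_source hx))).and
        (hv ℓ' hℓ')))).exists
    have ht0' : 0 < t := ht0
    simp only [e.right_inv htt, dist_self_add_right, norm_smul, Real.norm_eq_abs,
      abs_of_pos ht0'] at ht
    have h2 := ht.trans (mul_le_mul_of_nonneg_left ht' hC)
    rw [← mul_le_mul_iff_right₀ ht0']
    linarith
  have h3 : Tendsto (fun u : ℝ => C * u) (𝓝[>] ℓ) (𝓝 (C * ℓ)) :=
    ((continuous_const.mul continuous_id).tendsto _).mono_left nhdsWithin_le_nhds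
  refine ge_of_tendsto h3 ?_
  filter_upwards [self_mem_nhdsWithin] with u hu using key u hu

/-- A local inverse branch with Lipschitz constant `ℓ` stretches metric lengths by at most `ℓ`. -/
theorem fderiv_mem_metricBall {e e' : OpenPartialHomeomorph M (Eu m)} {x y : M}
    (hx : x ∈ e.source) (hy : y ∈ e'.source) {Γ : M → M} (hΓ : Γ x = y) (hΓc : ContinuousAt Γ x)
    {C : ℝ} (hC : 0 ≤ C) (h : ∀ᶠ p in 𝓝 (y, y), dist p.1 p.2 ≤ C * dist (e' p.1) (e' p.2))
    {ℓ : ℝ} (hℓ : 0 ≤ ℓ) (hlip : ∀ᶠ z in 𝓝 x, dist y (Γ z) ≤ ℓ * dist x z)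
    (hd : DifferentiableAt ℝ (e' ∘ Γ ∘ e.symm) (e x)) {v : Eu m} (hv : v ∈ metricBall e x 1) :
    fderiv ℝ (e' ∘ Γ ∘ e.symm) (e x) v ∈ metricBall e' y ℓ := by
  intro ℓ' hℓ'
  set w := fderiv ℝ (e' ∘ Γ ∘ e.symm) (e x) v
  -- Here `1 + η` is an admissible length for `v`, and `η` is also the error of the linear
  -- approximation, which the chart turns into a distance of at most `C η t`.
  obtain ⟨η, hη, hηℓ⟩ : ∃ η > 0, ℓ * (1 + η) + C * η ≤ ℓ' := by
    refine ⟨(ℓ' - ℓ) / (ℓ + C + 1), by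
      have : 0 < ℓ' - ℓ := sub_pos.2 hℓ'
      positivity, ?_⟩
    have h1 : (ℓ + C) * ((ℓ' - ℓ) / (ℓ + C + 1)) ≤ ℓ' - ℓ := by
      rw [mul_div_assoc', div_le_iff₀ (by positivity)]
      nlinarith
    linarith
  have hxt := tendsto_symm_add_smul hx v
  have hyt : Tendsto (fun t : ℝ => Γ (e.symm (e x + t • v))) (𝓝[>] 0) (𝓝 y) := by
    have := hΓc.tendsto
    rw [hΓ] at this
    exact this.comp hxt
  have hpair : Tendsto (fun t : ℝ => (Γ (e.symm (e x + t • v)), e'.symm (e' y + t • w)))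
      (𝓝[>] 0) (𝓝 (y, y)) := hyt.prodMk_nhds (tendsto_symm_add_smul hy w)
  have hderiv : ∀ᶠ t in 𝓝[>] (0 : ℝ),
      ‖e' (Γ (e.symm (e x + t • v))) - (e' y + t • w)‖ ≤ η * t := by
    have h1 : HasDerivAt (fun t : ℝ => (e' ∘ Γ ∘ e.symm) (e x + t • v)) w 0 := by
      have h2 : HasFDerivAt (e' ∘ Γ ∘ e.symm) (fderiv ℝ (e' ∘ Γ ∘ e.symm) (e x))
          (e x + (0 : ℝ) • v) := by
        rw [zero_smul, add_zero]
        exact hd.hasFDerivAt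
      have h3 : HasDerivAt (fun t : ℝ => e x + t • v) v 0 := by
        simpa using ((hasDerivAt_id (0 : ℝ)).smul_const v).const_add (e x)
      exact h2.comp_hasDerivAt (0 : ℝ) h3
    have h4 := (hasDerivAt_iff_isLittleO.1 h1).bound hη
    filter_upwards [nhdsWithin_le_nhds h4, self_mem_nhdsWithin] with t ht ht0
    have ht0' : 0 < t := ht0
    simpa [e.left_inv hx, hΓ, abs_of_pos ht0', sub_sub] using ht
  filter_upwards [hpair.eventually h, hxt.eventually hlip, hv (1 + η) (by linarith), hderiv,
    (tendsto_add_smul (e' y) w).eventually (e'.open_target.mem_nhds (e'.map_source hy)),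
    self_mem_nhdsWithin] with t h1 h2 h3 h4 h5 ht0
  have ht0' : 0 < t := ht0
  simp only [e'.right_inv h5, dist_eq_norm (e' _)] at h1
  calc dist y (e'.symm (e' y + t • w))
      ≤ dist y (Γ (e.symm (e x + t • v)))
        + dist (Γ (e.symm (e x + t • v))) (e'.symm (e' y + t • w)) := dist_triangle _ _ _
    _ ≤ ℓ * ((1 + η) * t) + C * (η * t) := add_le_add
        (h2.trans (mul_le_mul_of_nonneg_left h3 hℓ)) (h1.trans (mul_le_mul_of_nonneg_left h4 hC))
    _ = (ℓ * (1 + η) + C * η) * t := by ring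
    _ ≤ ℓ' * t := mul_le_mul_of_nonneg_right hηℓ ht0'.le

end UnitVectors

end

section

open scoped ENNReal NNReal

/-! ### Local inverses and their jets -/

section Maps

variable {m : ℕ} {M : Type*} [TopologicalSpace M] [ChartedSpace (Eu m) M] {r : ℕ}

namespace CrMap

theorem contDiffAt_charts (f : CrMap m M r) {e e' : OpenPartialHomeomorph M (Eu m)}
    (he : e ∈ IsManifold.maximalAtlas (𝓡 m) ∞ M) (he' : e' ∈ IsManifold.maximalAtlas (𝓡 m) ∞ M)
    {y : M} (hy : y ∈ e.source) (hfy : f y ∈ e'.source) :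
    ContDiffAt ℝ r (e' ∘ f ∘ e.symm) (e y) := by
  have h1 : ContMDiffAt (𝓡 m) (𝓡 m) r e.symm (e y) :=
    ((contMDiffOn_symm_of_mem_maximalAtlas he).contMDiffAt
      (e.open_target.mem_nhds (e.map_source hy))).of_le (by exact_mod_cast le_top)
  have h2 : ContMDiffAt (𝓡 m) (𝓡 m) r (f ∘ e.symm) (e y) := f.2.contMDiffAt.comp _ h1
  have h3 : ContMDiffAt (𝓡 m) (𝓡 m) r e' ((f ∘ e.symm) (e y)) := by
    rw [Function.comp_apply, e.left_inv hy]
    exact ((contMDiffOn_of_mem_maximalAtlas he').contMDiffAt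
      (e'.open_source.mem_nhds hfy)).of_le (by exact_mod_cast le_top)
  exact (h3.comp _ h2).contDiffAt

theorem continuous (f : CrMap m M r) : Continuous f := ContMDiff.continuous f.2

theorem basicNhd_mem_nhds (f : CrMap m M r) {e e' : OpenPartialHomeomorph M (Eu m)}
    (he : e ∈ IsManifold.maximalAtlas (𝓡 m) ∞ M) (he' : e' ∈ IsManifold.maximalAtlas (𝓡 m) ∞ M)
    {K : Set M} (hK : IsCompact K) (hKe : K ⊆ e.source) (hKf : MapsTo f K e'.source) {δ : ℝ}
    (hδ : 0 < δ) : basicNhd f e e' K δ ∈ 𝓝 f := by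
  refine (TopologicalSpace.isOpen_generateFrom_of_mem
    ⟨f, e, e', K, δ, he, he', hK, hKe, hKf, hδ, rfl⟩ : IsOpen (basicNhd f e e' K δ)).mem_nhds ?_
  exact ⟨hKf, fun s _ x _ => by simpa using hδ⟩

/-- Convergence in the `C^r` topology implies convergence of the derivatives, read in charts, at
moving points. -/
theorem jetTendsto [LocallyCompactSpace M] {ι : Type*} {l : Filter ι} {f : ι → CrMap m M r}
    {f₀ : CrMap m M r} (hf : Tendsto f l (𝓝 f₀)) {y : ι → M} {y₀ : M} (hy : Tendsto y l (𝓝 y₀))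
    {e e' : OpenPartialHomeomorph M (Eu m)}
    (he : e ∈ IsManifold.maximalAtlas (𝓡 m) ∞ M) (he' : e' ∈ IsManifold.maximalAtlas (𝓡 m) ∞ M)
    (hye : y₀ ∈ e.source) (hye' : f₀ y₀ ∈ e'.source) :
    JetTendsto l r (fun a => e' ∘ f a ∘ e.symm) (fun a => e (y a)) (e' ∘ f₀ ∘ e.symm) (e y₀) ∧
      ∀ᶠ a in l, f a (y a) ∈ e'.source := by
  obtain ⟨K, hK, hKs, hKc⟩ := local_compact_nhds (Filter.inter_mem (e.open_source.mem_nhds hye)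
    (f₀.continuous.continuousAt.preimage_mem_nhds (e'.open_source.mem_nhds hye')))
  have hKe : K ⊆ e.source := fun z hz => (hKs hz).1
  have hKf : MapsTo f₀ K e'.source := fun z hz => (hKs hz).2
  have hyK : ∀ᶠ a in l, y a ∈ K := hy.eventually hK
  have hnear : ∀ δ > 0, ∀ᶠ a in l, f a ∈ basicNhd f₀ e e' K δ := fun δ hδ =>
    hf.eventually (basicNhd_mem_nhds f₀ he he' hKc hKe hKf hδ)
  have hsrc : ∀ᶠ a in l, f a (y a) ∈ e'.source := by
    filter_upwards [hyK, hnear 1 one_pos] with a h1 h2 using h2.1 h1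
  refine ⟨⟨?_, f₀.contDiffAt_charts he he' hye hye', fun s hs => ?_⟩, hsrc⟩
  · filter_upwards [hyK, hsrc] with a h1 h2 using (f a).contDiffAt_charts he he' (hKe h1) h2
  · have h1 : Tendsto (fun a => iteratedFDeriv ℝ s (e' ∘ f₀ ∘ e.symm) (e (y a))) l
        (𝓝 (iteratedFDeriv ℝ s (e' ∘ f₀ ∘ e.symm) (e y₀))) := by
      have h2 : ContinuousAt (iteratedFDeriv ℝ s (e' ∘ f₀ ∘ e.symm)) (e y₀) :=
        ((f₀.contDiffAt_charts he he' hye hye').iteratedFDeriv_right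
          (m := 0) (i := s) (by simpa using hs)).continuousAt
      exact h2.tendsto.comp ((e.continuousAt hye).tendsto.comp hy)
    refine h1.congr_dist ?_
    rw [Metric.tendsto_nhds]
    intro δ hδ
    filter_upwards [hyK, hnear δ hδ] with a h2 h3
    rw [dist_zero_right, Real.norm_of_nonneg dist_nonneg, dist_comm, dist_eq_norm]
    exact h3.2 s hs _ h2

theorem tendsto_apply [LocallyCompactSpace M] [IsManifold (𝓡 m) ∞ M] {ι : Type*} {l : Filter ι}
    {f : ι → CrMap m M r}
    {f₀ : CrMap m M r} (hf : Tendsto f l (𝓝 f₀)) {y : ι → M} {y₀ : M} (hy : Tendsto y l (𝓝 y₀)) :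
    Tendsto (fun a => f a (y a)) l (𝓝 (f₀ y₀)) := by
  have hye := mem_chart_source (Eu m) y₀
  have hye' := mem_chart_source (Eu m) (f₀ y₀)
  obtain ⟨h1, h2⟩ := jetTendsto hf hy (IsManifold.chart_mem_maximalAtlas (I := 𝓡 m) (n := ∞) y₀)
    (IsManifold.chart_mem_maximalAtlas (I := 𝓡 m) (n := ∞) (f₀ y₀)) hye hye'
  have h3 := h1.tendsto_value
  simp only [Function.comp_apply, (chartAt (Eu m) y₀).left_inv hye] at h3
  have h4 := ((chartAt (Eu m) (f₀ y₀)).continuousAt_symm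
    ((chartAt (Eu m) (f₀ y₀)).map_source hye')).tendsto.comp h3
  rw [(chartAt (Eu m) (f₀ y₀)).left_inv hye'] at h4
  refine h4.congr' ?_
  filter_upwards [h2, hy.eventually ((chartAt (Eu m) y₀).open_source.mem_nhds hye)] with a ha hya
  simp only [Function.comp_apply, (chartAt (Eu m) y₀).left_inv hya]
  exact (chartAt (Eu m) (f₀ y₀)).left_inv ha

end CrMap

/-- `Γ` is a `C^r` local inverse of `f` that maps `f y` to `y`. -/
structure IsLocalInverse (m r : ℕ) {M : Type*} [TopologicalSpace M] [ChartedSpace (Eu m) M]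
    (f Γ : M → M) (y : M) : Prop where
  contMDiffAt : ContMDiffAt (𝓡 m) (𝓡 m) r Γ (f y)
  right_inv : f ∘ Γ =ᶠ[𝓝 (f y)] id
  left_inv : Γ ∘ f =ᶠ[𝓝 y] id

theorem IsLocalInverse.apply {f Γ : M → M} {y : M} (h : IsLocalInverse m r f Γ y) : Γ (f y) = y :=
  h.left_inv.eq_of_nhds

theorem exists_isLocalInverse {f : M → M} {y : M}
    (hf : IsLocalDiffeomorphAt (𝓡 m) (𝓡 m) r f y) : ∃ Γ, IsLocalInverse m r f Γ y := by
  obtain ⟨Φ, hy, hfΦ⟩ := hf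
  have hfy : f y ∈ Φ.target := by
    rw [hfΦ hy]
    exact Φ.map_source hy
  refine ⟨Φ.invFun, ?_, ?_, ?_⟩
  · exact (Φ.contMDiffOn_invFun _ hfy).contMDiffAt (Φ.open_target.mem_nhds hfy)
  · filter_upwards [Φ.open_target.mem_nhds hfy] with x hx
    exact (hfΦ (Φ.map_target hx)).trans (Φ.right_inv hx)
  · filter_upwards [Φ.open_source.mem_nhds hy] with z hz
    rw [Function.comp_apply, hfΦ hz]
    exact Φ.left_inv hz

namespace IsLocalInverse

variable {f Γ : M → M} {y : M} (h : IsLocalInverse m r f Γ y)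
  {e e' : OpenPartialHomeomorph M (Eu m)}

theorem contDiffAt_charts (h : IsLocalInverse m r f Γ y)
    (he : e ∈ IsManifold.maximalAtlas (𝓡 m) ∞ M) (he' : e' ∈ IsManifold.maximalAtlas (𝓡 m) ∞ M)
    (hy : y ∈ e.source) (hfy : f y ∈ e'.source) :
    ContDiffAt ℝ r (e ∘ Γ ∘ e'.symm) (e' (f y)) := by
  have h1 : ContMDiffAt (𝓡 m) (𝓡 m) r e'.symm (e' (f y)) :=
    ((contMDiffOn_symm_of_mem_maximalAtlas he').contMDiffAt
      (e'.open_target.mem_nhds (e'.map_source hfy))).of_le (by exact_mod_cast le_top)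
  have h2 : ContMDiffAt (𝓡 m) (𝓡 m) r (Γ ∘ e'.symm) (e' (f y)) := by
    refine ContMDiffAt.comp _ ?_ h1
    rw [e'.left_inv hfy]
    exact h.contMDiffAt
  have h3 : ContMDiffAt (𝓡 m) (𝓡 m) r e ((Γ ∘ e'.symm) (e' (f y))) := by
    rw [Function.comp_apply, e'.left_inv hfy, h.apply]
    exact ((contMDiffOn_of_mem_maximalAtlas he).contMDiffAt
      (e.open_source.mem_nhds hy)).of_le (by exact_mod_cast le_top)
  exact (h3.comp _ h2).contDiffAt

theorem charts_right_inv (h : IsLocalInverse m r f Γ y) (hy : y ∈ e.source)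
    (hfy : f y ∈ e'.source) :
    (e' ∘ f ∘ e.symm) ∘ (e ∘ Γ ∘ e'.symm) =ᶠ[𝓝 (e' (f y))] id := by
  have h1 : Tendsto e'.symm (𝓝 (e' (f y))) (𝓝 (f y)) := by
    have := (e'.continuousAt_symm (e'.map_source hfy)).tendsto
    rwa [e'.left_inv hfy] at this
  have h2 : Tendsto Γ (𝓝 (f y)) (𝓝 y) := by
    have := h.contMDiffAt.continuousAt.tendsto
    rwa [h.apply] at this
  filter_upwards [h1.eventually h.right_inv,
    (h2.comp h1).eventually (e.open_source.mem_nhds hy),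
    e'.open_target.mem_nhds (e'.map_source hfy)] with w h3 h4 h5
  simp only [Function.comp_apply, id] at h3 h4 ⊢
  rw [e.left_inv h4, h3, e'.right_inv h5]

theorem charts_left_inv (h : IsLocalInverse m r f Γ y) (hf : ContinuousAt f y) (hy : y ∈ e.source)
    (hfy : f y ∈ e'.source) :
    (e ∘ Γ ∘ e'.symm) ∘ (e' ∘ f ∘ e.symm) =ᶠ[𝓝 (e y)] id := by
  have h1 : Tendsto e.symm (𝓝 (e y)) (𝓝 y) := by
    have := (e.continuousAt_symm (e.map_source hy)).tendsto
    rwa [e.left_inv hy] at this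
  filter_upwards [h1.eventually h.left_inv,
    (hf.tendsto.comp h1).eventually (e'.open_source.mem_nhds hfy),
    e.open_target.mem_nhds (e.map_source hy)] with w h3 h4 h5
  simp only [Function.comp_apply, id] at h3 h4 ⊢
  rw [e'.left_inv h4, h3, e.right_inv h5]

end IsLocalInverse

/-- The jets of local inverses converge. -/
theorem jetTendsto_localInverse [LocallyCompactSpace M] (hr : 1 ≤ r) {ι : Type*}
    {l : Filter ι} {f : ι → CrMap m M r}
    {f₀ : CrMap m M r} (hf : Tendsto f l (𝓝 f₀)) {y : ι → M} {y₀ : M} (hy : Tendsto y l (𝓝 y₀))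
    {Γ : ι → M → M} {Γ₀ : M → M} (hΓ : ∀ᶠ a in l, IsLocalInverse m r (f a) (Γ a) (y a))
    (hΓ₀ : IsLocalInverse m r f₀ Γ₀ y₀) {e e' : OpenPartialHomeomorph M (Eu m)}
    (he : e ∈ IsManifold.maximalAtlas (𝓡 m) ∞ M) (he' : e' ∈ IsManifold.maximalAtlas (𝓡 m) ∞ M)
    (hye : y₀ ∈ e.source) (hye' : f₀ y₀ ∈ e'.source) :
    JetTendsto l r (fun a => e ∘ Γ a ∘ e'.symm) (fun a => e' (f a (y a)))
      (e ∘ Γ₀ ∘ e'.symm) (e' (f₀ y₀)) := by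
  obtain ⟨r, rfl⟩ : ∃ k, r = k + 1 := ⟨r - 1, by lia⟩
  obtain ⟨h1, h2⟩ := CrMap.jetTendsto hf hy he he' hye hye'
  have hya : ∀ᶠ a in l, y a ∈ e.source := hy.eventually (e.open_source.mem_nhds hye)
  have hval : ∀ᶠ a in l, (e' ∘ f a ∘ e.symm) (e (y a)) = e' (f a (y a)) := by
    filter_upwards [hya] with a ha
    simp [e.left_inv ha]
  have hval₀ : (e' ∘ f₀ ∘ e.symm) (e y₀) = e' (f₀ y₀) := by simp [e.left_inv hye]
  rw [← hval₀]
  refine JetTendsto.congr_point (JetTendsto.inverse h1 ((e.continuousAt hye).tendsto.comp hy)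
    ?_ ?_ ?_ ?_ ?_ ?_) hval
  · filter_upwards [hΓ, hya, h2, hval] with a k1 k2 k3 k4
    rw [k4]
    exact k1.contDiffAt_charts he he' k2 k3
  · rw [hval₀]
    exact hΓ₀.contDiffAt_charts he he' hye hye'
  · filter_upwards [hΓ, hya, h2, hval] with a k1 k2 k3 k4
    rw [k4]
    exact k1.charts_right_inv k2 k3
  · filter_upwards [hΓ, hya, h2] with a k1 k2 k3
    exact k1.charts_left_inv (f a).continuous.continuousAt k2 k3
  · rw [hval₀]
    exact hΓ₀.charts_right_inv hye hye'
  · exact hΓ₀.charts_left_inv f₀.continuous.continuousAt hye hye'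

end Maps

/-! ### Fibres under perturbation -/

section Fibres

open Metric in
/-- Maps that are uniformly close to an invertible linear map cover a uniform ball. -/
theorem eventually_ball_subset_image {ι E : Type*} [NormedAddCommGroup E] [NormedSpace ℝ E]
    [CompleteSpace E] {l : Filter ι} {F : ι → E → E} {z₀ y₀ : E} {A : E →L[ℝ] E} {B : E →L[ℝ] E}
    (hAB : A ∘L B = ContinuousLinearMap.id ℝ E)
    (hd : ∀ᶠ a in l ×ˢ 𝓝 z₀, DifferentiableAt ℝ (F a.1) a.2)
    (hF : Tendsto (fun a : ι × E => fderiv ℝ (F a.1) a.2) (l ×ˢ 𝓝 z₀) (𝓝 A))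
    (hv : Tendsto (fun a => F a z₀) l (𝓝 y₀)) {W : Set E} (hW : W ∈ 𝓝 z₀) :
    ∀ᶠ a in l ×ˢ 𝓝 y₀, ∃ w ∈ W, F a.1 w = a.2 := by
  set N : ℝ≥0 := ‖B‖₊ + 1
  have hN : (0 : ℝ) < N := by positivity
  -- With this choice `N⁻¹ - c = c > 0`, and the radius of the ball that is covered does not depend
  -- on the index.
  set c : ℝ≥0 := N⁻¹ / 2
  have hc : (0 : ℝ) < c := by positivity
  have h1 : ∀ᶠ a in l ×ˢ 𝓝 z₀, DifferentiableAt ℝ (F a.1) a.2 ∧ ‖fderiv ℝ (F a.1) a.2 - A‖ ≤ c ∧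
      a.2 ∈ W := by
    have h2 := (tendsto_iff_norm_sub_tendsto_zero.1 hF).eventually_le_const hc
    filter_upwards [hd, h2, tendsto_snd.eventually hW] with a h3 h4 h5 using ⟨h3, h4, h5⟩
  obtain ⟨pa, hpa, pb, hpb, hab⟩ := eventually_prod_iff.1 h1
  obtain ⟨τ, hτ, hball⟩ := nhds_basis_closedBall.mem_iff.1 hpb
  let Bi : A.NonlinearRightInverse :=
    { toFun := B
      nnnorm := N
      bound' := fun y => (B.le_opNorm y).trans (by
        have : ‖B‖ ≤ (N : ℝ) := by simp [N]
        gcongr)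
      right_inv' := fun y => DFunLike.congr_fun hAB y }
  have hrad : (0 : ℝ) < ((N : ℝ)⁻¹ - c) * τ := by
    have : ((N : ℝ)⁻¹ - c) = c := by
      simp only [c]
      push_cast
      ring
    rw [this]
    positivity
  have h6 : ∀ᶠ a in l ×ˢ 𝓝 y₀, dist a.2 (F a.1 z₀) < ((N : ℝ)⁻¹ - c) * τ := by
    have : Tendsto (fun a : ι × E => dist a.2 (F a.1 z₀)) (l ×ˢ 𝓝 y₀) (𝓝 (dist y₀ y₀)) :=
      Tendsto.dist tendsto_snd (hv.comp tendsto_fst)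
    rw [dist_self] at this
    exact this.eventually_lt_const hrad
  filter_upwards [h6, tendsto_fst.eventually hpa] with a ha hpa
  have happ : ApproximatesLinearOn (F a.1) A (closedBall z₀ τ) c := by
    intro x hx y hy
    exact (convex_closedBall z₀ τ).norm_image_sub_le_of_norm_fderiv_le' (𝕜 := ℝ)
      (fun w hw => (hab hpa (hball hw)).1) (fun w hw => (hab hpa (hball hw)).2.1) hy hx
  obtain ⟨w, hw, hwa⟩ := happ.surjOn_closedBall_of_nonlinearRightInverse Bi hτ.le subset_rfl ha.le
  exact ⟨w, (hab hpa (hball hw)).2.2, hwa⟩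

variable {m : ℕ} {M : Type*} [TopologicalSpace M] [ChartedSpace (Eu m) M] [IsManifold (𝓡 m) ∞ M]
  [LocallyCompactSpace M] {r d : ℕ}

/-- Preimages under local diffeomorphisms persist under perturbation. -/
theorem eventually_exists_preimage (hr : 1 ≤ r) {f₀ : CrMap m M r} {y₀ : M}
    (hf₀ : IsLocalDiffeomorphAt (𝓡 m) (𝓡 m) r f₀ y₀) {W : Set M} (hW : W ∈ 𝓝 y₀) :
    ∀ᶠ a in 𝓝 f₀ ×ˢ 𝓝 (f₀ y₀), ∃ z ∈ W, a.1 z = a.2 := by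
  obtain ⟨Γ, hΓ⟩ := exists_isLocalInverse hf₀
  set e := chartAt (Eu m) y₀
  set e' := chartAt (Eu m) (f₀ y₀)
  have hye : y₀ ∈ e.source := mem_chart_source (Eu m) y₀
  have hye' : f₀ y₀ ∈ e'.source := mem_chart_source (Eu m) (f₀ y₀)
  have he : e ∈ IsManifold.maximalAtlas (𝓡 m) ∞ M := IsManifold.chart_mem_maximalAtlas y₀
  have he' : e' ∈ IsManifold.maximalAtlas (𝓡 m) ∞ M := IsManifold.chart_mem_maximalAtlas _
  have hr' : ((r : ℕ) : WithTop ℕ∞) ≠ 0 := by exact_mod_cast (by lia : r ≠ 0)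
  have hsymm : Tendsto e.symm (𝓝 (e y₀)) (𝓝 y₀) := by
    have := (e.continuousAt_symm (e.map_source hye)).tendsto
    rwa [e.left_inv hye] at this
  obtain ⟨hj, hsrc⟩ := CrMap.jetTendsto (l := 𝓝 f₀ ×ˢ 𝓝 (e y₀)) (f := fun a => a.1)
    (y := fun a => e.symm a.2) tendsto_fst (hsymm.comp tendsto_snd) he he' hye hye'
  have htgt : ∀ᶠ a : CrMap m M r × Eu m in 𝓝 f₀ ×ˢ 𝓝 (e y₀), a.2 ∈ e.target :=
    tendsto_snd.eventually (e.open_target.mem_nhds (e.map_source hye))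
  have hj' := hj.congr_point (z' := fun a => a.2) (by
    filter_upwards [htgt] with a ha using e.right_inv ha)
  have hF₀ : DifferentiableAt ℝ (e' ∘ f₀ ∘ e.symm) (e y₀) := hj.contDiffAt_lim.differentiableAt hr'
  have hval₀ : (e' ∘ f₀ ∘ e.symm) (e y₀) = e' (f₀ y₀) := by simp [e.left_inv hye]
  have hG₀ : DifferentiableAt ℝ (e ∘ Γ ∘ e'.symm) (e' (f₀ y₀)) :=
    (hΓ.contDiffAt_charts he he' hye hye').differentiableAt hr'
  have hAB : fderiv ℝ (e' ∘ f₀ ∘ e.symm) (e y₀) ∘L fderiv ℝ (e ∘ Γ ∘ e'.symm) (e' (f₀ y₀))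
      = ContinuousLinearMap.id ℝ (Eu m) := by
    have hGv : (e ∘ Γ ∘ e'.symm) (e' (f₀ y₀)) = e y₀ := by simp [e'.left_inv hye', hΓ.apply]
    have h1 := (hΓ.charts_right_inv hye hye' : _ =ᶠ[𝓝 (e' (f₀ y₀))] id).fderiv_eq (𝕜 := ℝ)
    rw [fderiv_id, fderiv_comp _ (by rwa [hGv]) hG₀, hGv] at h1
    exact h1
  -- The solution found in the charts must be mapped into `e'.source`, since equal `e'`-coordinates
  -- determine the point only there. The condition is split into one on the map and one on the
  -- point, and the second is made part of the neighbourhood `W`.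
  obtain ⟨⟨pa, hpa, pb, hpb, hab⟩⟩ : Nonempty (∃ pa : CrMap m M r → Prop, (∀ᶠ x in 𝓝 f₀, pa x) ∧
      ∃ pb : Eu m → Prop, (∀ᶠ y in 𝓝 (e y₀), pb y) ∧
        ∀ {x}, pa x → ∀ {y}, pb y → x (e.symm y) ∈ e'.source) :=
    ⟨eventually_prod_iff.1 hsrc⟩
  have hmain := eventually_ball_subset_image (l := 𝓝 f₀) (F := fun f => e' ∘ f ∘ e.symm)
    (z₀ := e y₀) (y₀ := e' (f₀ y₀)) hAB
    (hj'.contDiffAt.mono fun a ha => ha.differentiableAt hr')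
    (by
      have h1 := hj'.tendsto 1 hr
      have h2 := ((continuousMultilinearCurryFin1 ℝ (Eu m) (Eu m)).continuous.tendsto _).comp h1
      refine (h2.congr fun a => ?_).trans_eq ?_
      · ext v
        simp [iteratedFDeriv_one_apply]
      · congr 1
        ext v
        simp [iteratedFDeriv_one_apply])
    (by
      have h1 := (CrMap.jetTendsto (l := 𝓝 f₀) (f := fun a => a) (y := fun _ => y₀) tendsto_id
        tendsto_const_nhds he he' hye hye').1.tendsto_value
      rwa [hval₀] at h1)
    (W := {w | e.symm w ∈ W ∧ pb w}) (Filter.Eventually.and (hsymm.eventually hW) hpb)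
  have htend : Tendsto (fun a : CrMap m M r × M => (a.1, e' a.2)) (𝓝 f₀ ×ˢ 𝓝 (f₀ y₀))
      (𝓝 f₀ ×ˢ 𝓝 (e' (f₀ y₀))) :=
    tendsto_fst.prodMk ((e'.continuousAt hye').tendsto.comp tendsto_snd)
  filter_upwards [htend.eventually hmain, tendsto_fst.eventually hpa,
    tendsto_snd.eventually (e'.open_source.mem_nhds hye')] with a h1 h2 h3
  obtain ⟨w, ⟨hw, hwb⟩, hwa⟩ := h1
  exact ⟨e.symm w, hw, e'.injOn (hab h2 hwb) h3 hwa⟩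

/-- `b` enumerates the fibre of `f` over `x`. -/
def IsEnum {M : Type*} {d : ℕ} (f : M → M) (x : M) (b : Fin d → M) : Prop :=
  Function.Injective b ∧ range b = f ⁻¹' {x}

theorem IsEnum.apply {M : Type*} {d : ℕ} {f : M → M} {x : M} {b : Fin d → M} (h : IsEnum f x b)
    (k : Fin d) : f (b k) = x := (h.2 ▸ mem_range_self k : b k ∈ f ⁻¹' {x})

theorem IsEnum.exists_eq {M : Type*} {d : ℕ} {f : M → M} {x y : M} {b : Fin d → M}
    (h : IsEnum f x b) (hy : f y = x) : ∃ k, b k = y :=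
  (h.2.symm ▸ hy : y ∈ range b)

theorem IsEnum.comp_equiv {M : Type*} {d : ℕ} {f : M → M} {x : M} {b : Fin d → M}
    (h : IsEnum f x b) (σ : Equiv.Perm (Fin d)) : IsEnum f x (b ∘ σ) :=
  ⟨h.1.comp σ.injective, by rw [σ.surjective.range_comp, h.2]⟩

theorem IsEnum.exists_perm {M : Type*} {d : ℕ} {f : M → M} {x : M} {b b' : Fin d → M}
    (h : IsEnum f x b) (h' : IsEnum f x b') : ∃ σ : Equiv.Perm (Fin d), b' ∘ σ = b := by
  have h1 : ∀ k, ∃ j, b' j = b k := fun k => h'.exists_eq (h.apply k)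
  choose σ hσ using h1
  have hinj : Function.Injective σ := fun i j hij => h.1 (by rw [← hσ, ← hσ, hij])
  exact ⟨Equiv.ofBijective σ (Finite.injective_iff_bijective.1 hinj), funext hσ⟩

theorem exists_isEnum {M : Type*} {f : M → M} {x : M} (hd : 0 < d)
    (h : (f ⁻¹' {x}).ncard = d) : ∃ b : Fin d → M, IsEnum f x b := by
  have hfin : (f ⁻¹' {x}).Finite := Set.finite_of_ncard_pos (h ▸ hd)
  have : Fintype (f ⁻¹' {x}) := hfin.fintype
  have hc : Fintype.card (f ⁻¹' {x}) = d := by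
    rw [← h, Set.ncard_eq_toFinset_card', Set.toFinset_card]
  let E := (Fintype.equivFinOfCardEq hc).symm
  exact ⟨fun k => E k, Subtype.val_injective.comp E.injective, by
    rw [show (fun k => (E k : M)) = Subtype.val ∘ E from rfl, E.surjective.range_comp,
      Subtype.range_coe]⟩

/-- Counting: `d` distinct points of a fibre with `d` elements exhaust it. -/
theorem IsEnum.of_injective {M : Type*} {f : M → M} {x : M} (hd : 0 < d)
    (h : (f ⁻¹' {x}).ncard = d) {b : Fin d → M} (hb : Function.Injective b)
    (hf : ∀ k, f (b k) = x) : IsEnum f x b := by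
  refine ⟨hb, Set.eq_of_subset_of_ncard_le (range_subset_iff.2 hf) ?_
    (Set.finite_of_ncard_pos (h ▸ hd))⟩
  rw [h, ← Set.image_univ, Set.ncard_image_of_injective _ hb]
  simp

/-- The fibres of local diffeomorphisms of constant degree move continuously. -/
theorem exists_enum_tendsto [T2Space M] (hr : 1 ≤ r) (hd : 0 < d) {ι : Type*} {l : Filter ι}
    {f : ι → CrMap m M r} {f₀ : CrMap m M r} (hf : Tendsto f l (𝓝 f₀))
    (hf₀ : IsLocalDiffeomorph (𝓡 m) (𝓡 m) r f₀)
    (hdeg : ∀ a x, (f a ⁻¹' {x}).ncard = d) {x : ι → M} {x₀ : M} (hx : Tendsto x l (𝓝 x₀))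
    {b₀ : Fin d → M} (hb₀ : IsEnum f₀ x₀ b₀) :
    ∃ b : ι → Fin d → M, (∀ᶠ a in l, IsEnum (f a) (x a) (b a)) ∧
      ∀ k, Tendsto (fun a => b a k) l (𝓝 (b₀ k)) := by
  obtain ⟨U, hU, hdisj⟩ := (finite_range b₀).t2_separation
  have hpre : ∀ k, ∀ W ∈ 𝓝 (b₀ k), ∀ᶠ a in l, ∃ z ∈ W, f a z = x a := by
    intro k W hW
    have h1 := eventually_exists_preimage hr (hf₀ (b₀ k)) hW
    rw [hb₀.apply k] at h1
    exact (hf.prodMk hx).eventually h1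
  classical
  let b : ι → Fin d → M := fun a k =>
    if h : ∃ z ∈ U (b₀ k), f a z = x a then h.choose else b₀ k
  have hUn : ∀ k, U (b₀ k) ∈ 𝓝 (b₀ k) := fun k => (hU _).2.mem_nhds (hU _).1
  have hb : ∀ᶠ a in l, ∀ k, b a k ∈ U (b₀ k) ∧ f a (b a k) = x a := by
    filter_upwards [eventually_all.2 fun k => hpre k _ (hUn k)] with a ha k
    simp only [b, dif_pos (ha k)]
    exact (ha k).choose_spec
  have huniq : ∀ {j k : Fin d} {z : M}, z ∈ U (b₀ j) → z ∈ U (b₀ k) → j = k := by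
    intro j k z h1 h2
    by_contra hjk
    exact Set.disjoint_left.1 (hdisj (mem_range_self j) (mem_range_self k)
      (fun h => hjk (hb₀.1 h))) h1 h2
  have henum : ∀ᶠ a in l, IsEnum (f a) (x a) (b a) := by
    filter_upwards [hb] with a ha
    refine IsEnum.of_injective hd (hdeg a (x a)) (fun j k hjk => ?_) fun k => (ha k).2
    exact huniq (ha j).1 (hjk ▸ (ha k).1)
  refine ⟨b, henum, fun k W hW => ?_⟩
  change ∀ᶠ a in l, b a k ∈ W
  filter_upwards [hb, henum, hpre k _ (Filter.inter_mem hW (hUn k))] with a h1 h2 ⟨z, hz, hza⟩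
  obtain ⟨j, hj⟩ := h2.exists_eq hza
  have : j = k := huniq (h1 j).1 (hj ▸ hz.2)
  subst this
  exact hj ▸ hz.1

/-- Near `x`, the local inverse branches enumerate the fibres. -/
theorem eventually_isEnum_localInverse [T2Space M] (hr : 1 ≤ r) (hd : 0 < d) (f : CrMap m M r)
    (hf : IsLocalDiffeomorph (𝓡 m) (𝓡 m) r f) (hdeg : ∀ x, (f ⁻¹' {x}).ncard = d) {x : M}
    {b : Fin d → M} (hb : IsEnum f x b) {Γ : Fin d → M → M}
    (hΓ : ∀ k, IsLocalInverse m r f (Γ k) (b k)) :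
    ∀ᶠ z in 𝓝 x, IsEnum f z fun k => Γ k z := by
  obtain ⟨b', h1, h2⟩ := exists_enum_tendsto (l := 𝓝 x) (f := fun _ => f) hr hd
    tendsto_const_nhds hf (fun _ => hdeg) tendsto_id hb
  filter_upwards [h1, eventually_all.2 fun k => (h2 k).eventually (hΓ k).left_inv] with z h3 h4
  have : (fun k => Γ k z) = b' z := by
    funext k
    have := h4 k
    rwa [Function.comp_apply, h3.apply k] at this
  rwa [this]

theorem transfer_eq_sum {M : Type*} {𝕜 : Type} [RCLike 𝕜] {f : M → M} {φ : M → ℝ} {g : M → 𝕜}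
    {x : M} {b : Fin d → M} (hb : IsEnum f x b) :
    transfer f φ g x = ∑ k, ((Real.exp (φ (b k)) : ℝ) : 𝕜) * g (b k) := by
  rw [transfer, ← hb.2, finsum_mem_range hb.1, finsum_eq_sum_of_fintype]

end Fibres

end

section

namespace JetTendsto

variable {ι : Type*} {E F G : Type*} [NormedAddCommGroup E] [NormedSpace ℝ E]
  [NormedAddCommGroup F] [NormedSpace ℝ F] [NormedAddCommGroup G] [NormedSpace ℝ G]
  {l : Filter ι} {r : ℕ} {f : ι → E → F} {z : ι → E} {f₀ : E → F} {z₀ : E}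

/-- Composition with a fixed smooth map. -/
theorem contDiff_comp {H : F → G} (hH : ContDiff ℝ r H) (hf : JetTendsto l r f z f₀ z₀) :
    JetTendsto l r (fun a => H ∘ f a) z (H ∘ f₀) z₀ :=
  (JetTendsto.const hH.contDiffAt hf.tendsto_value).comp hf

theorem add {g : ι → E → F} {g₀ : E → F} (hf : JetTendsto l r f z f₀ z₀)
    (hg : JetTendsto l r g z g₀ z₀) : JetTendsto l r (fun a => f a + g a) z (f₀ + g₀) z₀ :=
  contDiff_comp (H := fun p : F × F => p.1 + p.2) (contDiff_fst.add contDiff_snd) (hf.prodMk hg)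

theorem sum {J : Type*} (s : Finset J) {g : J → ι → E → F} {g₀ : J → E → F}
    (hz : Tendsto z l (𝓝 z₀)) (h : ∀ j ∈ s, JetTendsto l r (g j) z (g₀ j) z₀) :
    JetTendsto l r (fun a => ∑ j ∈ s, g j a) z (∑ j ∈ s, g₀ j) z₀ := by
  classical
  induction s using Finset.induction_on with
  | empty =>
    simp only [Finset.sum_empty]
    exact JetTendsto.const (f₀ := 0) contDiffAt_const hz
  | insert j s hj ih =>
    simp only [Finset.sum_insert hj]
    exact (h j (Finset.mem_insert_self _ _)).add (ih fun k hk => h k (Finset.mem_insert_of_mem hk))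

end JetTendsto

/-! ### Transfer operators on `C^r(M)` and their continuity -/

section Transfer

variable {m : ℕ} {M : Type*} [MetricSpace M] [CompactSpace M] [ChartedSpace (Eu m) M]
  [IsManifold (𝓡 m) ∞ M] {𝔠 : ChartCover m M} {r d : ℕ} {𝕜 : Type} [RCLike 𝕜]

/-- A summand of the transfer operator, read in charts: `Γ` is an inverse branch. -/
noncomputable def branchTerm (e e' : OpenPartialHomeomorph M (Eu m)) (Γ : M → M) (φ : M → ℝ) (g : M → 𝕜) :
    Eu m → 𝕜 :=
  fun z => Real.exp ((φ ∘ e'.symm) ((e' ∘ Γ ∘ e.symm) z)) • (g ∘ e'.symm) ((e' ∘ Γ ∘ e.symm) z)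

theorem transfer_eventuallyEq (hr : 1 ≤ r) (hd : 0 < d) (f : CrMap m M r)
    (hf : IsLocalDiffeomorph (𝓡 m) (𝓡 m) r f) (hdeg : ∀ x, (f ⁻¹' {x}).ncard = d) {x : M}
    {b : Fin d → M} (hb : IsEnum f x b) {Γ : Fin d → M → M}
    (hΓ : ∀ k, IsLocalInverse m r f (Γ k) (b k)) {e : OpenPartialHomeomorph M (Eu m)}
    (hx : x ∈ e.source) {e' : Fin d → OpenPartialHomeomorph M (Eu m)}
    (he' : ∀ k, b k ∈ (e' k).source) (φ : M → ℝ) (g : M → 𝕜) :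
    transfer f φ g ∘ e.symm =ᶠ[𝓝 (e x)] ∑ k, branchTerm e (e' k) (Γ k) φ g := by
  have hsymm : Tendsto e.symm (𝓝 (e x)) (𝓝 x) := by
    have := (e.continuousAt_symm (e.map_source hx)).tendsto
    rwa [e.left_inv hx] at this
  have hΓt : ∀ k, ∀ᶠ w in 𝓝 (e x), Γ k (e.symm w) ∈ (e' k).source := by
    intro k
    have h1 : Tendsto (Γ k) (𝓝 x) (𝓝 (b k)) := by
      have h2 := (hΓ k).contMDiffAt.continuousAt.tendsto
      rwa [(hΓ k).apply, hb.apply k] at h2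
    exact (h1.comp hsymm).eventually ((e' k).open_source.mem_nhds (he' k))
  filter_upwards [hsymm.eventually (eventually_isEnum_localInverse hr hd f hf hdeg hb hΓ),
    eventually_all.2 hΓt] with w h1 h2
  rw [Function.comp_apply, transfer_eq_sum h1, Finset.sum_apply]
  refine Finset.sum_congr rfl fun k _ => ?_
  simp only [branchTerm, Function.comp_apply, (e' k).left_inv (h2 k)]
  rw [RCLike.real_smul_eq_coe_mul]

theorem branchTerm_jetTendsto (hr : 1 ≤ r) {ι : Type*} {l : Filter ι}
    {f : ι → CrMap m M r} {f₀ : CrMap m M r} (hf : Tendsto f l (𝓝 f₀))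
    {φ : ι → CrFun 𝔠 r ℝ} {φ₀ : CrFun 𝔠 r ℝ} (hφ : Tendsto φ l (𝓝 φ₀))
    {g : ι → CrFun 𝔠 r 𝕜} {g₀ : CrFun 𝔠 r 𝕜} (hg : Tendsto g l (𝓝 g₀))
    {y : ι → M} {y₀ : M} (hy : Tendsto y l (𝓝 y₀))
    {Γ : ι → M → M} {Γ₀ : M → M} (hΓ : ∀ᶠ a in l, IsLocalInverse m r (f a) (Γ a) (y a))
    (hΓ₀ : IsLocalInverse m r f₀ Γ₀ y₀) {e e' : OpenPartialHomeomorph M (Eu m)}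
    (he : e ∈ IsManifold.maximalAtlas (𝓡 m) ∞ M) (he' : e' ∈ IsManifold.maximalAtlas (𝓡 m) ∞ M)
    (hx : f₀ y₀ ∈ e.source) (hy' : y₀ ∈ e'.source) :
    JetTendsto l r (fun a => branchTerm e e' (Γ a) (φ a) (g a)) (fun a => e (f a (y a)))
      (branchTerm e e' Γ₀ φ₀ g₀) (e (f₀ y₀)) := by
  have h1 := jetTendsto_localInverse hr hf hy hΓ hΓ₀ he' he hy' hx
  have hxa : ∀ᶠ a in l, f a (y a) ∈ e.source :=
    (CrMap.tendsto_apply hf hy).eventually (e.open_source.mem_nhds hx)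
  have hpt : ∀ᶠ a in l, e' (y a) = (e' ∘ Γ a ∘ e.symm) (e (f a (y a))) := by
    filter_upwards [hΓ, hxa] with a ha hxa
    simp [e.left_inv hxa, ha.apply]
  have hpt₀ : (e' ∘ Γ₀ ∘ e.symm) (e (f₀ y₀)) = e' y₀ := by
    simp [e.left_inv hx, hΓ₀.apply]
  have h2 := (CrFun.jetTendsto hφ hy he' hy').congr_point hpt
  have h3 := (CrFun.jetTendsto hg hy he' hy').congr_point hpt
  rw [← hpt₀] at h2 h3
  have h4 : ContDiff ℝ r fun p : ℝ × 𝕜 => Real.exp p.1 • p.2 :=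
    (Real.contDiff_exp.comp contDiff_fst).smul contDiff_snd
  exact JetTendsto.contDiff_comp h4 ((h2.comp h1).prodMk (h3.comp h1))

/-- Near a point the operator is a finite sum of compositions with inverse branches. The points of
the fibre converge, and so do the jets of the branches, of the potential and of `g` at these moving
points. -/
theorem transfer_jetTendsto (hr : 1 ≤ r) (hd : 0 < d) {ι : Type*} {l : Filter ι}
    {f : ι → CrMap m M r} {f₀ : CrMap m M r} (hf : Tendsto f l (𝓝 f₀))
    (hloc : ∀ a, IsLocalDiffeomorph (𝓡 m) (𝓡 m) r (f a))
    (hloc₀ : IsLocalDiffeomorph (𝓡 m) (𝓡 m) r f₀)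
    (hdeg : ∀ a x, (f a ⁻¹' {x}).ncard = d) (hdeg₀ : ∀ x, (f₀ ⁻¹' {x}).ncard = d)
    {φ : ι → CrFun 𝔠 r ℝ} {φ₀ : CrFun 𝔠 r ℝ} (hφ : Tendsto φ l (𝓝 φ₀))
    {g : ι → CrFun 𝔠 r 𝕜} {g₀ : CrFun 𝔠 r 𝕜} (hg : Tendsto g l (𝓝 g₀))
    {x : ι → M} {x₀ : M} (hx : Tendsto x l (𝓝 x₀)) {e : OpenPartialHomeomorph M (Eu m)}
    (he : e ∈ IsManifold.maximalAtlas (𝓡 m) ∞ M) (hxe : x₀ ∈ e.source) :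
    JetTendsto l r (fun a => transfer (f a) (φ a) (g a) ∘ e.symm) (fun a => e (x a))
      (transfer f₀ φ₀ g₀ ∘ e.symm) (e x₀) := by
  obtain ⟨b₀, hb₀⟩ := exists_isEnum hd (hdeg₀ x₀)
  obtain ⟨b, hb, hbt⟩ := exists_enum_tendsto hr hd hf hloc₀ hdeg hx hb₀
  choose Γ hΓ using fun a k => exists_isLocalInverse (hloc a (b a k))
  choose Γ₀ hΓ₀ using fun k => exists_isLocalInverse (hloc₀ (b₀ k))
  let e' : Fin d → OpenPartialHomeomorph M (Eu m) := fun k => chartAt (Eu m) (b₀ k)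
  have he' : ∀ k, e' k ∈ IsManifold.maximalAtlas (𝓡 m) ∞ M := fun k =>
    IsManifold.chart_mem_maximalAtlas _
  have hbe : ∀ k, b₀ k ∈ (e' k).source := fun k => mem_chart_source _ _
  have h1 : ∀ k, JetTendsto l r (fun a => branchTerm e (e' k) (Γ a k) (φ a) (g a))
      (fun a => e (x a)) (branchTerm e (e' k) (Γ₀ k) φ₀ g₀) (e x₀) := by
    intro k
    have h2 := branchTerm_jetTendsto hr hf hφ hg (hbt k)
      (Eventually.of_forall fun a => hΓ a k) (hΓ₀ k) he (he' k)
      (by rwa [hb₀.apply k]) (hbe k)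
    rw [hb₀.apply k] at h2
    refine h2.congr_point ?_
    filter_upwards [hb] with a ha
    rw [ha.apply k]
  have hxa : ∀ᶠ a in l, x a ∈ e.source := hx.eventually (e.open_source.mem_nhds hxe)
  refine (JetTendsto.sum Finset.univ ((e.continuousAt hxe).tendsto.comp hx)
    fun k _ => h1 k).congr ?_ ?_
  · filter_upwards [hb, hxa, eventually_all.2 fun k => (hbt k).eventually
      ((e' k).open_source.mem_nhds (hbe k))] with a h2 h3 h4
    exact (transfer_eventuallyEq hr hd (f a) (hloc a) (hdeg a) h2 (hΓ a) h3 h4 _ _).symm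
  · exact (transfer_eventuallyEq hr hd f₀ hloc₀ hdeg₀ hb₀ hΓ₀ hxe hbe _ _).symm

/-- Joint convergence of the jets in the parameter and the base point is, by compactness of the sets
`K i`, uniform convergence on them, which is convergence in norm. -/
theorem CrFun.tendsto_of_jetTendsto {X : Type*} [TopologicalSpace X] {a₀ : X}
    {g : X → CrFun 𝔠 r 𝕜}
    (h : ∀ i, ∀ x ∈ 𝔠.K i, JetTendsto (𝓝 (a₀, x)) r
      (fun a : X × M => g a.1 ∘ (𝔠.chart i).symm) (fun a => 𝔠.chart i a.2)
      (g a₀ ∘ (𝔠.chart i).symm) (𝔠.chart i x)) : ContinuousAt g a₀ := by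
  rw [ContinuousAt, Metric.tendsto_nhds]
  intro ε hε
  have key : ∀ i, ∀ s : Fin (r + 1), ∀ᶠ a in 𝓝 a₀, ∀ x ∈ 𝔠.K i,
      ‖(g a).derivAt i s x - (g a₀).derivAt i s x‖ < ε / 2 := by
    intro i s
    have hs : (s : ℕ) ≤ r := Nat.lt_succ_iff.1 s.2
    refine (𝔠.isCompact_K i).eventually_forall_of_forall_eventually fun x hx => ?_
    have h1 := (h i x hx).tendsto s hs
    have h2 : Tendsto (fun a : X × M => (g a₀).derivAt i s a.2) (𝓝 (a₀, x))
        (𝓝 ((g a₀).derivAt i s x)) := by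
      have h3 : ContinuousAt (iteratedFDeriv ℝ s (g a₀ ∘ (𝔠.chart i).symm)) (𝔠.chart i x) :=
        (((g a₀).contDiffAt_chart i (𝔠.K_subset i hx)).iteratedFDeriv_right
          (m := 0) (i := s) (by simpa using hs)).continuousAt
      exact h3.tendsto.comp (((𝔠.chart i).continuousAt (𝔠.K_subset i hx)).tendsto.comp
        continuousAt_snd)
    have h4 := (h1.sub h2).norm
    rw [show iteratedFDeriv ℝ s (g a₀ ∘ (𝔠.chart i).symm) (𝔠.chart i x)
      = (g a₀).derivAt i s x from rfl, sub_self, norm_zero] at h4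
    exact h4.eventually_lt_const (half_pos hε)
  filter_upwards [eventually_all.2 fun i => eventually_all.2 (key i)] with a ha
  rw [dist_eq_norm]
  refine lt_of_le_of_lt (norm_le_of_derivAt _ (half_pos hε).le fun i s hs x hx => ?_)
    (half_lt_self hε)
  rw [← derivCLM_apply i hs hx, map_sub]
  exact (ha i ⟨s, Nat.lt_succ_of_le hs⟩ x hx).le

/-- The maps of `ℱ` are local diffeomorphisms of degree `d`. -/
structure IsCoveringFamily (d : ℕ) (ℱ : Set (CrMap m M r)) : Prop where
  pos : 0 < d
  localDiffeo : ∀ f ∈ ℱ, IsLocalDiffeomorph (𝓡 m) (𝓡 m) r f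
  degree : ∀ f ∈ ℱ, ∀ x, (f ⁻¹' {x}).ncard = d

variable {ℱ : Set (CrMap m M r)} {𝒲 : Set (CrFun 𝔠 r ℝ)}

namespace Param

/-- The map of a pair, as an element of `C^r(M, M)`. -/
def crMap (p : Param ℱ 𝒲) : CrMap m M r := p.1.1

/-- The potential of a pair, as an element of `C^r(M)`. -/
def crPot (p : Param ℱ 𝒲) : CrFun 𝔠 r ℝ := p.2.1

theorem continuous_crMap : Continuous (crMap : Param ℱ 𝒲 → CrMap m M r) :=
  continuous_subtype_val.comp continuous_fst

theorem continuous_crPot : Continuous (crPot : Param ℱ 𝒲 → CrFun 𝔠 r ℝ) :=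
  continuous_subtype_val.comp continuous_snd

end Param

namespace IsCoveringFamily

variable (h : IsCoveringFamily d ℱ)

theorem exists_isEnum (h : IsCoveringFamily d ℱ) (p : Param ℱ 𝒲) (x : M) :
    ∃ b : Fin d → M, IsEnum p.map x b :=
  RandomSpectral.exists_isEnum h.pos (h.degree _ p.1.2 x)

theorem jetTendsto (h : IsCoveringFamily d ℱ) (hr : 1 ≤ r) {ι : Type*} {l : Filter ι}
    {p : ι → Param ℱ 𝒲} {p₀ : Param ℱ 𝒲} (hp : Tendsto p l (𝓝 p₀))
    {g : ι → CrFun 𝔠 r 𝕜} {g₀ : CrFun 𝔠 r 𝕜} (hg : Tendsto g l (𝓝 g₀))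
    {x : ι → M} {x₀ : M} (hx : Tendsto x l (𝓝 x₀)) {e : OpenPartialHomeomorph M (Eu m)}
    (he : e ∈ IsManifold.maximalAtlas (𝓡 m) ∞ M) (hxe : x₀ ∈ e.source) :
    JetTendsto l r (fun a => transfer (p a).map (p a).pot (g a) ∘ e.symm) (fun a => e (x a))
      (transfer p₀.map p₀.pot g₀ ∘ e.symm) (e x₀) :=
  transfer_jetTendsto hr h.pos (Param.continuous_crMap.continuousAt.tendsto.comp hp)
    (fun a => h.localDiffeo _ (p a).1.2) (h.localDiffeo _ p₀.1.2)
    (fun a => h.degree _ (p a).1.2) (h.degree _ p₀.1.2)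
    (Param.continuous_crPot.continuousAt.tendsto.comp hp) hg hx he hxe

theorem contMDiff_transfer (h : IsCoveringFamily d ℱ) (hr : 1 ≤ r) (p : Param ℱ 𝒲)
    (g : CrFun 𝔠 r 𝕜) : ContMDiff (𝓡 m) 𝓘(ℝ, 𝕜) r (transfer p.map p.pot g) :=
  CrFun.contMDiff_of_contDiffAt_chart 𝔠 fun i x hx =>
    -- Along the trivial filter every convergence is vacuous; only the smoothness of the limit
    -- function, which is part of `JetTendsto`, is used.
    (h.jetTendsto hr (l := (⊥ : Filter Unit)) (p := fun _ => p) (p₀ := p) tendsto_bot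
      (g := fun _ => g) (g₀ := g) tendsto_bot (x := fun _ => x) tendsto_bot (𝔠.chart_mem i)
      (𝔠.K_subset i hx)).contDiffAt_lim

/-- The transfer operator as a linear map of `C^r(M)`. -/
noncomputable def transferCr (h : IsCoveringFamily d ℱ) (hr : 1 ≤ r) (p : Param ℱ 𝒲) :
    CrFun 𝔠 r 𝕜 →ₗ[𝕜] CrFun 𝔠 r 𝕜 where
  toFun g := ⟨transfer p.map p.pot g, h.contMDiff_transfer hr p g⟩
  map_add' g g' := by
    refine Subtype.ext (funext fun x => ?_)
    obtain ⟨b, hb⟩ := h.exists_isEnum p x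
    change transfer p.map p.pot ((g + g' : CrFun 𝔠 r 𝕜) : M → 𝕜) x
      = transfer p.map p.pot g x + transfer p.map p.pot g' x
    simp only [transfer_eq_sum hb, CrFun.coe_add, Pi.add_apply, mul_add, Finset.sum_add_distrib]
  map_smul' c g := by
    refine Subtype.ext (funext fun x => ?_)
    obtain ⟨b, hb⟩ := h.exists_isEnum p x
    change transfer p.map p.pot ((c • g : CrFun 𝔠 r 𝕜) : M → 𝕜) x
      = c • transfer p.map p.pot g x
    simp only [transfer_eq_sum hb, CrFun.coe_smul, Pi.smul_apply, smul_eq_mul, Finset.mul_sum]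
    exact Finset.sum_congr rfl fun k _ => by ring

/-- This is joint continuity in the pair and the function. The operators themselves are not claimed
to depend continuously on the pair in the operator norm. -/
theorem continuous_transferCr (h : IsCoveringFamily d ℱ) (hr : 1 ≤ r) :
    Continuous fun a : Param ℱ 𝒲 × CrFun 𝔠 r 𝕜 => h.transferCr hr a.1 a.2 := by
  refine continuous_iff_continuousAt.2 fun a₀ => CrFun.tendsto_of_jetTendsto fun i x hx => ?_
  exact h.jetTendsto hr ((continuous_fst.comp continuous_fst).tendsto (a₀, x))
    ((continuous_snd.comp continuous_fst).tendsto (a₀, x)) (continuous_snd.tendsto (a₀, x))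
    (𝔠.chart_mem i) (𝔠.K_subset i hx)

/-- Transfer operators are locally uniformly bounded on `C^r(M)`. -/
theorem eventually_norm_transferCr_le (h : IsCoveringFamily d ℱ) (hr : 1 ≤ r) (p₀ : Param ℱ 𝒲) :
    ∃ C, ∀ᶠ p in 𝓝 p₀, ∀ g : CrFun 𝔠 r 𝕜, ‖h.transferCr hr p g‖ ≤ C * ‖g‖ := by
  -- Joint continuity at `(p₀, 0)` provides one ball around zero that works for all `p` near `p₀`;
  -- by scaling this is a uniform operator bound.
  have h1 : ∀ᶠ a in 𝓝 (p₀, (0 : CrFun 𝔠 r 𝕜)), ‖h.transferCr hr a.1 a.2‖ < 1 := by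
    have h2 := (h.continuous_transferCr (𝒲 := 𝒲) (𝕜 := 𝕜) hr).norm.tendsto (p₀, 0)
    rw [map_zero, norm_zero] at h2
    exact h2.eventually_lt_const one_pos
  rw [nhds_prod_eq] at h1
  obtain ⟨pa, hpa, pb, hpb, hab⟩ := eventually_prod_iff.1 h1
  obtain ⟨δ, hδ, hball⟩ := Metric.eventually_nhds_iff_ball.1 hpb
  refine ⟨2 / δ, ?_⟩
  filter_upwards [hpa] with p hp g
  rcases eq_or_ne g 0 with rfl | hg
  · simp
  have hg' : 0 < ‖g‖ := norm_pos_iff.2 hg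
  set c : ℝ := δ / (2 * ‖g‖)
  have hc : 0 < c := by positivity
  have h3 : ‖((c : 𝕜) • g)‖ = δ / 2 := by
    rw [norm_smul, RCLike.norm_ofReal, abs_of_pos hc]
    simp only [c]
    field_simp
  have h4 := hab hp (hball ((c : 𝕜) • g) (by
    rw [mem_ball_zero_iff, h3]
    exact half_lt_self hδ))
  simp only [map_smul, norm_smul, RCLike.norm_ofReal, abs_of_pos hc] at h4
  have h5 : ‖h.transferCr hr p g‖ < 1 / c := by rwa [lt_div_iff₀' hc]
  refine h5.le.trans_eq ?_
  simp only [c]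
  field_simp

/-- The transfer operator as a bounded operator of `C^r(M)`. -/
noncomputable def transferCLM (h : IsCoveringFamily d ℱ) (hr : 1 ≤ r) (p : Param ℱ 𝒲) :
    CrFun 𝔠 r 𝕜 →L[𝕜] CrFun 𝔠 r 𝕜 :=
  ⟨h.transferCr hr p, (h.continuous_transferCr hr).comp (continuous_const.prodMk continuous_id)⟩

theorem continuous_transferCLM (h : IsCoveringFamily d ℱ) (hr : 1 ≤ r) (g : CrFun 𝔠 r 𝕜) :
    Continuous fun p : Param ℱ 𝒲 => h.transferCLM hr p g :=
  (h.continuous_transferCr hr).comp (continuous_id.prodMk continuous_const)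

/-- The transfer operator of a continuous function is jointly continuous. -/
theorem continuous_transfer (h : IsCoveringFamily d ℱ) (hr : 1 ≤ r) {g : M → 𝕜}
    (hg : Continuous g) :
    Continuous fun a : Param ℱ 𝒲 × M => transfer a.1.map a.1.pot g a.2 := by
  refine continuous_iff_continuousAt.2 fun ⟨p₀, x₀⟩ => ?_
  obtain ⟨b₀, hb₀⟩ := h.exists_isEnum p₀ x₀
  obtain ⟨b, hb, hbt⟩ := exists_enum_tendsto (l := 𝓝 (p₀, x₀)) hr h.pos
    (f := fun a : Param ℱ 𝒲 × M => a.1.crMap) (f₀ := p₀.crMap)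
    ((Param.continuous_crMap.comp continuous_fst).tendsto _) (h.localDiffeo _ p₀.1.2)
    (fun a => h.degree _ a.1.1.2) (x := fun a => a.2) (continuous_snd.tendsto _) hb₀
  have h1 : ∀ k, Tendsto (fun a : Param ℱ 𝒲 × M => a.1.pot (b a k)) (𝓝 (p₀, x₀))
      (𝓝 (p₀.pot (b₀ k))) := by
    intro k
    have hp : Tendsto (fun a : Param ℱ 𝒲 × M => a.1.crPot) (𝓝 (p₀, x₀)) (𝓝 p₀.crPot) :=
      (Param.continuous_crPot.comp continuous_fst).tendsto _
    have hs := mem_chart_source (Eu m) (b₀ k)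
    have h2 := (CrFun.jetTendsto hp (hbt k)
      (IsManifold.chart_mem_maximalAtlas (I := 𝓡 m) (n := ∞) (b₀ k)) hs).tendsto_value
    simp only [Function.comp_apply, (chartAt (Eu m) (b₀ k)).left_inv hs] at h2
    refine h2.congr' ?_
    filter_upwards [(hbt k).eventually ((chartAt (Eu m) (b₀ k)).open_source.mem_nhds hs)]
      with a ha
    rw [(chartAt (Eu m) (b₀ k)).left_inv ha]
    rfl
  have h2 : Tendsto (fun a : Param ℱ 𝒲 × M =>
      ∑ k, ((Real.exp (a.1.pot (b a k)) : ℝ) : 𝕜) * g (b a k)) (𝓝 (p₀, x₀))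
      (𝓝 (∑ k, ((Real.exp (p₀.pot (b₀ k)) : ℝ) : 𝕜) * g (b₀ k))) :=
    tendsto_finsetSum _ fun k _ => ((RCLike.continuous_ofReal.tendsto _).comp
      ((Real.continuous_exp.tendsto _).comp (h1 k))).mul ((hg.tendsto _).comp (hbt k))
  rw [ContinuousAt, transfer_eq_sum hb₀]
  refine h2.congr' ?_
  filter_upwards [hb] with a ha using (transfer_eq_sum ha).symm

end IsCoveringFamily

end Transfer

end

section

/-! ### Expansion on average and matching of fibres -/

section Expansion

/-- Take `ℓ = L` on `A` and `ℓ = σ⁻¹` elsewhere. At most `q` points of a fibre lie in `A`: each lies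
in a member of `𝒱`, and by injectivity no member contains two points of a fibre. Finally `L ^ s ≤ L
^ r` and `σ⁻¹ ^ s ≤ σ⁻¹` for `1 ≤ s ≤ r`. -/
theorem IsAdmissibleMap.exists_expansion {M : Type*} [MetricSpace M] {d q r : ℕ} {σ L : ℝ}
    {f : M → M} (h : IsAdmissibleMap d q σ L f) (hσ : 1 < σ) (hL : 1 ≤ L) :
    ∃ ℓ : M → ℝ, (∀ y, 0 < ℓ y) ∧
      (∀ y, ∃ U ∈ 𝓝 y, ∀ z ∈ U, ∀ w ∈ U, dist z w ≤ ℓ y * dist (f z) (f w)) ∧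
      ∀ (x : M) (b : Fin d → M), IsEnum f x b → ∀ s, 1 ≤ s → s ≤ r →
        ∑ k, ℓ (b k) ^ s ≤ q * L ^ r + (d - q) * σ⁻¹ := by
  classical
  obtain ⟨Lf, A, 𝒰, 𝒱, -, hexp, -, hA, hA', h𝒰, -, h𝒱, hq, hcov⟩ := h.h1h2
  have hσ0 : 0 < σ := one_pos.trans hσ
  have hσ1 : σ⁻¹ ≤ 1 := inv_le_one_of_one_le₀ hσ.le
  refine ⟨fun y => if y ∈ A then L else σ⁻¹, fun y => ?_, fun y => ?_, fun x b hb s hs hsr => ?_⟩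
  · dsimp only
    split_ifs
    · linarith
    · positivity
  · obtain ⟨U, hU, hy, -, h1⟩ := hexp y
    refine ⟨U, hU.mem_nhds hy, fun z hz w hw => (h1 z hz w hw).trans ?_⟩
    refine mul_le_mul_of_nonneg_right ?_ dist_nonneg
    dsimp only
    split_ifs with hyA
    · exact hA y hyA
    · exact (hA' y hyA).le
  · have hcard : (Finset.univ.filter fun k => b k ∈ A).card ≤ q := by
      have h1 : ∀ k, b k ∈ A → ∃ U ∈ 𝒱, b k ∈ U := fun k hk => by
        simpa using hcov hk
      choose! U hU𝒱 hU using h1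
      refine (Finset.card_le_card_of_injOn U (fun k hk => hU𝒱 k (by simpa using hk)) ?_).trans hq
      intro j hj k hk hjk
      have hj' : b j ∈ A := by simpa using hj
      have hk' : b k ∈ A := by simpa using hk
      refine hb.1 ((h𝒰 _ (h𝒱 (hU𝒱 j hj'))).2 (hU j hj') (hjk ▸ hU k hk') ?_)
      rw [hb.apply, hb.apply]
    have hL1 : L ^ s ≤ L ^ r := pow_le_pow_right₀ hL hsr
    have hL2 : (1 : ℝ) ≤ L ^ r := one_le_pow₀ hL
    have hs1 : σ⁻¹ ^ s ≤ σ⁻¹ := pow_le_of_le_one (by positivity) hσ1 (by lia)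
    calc ∑ k, (if b k ∈ A then L else σ⁻¹) ^ s
        ≤ ∑ k, if b k ∈ A then L ^ r else σ⁻¹ := by
          refine Finset.sum_le_sum fun k _ => ?_
          split_ifs
          · exact hL1
          · exact hs1
      _ = ∑ k, (σ⁻¹ + if b k ∈ A then L ^ r - σ⁻¹ else 0) := by
          refine Finset.sum_congr rfl fun k _ => ?_
          split_ifs <;> ring
      _ = d * σ⁻¹ + (Finset.univ.filter fun k => b k ∈ A).card * (L ^ r - σ⁻¹) := by
          rw [Finset.sum_add_distrib, ← Finset.sum_filter, Finset.sum_const, Finset.sum_const]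
          simp
      _ ≤ d * σ⁻¹ + q * (L ^ r - σ⁻¹) := by
          have : ((Finset.univ.filter fun k => b k ∈ A).card : ℝ) ≤ q := by exact_mod_cast hcard
          have h3 : 0 ≤ L ^ r - σ⁻¹ := by linarith
          gcongr
      _ = q * L ^ r + (d - q) * σ⁻¹ := by ring

/-- Fibres of `f` can be matched so that the sum of the distances is at most `κ` times the distance
of the base points. -/
def HasPairing {M : Type*} [MetricSpace M] (d : ℕ) (κ : ℝ) (f : M → M) : Prop :=
  ∀ x y : M, ∀ η > 0, ∃ a b : Fin d → M, IsEnum f x a ∧ IsEnum f y b ∧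
    ∑ k, dist (a k) (b k) ≤ κ * dist x y + η

/-- Nearby fibres are matched through the local inverse branches over a common base point, and the
sum of the Lipschitz constants is at most `κ`. Far away fibres are matched along a chain of short
steps. The bound `κ` holds for the whole sum at each step, so it survives although the contraction
along single branches is lost. -/
theorem IsLengthManifold.hasPairing {m : ℕ} {M : Type*} [MetricSpace M] [CompactSpace M]
    [ChartedSpace (Eu m) M] [IsManifold (𝓡 m) ∞ M] (hM : IsLengthManifold m M) {r d : ℕ}
    (hr : 1 ≤ r) (hd : 0 < d) (f : CrMap m M r) (hf : IsLocalDiffeomorph (𝓡 m) (𝓡 m) r f)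
    (hdeg : ∀ x, (f ⁻¹' {x}).ncard = d) {ℓ : M → ℝ} {κ : ℝ} (hκ : 0 ≤ κ)
    (hℓ : ∀ y, ∃ U ∈ 𝓝 y, ∀ z ∈ U, ∀ w ∈ U, dist z w ≤ ℓ y * dist (f z) (f w))
    (hsum : ∀ (x : M) (b : Fin d → M), IsEnum f x b → ∑ k, ℓ (b k) ≤ κ) :
    HasPairing d κ f := by
  have hloc : ∀ x : M, ∀ᶠ p in 𝓝 (x, x), ∃ a b : Fin d → M, IsEnum f p.1 a ∧ IsEnum f p.2 b ∧
      ∑ k, dist (a k) (b k) ≤ κ * dist p.1 p.2 := by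
    intro x
    obtain ⟨b, hb⟩ := exists_isEnum hd (hdeg x)
    choose Γ hΓ using fun k => exists_isLocalInverse (hf (b k))
    choose U hU hUd using fun k => hℓ (b k)
    have h1 : ∀ᶠ z in 𝓝 x, IsEnum f z (fun k => Γ k z) ∧ ∀ k, Γ k z ∈ U k := by
      refine (eventually_isEnum_localInverse hr hd f hf hdeg hb hΓ).and (eventually_all.2 fun k => ?_)
      have h2 := (hΓ k).contMDiffAt.continuousAt.tendsto
      rw [(hΓ k).apply, hb.apply k] at h2
      exact h2.eventually (hU k)
    filter_upwards [h1.prod_nhds h1] with p hp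
    refine ⟨_, _, hp.1.1, hp.2.1, ?_⟩
    calc ∑ k, dist (Γ k p.1) (Γ k p.2) ≤ ∑ k, ℓ (b k) * dist p.1 p.2 := by
          refine Finset.sum_le_sum fun k _ => ?_
          have := hUd k _ (hp.1.2 k) _ (hp.2.2 k)
          rwa [hp.1.1.apply k, hp.2.1.apply k] at this
      _ = (∑ k, ℓ (b k)) * dist p.1 p.2 := by rw [Finset.sum_mul]
      _ ≤ κ * dist p.1 p.2 := mul_le_mul_of_nonneg_right (hsum x b hb) dist_nonneg
  have hunif : ∀ᶠ p in uniformity M, ∃ a b : Fin d → M, IsEnum f p.1 a ∧ IsEnum f p.2 b ∧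
      ∑ k, dist (a k) (b k) ≤ κ * dist p.1 p.2 := by
    rw [compactSpace_uniformity, eventually_iSup]
    exact hloc
  obtain ⟨δ, hδ, hd'⟩ := Metric.mem_uniformity_dist.1 hunif
  intro x y η hη
  -- The excess length is multiplied by `κ`, and `κ / (κ + 1) ≤ 1`.
  obtain ⟨n, c, h0, hn, hs, ht⟩ := hM.chain x y δ (η / (κ + 1)) hδ (by positivity)
  obtain ⟨a, ha⟩ := exists_isEnum hd (hdeg (c 0))
  have h1 : ∀ j ≤ n, ∃ b : Fin d → M, IsEnum f (c j) b ∧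
      ∑ k, dist (a k) (b k) ≤ κ * ∑ i ∈ Finset.range j, dist (c i) (c (i + 1)) := by
    intro j
    induction j with
    | zero => exact fun _ => ⟨a, ha, by simp⟩
    | succ j ih =>
      intro hj
      obtain ⟨b, hb, hab⟩ := ih (by lia)
      obtain ⟨b₁, b₂, hb₁, hb₂, h12⟩ := hd' (hs j hj)
      -- The local matching comes with its own numbering of the fibre over `c j`; a permutation
      -- aligns it with the one carried along the chain.
      obtain ⟨τ, hτ⟩ := hb.exists_perm hb₁
      refine ⟨b₂ ∘ τ, hb₂.comp_equiv τ, ?_⟩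
      rw [Finset.sum_range_succ, mul_add]
      calc ∑ k, dist (a k) ((b₂ ∘ τ) k)
          ≤ ∑ k, (dist (a k) (b k) + dist (b₁ (τ k)) (b₂ (τ k))) := by
            refine Finset.sum_le_sum fun k _ => ?_
            rw [show b₁ (τ k) = b k from congrFun hτ k]
            exact dist_triangle _ _ _
        _ = ∑ k, dist (a k) (b k) + ∑ k, dist (b₁ k) (b₂ k) := by
            rw [Finset.sum_add_distrib, Equiv.sum_comp τ fun k => dist (b₁ k) (b₂ k)]
        _ ≤ _ := add_le_add hab h12
  obtain ⟨b, hb, hab⟩ := h1 n le_rfl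
  refine ⟨a, b, h0 ▸ ha, hn ▸ hb, hab.trans ?_⟩
  calc κ * ∑ i ∈ Finset.range n, dist (c i) (c (i + 1)) ≤ κ * (dist x y + η / (κ + 1)) :=
        mul_le_mul_of_nonneg_left ht.le hκ
    _ = κ * dist x y + η * (κ / (κ + 1)) := by ring
    _ ≤ κ * dist x y + η * 1 := by
        gcongr
        rw [div_le_one (by positivity)]
        linarith
    _ = κ * dist x y + η := by rw [mul_one]

end Expansion

/-! ### The comparison inequalities for a single transfer operator -/

section Comparison

variable {M : Type*} [MetricSpace M] {d : ℕ} {κ b S : ℝ} {f : M → M} {φ : M → ℝ}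

/-- For matched points `α` and `β` there are two cases. If `φ α - φ β ≤ s`, exchanging the weights
costs a factor `e^s`. If not, `b d(α, β) > s`, and the term, which is at most `e^S U`, is at most
`e^S (b U / s) d(α, β)`. Thus large distances between matched points are paid for by an additive
term that sums to a multiple of `κ d(x, y)`. -/
theorem HasPairing.transfer_compare (hf : HasPairing d κ f) (hφ : ∀ x y, |φ x - φ y| ≤ b * dist x y)
    (hS : ∀ x, φ x ≤ S) (hb : 0 ≤ b)
    {u v : M → ℝ} {B a U s : ℝ} (hu : ∀ x, 0 ≤ u x) (hv : ∀ x, 0 ≤ v x) (hB : 0 ≤ B) (ha : 0 ≤ a)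
    (hs : 0 < s) (hU : ∀ x, u x ≤ U) (h : ∀ x y, u x ≤ B * v y + a * dist x y) (x y : M) :
    transfer f φ u x ≤ Real.exp s * B * transfer f φ v y
      + Real.exp S * κ * (a + b * U / s) * dist x y := by
  have hU0 : 0 ≤ U := (hu x).trans (hU x)
  set c := Real.exp S * (a + b * U / s)
  have hc : 0 ≤ c := by positivity
  have key : ∀ η > 0, transfer f φ u x ≤ Real.exp s * B * transfer f φ v y
      + c * (κ * dist x y + η) := by
    intro η hη
    obtain ⟨α, β, hα, hβ, hαβ⟩ := hf x y η hη
    rw [transfer_eq_sum hα, transfer_eq_sum hβ]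
    have hterm : ∀ k, Real.exp (φ (α k)) * u (α k) ≤
        Real.exp s * B * (Real.exp (φ (β k)) * v (β k)) + c * dist (α k) (β k) := by
      intro k
      have hd0 : 0 ≤ dist (α k) (β k) := dist_nonneg
      have hexpS : Real.exp (φ (α k)) ≤ Real.exp S := Real.exp_le_exp.2 (hS _)
      rcases le_or_gt (φ (α k) - φ (β k)) s with h1 | h1
      · have h2 : Real.exp (φ (α k)) ≤ Real.exp s * Real.exp (φ (β k)) := by
          rw [← Real.exp_add]
          exact Real.exp_le_exp.2 (by linarith)
        calc Real.exp (φ (α k)) * u (α k)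
            ≤ Real.exp (φ (α k)) * (B * v (β k) + a * dist (α k) (β k)) :=
              mul_le_mul_of_nonneg_left (h _ _) (Real.exp_pos _).le
          _ = Real.exp (φ (α k)) * (B * v (β k)) + Real.exp (φ (α k)) * (a * dist (α k) (β k)) := by
              ring
          _ ≤ (Real.exp s * Real.exp (φ (β k))) * (B * v (β k))
              + Real.exp S * (a * dist (α k) (β k)) := add_le_add
              (mul_le_mul_of_nonneg_right h2 (mul_nonneg hB (hv _)))
              (mul_le_mul_of_nonneg_right hexpS (by positivity))
          _ ≤ Real.exp s * B * (Real.exp (φ (β k)) * v (β k)) + c * dist (α k) (β k) := by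
              have h3 : 0 ≤ Real.exp S * (b * U / s) * dist (α k) (β k) := by positivity
              simp only [c]
              linarith
      · have h2 : s ≤ b * dist (α k) (β k) := h1.le.trans ((le_abs_self _).trans (hφ _ _))
        calc Real.exp (φ (α k)) * u (α k) ≤ Real.exp S * U :=
              mul_le_mul hexpS (hU _) (hu _) (Real.exp_pos _).le
          _ = Real.exp S * (U / s) * s := by field_simp
          _ ≤ Real.exp S * (U / s) * (b * dist (α k) (β k)) :=
              mul_le_mul_of_nonneg_left h2 (by positivity)
          _ = Real.exp S * (b * U / s) * dist (α k) (β k) := by ring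
          _ ≤ Real.exp s * B * (Real.exp (φ (β k)) * v (β k)) + c * dist (α k) (β k) := by
              have h3 : 0 ≤ Real.exp s * B * (Real.exp (φ (β k)) * v (β k)) :=
                mul_nonneg (by positivity) (mul_nonneg (Real.exp_pos _).le (hv _))
              have h4 : 0 ≤ Real.exp S * a * dist (α k) (β k) := by positivity
              simp only [c]
              linarith
    calc ∑ k, Real.exp (φ (α k)) * u (α k)
        ≤ ∑ k, (Real.exp s * B * (Real.exp (φ (β k)) * v (β k)) + c * dist (α k) (β k)) :=
          Finset.sum_le_sum fun k _ => hterm k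
      _ = Real.exp s * B * ∑ k, Real.exp (φ (β k)) * v (β k) + c * ∑ k, dist (α k) (β k) := by
          rw [Finset.sum_add_distrib, Finset.mul_sum, Finset.mul_sum]
      _ ≤ _ := add_le_add le_rfl (mul_le_mul_of_nonneg_left hαβ hc)
  have hlim : Tendsto (fun η : ℝ => Real.exp s * B * transfer f φ v y
      + c * (κ * dist x y + η)) (𝓝[>] 0) (𝓝 (Real.exp s * B * transfer f φ v y
      + c * (κ * dist x y + 0))) :=
    ((continuous_const.add (continuous_const.mul
      (continuous_const.add continuous_id))).tendsto _).mono_left nhdsWithin_le_nhds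
  have h5 := ge_of_tendsto hlim (by filter_upwards [self_mem_nhdsWithin] with η hη using key η hη)
  refine h5.trans_eq ?_
  simp only [c]
  ring

/-- The product rule over matched points, with the mean value inequality for the exponential on
`(-∞, S]`. -/
theorem HasPairing.transfer_lip (hf : HasPairing d κ f) (hφ : ∀ x y, |φ x - φ y| ≤ b * dist x y)
    (hS : ∀ x, φ x ≤ S) (hb : 0 ≤ b) {u : M → ℝ} {a U : ℝ} (ha : 0 ≤ a)
    (hu : ∀ x y, |u x - u y| ≤ a * dist x y) (hU : ∀ x, |u x| ≤ U) (x y : M) :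
    |transfer f φ u x - transfer f φ u y| ≤ Real.exp S * κ * (a + b * U) * dist x y := by
  have hU0 : 0 ≤ U := (abs_nonneg _).trans (hU x)
  set c := Real.exp S * (a + b * U)
  have hc : 0 ≤ c := by positivity
  have key : ∀ η > 0, |transfer f φ u x - transfer f φ u y| ≤ c * (κ * dist x y + η) := by
    intro η hη
    obtain ⟨α, β, hα, hβ, hαβ⟩ := hf x y η hη
    rw [transfer_eq_sum hα, transfer_eq_sum hβ, ← Finset.sum_sub_distrib]
    have hterm : ∀ k, |Real.exp (φ (α k)) * u (α k) - Real.exp (φ (β k)) * u (β k)|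
        ≤ c * dist (α k) (β k) := by
      intro k
      have h1 : |Real.exp (φ (α k)) - Real.exp (φ (β k))| ≤ Real.exp S * |φ (α k) - φ (β k)| := by
        have := (convex_Iic S).norm_image_sub_le_of_norm_deriv_le (f := Real.exp) (C := Real.exp S)
          (fun z _ => Real.differentiableAt_exp) (fun z hz => by
            rw [Real.deriv_exp, Real.norm_eq_abs, Real.abs_exp]
            exact Real.exp_le_exp.2 hz) (hS (β k)) (hS (α k))
        exact this
      calc |Real.exp (φ (α k)) * u (α k) - Real.exp (φ (β k)) * u (β k)|
          = |Real.exp (φ (α k)) * (u (α k) - u (β k))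
            + (Real.exp (φ (α k)) - Real.exp (φ (β k))) * u (β k)| := by ring_nf
        _ ≤ Real.exp (φ (α k)) * |u (α k) - u (β k)|
            + |Real.exp (φ (α k)) - Real.exp (φ (β k))| * |u (β k)| := by
            refine (abs_add_le _ _).trans_eq ?_
            rw [abs_mul, abs_mul, Real.abs_exp]
        _ ≤ Real.exp S * (a * dist (α k) (β k))
            + (Real.exp S * (b * dist (α k) (β k))) * U := by
            refine add_le_add (mul_le_mul (Real.exp_le_exp.2 (hS _)) (hu _ _) (abs_nonneg _)
              (Real.exp_pos _).le) (mul_le_mul (h1.trans ?_) (hU _) (abs_nonneg _) (by positivity))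
            exact mul_le_mul_of_nonneg_left (hφ _ _) (Real.exp_pos _).le
        _ = c * dist (α k) (β k) := by
            simp only [c]
            ring
    calc |∑ k, (Real.exp (φ (α k)) * u (α k) - Real.exp (φ (β k)) * u (β k))|
        ≤ ∑ k, c * dist (α k) (β k) :=
          (Finset.abs_sum_le_sum_abs _ _).trans (Finset.sum_le_sum fun k _ => hterm k)
      _ = c * ∑ k, dist (α k) (β k) := by rw [Finset.mul_sum]
      _ ≤ _ := mul_le_mul_of_nonneg_left hαβ hc
  have hlim : Tendsto (fun η : ℝ => c * (κ * dist x y + η)) (𝓝[>] 0)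
      (𝓝 (c * (κ * dist x y + 0))) :=
    ((continuous_const.mul
      (continuous_const.add continuous_id)).tendsto _).mono_left nhdsWithin_le_nhds
  have h5 := ge_of_tendsto hlim (by filter_upwards [self_mem_nhdsWithin] with η hη using key η hη)
  refine h5.trans_eq ?_
  simp only [c]
  ring

end Comparison

/-! ### The integrated operator on continuous functions and its normalization -/

section Integrated

variable {m : ℕ} {M : Type*} [MetricSpace M] [CompactSpace M] [ChartedSpace (Eu m) M]
  [IsManifold (𝓡 m) ∞ M] {𝔠 : ChartCover m M} {r d : ℕ} {𝕜 : Type} [RCLike 𝕜]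
  {ℱ : Set (CrMap m M r)} {𝒲 : Set (CrFun 𝔠 r ℝ)}

theorem CrFun.continuous (g : CrFun 𝔠 r 𝕜) : Continuous g := ContMDiff.continuous g.2

/-- The minimum of the potential. -/
noncomputable def Param.potMin (p : Param ℱ 𝒲) : ℝ := ⨅ x, p.pot x

theorem Param.bddBelow_pot (p : Param ℱ 𝒲) : BddBelow (range p.pot) :=
  (isCompact_range (CrFun.continuous p.crPot)).bddBelow

theorem Param.bddAbove_pot (p : Param ℱ 𝒲) : BddAbove (range p.pot) :=
  (isCompact_range (CrFun.continuous p.crPot)).bddAbove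

theorem Param.potMin_le (p : Param ℱ 𝒲) (x : M) : p.potMin ≤ p.pot x :=
  ciInf_le p.bddBelow_pot x

/-- The minimum is 1-Lipschitz in the sup norm of the potential. -/
theorem Param.continuous_potMin [Nonempty M] :
    Continuous (Param.potMin : Param ℱ 𝒲 → ℝ) := by
  have h1 : ∀ p p' : Param ℱ 𝒲, p.potMin ≤ p'.potMin + dist p.crPot p'.crPot := by
    intro p p'
    rw [← sub_le_iff_le_add]
    refine le_ciInf fun x => ?_
    have h2 := p.potMin_le x
    have h3 : ‖p.pot x - p'.pot x‖ ≤ dist p.crPot p'.crPot := by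
      rw [dist_eq_norm]
      exact (p.crPot - p'.crPot).norm_apply_le x
    have h4 := (le_abs_self _).trans h3
    linarith
  refine continuous_iff_continuousAt.2 fun p₀ => ?_
  have h2 : Tendsto (fun p : Param ℱ 𝒲 => dist p.crPot p₀.crPot) (𝓝 p₀) (𝓝 0) := by
    have := (Param.continuous_crPot.dist continuous_const : Continuous fun p : Param ℱ 𝒲 =>
      dist p.crPot p₀.crPot).tendsto p₀
    rwa [dist_self] at this
  rw [ContinuousAt, tendsto_iff_dist_tendsto_zero]
  refine squeeze_zero (fun _ => dist_nonneg) (fun p => ?_) h2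
  rw [Real.dist_eq, abs_le]
  have h3 := h1 p p₀
  have h4 := h1 p₀ p
  rw [dist_comm] at h4
  constructor <;> linarith

namespace IsCoveringFamily

theorem norm_transfer_le (h : IsCoveringFamily d ℱ) {p : Param ℱ 𝒲} {R U : ℝ}
    (hR : ∀ x, |p.pot x| ≤ R) {g : M → 𝕜} (hg : ∀ x, ‖g x‖ ≤ U) (x : M) :
    ‖transfer p.map p.pot g x‖ ≤ d * (Real.exp R * U) := by
  obtain ⟨b, hb⟩ := h.exists_isEnum p x
  rw [transfer_eq_sum hb]
  refine (norm_sum_le _ _).trans ((Finset.sum_le_sum (g := fun _ => Real.exp R * U)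
    fun k _ => ?_).trans_eq (by simp))
  rw [norm_mul, RCLike.norm_ofReal, Real.abs_exp]
  exact mul_le_mul (Real.exp_le_exp.2 ((le_abs_self _).trans (hR _))) (hg _) (norm_nonneg _)
    (Real.exp_pos _).le

theorem integrable_transfer (h : IsCoveringFamily d ℱ) (hr : 1 ≤ r) {θ : Measure (Param ℱ 𝒲)}
    [IsFiniteMeasure θ] {R : ℝ} (hR : ∀ᵐ p ∂θ, ∀ x, |p.pot x| ≤ R) (g : C(M, 𝕜)) (x : M) :
    Integrable (fun p => transfer p.map p.pot g x) θ := by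
  refine Integrable.of_bound (C := d * (Real.exp R * ‖g‖)) ?_ ?_
  · exact ((h.continuous_transfer hr g.continuous).comp
      (continuous_id.prodMk continuous_const)).aestronglyMeasurable
  · filter_upwards [hR] with p hp using h.norm_transfer_le hp (fun x => g.norm_coe_le_norm x) x

theorem continuous_integratedTransfer (h : IsCoveringFamily d ℱ) (hr : 1 ≤ r)
    {θ : Measure (Param ℱ 𝒲)} [IsFiniteMeasure θ] {R : ℝ} (hR : ∀ᵐ p ∂θ, ∀ x, |p.pot x| ≤ R)
    (g : C(M, 𝕜)) : Continuous (integratedTransfer θ g) := by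
  refine continuous_of_dominated (bound := fun _ => d * (Real.exp R * ‖g‖))
    (fun x => (h.integrable_transfer hr hR g x).1) (fun x => ?_) (integrable_const _) ?_
  · filter_upwards [hR] with p hp using h.norm_transfer_le hp (fun x => g.norm_coe_le_norm x) x
  · exact Eventually.of_forall fun p => (h.continuous_transfer hr g.continuous).comp
      (continuous_const.prodMk continuous_id)

theorem transfer_add (h : IsCoveringFamily d ℱ) (p : Param ℱ 𝒲) (g g' : M → 𝕜) (x : M) :
    transfer p.map p.pot (g + g') x = transfer p.map p.pot g x + transfer p.map p.pot g' x := by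
  obtain ⟨b, hb⟩ := h.exists_isEnum p x
  simp only [transfer_eq_sum hb, Pi.add_apply, mul_add, Finset.sum_add_distrib]

theorem transfer_smul (h : IsCoveringFamily d ℱ) (p : Param ℱ 𝒲) (c : 𝕜) (g : M → 𝕜) (x : M) :
    transfer p.map p.pot (c • g) x = c * transfer p.map p.pot g x := by
  obtain ⟨b, hb⟩ := h.exists_isEnum p x
  simp only [transfer_eq_sum hb, Pi.smul_apply, smul_eq_mul, Finset.mul_sum]
  exact Finset.sum_congr rfl fun k _ => by ring

/-- The integrated transfer operator on continuous functions. -/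
noncomputable def integratedC (h : IsCoveringFamily d ℱ) (hr : 1 ≤ r)
    (θ : Measure (Param ℱ 𝒲)) [IsFiniteMeasure θ] {R : ℝ}
    (hR : ∀ᵐ p ∂θ, ∀ x, |p.pot x| ≤ R) : Module.End ℝ C(M, ℝ) where
  toFun g := ⟨integratedTransfer θ g, h.continuous_integratedTransfer hr hR g⟩
  map_add' g g' := by
    ext x
    change ∫ p, transfer p.map p.pot (⇑(g + g')) x ∂θ
      = (∫ p, transfer p.map p.pot g x ∂θ) + ∫ p, transfer p.map p.pot g' x ∂θ
    rw [← integral_add (h.integrable_transfer hr hR g x) (h.integrable_transfer hr hR g' x)]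
    exact integral_congr_ae (Eventually.of_forall fun p => h.transfer_add p g g' x)
  map_smul' c g := by
    ext x
    change ∫ p, transfer p.map p.pot (⇑(c • g)) x ∂θ = c * ∫ p, transfer p.map p.pot g x ∂θ
    rw [← integral_const_mul]
    exact integral_congr_ae (Eventually.of_forall fun p => h.transfer_smul p c g x)

/-- The normalization constant `∫ d e^{min φ} dθ`. -/
noncomputable def mass (d : ℕ) (θ : Measure (Param ℱ 𝒲)) : ℝ :=
  ∫ p, d * Real.exp p.potMin ∂θ

theorem abs_potMin_le [Nonempty M] {p : Param ℱ 𝒲} {R : ℝ} (hR : ∀ x, |p.pot x| ≤ R) :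
    |p.potMin| ≤ R := by
  have x := Classical.arbitrary M
  refine abs_le.2 ⟨le_ciInf fun x => (abs_le.1 (hR x)).1, (p.potMin_le x).trans ?_⟩
  exact (le_abs_self _).trans (hR x)

theorem integrable_mass [Nonempty M] {θ : Measure (Param ℱ 𝒲)} [IsFiniteMeasure θ] {R : ℝ}
    (hR : ∀ᵐ p ∂θ, ∀ x, |p.pot x| ≤ R) : Integrable (fun p => d * Real.exp p.potMin) θ := by
  refine Integrable.of_bound (C := d * Real.exp R) ?_ ?_
  · exact (continuous_const.mul
      (Real.continuous_exp.comp Param.continuous_potMin)).aestronglyMeasurable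
  · filter_upwards [hR] with p hp
    rw [norm_mul, Real.norm_natCast, Real.norm_eq_abs, Real.abs_exp]
    gcongr
    exact (le_abs_self _).trans (abs_potMin_le hp)

theorem le_mass [Nonempty M] {θ : Measure (Param ℱ 𝒲)} [IsProbabilityMeasure θ] {R : ℝ}
    (hR : ∀ᵐ p ∂θ, ∀ x, |p.pot x| ≤ R) : d * Real.exp (-R) ≤ mass d θ := by
  have h1 : ∫ _, (d : ℝ) * Real.exp (-R) ∂θ = d * Real.exp (-R) := by simp
  rw [← h1]
  refine integral_mono_ae (integrable_const _) (integrable_mass hR) ?_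
  filter_upwards [hR] with p hp
  gcongr
  exact (abs_le.1 (abs_potMin_le hp)).1

theorem mass_pos [Nonempty M] (hd : 0 < d) {θ : Measure (Param ℱ 𝒲)} [IsProbabilityMeasure θ]
    {R : ℝ} (hR : ∀ᵐ p ∂θ, ∀ x, |p.pot x| ≤ R) : 0 < mass d θ := by
  refine lt_of_lt_of_le ?_ (le_mass hR)
  positivity

/-- The bounds for a single pair involve `sup φ`, which varies with the pair, but (P') gives `e^{sup
φ} κ ≤ ρ d e^{min φ}`. After integration the right hand side becomes `ρ` times `mass`, so the
division leaves exactly `ρ`. Each fibre has `d` points of weight at least `e^{min φ}`, which gives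
`T 1 ≥ 1`. -/
theorem isOscContracting [Nonempty M] (h : IsCoveringFamily d ℱ) (hr : 1 ≤ r)
    {θ : Measure (Param ℱ 𝒲)} [IsProbabilityMeasure θ] {R κ b εφ : ℝ}
    (hR : ∀ᵐ p ∂θ, ∀ x, |p.pot x| ≤ R)
    (hb : 0 ≤ b) (hκ : 0 ≤ κ) (hpair : ∀ p : Param ℱ 𝒲, HasPairing d κ p.map)
    (hlip : ∀ (p : Param ℱ 𝒲) (x y : M), |p.pot x - p.pot y| ≤ b * dist x y)
    (hosc : ∀ (p : Param ℱ 𝒲) (x : M), p.pot x ≤ p.potMin + εφ) :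
    IsOscContracting (Real.exp εφ * (κ / d)) b ((mass d θ)⁻¹ • h.integratedC hr θ hR) := by
  have hd : (0 : ℝ) < d := by exact_mod_cast h.pos
  have hΛ := mass_pos h.pos hR
  set ρ := Real.exp εφ * (κ / d)
  have hρ : 0 ≤ ρ := by positivity
  have hexp : ∀ p : Param ℱ 𝒲, Real.exp (p.potMin + εφ) * κ = ρ * (d * Real.exp p.potMin) := by
    intro p
    simp only [ρ]
    rw [Real.exp_add]
    field_simp
  have happ : ∀ (g : C(M, ℝ)) (x : M), ((mass d θ)⁻¹ • h.integratedC hr θ hR) g x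
      = (mass d θ)⁻¹ * ∫ p, transfer p.map p.pot g x ∂θ := fun g x => rfl
  refine ⟨fun u hu x => ?_, fun x => ?_, ?_, ?_⟩
  · rw [happ]
    refine mul_nonneg (inv_nonneg.2 hΛ.le) (integral_nonneg fun p => ?_)
    obtain ⟨b, hb⟩ := h.exists_isEnum p x
    simp only [transfer_eq_sum hb]
    exact Finset.sum_nonneg fun k _ => mul_nonneg (Real.exp_pos _).le (hu _)
  · rw [happ, ← div_eq_inv_mul, one_le_div hΛ]
    refine integral_mono_ae (integrable_mass hR) (h.integrable_transfer hr hR 1 x) ?_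
    refine Eventually.of_forall fun p => ?_
    obtain ⟨b, hb⟩ := h.exists_isEnum p x
    simp only [transfer_eq_sum hb, ContinuousMap.one_apply, mul_one, RCLike.ofReal_real_eq_id, id]
    refine le_trans (by simp) (Finset.sum_le_sum (f := fun _ => Real.exp p.potMin) fun k _ =>
      Real.exp_le_exp.2 (p.potMin_le _))
  · intro u v B a U s hu hv hB ha hs hU huv x y
    rw [happ, happ]
    have h1 : ∫ p, transfer p.map p.pot u x ∂θ ≤ ∫ p, (Real.exp s * B * transfer p.map p.pot v y
        + ρ * (a + b * U / s) * dist x y * (d * Real.exp p.potMin)) ∂θ := by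
      refine integral_mono_ae (h.integrable_transfer hr hR u x)
        (((h.integrable_transfer hr hR v y).const_mul _).add ((integrable_mass hR).const_mul _))
        (Eventually.of_forall fun p => ?_)
      refine ((hpair p).transfer_compare (hlip p) (hosc p) hb hu hv hB ha hs hU huv x y).trans_eq ?_
      rw [hexp]
      ring
    rw [integral_add ((h.integrable_transfer hr hR v y).const_mul _)
      ((integrable_mass hR).const_mul _), integral_const_mul, integral_const_mul] at h1
    refine (mul_le_mul_of_nonneg_left h1 (inv_nonneg.2 hΛ.le)).trans_eq ?_
    rw [show ∫ p, (d : ℝ) * Real.exp p.potMin ∂θ = mass d θ from rfl]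
    field_simp
  · intro u a U ha hu hU x y
    rw [happ, happ, ← mul_sub, ← integral_sub (h.integrable_transfer hr hR u x)
      (h.integrable_transfer hr hR u y), abs_mul, abs_of_pos (inv_pos.2 hΛ)]
    have h1 : |∫ p, (transfer p.map p.pot u x - transfer p.map p.pot u y) ∂θ|
        ≤ ∫ p, ρ * (a + b * U) * dist x y * (d * Real.exp p.potMin) ∂θ := by
      refine (abs_integral_le_integral_abs).trans (integral_mono_ae ?_
        ((integrable_mass hR).const_mul _) (Eventually.of_forall fun p => ?_))
      · exact ((h.integrable_transfer hr hR u x).sub (h.integrable_transfer hr hR u y)).abs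
      · refine ((hpair p).transfer_lip (hlip p) (hosc p) hb ha hu hU x y).trans_eq ?_
        rw [hexp]
        ring
    rw [integral_const_mul] at h1
    refine (mul_le_mul_of_nonneg_left h1 (inv_nonneg.2 hΛ.le)).trans_eq ?_
    rw [show ∫ p, (d : ℝ) * Real.exp p.potMin ∂θ = mass d θ from rfl]
    field_simp

end IsCoveringFamily

end Integrated

end

section

/-! ### Uniform branch bounds and derivatives on metric unit vectors -/

section LasotaYorke

variable {m : ℕ} {M : Type*} [MetricSpace M] [CompactSpace M] [ChartedSpace (Eu m) M]
  [IsManifold (𝓡 m) ∞ M] {𝔠 : ChartCover m M} {r d : ℕ} {𝕜 : Type} [RCLike 𝕜]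
  {ℱ : Set (CrMap m M r)} {𝒲 : Set (CrFun 𝔠 r ℝ)}

/-- The constant functions. -/
noncomputable def CrFun.const (𝔠 : ChartCover m M) (r : ℕ) (c : 𝕜) : CrFun 𝔠 r 𝕜 :=
  ⟨fun _ => c, contMDiff_const⟩

/-- The weight of an inverse branch `Γ`, read in charts. -/
noncomputable def branchWeight (e e' : OpenPartialHomeomorph M (Eu m)) (Γ : M → M) (φ : M → ℝ) :
    Eu m → ℝ :=
  fun z => Real.exp ((φ ∘ e'.symm) ((e' ∘ Γ ∘ e.symm) z))

/-- Bounds for the derivatives of an inverse branch and of its weight. -/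
def HasBranchBound (𝔠 : ChartCover m M) (r : ℕ) (p : Param ℱ 𝒲) (C : ℝ) (i j : Fin 𝔠.N) (y : M) :
    Prop :=
  y ∈ 𝔠.K j → p.map y ∈ 𝔠.K i → ∃ Γ, IsLocalInverse m r p.map Γ y ∧ ∀ k ≤ r,
    ‖iteratedFDeriv ℝ k (𝔠.chart j ∘ Γ ∘ (𝔠.chart i).symm) (𝔠.chart i (p.map y))‖ ≤ C ∧
    ‖iteratedFDeriv ℝ k (branchWeight (𝔠.chart i) (𝔠.chart j) Γ p.pot)
      (𝔠.chart i (p.map y))‖ ≤ C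

theorem JetTendsto.exists_eventually_norm_le {ι E F : Type*} [NormedAddCommGroup E]
    [NormedSpace ℝ E] [NormedAddCommGroup F] [NormedSpace ℝ F] {l : Filter ι} {r : ℕ}
    {f : ι → E → F} {z : ι → E} {f₀ : E → F} {z₀ : E} (h : JetTendsto l r f z f₀ z₀) :
    ∃ C, ∀ᶠ a in l, ∀ k ≤ r, ‖iteratedFDeriv ℝ k (f a) (z a)‖ ≤ C := by
  refine ⟨∑ k ∈ Finset.range (r + 1), (‖iteratedFDeriv ℝ k f₀ z₀‖ + 1), ?_⟩
  have h1 : ∀ᶠ a in l, ∀ k ∈ Finset.range (r + 1),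
      ‖iteratedFDeriv ℝ k (f a) (z a)‖ < ‖iteratedFDeriv ℝ k f₀ z₀‖ + 1 :=
    (eventually_all_finset _).2 fun k hk =>
      ((h.tendsto k (by simpa [Nat.lt_succ_iff] using hk)).norm).eventually_lt_const (by linarith)
  filter_upwards [h1] with a ha k hk
  have hk' : k ∈ Finset.range (r + 1) := by simpa [Nat.lt_succ_iff] using hk
  exact (ha k hk').le.trans (Finset.single_le_sum
    (f := fun k => ‖iteratedFDeriv ℝ k f₀ z₀‖ + 1) (fun _ _ => by positivity) hk')

/-- The jets of the inverse branches and of the weights converge when the pair and the point vary,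
so they are locally bounded; compactness of `M` removes the dependence on the point. -/
theorem IsCoveringFamily.eventually_hasBranchBound (h : IsCoveringFamily d ℱ) (hr : 1 ≤ r)
    (p₀ : Param ℱ 𝒲) :
    ∃ C, ∀ᶠ p in 𝓝 p₀, ∀ i j y, HasBranchBound 𝔠 r p C i j y := by
  have hloc : ∀ i j (y₀ : M), ∃ C, ∀ᶠ a in 𝓝 (p₀, y₀), HasBranchBound 𝔠 r a.1 C i j a.2 := by
    intro i j y₀
    have hmap : Tendsto (fun a : Param ℱ 𝒲 × M => a.1.map a.2) (𝓝 (p₀, y₀)) (𝓝 (p₀.map y₀)) :=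
      CrMap.tendsto_apply (f := fun a : Param ℱ 𝒲 × M => a.1.crMap) (f₀ := p₀.crMap)
        ((Param.continuous_crMap.comp continuous_fst).tendsto (p₀, y₀)) (continuous_snd.tendsto _)
    -- Away from the closed sets `K j` and `K i` the condition is vacuous nearby.
    by_cases hy : y₀ ∈ 𝔠.K j
    swap
    · refine ⟨0, ?_⟩
      filter_upwards [(continuous_snd.tendsto (p₀, y₀)).eventually
        ((𝔠.isCompact_K j).isClosed.isOpen_compl.mem_nhds hy)] with a ha h1
      exact absurd h1 ha
    by_cases hx : p₀.map y₀ ∈ 𝔠.K i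
    swap
    · refine ⟨0, ?_⟩
      filter_upwards [hmap.eventually
        ((𝔠.isCompact_K i).isClosed.isOpen_compl.mem_nhds hx)] with a ha _ h1
      exact absurd h1 ha
    choose Γ hΓ using fun a : Param ℱ 𝒲 × M =>
      exists_isLocalInverse (h.localDiffeo _ a.1.1.2 a.2)
    have hf : Tendsto (fun a : Param ℱ 𝒲 × M => a.1.crMap) (𝓝 (p₀, y₀)) (𝓝 p₀.crMap) :=
      (Param.continuous_crMap.comp continuous_fst).tendsto _
    have hφ : Tendsto (fun a : Param ℱ 𝒲 × M => a.1.crPot) (𝓝 (p₀, y₀)) (𝓝 p₀.crPot) :=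
      (Param.continuous_crPot.comp continuous_fst).tendsto _
    obtain ⟨C₁, h1⟩ := (jetTendsto_localInverse hr hf (continuous_snd.tendsto (p₀, y₀))
      (Eventually.of_forall hΓ) (hΓ (p₀, y₀)) (𝔠.chart_mem j) (𝔠.chart_mem i) (𝔠.K_subset j hy)
      (𝔠.K_subset i hx)).exists_eventually_norm_le
    obtain ⟨C₂, h2⟩ := (branchTerm_jetTendsto hr hf hφ
      -- The weight alone is the branch term of the constant function 1.
      (tendsto_const_nhds (x := CrFun.const 𝔠 r (1 : ℝ))) (continuous_snd.tendsto (p₀, y₀))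
      (Eventually.of_forall hΓ) (hΓ (p₀, y₀)) (𝔠.chart_mem i) (𝔠.chart_mem j) (𝔠.K_subset i hx)
      (𝔠.K_subset j hy)).exists_eventually_norm_le
    refine ⟨max C₁ C₂, ?_⟩
    filter_upwards [h1, h2] with a h1 h2 _ _
    refine ⟨Γ a, hΓ a, fun k hk => ⟨(h1 k hk).trans (le_max_left _ _), ?_⟩⟩
    refine le_trans (le_of_eq ?_) ((h2 k hk).trans (le_max_right _ _))
    congr 2
    funext z
    simp [branchWeight, branchTerm, CrFun.const, Param.pot, Param.crPot]
  have hmono : ∀ i j (y : M), Monotone fun C => ∀ᶠ a in 𝓝 (p₀, y),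
      HasBranchBound 𝔠 r a.1 C i j a.2 := fun i j y C C' hC hev => by
    filter_upwards [hev] with a ha h1 h2
    obtain ⟨Γ, hΓ, hb⟩ := ha h1 h2
    exact ⟨Γ, hΓ, fun k hk => ⟨(hb k hk).1.trans hC, (hb k hk).2.trans hC⟩⟩
  have hij : ∀ i j, ∃ C, ∀ᶠ p in 𝓝 p₀, ∀ y, HasBranchBound 𝔠 r p C i j y := by
    intro i j
    obtain ⟨C, -, hC⟩ := exists_forall_of_eventually (isCompact_univ (X := M)) (hmono i j)
      fun y _ => by
        obtain ⟨C, hC⟩ := hloc i j y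
        refine ⟨C, ?_⟩
        rw [nhdsWithin_univ]
        exact ((continuous_const.prodMk continuous_id).tendsto y).eventually
          (eventually_eventually_nhds.2 hC)
    refine ⟨C, ?_⟩
    have := (isCompact_univ (X := M)).eventually_forall_of_forall_eventually
      (P := fun p y => HasBranchBound 𝔠 r p C i j y) (x₀ := p₀) fun y _ => hC y trivial
    filter_upwards [this] with p hp y using hp y trivial
  choose C hC using hij
  refine ⟨∑ i, ∑ j, |C i j|, ?_⟩
  filter_upwards [eventually_all.2 fun i => eventually_all.2 (hC i)] with p hp i j y h1 h2
  obtain ⟨Γ, hΓ, hb⟩ := hp i j y h1 h2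
  have hle : C i j ≤ ∑ i, ∑ j, |C i j| :=
    (le_abs_self _).trans ((Finset.single_le_sum (f := fun j => |C i j|)
      (fun _ _ => abs_nonneg _) (Finset.mem_univ j)).trans
      (Finset.single_le_sum (f := fun i => ∑ j, |C i j|)
      (fun _ _ => Finset.sum_nonneg fun _ _ => abs_nonneg _) (Finset.mem_univ i)))
  exact ⟨Γ, hΓ, fun k hk => ⟨(hb k hk).1.trans hle, (hb k hk).2.trans hle⟩⟩

/-- The charts are bi-Lipschitz at the points of the compact sets, with a uniform constant. -/
def HasChartConstant (𝔠 : ChartCover m M) (C : ℝ) : Prop :=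
  1 ≤ C ∧ ∀ i, ∀ x ∈ 𝔠.K i, ∀ᶠ p in 𝓝 (x, x),
    dist p.1 p.2 ≤ C * dist (𝔠.chart i p.1) (𝔠.chart i p.2) ∧
    dist (𝔠.chart i p.1) (𝔠.chart i p.2) ≤ C * dist p.1 p.2

theorem IsLengthManifold.exists_hasChartConstant (hM : IsLengthManifold m M)
    (𝔠 : ChartCover m M) : ∃ C, HasChartConstant 𝔠 C := by
  have h1 : ∀ i, ∃ C, 0 ≤ C ∧ ∀ x ∈ 𝔠.K i, ∀ᶠ p in 𝓝 (x, x),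
      dist p.1 p.2 ≤ C * dist (𝔠.chart i p.1) (𝔠.chart i p.2) ∧
      dist (𝔠.chart i p.1) (𝔠.chart i p.2) ≤ C * dist p.1 p.2 := by
    intro i
    refine exists_forall_of_eventually (𝔠.isCompact_K i) (fun x C C' hC h => ?_) fun x hx => ?_
    · filter_upwards [h] with p hp
      exact ⟨hp.1.trans (by gcongr), hp.2.trans (by gcongr)⟩
    · obtain ⟨C, hC⟩ := hM.bilipschitz _ (𝔠.chart_mem i) x (𝔠.K_subset i hx)
      refine ⟨C, nhdsWithin_le_nhds ?_⟩
      exact ((continuous_id.prodMk continuous_id).tendsto x).eventually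
        (eventually_eventually_nhds.2 hC)
  choose C hC0 hC using h1
  refine ⟨1 + ∑ i, C i, by linarith [Finset.sum_nonneg fun i (_ : i ∈ Finset.univ) => hC0 i],
    fun i x hx => ?_⟩
  have hle : C i ≤ 1 + ∑ i, C i := by
    linarith [Finset.single_le_sum (fun i _ => hC0 i) (Finset.mem_univ i)]
  filter_upwards [hC i x hx] with p hp
  exact ⟨hp.1.trans (by gcongr), hp.2.trans (by gcongr)⟩

/-- The `s`-th derivatives of `g` are bounded by `B` on vectors of metric length at most one. -/
def UnitBound (g : CrFun 𝔠 r 𝕜) (s : ℕ) (B : ℝ) : Prop :=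
  ∀ i, ∀ x ∈ 𝔠.K i, ∀ v : Fin s → Eu m, (∀ a, v a ∈ metricBall (𝔠.chart i) x 1) →
    ‖g.derivAt i s x v‖ ≤ B

/-- Homogeneity: dividing the vectors by `ℓ` brings them into the unit ball, and multilinearity
returns `ℓ ^ s`. This is how the sums of `ℓ ^ s` over a fibre enter. -/
theorem norm_map_le_of_metricBall {e : OpenPartialHomeomorph M (Eu m)} {x : M} {s : ℕ}
    {Φ : ContinuousMultilinearMap ℝ (fun _ : Fin s => Eu m) 𝕜} {B ℓ : ℝ} (hℓ : 0 < ℓ)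
    (h : ∀ v : Fin s → Eu m, (∀ a, v a ∈ metricBall e x 1) → ‖Φ v‖ ≤ B) {v : Fin s → Eu m}
    (hv : ∀ a, v a ∈ metricBall e x ℓ) : ‖Φ v‖ ≤ ℓ ^ s * B := by
  have h1 := h (fun a => ℓ⁻¹ • v a) fun a => by
    have := smul_mem_metricBall (inv_pos.2 hℓ) (hv a)
    rwa [inv_mul_cancel₀ hℓ.ne'] at this
  rw [Φ.map_smul_univ, norm_smul] at h1
  simp only [Finset.prod_const, Finset.card_univ, Fintype.card_fin, norm_pow, norm_inv,
    Real.norm_eq_abs, abs_of_pos hℓ] at h1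
  have h2 : 0 < ℓ ^ s := by positivity
  calc ‖Φ v‖ = ℓ ^ s * (ℓ⁻¹ ^ s * ‖Φ v‖) := by rw [inv_pow]; field_simp
    _ ≤ ℓ ^ s * B := by gcongr

theorem UnitBound.norm_derivAt_le {g : CrFun 𝔠 r 𝕜} {s : ℕ} {B C : ℝ} (h : UnitBound g s B)
    (hC : HasChartConstant 𝔠 C) (hB : 0 ≤ B) {i : Fin 𝔠.N} {x : M} (hx : x ∈ 𝔠.K i) :
    ‖g.derivAt i s x‖ ≤ C ^ s * B := by
  have hC0 : 0 < C := one_pos.trans_le hC.1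
  refine ContinuousMultilinearMap.opNorm_le_bound (by positivity) fun v => ?_
  by_cases hv : ∃ a, v a = 0
  · obtain ⟨a, ha⟩ := hv
    rw [(g.derivAt i s x).map_coord_zero a ha, norm_zero]
    positivity
  push Not at hv
  have h1 := norm_map_le_of_metricBall hC0 (h i x hx) (v := fun a => ‖v a‖⁻¹ • v a) fun a =>
    mem_metricBall_of_norm_le (𝔠.K_subset i hx) ((hC.2 i x hx).mono fun p hp => hp.1) (by
      rw [norm_smul, norm_inv, norm_norm, inv_mul_cancel₀ (norm_ne_zero_iff.2 (hv a)), mul_one])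
  rw [ContinuousMultilinearMap.map_smul_univ, norm_smul, norm_prod] at h1
  simp only [norm_inv, norm_norm] at h1
  have h2 : 0 < ∏ a, ‖v a‖ := Finset.prod_pos fun a _ => norm_pos_iff.2 (hv a)
  rw [Finset.prod_inv_distrib, inv_mul_le_iff₀ h2] at h1
  linarith

theorem unitBound_of_norm_derivAt_le {g : CrFun 𝔠 r 𝕜} {s : ℕ} {B C : ℝ}
    (hC : HasChartConstant 𝔠 C)
    (h : ∀ i, ∀ x ∈ 𝔠.K i, ‖g.derivAt i s x‖ ≤ B) : UnitBound g s (B * C ^ s) := by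
  intro i x hx v hv
  have hC0 : 0 ≤ C := zero_le_one.trans hC.1
  refine ((g.derivAt i s x).le_opNorm v).trans ?_
  refine mul_le_mul (h i x hx) ?_ (Finset.prod_nonneg fun _ _ => norm_nonneg _)
    ((norm_nonneg _).trans (h i x hx))
  calc ∏ a, ‖v a‖ ≤ ∏ _a : Fin s, C := Finset.prod_le_prod (fun _ _ => norm_nonneg _) fun a _ => by
        have := norm_le_of_mem_metricBall (𝔠.K_subset i hx) hC0
          ((hC.2 i x hx).mono fun p hp => hp.2) (hv a)
        rwa [mul_one] at this
    _ = C ^ s := by simp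

end LasotaYorke

end

section

/-! ### The Lasota–Yorke inequality for a single pair -/

section LasotaYorke

variable {m : ℕ} {M : Type*} [MetricSpace M] [CompactSpace M] [ChartedSpace (Eu m) M]
  [IsManifold (𝓡 m) ∞ M] {𝔠 : ChartCover m M} {r d : ℕ} {𝕜 : Type} [RCLike 𝕜]
  {ℱ : Set (CrMap m M r)} {𝒲 : Set (CrFun 𝔠 r ℝ)}

/-- The inverse branches of `f` are Lipschitz with local constants whose powers of order at most
`r` have sums over the fibres bounded by `κ`. -/
def HasExpansion {M : Type*} [MetricSpace M] (d r : ℕ) (κ : ℝ) (f : M → M) : Prop :=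
  ∃ ℓ : M → ℝ, (∀ y, 0 < ℓ y) ∧
    (∀ y, ∃ U ∈ 𝓝 y, ∀ z ∈ U, ∀ w ∈ U, dist z w ≤ ℓ y * dist (f z) (f w)) ∧
    ∀ (x : M) (b : Fin d → M), IsEnum f x b → ∀ s, 1 ≤ s → s ≤ r → ∑ k, ℓ (b k) ^ s ≤ κ

theorem IsLocalInverse.eventually_dist_le {f Γ : M → M} {y : M} (h : IsLocalInverse m r f Γ y)
    {ℓ : ℝ} (hℓ : ∃ U ∈ 𝓝 y, ∀ z ∈ U, ∀ w ∈ U, dist z w ≤ ℓ * dist (f z) (f w)) :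
    ∀ᶠ z in 𝓝 (f y), dist y (Γ z) ≤ ℓ * dist (f y) z := by
  obtain ⟨U, hU, hd⟩ := hℓ
  have h1 : Tendsto Γ (𝓝 (f y)) (𝓝 y) := by
    have := h.contMDiffAt.continuousAt.tendsto
    rwa [h.apply] at this
  filter_upwards [h1.eventually hU, h.right_inv] with z hz hz'
  have h2 := hd y (mem_of_mem_nhds hU) _ hz
  rwa [show f (Γ z) = z from hz'] at h2

/-- The main part of the derivative of a branch term. -/
theorem norm_branchTerm_le {p : Param ℱ 𝒲} {Γ : M → M} {y : M} {i j : Fin 𝔠.N} {s : ℕ} (hs1 : 1 ≤ s)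
    (hs : s ≤ r) {C Cc K : ℝ} (hCc : HasChartConstant 𝔠 Cc) (hK0 : 0 ≤ K)
    (hK : ∀ (w : Eu m → ℝ) (g : Eu m → 𝕜) (f : Eu m → Eu m) (z : Eu m) (b : ℝ),
      ContDiffAt ℝ s w z → ContDiffAt ℝ s g (f z) → ContDiffAt ℝ s f z → 0 ≤ b →
      (∀ k ≤ s, ‖iteratedFDeriv ℝ k f z‖ ≤ C) → (∀ k ≤ s, ‖iteratedFDeriv ℝ k w z‖ ≤ C) →
      (∀ k < s, ‖iteratedFDeriv ℝ k g (f z)‖ ≤ b) → ∀ v : Fin s → Eu m,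
      ‖iteratedFDeriv ℝ s (fun y => w y • g (f y)) z v
        - w z • iteratedFDeriv ℝ s g (f z) (fun i => fderiv ℝ f z (v i))‖
        ≤ K * b * ∏ i, ‖v i‖)
    (hΓ : IsLocalInverse m r p.map Γ y) (hy : y ∈ 𝔠.K j) (hx : p.map y ∈ 𝔠.K i)
    (hbound : ∀ k ≤ r,
      ‖iteratedFDeriv ℝ k (𝔠.chart j ∘ Γ ∘ (𝔠.chart i).symm) (𝔠.chart i (p.map y))‖ ≤ C ∧
      ‖iteratedFDeriv ℝ k (branchWeight (𝔠.chart i) (𝔠.chart j) Γ p.pot)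
        (𝔠.chart i (p.map y))‖ ≤ C)
    {ℓ : ℝ} (hℓ : 0 < ℓ) (hlip : ∀ᶠ z in 𝓝 (p.map y), dist y (Γ z) ≤ ℓ * dist (p.map y) z)
    (g : CrFun 𝔠 r 𝕜) {S B b : ℝ} (hS : p.pot y ≤ S) (hB : UnitBound g s B)
    (hb : 0 ≤ b) (hgb : ∀ k < s, ∀ i, ∀ x ∈ 𝔠.K i, ‖g.derivAt i k x‖ ≤ b) {v : Fin s → Eu m}
    (hv : ∀ a, v a ∈ metricBall (𝔠.chart i) (p.map y) 1) :
    ContDiffAt ℝ s (branchTerm (𝔠.chart i) (𝔠.chart j) Γ p.pot g) (𝔠.chart i (p.map y)) ∧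
    ‖iteratedFDeriv ℝ s (branchTerm (𝔠.chart i) (𝔠.chart j) Γ p.pot g) (𝔠.chart i (p.map y)) v‖
      ≤ Real.exp S * ℓ ^ s * B + K * b * Cc ^ s := by
  set e := 𝔠.chart i
  set e' := 𝔠.chart j
  set x := p.map y with hxdef
  have hxe : x ∈ e.source := 𝔠.K_subset i hx
  have hye : y ∈ e'.source := 𝔠.K_subset j hy
  have hCc0 : 0 ≤ Cc := zero_le_one.trans hCc.1
  have hval : (e' ∘ Γ ∘ e.symm) (e x) = e' y := by
    rw [Function.comp_apply, Function.comp_apply, e.left_inv hxe]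
    exact congrArg e' hΓ.apply
  have hsr : (s : WithTop ℕ∞) ≤ r := by exact_mod_cast hs
  have hf : ContDiffAt ℝ r (e' ∘ Γ ∘ e.symm) (e x) :=
    hΓ.contDiffAt_charts (𝔠.chart_mem j) (𝔠.chart_mem i) hye hxe
  have hg : ContDiffAt ℝ r (g ∘ e'.symm) ((e' ∘ Γ ∘ e.symm) (e x)) := by
    rw [hval]
    exact g.contDiffAt_chart j hye
  have hw : ContDiffAt ℝ r (branchWeight e e' Γ p.pot) (e x) := by
    have h1 : ContDiffAt ℝ r (p.pot ∘ e'.symm) ((e' ∘ Γ ∘ e.symm) (e x)) := by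
      rw [hval]
      exact p.crPot.contDiffAt_chart j hye
    exact Real.contDiff_exp.contDiffAt.comp _ (h1.comp (e x) hf)
  have hwval : branchWeight e e' Γ p.pot (e x) = Real.exp (p.pot y) := by
    simp only [branchWeight, hval, Function.comp_apply, e'.left_inv hye]
  refine ⟨(hw.smul (hg.comp (e x) hf)).of_le hsr, ?_⟩
  have h1 := hK _ _ _ (e x) b (hw.of_le hsr) (hg.of_le hsr) (hf.of_le hsr) hb
    (fun k hk => (hbound k (hk.trans hs)).1) (fun k hk => (hbound k (hk.trans hs)).2)
    (fun k hk => by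
      rw [hval]
      exact hgb k hk j y hy) v
  have hΓc : ContinuousAt Γ x := hΓ.contMDiffAt.continuousAt
  have hr0 : (r : WithTop ℕ∞) ≠ 0 := by exact_mod_cast (by lia : r ≠ 0)
  -- The branch maps metric unit vectors to vectors of metric length at most `ℓ`, so the leading
  -- term is bounded with exactly the factor `ℓ ^ s`, without chart constants. Chart constants enter
  -- only in the lower order terms.
  have h2 : ‖iteratedFDeriv ℝ s (g ∘ e'.symm) ((e' ∘ Γ ∘ e.symm) (e x))
      (fun a => fderiv ℝ (e' ∘ Γ ∘ e.symm) (e x) (v a))‖ ≤ ℓ ^ s * B := by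
    rw [hval]
    exact norm_map_le_of_metricBall hℓ (hB j y hy) fun a =>
      fderiv_mem_metricBall hxe hye hΓ.apply hΓc hCc0
        ((hCc.2 j y hy).mono fun p hp => hp.1) hℓ.le hlip (hf.differentiableAt hr0) (hv a)
  have h3 : ∏ a, ‖v a‖ ≤ Cc ^ s := by
    calc ∏ a, ‖v a‖ ≤ ∏ _a : Fin s, Cc :=
          Finset.prod_le_prod (fun _ _ => norm_nonneg _) fun a _ => by
            have := norm_le_of_mem_metricBall hxe hCc0
              ((hCc.2 i x hx).mono fun p hp => hp.2) (hv a)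
            rwa [mul_one] at this
      _ = Cc ^ s := by simp
  rw [hwval] at h1
  set D := iteratedFDeriv ℝ s (g ∘ e'.symm) ((e' ∘ Γ ∘ e.symm) (e x))
      (fun a => fderiv ℝ (e' ∘ Γ ∘ e.symm) (e x) (v a))
  have h4 : ‖Real.exp (p.pot y) • D‖ ≤ Real.exp S * ℓ ^ s * B := by
    rw [norm_smul, Real.norm_eq_abs, Real.abs_exp, mul_assoc]
    exact mul_le_mul (Real.exp_le_exp.2 hS) h2 (norm_nonneg _) (Real.exp_pos _).le
  have h5 := norm_le_norm_add_norm_sub' (iteratedFDeriv ℝ s (branchTerm e e' Γ p.pot g) (e x) v)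
    (Real.exp (p.pot y) • D)
  refine h5.trans (add_le_add h4 (h1.trans ?_))
  exact mul_le_mul_of_nonneg_left h3 (by positivity)

/-- The Lasota–Yorke inequality for a single transfer operator. -/
theorem IsCoveringFamily.exists_unitBound_transferCr (h : IsCoveringFamily d ℱ) (hr : 1 ≤ r)
    {Cc : ℝ} (hCc : HasChartConstant 𝔠 Cc) (C : ℝ) {κ : ℝ} :
    ∃ C', 0 ≤ C' ∧ ∀ p : Param ℱ 𝒲, HasExpansion d r κ p.map →
      (∀ i j y, HasBranchBound 𝔠 r p C i j y) → ∀ s, 1 ≤ s → s ≤ r →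
      ∀ (g : CrFun 𝔠 r 𝕜) (S B b : ℝ), (∀ x, p.pot x ≤ S) → 0 ≤ B → UnitBound g s B → 0 ≤ b →
      (∀ k < s, ∀ i, ∀ x ∈ 𝔠.K i, ‖g.derivAt i k x‖ ≤ b) →
      UnitBound (h.transferCr hr p g) s (Real.exp S * κ * B + C' * b) := by
  have hCc0 : 0 ≤ Cc := zero_le_one.trans hCc.1
  -- The bound for the leading term requires a constant that is at least one, hence `max C 1`. The
  -- sum over all orders then gives one constant for every `s ≤ r`.
  choose K hK0 hK using fun s => exists_leading_term_bound (Eu m) (Eu m) 𝕜 s (le_max_right C 1)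
  have hnn : ∀ s, 0 ≤ d * (K s * Cc ^ s) := fun s =>
    mul_nonneg (Nat.cast_nonneg _) (mul_nonneg (hK0 s) (pow_nonneg hCc0 s))
  refine ⟨∑ s ∈ Finset.range (r + 1), d * (K s * Cc ^ s), Finset.sum_nonneg fun s _ => hnn s, ?_⟩
  intro p hexp hbr s hs1 hs g S B b hS hB0 hB hb hgb i x hx v hv
  obtain ⟨ℓ, hℓ0, hℓ, hsum⟩ := hexp
  obtain ⟨β, hβ⟩ := h.exists_isEnum p x
  have hcov : ∀ k, ∃ j, β k ∈ 𝔠.K j := fun k => mem_iUnion.1 (𝔠.cover.symm ▸ mem_univ (β k))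
  choose j hj using hcov
  have hxk : ∀ k, p.map (β k) ∈ 𝔠.K i := fun k => by rwa [hβ.apply k]
  choose Γ hΓ hbound using fun k => hbr i (j k) (β k) (hj k) (hxk k)
  have key : ∀ k, ContDiffAt ℝ s (branchTerm (𝔠.chart i) (𝔠.chart (j k)) (Γ k) p.pot g)
      (𝔠.chart i x) ∧
      ‖iteratedFDeriv ℝ s (branchTerm (𝔠.chart i) (𝔠.chart (j k)) (Γ k) p.pot g) (𝔠.chart i x) v‖
        ≤ Real.exp S * ℓ (β k) ^ s * B + K s * b * Cc ^ s := by
    intro k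
    have := norm_branchTerm_le hs1 hs hCc (hK0 s) (hK s) (hΓ k) (hj k) (hxk k)
      (fun n hn => ⟨((hbound k n hn).1).trans (le_max_left _ _),
        ((hbound k n hn).2).trans (le_max_left _ _)⟩) (hℓ0 (β k))
      ((hΓ k).eventually_dist_le (hℓ (β k))) g (hS (β k)) hB hb hgb (v := v)
      (by rwa [hβ.apply k])
    rwa [hβ.apply k] at this
  have hev := transfer_eventuallyEq hr h.pos p.crMap (h.localDiffeo _ p.1.2) (h.degree _ p.1.2) hβ
    hΓ (𝔠.K_subset i hx) (fun k => 𝔠.K_subset (j k) (hj k)) p.pot g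
  have hD : (h.transferCr hr p g).derivAt i s x
      = ∑ k, iteratedFDeriv ℝ s (branchTerm (𝔠.chart i) (𝔠.chart (j k)) (Γ k) p.pot g)
        (𝔠.chart i x) :=
    (hev.iteratedFDeriv ℝ s).eq_of_nhds.trans (iteratedFDeriv_sum_apply fun k _ => (key k).1)
  rw [hD, sum_apply]
  refine (norm_sum_le_of_le _ fun k _ => (key k).2).trans ?_
  rw [Finset.sum_add_distrib, ← Finset.sum_mul, ← Finset.mul_sum]
  refine add_le_add ?_ ?_
  · have := hsum x β hβ s hs1 hs
    gcongr
  · have h1 := Finset.single_le_sum (fun s _ => hnn s)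
      (Finset.mem_range.2 (Nat.lt_succ_of_le hs))
    simp only [Finset.sum_const, Finset.card_univ, Fintype.card_fin, nsmul_eq_mul]
    calc (d : ℝ) * (K s * b * Cc ^ s) = (d * (K s * Cc ^ s)) * b := by ring
      _ ≤ _ := mul_le_mul_of_nonneg_right h1 hb

end LasotaYorke

end

section

/-! ### The integrated operator on `C^r(M)` -/

section Integrated

variable {m : ℕ} {M : Type*} [MetricSpace M] [CompactSpace M] [ChartedSpace (Eu m) M]
  [IsManifold (𝓡 m) ∞ M] {𝔠 : ChartCover m M} {r d : ℕ} {𝕜 : Type} [RCLike 𝕜]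
  {ℱ : Set (CrMap m M r)} {𝒲 : Set (CrFun 𝔠 r ℝ)}

theorem UnitBound.mono {g : CrFun 𝔠 r 𝕜} {s : ℕ} {B B' : ℝ} (h : UnitBound g s B) (hB : B ≤ B') :
    UnitBound g s B' := fun i x hx v hv => (h i x hx v hv).trans hB

/-- The real normed space underlying `C^r(M, 𝕜)`. -/
@[reducible] noncomputable def CrFun.normedSpaceReal (𝔠 : ChartCover m M) (r : ℕ) (𝕜 : Type)
    [RCLike 𝕜] : NormedSpace ℝ (CrFun 𝔠 r 𝕜) := NormedSpace.restrictScalars ℝ 𝕜 _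

/-- Bounds for the transfer operator of a pair on `C^r(M, 𝕜)`. -/
structure IsCoveringFamily.IsBounded (h : IsCoveringFamily d ℱ) (hr : 1 ≤ r) (𝕜 : Type) [RCLike 𝕜]
    (εφ κ C : ℝ) (p : Param ℱ 𝒲) : Prop where
  nonneg : 0 ≤ C
  pot_le : ∀ x, |p.pot x| ≤ C
  norm_le : ∀ g : CrFun 𝔠 r 𝕜, ‖h.transferCr hr p g‖ ≤ C * ‖g‖
  unitBound : ∀ s, 1 ≤ s → s ≤ r → ∀ (g : CrFun 𝔠 r 𝕜) (B b : ℝ), 0 ≤ B → UnitBound g s B →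
    0 ≤ b → (∀ k < s, ∀ i, ∀ x ∈ 𝔠.K i, ‖g.derivAt i k x‖ ≤ b) →
    UnitBound (h.transferCr hr p g) s (Real.exp (p.potMin + εφ) * κ * B + C * b)

/-- The Lasota–Yorke inequalities for an operator of `C^r(M, 𝕜)`. -/
structure IsLasotaYorke (ρ C : ℝ) (A : CrFun 𝔠 r 𝕜 →L[𝕜] CrFun 𝔠 r 𝕜) : Prop where
  norm_le : ∀ g, ‖A g‖ ≤ C * ‖g‖
  unitBound : ∀ s, 1 ≤ s → s ≤ r → ∀ (g : CrFun 𝔠 r 𝕜) (B b : ℝ), 0 ≤ B → UnitBound g s B →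
    0 ≤ b → (∀ k < s, ∀ i, ∀ x ∈ 𝔠.K i, ‖g.derivAt i k x‖ ≤ b) →
    UnitBound (A g) s (ρ * B + C * b)

namespace IsCoveringFamily

variable (h : IsCoveringFamily d ℱ) (hr : 1 ≤ r)

theorem IsBounded.mono {h : IsCoveringFamily d ℱ} {hr : 1 ≤ r} {εφ κ C C' : ℝ} {p : Param ℱ 𝒲}
    (hp : h.IsBounded hr 𝕜 εφ κ C p) (hC : C ≤ C') : h.IsBounded hr 𝕜 εφ κ C' p :=
  ⟨hp.nonneg.trans hC, fun x => (hp.pot_le x).trans hC, fun g => (hp.norm_le g).trans (by gcongr),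
    fun s hs1 hs g B b hB hg hb hgb => (hp.unitBound s hs1 hs g B b hB hg hb hgb).mono (by gcongr)⟩

theorem exists_eventually_isBounded (hM : IsLengthManifold m M) (h : IsCoveringFamily d ℱ)
    (hr : 1 ≤ r) {εφ κ : ℝ} (hexp : ∀ p : Param ℱ 𝒲, HasExpansion d r κ p.map)
    (hosc : ∀ (p : Param ℱ 𝒲) (x : M), p.pot x ≤ p.potMin + εφ) (p₀ : Param ℱ 𝒲) :
    ∃ C, ∀ᶠ p in 𝓝 p₀, h.IsBounded hr 𝕜 εφ κ C p := by
  obtain ⟨C₁, h1⟩ := h.eventually_norm_transferCr_le (𝒲 := 𝒲) (𝕜 := 𝕜) hr p₀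
  obtain ⟨C₂, h2⟩ := h.eventually_hasBranchBound (𝒲 := 𝒲) hr p₀
  obtain ⟨Cc, hCc⟩ := hM.exists_hasChartConstant 𝔠
  obtain ⟨C₃, hC₃, h3⟩ := h.exists_unitBound_transferCr (𝒲 := 𝒲) (𝕜 := 𝕜) hr hCc C₂ (κ := κ)
  have h4 : ∀ᶠ p : Param ℱ 𝒲 in 𝓝 p₀, ‖p.crPot‖ < ‖p₀.crPot‖ + 1 :=
    (Param.continuous_crPot.norm.tendsto p₀).eventually_lt_const (by linarith)
  refine ⟨|C₁| + C₃ + (‖p₀.crPot‖ + 1), ?_⟩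
  filter_upwards [h1, h2, h4] with p h1 h2 h4
  have hn := norm_nonneg p₀.crPot
  have hn1 := abs_nonneg C₁
  refine ⟨by positivity, fun x => ?_, fun g => ?_, fun s hs1 hs g B b hB hg hb hgb => ?_⟩
  · have := p.crPot.norm_apply_le x
    rw [Real.norm_eq_abs] at this
    refine le_trans (this.trans h4.le) ?_
    linarith
  · refine (h1 g).trans ?_
    gcongr
    linarith [le_abs_self C₁]
  · refine (h3 p (hexp p) h2 s hs1 hs g _ B b (hosc p) hB hg hb hgb).mono ?_
    gcongr
    linarith

attribute [local instance] CrFun.normedSpaceReal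

variable {θ : Measure (Param ℱ 𝒲)} [IsProbabilityMeasure θ] {εφ κ C : ℝ}

theorem integrable_transferCLM (hC : ∀ᵐ p ∂θ, h.IsBounded hr 𝕜 εφ κ C p) (g : CrFun 𝔠 r 𝕜) :
    Integrable (fun p => h.transferCLM hr p g) θ := by
  refine Integrable.of_bound (h.continuous_transferCLM hr g).aestronglyMeasurable (C * ‖g‖) ?_
  filter_upwards [hC] with p hp using hp.norm_le g

/-- The integrated transfer operator on `C^r(M, 𝕜)`. -/
noncomputable def integratedCr (hC : ∀ᵐ p ∂θ, h.IsBounded hr 𝕜 εφ κ C p) :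
    CrFun 𝔠 r 𝕜 →L[𝕜] CrFun 𝔠 r 𝕜 :=
  LinearMap.mkContinuous
    { toFun := fun g => ∫ p, h.transferCLM hr p g ∂θ
      map_add' := fun g g' => by
        simp only [map_add]
        exact integral_add (h.integrable_transferCLM hr hC g) (h.integrable_transferCLM hr hC g')
      map_smul' := fun c g => by
        simp only [map_smul]
        exact integral_smul c _ }
    C fun g => by
      refine (norm_integral_le_of_norm_le_const (C := C * ‖g‖) ?_).trans_eq (by simp)
      filter_upwards [hC] with p hp using hp.norm_le g

theorem integratedCr_eq (hC : ∀ᵐ p ∂θ, h.IsBounded hr 𝕜 εφ κ C p) (g : CrFun 𝔠 r 𝕜) :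
    h.integratedCr hr hC g = ∫ p, h.transferCLM hr p g ∂θ := rfl

theorem norm_integratedCr_le (hC : ∀ᵐ p ∂θ, h.IsBounded hr 𝕜 εφ κ C p) (g : CrFun 𝔠 r 𝕜) :
    ‖h.integratedCr hr hC g‖ ≤ C * ‖g‖ := by
  rw [integratedCr_eq]
  refine (norm_integral_le_of_norm_le_const (C := C * ‖g‖) ?_).trans_eq (by simp)
  filter_upwards [hC] with p hp using hp.norm_le g

theorem integratedCr_apply (hC : ∀ᵐ p ∂θ, h.IsBounded hr 𝕜 εφ κ C p) (g : CrFun 𝔠 r 𝕜) (x : M) :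
    h.integratedCr hr hC g x = integratedTransfer θ g x := by
  rw [integratedCr_eq, ← CrFun.evalCLM_apply,
    ← (CrFun.evalCLM x).integral_comp_comm (h.integrable_transferCLM hr hC g)]
  rfl

/-- The derivative at a point and the evaluation at `v` are continuous linear maps on `C^r(M)`, so
they commute with the Bochner integral. -/
theorem derivAt_integratedCr (hC : ∀ᵐ p ∂θ, h.IsBounded hr 𝕜 εφ κ C p) (g : CrFun 𝔠 r 𝕜)
    {i : Fin 𝔠.N} {s : ℕ} (hs : s ≤ r) {x : M} (hx : x ∈ 𝔠.K i) (v : Fin s → Eu m) :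
    (h.integratedCr hr hC g).derivAt i s x v
      = ∫ p, (h.transferCr hr p g).derivAt i s x v ∂θ := by
  have h1 := h.integrable_transferCLM hr hC g
  rw [integratedCr_eq, ← CrFun.derivCLM_apply i hs hx,
    ← (CrFun.derivCLM i hs hx).integral_comp_comm h1]
  have h2 := ((CrFun.derivCLM i hs hx).restrictScalars ℝ).integrable_comp h1
  exact ((ContinuousMultilinearMap.apply ℝ (fun _ : Fin s => Eu m) 𝕜 v).integral_comp_comm h2).symm

/-- The integrated transfer operator on `C^r(M, 𝕜)`, divided by `∫ d e^{min φ} dθ`. -/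
noncomputable def normalizedCr (hC : ∀ᵐ p ∂θ, h.IsBounded hr 𝕜 εφ κ C p) :
    CrFun 𝔠 r 𝕜 →L[𝕜] CrFun 𝔠 r 𝕜 :=
  (((mass d θ)⁻¹ : ℝ) : 𝕜) • h.integratedCr hr hC

theorem normalizedCr_eq (hC : ∀ᵐ p ∂θ, h.IsBounded hr 𝕜 εφ κ C p) (g : CrFun 𝔠 r 𝕜) :
    h.normalizedCr hr hC g = (((mass d θ)⁻¹ : ℝ) : 𝕜) • h.integratedCr hr hC g := rfl

theorem normalizedCr_apply (hC : ∀ᵐ p ∂θ, h.IsBounded hr 𝕜 εφ κ C p) (g : CrFun 𝔠 r 𝕜) (x : M) :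
    h.normalizedCr hr hC g x = (((mass d θ)⁻¹ : ℝ) : 𝕜) * integratedTransfer θ g x := by
  rw [← h.integratedCr_apply hr hC]
  rfl

theorem inv_mass_le [Nonempty M] (h : IsCoveringFamily d ℱ)
    (hC : ∀ᵐ p ∂θ, ∀ x, |p.pot x| ≤ C) : (mass d θ)⁻¹ ≤ Real.exp C := by
  have h1 := le_mass (d := d) hC
  have h2 : (1 : ℝ) ≤ d := by exact_mod_cast h.pos
  rw [inv_le_comm₀ (mass_pos h.pos hC) (Real.exp_pos _), ← Real.exp_neg]
  exact (le_mul_of_one_le_left (Real.exp_pos _).le h2).trans h1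

/-- The coefficient of `B` for a single pair is `e^{min φ + εφ} κ = ρ d e^{min φ}`. It integrates to
`ρ` times `mass`, so the normalization again leaves the factor `ρ`; in the other terms `mass⁻¹ ≤
e^C`. -/
theorem isLasotaYorke [Nonempty M] (hC : ∀ᵐ p ∂θ, h.IsBounded hr 𝕜 εφ κ C p) :
    IsLasotaYorke (Real.exp εφ * (κ / d)) (Real.exp C * C) (h.normalizedCr hr hC) := by
  have hR : ∀ᵐ p ∂θ, ∀ x, |p.pot x| ≤ C := hC.mono fun p hp => hp.pot_le
  have hΛ := mass_pos h.pos hR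
  have hΛC := h.inv_mass_le hR
  obtain ⟨p₁, hp₁⟩ := hC.exists
  have hC0 := hp₁.nonneg
  have hd : (0 : ℝ) < d := by exact_mod_cast h.pos
  have hnorm : ‖(((mass d θ)⁻¹ : ℝ) : 𝕜)‖ = (mass d θ)⁻¹ := by
    rw [RCLike.norm_ofReal, abs_of_pos (inv_pos.2 hΛ)]
  refine ⟨fun g => ?_, fun s hs1 hs g B b hB hg hb hgb i x hx v hv => ?_⟩
  · rw [normalizedCr_eq, norm_smul, hnorm, mul_assoc]
    exact mul_le_mul hΛC (h.norm_integratedCr_le hr hC g) (norm_nonneg _) (Real.exp_pos _).le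
  · rw [normalizedCr_eq, ← CrFun.derivCLM_apply i hs hx, map_smul, smul_apply,
      CrFun.derivCLM_apply i hs hx, norm_smul, hnorm, derivAt_integratedCr h hr hC g hs hx]
    have hint : Integrable (fun p : Param ℱ 𝒲 =>
        Real.exp εφ * (κ / d) * B * (d * Real.exp p.potMin) + C * b) θ :=
      ((integrable_mass hR).const_mul _).add (integrable_const _)
    have h1 : ‖∫ p, (h.transferCr hr p g).derivAt i s x v ∂θ‖
        ≤ Real.exp εφ * (κ / d) * B * mass d θ + C * b := by
      refine (norm_integral_le_of_norm_le hint ?_).trans_eq ?_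
      · filter_upwards [hC] with p hp
        refine (hp.unitBound s hs1 hs g B b hB hg hb hgb i x hx v hv).trans_eq ?_
        rw [Real.exp_add]
        field_simp
      · rw [integral_add ((integrable_mass hR).const_mul _) (integrable_const _),
          integral_const_mul]
        simp [mass]
    calc (mass d θ)⁻¹ * ‖∫ p, (h.transferCr hr p g).derivAt i s x v ∂θ‖
        ≤ (mass d θ)⁻¹ * (Real.exp εφ * (κ / d) * B * mass d θ + C * b) := by gcongr
      _ = Real.exp εφ * (κ / d) * B + (mass d θ)⁻¹ * (C * b) := by field_simp
      _ ≤ Real.exp εφ * (κ / d) * B + Real.exp C * (C * b) := by gcongr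
      _ = _ := by ring

end IsCoveringFamily

end Integrated

end

section

/-! ### From decay of the sup norm to decay in `C^r` -/

section Contraction

variable {m : ℕ} {M : Type*} [MetricSpace M] [CompactSpace M] [ChartedSpace (Eu m) M]
  [IsManifold (𝓡 m) ∞ M] {𝔠 : ChartCover m M} {r d : ℕ} {𝕜 : Type} [RCLike 𝕜]
  {ℱ : Set (CrMap m M r)} {𝒲 : Set (CrFun 𝔠 r ℝ)}

theorem IsLasotaYorke.norm_pow_le {ρ C : ℝ} {A : CrFun 𝔠 r 𝕜 →L[𝕜] CrFun 𝔠 r 𝕜}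
    (hA : IsLasotaYorke ρ C A) (hC : 0 ≤ C) (n : ℕ) (g : CrFun 𝔠 r 𝕜) :
    ‖(A ^ n) g‖ ≤ C ^ n * ‖g‖ := by
  induction n with
  | zero => simp
  | succ n ih =>
    rw [pow_succ', mul_apply_eq_comp, pow_succ', mul_assoc]
    exact (hA.norm_le _).trans (by gcongr)

/-- Decay of the supremum norm and the Lasota–Yorke inequalities give decay of all derivatives. -/
theorem exists_norm_derivAt_pow_le {Cc ρ C : ℝ} (hCc : HasChartConstant 𝔠 Cc) (hρ : 0 ≤ ρ)
    (hρ1 : ρ < 1) (hC : 0 ≤ C) (n₀ : ℝ → ℕ) (s : ℕ) (hs : s ≤ r) (η : ℝ) (hη : 0 < η) :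
    ∃ n₂ : ℕ, ∀ (A : CrFun 𝔠 r 𝕜 →L[𝕜] CrFun 𝔠 r 𝕜) (l : ℝ) (g : CrFun 𝔠 r 𝕜),
      IsLasotaYorke ρ C A → 1 ≤ l →
      (∀ η > 0, ∀ n ≥ n₀ η, ∀ x, ‖(A ^ n) g x‖ ≤ η * ‖g‖ * l ^ n) →
      ∀ n ≥ n₂, ∀ k ≤ s, ∀ i, ∀ x ∈ 𝔠.K i, ‖((A ^ n) g).derivAt i k x‖ ≤ η * ‖g‖ * l ^ n := by
  induction s generalizing η with
  | zero =>
    refine ⟨n₀ η, fun A l g _ _ hg n hn k hk i x hx => ?_⟩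
    obtain rfl := Nat.le_zero.1 hk
    rw [CrFun.norm_derivAt_zero _ i hx]
    exact hg η hη n hn x
  | succ s ih =>
    have hCc0 : 0 < Cc := one_pos.trans_le hCc.1
    have hρ' : 0 < 1 - ρ := by linarith
    -- The lower derivatives, once they are bounded by `η'`, contribute at most `Q η'` to the
    -- derivative of order `s + 1`. The choice of `η'` makes this at most `η / 2`.
    set Q := Cc ^ (s + 1) * (C / (1 - ρ)) with hQ
    have hQ0 : 0 ≤ Q := by positivity
    set η' := η / (2 * (Q + 1)) with hη'
    have hη'0 : 0 < η' := by positivity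
    have hη'Q : (Q + 1) * η' = η / 2 := by rw [hη']; field_simp
    obtain ⟨n₁, hn₁⟩ := ih (by lia) η' hη'0
    set D := C ^ n₁ * Cc ^ (s + 1) with hD
    have hD0 : 0 ≤ D := by positivity
    have hlim : Tendsto (fun k : ℕ => Cc ^ (s + 1) * (ρ ^ k * D)) atTop
        (𝓝 (Cc ^ (s + 1) * (0 * D))) :=
      ((tendsto_pow_atTop_nhds_zero_of_lt_one hρ hρ1).mul_const D).const_mul _
    obtain ⟨k₀, hk₀⟩ := eventually_atTop.1
      (hlim.eventually_lt_const (show Cc ^ (s + 1) * (0 * D) < η / 2 by simpa using half_pos hη))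
    refine ⟨n₁ + k₀, fun A l g hA hl hg n hn j hj i x hx => ?_⟩
    have hl0 : 0 < l := one_pos.trans_le hl
    have hsmall := hn₁ A l g hA hl hg
    rcases Nat.lt_or_ge s j with hsj | hsj
    swap
    · refine (hsmall n (by lia) j hsj i x hx).trans ?_
      gcongr
      nlinarith
    obtain rfl : j = s + 1 := by lia
    -- From time `n₁` on, the lower derivatives are small, and the bound obeys the affine recursion
    -- `t ↦ ρ t + C η'`, with fixed point `C η' / (1 - ρ)`. The crude bound `D` at time `n₁` is
    -- damped by `ρ ^ k`. As `l ≥ 1`, the factor `l ^ n` may grow along.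
    have hunit : ∀ k : ℕ, UnitBound ((A ^ (n₁ + k)) g) (s + 1)
        ((ρ ^ k * D + C * η' / (1 - ρ)) * ‖g‖ * l ^ (n₁ + k)) := by
      intro k
      induction k with
      | zero =>
        refine (unitBound_of_norm_derivAt_le hCc fun i x hx =>
          (CrFun.norm_derivAt_le _ hs hx).trans (hA.norm_pow_le hC n₁ g)).mono ?_
        have h1 : 1 ≤ l ^ n₁ := one_le_pow₀ hl
        have h2 : 0 ≤ C * η' / (1 - ρ) := by positivity
        calc C ^ n₁ * ‖g‖ * Cc ^ (s + 1) = D * ‖g‖ * 1 := by rw [hD]; ring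
          _ ≤ (D + C * η' / (1 - ρ)) * ‖g‖ * l ^ n₁ := by gcongr; linarith
          _ = _ := by simp
      | succ k ihk =>
        have h1 := hA.unitBound (s + 1) (by lia) hs _ _ (η' * ‖g‖ * l ^ (n₁ + k)) (by positivity)
          ihk (by positivity) fun j hj i x hx => hsmall (n₁ + k) (by lia) j (by lia) i x hx
        rw [← add_assoc, pow_succ' A, mul_apply_eq_comp]
        refine h1.mono ?_
        have h2 : C * η' / (1 - ρ) = ρ * (C * η' / (1 - ρ)) + C * η' := by
          field_simp
          ring
        calc ρ * ((ρ ^ k * D + C * η' / (1 - ρ)) * ‖g‖ * l ^ (n₁ + k))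
              + C * (η' * ‖g‖ * l ^ (n₁ + k))
            = (ρ ^ (k + 1) * D + (ρ * (C * η' / (1 - ρ)) + C * η')) * ‖g‖ * l ^ (n₁ + k) := by
              ring
          _ = (ρ ^ (k + 1) * D + C * η' / (1 - ρ)) * ‖g‖ * l ^ (n₁ + k) := by rw [← h2]
          _ ≤ (ρ ^ (k + 1) * D + C * η' / (1 - ρ)) * ‖g‖ * l ^ (n₁ + k + 1) :=
              mul_le_mul_of_nonneg_left (pow_le_pow_right₀ hl (Nat.le_succ _)) (by positivity)
    obtain ⟨k, rfl⟩ : ∃ k, n = n₁ + k := ⟨n - n₁, by lia⟩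
    refine ((hunit k).norm_derivAt_le hCc (by positivity) hx).trans ?_
    rw [← mul_assoc, ← mul_assoc]
    gcongr
    have h3 := hk₀ k (by lia)
    calc Cc ^ (s + 1) * (ρ ^ k * D + C * η' / (1 - ρ))
        = Cc ^ (s + 1) * (ρ ^ k * D) + Q * η' := by rw [hQ]; ring
      _ ≤ η / 2 + (Q + 1) * η' := by
          gcongr
          linarith
      _ = η := by rw [hη'Q]; ring

theorem exists_norm_pow_le {Cc ρ C : ℝ} (hCc : HasChartConstant 𝔠 Cc) (hρ : 0 ≤ ρ)
    (hρ1 : ρ < 1) (hC : 0 ≤ C) (n₀ : ℝ → ℕ) {η : ℝ} (hη : 0 < η) :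
    ∃ n₂ : ℕ, ∀ (A : CrFun 𝔠 r 𝕜 →L[𝕜] CrFun 𝔠 r 𝕜) (l : ℝ) (g : CrFun 𝔠 r 𝕜),
      IsLasotaYorke ρ C A → 1 ≤ l →
      (∀ η > 0, ∀ n ≥ n₀ η, ∀ x, ‖(A ^ n) g x‖ ≤ η * ‖g‖ * l ^ n) →
      ∀ n ≥ n₂, ‖(A ^ n) g‖ ≤ η * ‖g‖ * l ^ n := by
  obtain ⟨n₂, h⟩ := exists_norm_derivAt_pow_le (𝕜 := 𝕜) hCc hρ hρ1 hC n₀ r le_rfl η hη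
  refine ⟨n₂, fun A l g hA hl hg n hn => CrFun.norm_le_of_derivAt _ (by positivity)
    fun i s hs x hx => h A l g hA hl hg n hn s hs i x hx⟩

/-- A real-linear functional of a `C^r` function, as a continuous function. -/
noncomputable def CrFun.compC (L : 𝕜 →L[ℝ] ℝ) (g : CrFun 𝔠 r 𝕜) : C(M, ℝ) :=
  ⟨fun x => L (g x), L.continuous.comp g.continuous⟩

namespace IsCoveringFamily

variable (h : IsCoveringFamily d ℱ) (hr : 1 ≤ r) {θ : Measure (Param ℱ 𝒲)} [IsProbabilityMeasure θ]
  {εφ κ C R : ℝ}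

theorem integratedTransfer_comp (h : IsCoveringFamily d ℱ) (hr : 1 ≤ r)
    (hR : ∀ᵐ p ∂θ, ∀ x, |p.pot x| ≤ R) (L : 𝕜 →L[ℝ] ℝ)
    (g : C(M, 𝕜)) (x : M) :
    L (integratedTransfer θ g x) = integratedTransfer θ (fun y => L (g y)) x := by
  rw [integratedTransfer, ← L.integral_comp_comm (h.integrable_transfer hr hR g x)]
  refine integral_congr_ae (Eventually.of_forall fun p => ?_)
  obtain ⟨b, hb⟩ := h.exists_isEnum p x
  simp only [transfer_eq_sum hb, map_sum, ← RCLike.real_smul_eq_coe_mul, map_smul, smul_eq_mul]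

/-- The operators on `C(M)` and on `C^r(M)` are given by the same real kernel. So real-linear
functionals of the values, such as real and imaginary parts, transfer the results on real continuous
functions to both scalar fields. -/
theorem compC_normalizedCr_pow (hC : ∀ᵐ p ∂θ, h.IsBounded hr 𝕜 εφ κ C p)
    (hR : ∀ᵐ p ∂θ, ∀ x, |p.pot x| ≤ R) (L : 𝕜 →L[ℝ] ℝ) (n : ℕ) (g : CrFun 𝔠 r 𝕜) :
    (((mass d θ)⁻¹ • h.integratedC hr θ hR) ^ n) (CrFun.compC L g)
      = CrFun.compC L ((h.normalizedCr hr hC ^ n) g) := by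
  induction n with
  | zero => rfl
  | succ n ih =>
    rw [pow_succ', pow_succ', Module.End.mul_apply, ih, mul_apply_eq_comp]
    set u := (h.normalizedCr hr hC ^ n) g
    ext x
    change (mass d θ)⁻¹ * integratedTransfer θ (fun y => L (u y)) x
      = L (h.normalizedCr hr hC u x)
    rw [h.normalizedCr_apply hr hC, ← RCLike.real_smul_eq_coe_mul, map_smul, smul_eq_mul]
    exact congrArg _ (h.integratedTransfer_comp hr hR L ⟨u, u.continuous⟩ x).symm

end IsCoveringFamily

end Contraction

end

section

/-! ### Leading eigenvalue and eigenfunction with uniform constants -/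

section Leading

variable {m : ℕ} {M : Type*} [MetricSpace M] [CompactSpace M] [ChartedSpace (Eu m) M]
  [IsManifold (𝓡 m) ∞ M] {𝔠 : ChartCover m M} {r d : ℕ} {𝕜 : Type} [RCLike 𝕜]
  {ℱ : Set (CrMap m M r)} {𝒲 : Set (CrFun 𝔠 r ℝ)} [MeasurableSpace M] [BorelSpace M]

theorem CrFun.integrable (g : CrFun 𝔠 r 𝕜) (ν : Measure M) [IsFiniteMeasure ν] :
    Integrable g ν :=
  Integrable.of_bound g.continuous.aestronglyMeasurable ‖g‖ (Eventually.of_forall g.norm_apply_le)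

/-- Integration against a probability measure. -/
noncomputable def CrFun.integralCLM (𝔠 : ChartCover m M) (r : ℕ) (𝕜 : Type) [RCLike 𝕜]
    (ν : Measure M) [IsProbabilityMeasure ν] : CrFun 𝔠 r 𝕜 →L[𝕜] 𝕜 :=
  LinearMap.mkContinuous
    { toFun := fun g => ∫ x, g x ∂ν
      map_add' := fun g g' => integral_add (g.integrable ν) (g'.integrable ν)
      map_smul' := fun c g => integral_const_mul c _ }
    1 fun g => (norm_integral_le_of_norm_le_const (C := 1 * ‖g‖)
      (Eventually.of_forall fun x => by rw [one_mul]; exact g.norm_apply_le x)).trans_eq (by simp)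

theorem CrFun.integralCLM_apply (ν : Measure M) [IsProbabilityMeasure ν] (g : CrFun 𝔠 r 𝕜) :
    CrFun.integralCLM 𝔠 r 𝕜 ν g = ∫ x, g x ∂ν := rfl

theorem CrFun.integral_compC (ν : Measure M) [IsProbabilityMeasure ν] (L : 𝕜 →L[ℝ] ℝ)
    (g : CrFun 𝔠 r 𝕜) : ∫ x, CrFun.compC L g x ∂ν = L (∫ x, g x ∂ν) :=
  L.integral_comp_comm (g.integrable ν)

/-- A real function, regarded as a complex one. -/
noncomputable def CrFun.toComplex (g : CrFun 𝔠 r ℝ) : CrFun 𝔠 r ℂ :=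
  ⟨fun x => (g x : ℂ), Complex.ofRealCLM.contDiff.comp_contMDiff g.2⟩

namespace IsCoveringFamily

variable (h : IsCoveringFamily d ℱ) (hr : 1 ≤ r) {θ : Measure (Param ℱ 𝒲)} [IsProbabilityMeasure θ]
  {εφ κ C R : ℝ}

theorem integral_normalizedCr (hC : ∀ᵐ p ∂θ, h.IsBounded hr 𝕜 εφ κ C p)
    (hR : ∀ᵐ p ∂θ, ∀ x, |p.pot x| ≤ R) {ν : Measure M} [IsProbabilityMeasure ν] {l : ℝ}
    (hν : ∀ g : C(M, ℝ), ∫ x, ((mass d θ)⁻¹ • h.integratedC hr θ hR) g x ∂ν = l * ∫ x, g x ∂ν)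
    (g : CrFun 𝔠 r 𝕜) :
    CrFun.integralCLM 𝔠 r 𝕜 ν (h.normalizedCr hr hC g) = l * CrFun.integralCLM 𝔠 r 𝕜 ν g := by
  have key : ∀ L : 𝕜 →L[ℝ] ℝ, L (CrFun.integralCLM 𝔠 r 𝕜 ν (h.normalizedCr hr hC g))
      = L (l * CrFun.integralCLM 𝔠 r 𝕜 ν g) := by
    intro L
    rw [← RCLike.real_smul_eq_coe_mul, map_smul, smul_eq_mul, CrFun.integralCLM_apply,
      CrFun.integralCLM_apply, ← CrFun.integral_compC, ← CrFun.integral_compC, ← hν]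
    have h1 := h.compC_normalizedCr_pow hr hC hR L 1 g
    rw [pow_one, pow_one] at h1
    rw [h1]
  exact RCLike.ext (key RCLike.reCLM) (key RCLike.imCLM)

/-- Real and imaginary parts of `g` are `(K + 1) ‖g‖`-Lipschitz and bounded by the same constant,
and both have integral zero; the factor 2 adds the two parts. -/
theorem norm_normalizedCr_pow_apply_le (hC : ∀ᵐ p ∂θ, h.IsBounded hr 𝕜 εφ κ C p)
    (hR : ∀ᵐ p ∂θ, ∀ x, |p.pot x| ≤ R) {ν : Measure M} [IsProbabilityMeasure ν] {l η K : ℝ} {n : ℕ}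
    (hK0 : 0 ≤ K) (hK : ∀ (g : CrFun 𝔠 r 𝕜) (B : ℝ), 0 ≤ B →
      (∀ i, ∀ x ∈ 𝔠.K i, ‖g.derivAt i 1 x‖ ≤ B) → ∀ x y, ‖g x - g y‖ ≤ K * B * dist x y)
    (hν : ∀ (g : C(M, ℝ)) (N : ℝ), LipBound g N → ∫ x, g x ∂ν = 0 → ∀ x,
      |(((mass d θ)⁻¹ • h.integratedC hr θ hR) ^ n) g x| ≤ η * N * l ^ n)
    {g : CrFun 𝔠 r 𝕜} (hg : CrFun.integralCLM 𝔠 r 𝕜 ν g = 0) (x : M) :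
    ‖(h.normalizedCr hr hC ^ n) g x‖ ≤ η * (2 * (K + 1)) * ‖g‖ * l ^ n := by
  have key : ∀ L : 𝕜 →L[ℝ] ℝ, (∀ z, |L z| ≤ ‖z‖) →
      |L ((h.normalizedCr hr hC ^ n) g x)| ≤ η * ((K + 1) * ‖g‖) * l ^ n := by
    intro L hL
    have h1 := hν (CrFun.compC L g) ((K + 1) * ‖g‖) ⟨fun y => ?_, fun y z => ?_⟩ ?_ x
    · rw [h.compC_normalizedCr_pow hr hC hR] at h1
      exact h1
    · refine (hL (g y)).trans ((g.norm_apply_le y).trans ?_)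
      nlinarith [norm_nonneg g]
    · change |L (g y) - L (g z)| ≤ _
      rw [← map_sub]
      refine (hL _).trans ((hK g ‖g‖ (norm_nonneg g)
        (fun i x hx => g.norm_derivAt_le hr hx) y z).trans ?_)
      gcongr
      linarith
    · rw [CrFun.integral_compC]
      rw [CrFun.integralCLM_apply] at hg
      rw [hg, map_zero]
  have h1 := key RCLike.reCLM RCLike.abs_re_le_norm
  have h2 := key RCLike.imCLM RCLike.abs_im_le_norm
  set z := (h.normalizedCr hr hC ^ n) g x
  have h3 : ‖z‖ ≤ |RCLike.re z| + |RCLike.im z| := by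
    conv_lhs => rw [← RCLike.re_add_im z]
    refine (norm_add_le _ _).trans (add_le_add (RCLike.norm_ofReal _).le ?_)
    rw [norm_mul, RCLike.norm_ofReal]
    refine mul_le_of_le_one_right (abs_nonneg _) ?_
    rw [RCLike.norm_I]
    split_ifs <;> norm_num
  refine h3.trans ((add_le_add h1 h2).trans_eq ?_)
  ring

theorem integratedTransfer_ofReal (h : IsCoveringFamily d ℱ) (g : M → ℝ) (x : M) :
    integratedTransfer θ (fun y => (g y : ℂ)) x = ((integratedTransfer θ g x : ℝ) : ℂ) := by
  rw [integratedTransfer, integratedTransfer, ← integral_complex_ofReal]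
  refine integral_congr_ae (Eventually.of_forall fun p => ?_)
  obtain ⟨b, hb⟩ := h.exists_isEnum p x
  simp [transfer_eq_sum hb]

theorem integratedCr_eq_smul [Nonempty M] (hC : ∀ᵐ p ∂θ, h.IsBounded hr 𝕜 εφ κ C p) :
    h.integratedCr hr hC = ((mass d θ : ℝ) : 𝕜) • h.normalizedCr hr hC := by
  have hΛ := mass_pos h.pos (hC.mono fun p hp => hp.pot_le)
  rw [normalizedCr, smul_smul, ← RCLike.ofReal_mul, mul_inv_cancel₀ hΛ.ne', RCLike.ofReal_one,
    one_smul]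

/-- This joins the sup norm theory to the Lasota–Yorke inequalities. The order of the quantifiers is
the point: `H`, `K` and `c` are fixed before the measure, depending only on the bounds that all
admissible measures share. -/
theorem exists_leading [Nonempty M] (hM : IsLengthManifold m M) (h : IsCoveringFamily d ℱ)
    (hr : 1 ≤ r) {b : ℝ} (hκ : 0 < κ) (hκ1 : Real.exp εφ * (κ / d) < 1) (hC0 : 0 ≤ C) (hb : 0 ≤ b)
    (hpair : ∀ p : Param ℱ 𝒲, HasPairing d κ p.map)
    (hlip : ∀ (p : Param ℱ 𝒲) (x y : M), |p.pot x - p.pot y| ≤ b * dist x y)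
    (hosc : ∀ (p : Param ℱ 𝒲) (x : M), p.pot x ≤ p.potMin + εφ) :
    ∃ H K c : ℝ, 1 ≤ H ∧ 0 ≤ K ∧ 0 ≤ c ∧ c < 1 ∧
      ∀ (θ : Measure (Param ℱ 𝒲)) [IsProbabilityMeasure θ]
        (hCR : ∀ᵐ p ∂θ, h.IsBounded hr ℝ εφ κ C p) (_ : ∀ᵐ p ∂θ, h.IsBounded hr ℂ εφ κ C p),
        ∃ (l : ℝ) (u : CrFun 𝔠 r ℝ), 1 ≤ l ∧
          HasLeadingData (integratedTransfer θ) (integratedTransfer θ) (mass d θ * l) u ∧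
          (∀ (n : ℕ) (x : M), l ^ n ≤ H * (h.normalizedCr hr hCR ^ n) (CrFun.const 𝔠 r 1) x ∧
            (h.normalizedCr hr hCR ^ n) (CrFun.const 𝔠 r 1) x ≤ H * l ^ n) ∧
          ∀ n : ℕ, ‖((l⁻¹ • h.normalizedCr hr hCR) ^ n) (CrFun.const 𝔠 r 1) - u‖ ≤ K * c ^ n := by
  set ρ := Real.exp εφ * (κ / d) with hρdef
  have hd : (0 : ℝ) < d := by exact_mod_cast h.pos
  have hρ : 0 < ρ := by positivity
  obtain ⟨H, n₀, hH, hdata⟩ := exists_eigenmeasure M b hρ hκ1 hb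
  obtain ⟨Kr, hKr0, hKr⟩ := exists_lipschitz_bound hM 𝔠 hr ℝ
  obtain ⟨Kc, hKc0, hKc⟩ := exists_lipschitz_bound hM 𝔠 hr ℂ
  obtain ⟨Cc, hCc⟩ := hM.exists_hasChartConstant 𝔠
  have hC1 : 0 ≤ Real.exp C * C := by positivity
  -- The waiting time at `η / (2 (Kr + 1))` undoes the factor lost when `g` is replaced by its real
  -- and imaginary parts.
  obtain ⟨n₁, hn₁⟩ := exists_norm_pow_le (𝕜 := ℝ) (r := r) hCc hρ.le hκ1 hC1
    (fun η => n₀ (η / (2 * (Kr + 1)))) one_half_pos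
  obtain ⟨n₂, hn₂⟩ := exists_norm_pow_le (𝕜 := ℂ) (r := r) hCc hρ.le hκ1 hC1
    (fun η => n₀ (η / (2 * (Kc + 1)))) one_half_pos
  obtain ⟨K, c, hK, hc, hc1, hfix⟩ := exists_fixed_of_contracting (𝕜 := ℝ) (X := CrFun 𝔠 r ℝ)
    (N := n₁ + 1) (Nat.succ_pos _) hC1 (norm_nonneg (CrFun.const 𝔠 r (1 : ℝ)))
  refine ⟨H, K, c, hH, hK, hc, hc1, fun θ _ hCR hCC => ?_⟩
  have hR : ∀ᵐ p ∂θ, ∀ x, |p.pot x| ≤ C := hCR.mono fun p hp => hp.pot_le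
  have hΛ := mass_pos h.pos hR
  obtain ⟨l, ν, hl, _, hν, hHl, hdecay⟩ :=
    hdata _ (h.isOscContracting hr hR hb hκ.le hpair hlip hosc)
  have hl0 : 0 < l := one_pos.trans_le hl
  have hcontrR : ∀ g, CrFun.integralCLM 𝔠 r ℝ ν g = 0 → ∀ n ≥ n₁,
      ‖(h.normalizedCr hr hCR ^ n) g‖ ≤ 1 / 2 * ‖g‖ * l ^ n := by
    refine fun g hg => hn₁ _ l g (h.isLasotaYorke hr hCR) hl fun η hη n hn x => ?_
    refine (h.norm_normalizedCr_pow_apply_le hr hCR hR hKr0 hKr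
      (fun g N hg hg0 => hdecay _ (by positivity) g N hg hg0 n hn) hg x).trans_eq ?_
    field_simp
  have hcontrC : ∀ g, CrFun.integralCLM 𝔠 r ℂ ν g = 0 → ∀ n ≥ n₂,
      ‖(h.normalizedCr hr hCC ^ n) g‖ ≤ 1 / 2 * ‖g‖ * l ^ n := by
    refine fun g hg => hn₂ _ l g (h.isLasotaYorke hr hCC) hl fun η hη n hn x => ?_
    refine (h.norm_normalizedCr_pow_apply_le hr hCC hR hKc0 hKc
      (fun g N hg hg0 => hdecay _ (by positivity) g N hg hg0 n hn) hg x).trans_eq ?_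
    field_simp
  obtain ⟨u, hu, hu1, hconv⟩ := hfix (l⁻¹ • h.normalizedCr hr hCR) (CrFun.integralCLM 𝔠 r ℝ ν)
    (CrFun.const 𝔠 r 1)
    (by
      refine ContinuousLinearMap.opNorm_le_bound _ hC1 fun g => ?_
      rw [smul_apply, norm_smul, Real.norm_eq_abs, abs_of_pos (inv_pos.2 hl0)]
      exact (mul_le_of_le_one_left (norm_nonneg _) (inv_le_one_of_one_le₀ hl)).trans
        ((h.isLasotaYorke hr hCR).norm_le g)) le_rfl
    (by
      change ∫ _, (1 : ℝ) ∂ν = 1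
      simp)
    (fun g => by
      rw [smul_apply, map_smul, h.integral_normalizedCr hr hCR hR hν, smul_eq_mul]
      simp only [RCLike.ofReal_real_eq_id, id]
      field_simp)
    (fun g hg => by
      rw [smul_pow, smul_apply, norm_smul, norm_pow, Real.norm_eq_abs, abs_of_pos (inv_pos.2 hl0)]
      have h1 := hcontrR g hg (n₁ + 1) (Nat.le_succ _)
      calc l⁻¹ ^ (n₁ + 1) * ‖(h.normalizedCr hr hCR ^ (n₁ + 1)) g‖
          ≤ l⁻¹ ^ (n₁ + 1) * (1 / 2 * ‖g‖ * l ^ (n₁ + 1)) := by gcongr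
        _ = 1 / 2 * ‖g‖ := by
          rw [inv_pow]
          field_simp)
  have hAu : h.normalizedCr hr hCR u = l • u := by
    rw [← hu, smul_apply, smul_smul, mul_inv_cancel₀ hl0.ne', one_smul, ← smul_apply, hu]
  have hTu : ∀ x, integratedTransfer θ u x = mass d θ * l * u x := by
    intro x
    rw [← h.integratedCr_apply hr hCR, h.integratedCr_eq_smul hr hCR, smul_apply, hAu, smul_smul]
    rfl
  refine ⟨l, u, hl, ⟨⟨h.integratedCr hr hCC, h.integratedCr_apply hr hCC, ?_⟩, hTu, ν,
    inferInstance, fun g => ⟨h.continuous_integratedTransfer hr hR g, ?_⟩, hu1⟩, fun n x => ?_,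
    hconv⟩
  -- The gap is a statement about the complex space, whereas the eigenfunction was constructed in
  -- the real one and is carried over. The exponent `n₂ + 1` is used because it must be positive.
  · refine hasSpectralGap_of_contracting (mul_pos hΛ hl0) (h := u.toComplex)
      (CrFun.integralCLM 𝔠 r ℂ ν) ?_ (fun g => ?_) ?_ (N := n₂ + 1) (Nat.succ_pos _) fun g hg => ?_
    · refine Subtype.ext (funext fun x => ?_)
      change h.integratedCr hr hCC u.toComplex x = ((mass d θ * l : ℝ) : ℂ) * (u x : ℂ)
      rw [h.integratedCr_apply hr hCC, ← Complex.ofReal_mul, ← hTu]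
      exact h.integratedTransfer_ofReal _ x
    · rw [h.integratedCr_eq_smul hr hCC, smul_apply, map_smul,
        h.integral_normalizedCr hr hCC hR hν, smul_eq_mul, Complex.ofReal_mul, mul_assoc]
      rfl
    · rw [CrFun.integralCLM_apply]
      change ∫ x, ((u x : ℝ) : ℂ) ∂ν = 1
      rw [integral_complex_ofReal]
      rw [CrFun.integralCLM_apply] at hu1
      rw [hu1, Complex.ofReal_one]
    · rw [h.integratedCr_eq_smul hr hCC, smul_pow, smul_apply, norm_smul, norm_pow,
        RCLike.norm_ofReal, abs_of_pos hΛ]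
      have h1 := hcontrC g hg (n₂ + 1) (Nat.le_succ _)
      calc mass d θ ^ (n₂ + 1) * ‖(h.normalizedCr hr hCC ^ (n₂ + 1)) g‖
          ≤ mass d θ ^ (n₂ + 1) * (1 / 2 * ‖g‖ * l ^ (n₂ + 1)) := by gcongr
        _ = (mass d θ * l) ^ (n₂ + 1) / 2 * ‖g‖ := by ring
  · have h1 := hν g
    have h2 : ∀ x, ((mass d θ)⁻¹ • h.integratedC hr θ hR) g x
        = (mass d θ)⁻¹ * integratedTransfer θ g x := fun x => rfl
    simp only [h2] at h1
    rw [integral_const_mul, inv_mul_eq_iff_eq_mul₀ hΛ.ne'] at h1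
    rw [h1, mul_assoc]
  · have h1 := hHl n x
    have h2 : (1 : C(M, ℝ)) = CrFun.compC (RCLike.reCLM (K := ℝ)) (CrFun.const 𝔠 r (1 : ℝ)) := by
      ext y
      simp [CrFun.compC, CrFun.const]
    rw [h2, h.compC_normalizedCr_pow hr hCR hR] at h1
    exact h1

end IsCoveringFamily

end Leading

end

section

open scoped BoundedContinuousFunction

/-! ### Weak convergence and Bochner integrals -/

section WeakConvergence

variable {Ω : Type*} [TopologicalSpace Ω] [MeasurableSpace Ω] [OpensMeasurableSpace Ω]
  {E : Type*} [NormedAddCommGroup E] [NormedSpace ℝ E] [SecondCountableTopology E]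

/-- A bounded continuous function with values in a separable space is a finite sum of scalar ones
up to an error that is small in mean. -/
theorem exists_finite_rank_approx (μ : Measure Ω) [IsProbabilityMeasure μ] {F : Ω → E}
    (hF : Continuous F) {R : ℝ} (hR : ∀ p, ‖F p‖ ≤ R) {η : ℝ} (hη : 0 < η) :
    ∃ (n : ℕ) (e : ℕ → E) (w : ℕ → Ω →ᵇ ℝ) (c : Ω →ᵇ ℝ), ∫ p, c p ∂μ < η ∧
      ∀ p, ‖F p - ∑ k ∈ Finset.range n, w k p • e k‖ ≤ η + R * c p := by
  set e := TopologicalSpace.denseSeq E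
  -- Hat functions around a dense sequence: `ψ k` is positive exactly where `e k` is `η`-close to
  -- `F`.
  set ψ : ℕ → Ω → ℝ := fun k p => max 0 (η - ‖F p - e k‖) with hψ
  have hψ0 : ∀ k p, 0 ≤ ψ k p := fun k p => le_max_left _ _
  have hψc : ∀ k, Continuous (ψ k) := fun k =>
    continuous_const.max (continuous_const.sub (hF.sub continuous_const).norm)
  set S : ℕ → Ω → ℝ := fun n p => ∑ k ∈ Finset.range n, ψ k p with hS
  have hS0 : ∀ n p, 0 ≤ S n p := fun n p => Finset.sum_nonneg fun k _ => hψ0 k p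
  have hSc : ∀ n, Continuous (S n) := fun n => continuous_finsetSum _ fun k _ => hψc k
  -- Dividing by `S n + τ n` avoids a vanishing denominator. The remainder `c = τ n / (S n + τ n)`
  -- is bounded and continuous and tends to zero pointwise by density, so its integral tends to zero
  -- by dominated convergence.
  set τ : ℕ → ℝ := fun n => 1 / ((n : ℝ) + 1)
  have hτ : ∀ n, 0 < τ n := fun n => by positivity
  have hden : ∀ n p, 0 < S n p + τ n := fun n p => by linarith [hS0 n p, hτ n]
  have hc1 : ∀ n p, ‖τ n / (S n p + τ n)‖ ≤ 1 := fun n p => by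
    rw [Real.norm_eq_abs, abs_of_pos (div_pos (hτ n) (hden n p)), div_le_one (hden n p)]
    linarith [hS0 n p]
  have hcc : ∀ n, Continuous fun p => τ n / (S n p + τ n) := fun n =>
    continuous_const.div ((hSc n).add continuous_const) fun p => (hden n p).ne'
  have hlim : Tendsto (fun n => ∫ p, τ n / (S n p + τ n) ∂μ) atTop (𝓝 (∫ _, (0 : ℝ) ∂μ)) := by
    refine tendsto_integral_of_dominated_convergence (fun _ => 1)
      (fun n => (hcc n).aestronglyMeasurable) (integrable_const _)
      (fun n => Eventually.of_forall (hc1 n)) (Eventually.of_forall fun p => ?_)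
    obtain ⟨k, hk⟩ := (TopologicalSpace.denseRange_denseSeq E).exists_dist_lt (F p) hη
    rw [dist_eq_norm] at hk
    have hψk : 0 < ψ k p := lt_max_of_lt_right (by linarith)
    have h1 : Tendsto (fun n => τ n / ψ k p) atTop (𝓝 (0 / ψ k p)) :=
      tendsto_one_div_add_atTop_nhds_zero_nat.div_const _
    rw [zero_div] at h1
    refine squeeze_zero' (Eventually.of_forall fun n => (div_pos (hτ n) (hden n p)).le) ?_ h1
    filter_upwards [eventually_gt_atTop k] with n hn
    refine div_le_div_of_nonneg_left (hτ n).le hψk ?_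
    have := Finset.single_le_sum (fun k _ => hψ0 k p) (Finset.mem_range.2 hn)
    linarith [hτ n]
  rw [integral_zero] at hlim
  obtain ⟨n, hn⟩ := (hlim.eventually_lt_const hη).exists
  have hw1 : ∀ k p, ‖ψ k p / (S n p + τ n)‖ ≤ η / τ n := fun k p => by
    rw [Real.norm_eq_abs, abs_of_nonneg (div_nonneg (hψ0 k p) (hden n p).le)]
    refine div_le_div₀ hη.le ?_ (hτ n) (by linarith [hS0 n p])
    exact max_le hη.le (by linarith [norm_nonneg (F p - e k)])
  refine ⟨n, e, fun k => BoundedContinuousFunction.ofNormedAddCommGroup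
    (fun p => ψ k p / (S n p + τ n)) ((hψc k).div ((hSc n).add continuous_const)
      fun p => (hden n p).ne') _ (hw1 k),
    BoundedContinuousFunction.ofNormedAddCommGroup _ (hcc n) _ (hc1 n), hn, fun p => ?_⟩
  change ‖F p - ∑ k ∈ Finset.range n, (ψ k p / (S n p + τ n)) • e k‖ ≤ η + R * (τ n / (S n p + τ n))
  -- The difference is a convex combination of the vectors `F - e k`, which have norm at most `η`
  -- where their weight is not zero, and of `F`, with weight `c`.
  have h1 : F p - ∑ k ∈ Finset.range n, (ψ k p / (S n p + τ n)) • e k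
      = (S n p + τ n)⁻¹ • (∑ k ∈ Finset.range n, ψ k p • (F p - e k) + τ n • F p) := by
    have h2 : F p = (S n p + τ n)⁻¹ • (S n p + τ n) • F p := by
      rw [smul_smul, inv_mul_cancel₀ (hden n p).ne', one_smul]
    conv_lhs => rw [h2]
    simp only [smul_sub, smul_add, add_smul, Finset.sum_sub_distrib, Finset.smul_sum, smul_smul,
      div_eq_inv_mul, ← Finset.sum_smul, hS]
    abel
  have h3 : ∀ k, ‖ψ k p • (F p - e k)‖ ≤ ψ k p * η := fun k => by
    rw [norm_smul, Real.norm_eq_abs, abs_of_nonneg (hψ0 k p)]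
    rcases le_or_gt (η - ‖F p - e k‖) 0 with h | h
    · rw [hψ]
      simp [max_eq_left h]
    · exact mul_le_mul_of_nonneg_left (by linarith) (hψ0 k p)
  rw [h1, norm_smul, norm_inv, Real.norm_eq_abs, abs_of_pos (hden n p),
    inv_mul_le_iff₀ (hden n p)]
  refine (norm_add_le _ _).trans ((add_le_add (norm_sum_le_of_le _ fun k _ => h3 k)
    (le_of_eq (norm_smul _ _))).trans ?_)
  rw [← Finset.sum_mul, Real.norm_eq_abs, abs_of_pos (hτ n)]
  have h4 : (S n p + τ n) * (η + R * (τ n / (S n p + τ n))) = (S n p + τ n) * η + τ n * R := by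
    have := (hden n p).ne'
    field_simp
  rw [h4]
  have h5 := mul_le_mul_of_nonneg_left (hR p) (hτ n).le
  have h6 := mul_pos (hτ n) hη
  change S n p * η + τ n * ‖F p‖ ≤ _
  linarith

/-- Weak convergence of measures implies convergence of Bochner integrals of bounded continuous
functions with values in a separable Banach space. -/
theorem tendsto_bochner_integral [CompleteSpace E] {ι : Type*} {l : Filter ι}
    {μ : ι → ProbabilityMeasure Ω} {μ₀ : ProbabilityMeasure Ω} (hμ : Tendsto μ l (𝓝 μ₀)) {F : Ω → E}
    (hF : Continuous F) {R : ℝ} (hR : ∀ p, ‖F p‖ ≤ R) :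
    Tendsto (fun a => ∫ p, F p ∂(μ a : Measure Ω)) l (𝓝 (∫ p, F p ∂(μ₀ : Measure Ω))) := by
  rw [ProbabilityMeasure.tendsto_iff_forall_integral_tendsto] at hμ
  obtain ⟨p₀⟩ : Nonempty Ω := (μ₀ : Measure Ω).nonempty_of_neZero
  have hR0 : 0 ≤ R := (norm_nonneg _).trans (hR p₀)
  rw [Metric.tendsto_nhds]
  intro δ hδ
  set η := δ / (2 * (3 + 2 * R)) with hηdef
  have hη : 0 < η := by positivity
  -- The approximation is made for `μ₀`. As `c` is itself a bounded continuous function, its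
  -- integral is small for the nearby measures too, and no tightness is needed.
  obtain ⟨n, e, w, c, hc, hG⟩ := exists_finite_rank_approx (μ₀ : Measure Ω) hF hR hη
  set G : Ω → E := fun p => ∑ k ∈ Finset.range n, w k p • e k
  have hint : ∀ ν : ProbabilityMeasure Ω, ∀ k, Integrable (fun p => w k p • e k) (ν : Measure Ω) :=
    fun ν k => ((w k).integrable _).smul_const _
  have hGi : ∀ ν : ProbabilityMeasure Ω, Integrable G (ν : Measure Ω) := fun ν =>
    integrable_finsetSum _ fun k _ => hint ν k
  have hFi : ∀ ν : ProbabilityMeasure Ω, Integrable F (ν : Measure Ω) := fun ν =>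
    Integrable.of_bound hF.aestronglyMeasurable R (Eventually.of_forall hR)
  have hFG : ∀ ν : ProbabilityMeasure Ω, ∫ p, c p ∂(ν : Measure Ω) < η →
      ‖∫ p, F p ∂(ν : Measure Ω) - ∫ p, G p ∂(ν : Measure Ω)‖ ≤ η + R * η := by
    intro ν hν
    rw [← integral_sub (hFi ν) (hGi ν)]
    refine (norm_integral_le_of_norm_le ((integrable_const η).add ((c.integrable _).const_mul R))
      (Eventually.of_forall hG)).trans ?_
    simp only [Pi.add_apply]
    rw [integral_add (integrable_const η) ((c.integrable _).const_mul R), integral_const_mul]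
    simp only [integral_const, probReal_univ, one_smul]
    gcongr
  have hGt : Tendsto (fun a => ∫ p, G p ∂(μ a : Measure Ω)) l (𝓝 (∫ p, G p ∂(μ₀ : Measure Ω))) := by
    simp only [G]
    simp only [integral_finsetSum _ fun k _ => hint _ k, integral_smul_const]
    exact tendsto_finsetSum _ fun k _ => (hμ (w k)).smul_const _
  filter_upwards [(hμ c).eventually_lt_const hc, Metric.tendsto_nhds.1 hGt η hη] with a ha hGa
  rw [dist_eq_norm] at hGa ⊢
  have h1 := hFG (μ a) ha
  have h2 := hFG μ₀ hc
  rw [norm_sub_rev] at h2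
  have h3 : ∫ p, F p ∂(μ a : Measure Ω) - ∫ p, F p ∂(μ₀ : Measure Ω)
      = (∫ p, F p ∂(μ a : Measure Ω) - ∫ p, G p ∂(μ a : Measure Ω))
        + (∫ p, G p ∂(μ a : Measure Ω) - ∫ p, G p ∂(μ₀ : Measure Ω))
        + (∫ p, G p ∂(μ₀ : Measure Ω) - ∫ p, F p ∂(μ₀ : Measure Ω)) := by abel
  rw [h3]
  have h4 : η * (3 + 2 * R) = δ / 2 := by
    rw [hηdef]
    field_simp
  have h5 := norm_add₃_le (a := ∫ p, F p ∂(μ a : Measure Ω) - ∫ p, G p ∂(μ a : Measure Ω))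
    (b := ∫ p, G p ∂(μ a : Measure Ω) - ∫ p, G p ∂(μ₀ : Measure Ω))
    (c := ∫ p, G p ∂(μ₀ : Measure Ω) - ∫ p, F p ∂(μ₀ : Measure Ω))
  linarith

/-- The same for continuous functions that are bounded almost everywhere. -/
theorem tendsto_bochner_integral_of_ae [CompleteSpace E] {ι : Type*} {l : Filter ι}
    {μ : ι → ProbabilityMeasure Ω} {μ₀ : ProbabilityMeasure Ω} (hμ : Tendsto μ l (𝓝 μ₀)) {F : Ω → E}
    (hF : Continuous F) {R : ℝ} (hR : ∀ᶠ a in l, ∀ᵐ p ∂(μ a : Measure Ω), ‖F p‖ ≤ R)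
    (hR₀ : ∀ᵐ p ∂(μ₀ : Measure Ω), ‖F p‖ ≤ R) :
    Tendsto (fun a => ∫ p, F p ∂(μ a : Measure Ω)) l (𝓝 (∫ p, F p ∂(μ₀ : Measure Ω))) := by
  set R' := max R 1
  have hR' : 0 < R' := one_pos.trans_le (le_max_right _ _)
  have hm : ∀ p, 0 < max R' ‖F p‖ := fun p => hR'.trans_le (le_max_left _ _)
  -- `F` is truncated radially to norm at most `R'`, which changes nothing almost everywhere and
  -- makes the bound global.
  have h1 := tendsto_bochner_integral hμ (F := fun p => (R' / max R' ‖F p‖) • F p) (R := R')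
    ((continuous_const.div (continuous_const.max hF.norm) fun p => (hm p).ne').smul hF) fun p => by
      rw [norm_smul, Real.norm_eq_abs, abs_of_pos (div_pos hR' (hm p)), div_mul_eq_mul_div,
        div_le_iff₀ (hm p)]
      exact mul_le_mul_of_nonneg_left (le_max_right _ _) hR'.le
  have h2 : ∀ p, ‖F p‖ ≤ R → (R' / max R' ‖F p‖) • F p = F p := fun p hp => by
    rw [max_eq_left (hp.trans (le_max_left _ _)), div_self hR'.ne', one_smul]
  rw [integral_congr_ae (hR₀.mono h2)] at h1
  refine h1.congr' ?_
  filter_upwards [hR] with a ha using integral_congr_ae (ha.mono h2)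

end WeakConvergence

end

section

/-! ### Strong convergence implies convergence of eigenvalues and eigenvectors -/

section Abstract

variable {X : Type*} [NormedAddCommGroup X] [NormedSpace ℝ X] {ι : Type*} {𝓁 : Filter ι}

/-- Strong convergence with uniform bounds passes to powers. -/
theorem tendsto_pow_apply {A : ι → X →L[ℝ] X} {A₀ : X →L[ℝ] X} {C : ℝ}
    (hC : ∀ᶠ a in 𝓁, ∀ g, ‖A a g‖ ≤ C * ‖g‖) (hA : ∀ g, Tendsto (fun a => A a g) 𝓁 (𝓝 (A₀ g)))
    (n : ℕ) (g : X) : Tendsto (fun a => (A a ^ n) g) 𝓁 (𝓝 ((A₀ ^ n) g)) := by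
  induction n with
  | zero => simpa using tendsto_const_nhds
  | succ n ih =>
    simp only [pow_succ', mul_apply_eq_comp]
    have h1 : Tendsto (fun a => A a ((A a ^ n) g - (A₀ ^ n) g)) 𝓁 (𝓝 0) := by
      refine squeeze_zero_norm' (hC.mono fun a ha => ha _) ?_
      have := ((ih.sub_const ((A₀ ^ n) g)).norm).const_mul C
      simpa using this
    have h2 := h1.add (hA ((A₀ ^ n) g))
    simpa using h2

/-- Eigenvalues that govern the growth of the iterates depend continuously on the operator. -/
theorem tendsto_eigenvalue {A : ι → X →L[ℝ] X} {A₀ : X →L[ℝ] X} {C H : ℝ} (hH : 1 ≤ H)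
    (hC : ∀ᶠ a in 𝓁, ∀ g, ‖A a g‖ ≤ C * ‖g‖) (hA : ∀ g, Tendsto (fun a => A a g) 𝓁 (𝓝 (A₀ g)))
    {e : X} {f : X →L[ℝ] ℝ} {l : ι → ℝ} {l₀ : ℝ} (hl : ∀ᶠ a in 𝓁, 1 ≤ l a) (hl₀ : 1 ≤ l₀)
    (hgrow : ∀ᶠ a in 𝓁, ∀ n : ℕ, l a ^ n ≤ H * f ((A a ^ n) e) ∧ f ((A a ^ n) e) ≤ H * l a ^ n)
    (hgrow₀ : ∀ n : ℕ, l₀ ^ n ≤ H * f ((A₀ ^ n) e) ∧ f ((A₀ ^ n) e) ≤ H * l₀ ^ n) :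
    Tendsto l 𝓁 (𝓝 l₀) := by
  have hH0 : 0 < H := by linarith
  have key : ∀ δ : ℝ, 1 < δ → ∀ᶠ a in 𝓁, l a ≤ δ * l₀ ∧ l₀ ≤ δ * l a := by
    intro δ hδ
    -- For one fixed large `n` the numbers `f (A ^ n e)` and `f (A₀ ^ n e)` differ by a factor of at
    -- most 2, so `l a ^ n` and `l₀ ^ n` differ by at most `2 H² ≤ δ ^ n`; then take `n`-th roots.
    obtain ⟨n, hn1, hn⟩ := ((eventually_ge_atTop 1).and
      ((tendsto_pow_atTop_atTop_of_one_lt hδ).eventually_ge_atTop (2 * H ^ 2))).exists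
    have ht := (f.continuous.tendsto _).comp (tendsto_pow_apply hC hA n e)
    have hpos : 0 < f ((A₀ ^ n) e) := by
      have h1 : 0 < H * f ((A₀ ^ n) e) := (pow_pos (by linarith) n).trans_le (hgrow₀ n).1
      exact (mul_pos_iff_of_pos_left hH0).1 h1
    filter_upwards [hl, hgrow, ht.eventually_lt_const (show f ((A₀ ^ n) e) < 2 * f ((A₀ ^ n) e) by
      linarith), ht.eventually_const_lt (show f ((A₀ ^ n) e) / 2 < f ((A₀ ^ n) e) by linarith)]
      with a h1 h2 h3 h4
    simp only [Function.comp_apply] at h3 h4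
    have hla : 0 < l a := by linarith
    have hl0 : 0 < l₀ := by linarith
    have hn0 : n ≠ 0 := by lia
    have h5 : f ((A a ^ n) e) ≤ 2 * (H * l₀ ^ n) := by linarith [(hgrow₀ n).2]
    have h6 : f ((A₀ ^ n) e) ≤ 2 * (H * l a ^ n) := by linarith [(h2 n).2]
    constructor
    · refine le_of_pow_le_pow_left₀ hn0 (by positivity) ?_
      calc l a ^ n ≤ H * (2 * (H * l₀ ^ n)) := (h2 n).1.trans (by gcongr)
        _ = (2 * H ^ 2) * l₀ ^ n := by ring
        _ ≤ δ ^ n * l₀ ^ n := by gcongr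
        _ = _ := (mul_pow _ _ _).symm
    · refine le_of_pow_le_pow_left₀ hn0 (by positivity) ?_
      calc l₀ ^ n ≤ H * (2 * (H * l a ^ n)) := (hgrow₀ n).1.trans (by gcongr)
        _ = (2 * H ^ 2) * l a ^ n := by ring
        _ ≤ δ ^ n * l a ^ n := by gcongr
        _ = _ := (mul_pow _ _ _).symm
  have hl0 : 0 < l₀ := by linarith
  rw [Metric.tendsto_nhds]
  intro η hη
  obtain ⟨δ, hδ1, hδ2⟩ : ∃ δ : ℝ, 1 < δ ∧ δ * (δ - 1) * l₀ < η := by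
    have h1 : Tendsto (fun δ : ℝ => δ * (δ - 1) * l₀) (𝓝[>] 1) (𝓝 (1 * (1 - 1) * l₀)) :=
      ((by fun_prop : Continuous fun δ : ℝ => δ * (δ - 1) * l₀).tendsto 1).mono_left
        nhdsWithin_le_nhds
    have h2 : ∀ᶠ δ in 𝓝[>] (1 : ℝ), δ ∈ Ioi (1 : ℝ) := self_mem_nhdsWithin
    exact (h2.and (h1.eventually_lt_const (by simpa using hη))).exists
  filter_upwards [key δ hδ1] with a ⟨h1, h2⟩
  rw [Real.dist_eq, abs_lt]
  have h3 : 0 < δ - 1 := by linarith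
  have h4 := mul_le_mul_of_nonneg_left h1 h3.le
  constructor <;> nlinarith

/-- Uniform limits of convergent sequences of iterates converge. -/
theorem tendsto_eigenvector {A : ι → X →L[ℝ] X} {A₀ : X →L[ℝ] X} {C K c : ℝ} (hc : 0 ≤ c)
    (hc1 : c < 1)
    (hC : ∀ᶠ a in 𝓁, ∀ g, ‖A a g‖ ≤ C * ‖g‖) (hA : ∀ g, Tendsto (fun a => A a g) 𝓁 (𝓝 (A₀ g)))
    {e : X} {u : ι → X} {u₀ : X} (hu : ∀ᶠ a in 𝓁, ∀ n : ℕ, ‖(A a ^ n) e - u a‖ ≤ K * c ^ n)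
    (hu₀ : ∀ n : ℕ, ‖(A₀ ^ n) e - u₀‖ ≤ K * c ^ n) : Tendsto u 𝓁 (𝓝 u₀) := by
  rw [Metric.tendsto_nhds]
  intro η hη
  have h1 : Tendsto (fun n : ℕ => K * c ^ n) atTop (𝓝 (K * 0)) :=
    (tendsto_pow_atTop_nhds_zero_of_lt_one hc hc1).const_mul K
  obtain ⟨n, hn⟩ := (h1.eventually_lt_const (show K * 0 < η / 3 by simpa using by linarith)).exists
  filter_upwards [hu, Metric.tendsto_nhds.1 (tendsto_pow_apply hC hA n e) (η / 3) (by linarith)]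
    with a ha ha'
  have h2 := dist_triangle4 (u a) ((A a ^ n) e) ((A₀ ^ n) e) u₀
  have h3 := ha n
  have h4 := hu₀ n
  rw [← dist_eq_norm] at h3 h4
  rw [dist_comm] at h3
  linarith

end Abstract

/-! ### The leading data as continuous functions of the measure -/

section Continuity

variable {m : ℕ} {M : Type*} [MetricSpace M] [CompactSpace M] [ChartedSpace (Eu m) M]
  [IsManifold (𝓡 m) ∞ M] {𝔠 : ChartCover m M} {r d : ℕ} {𝕜 : Type} [RCLike 𝕜]
  {ℱ : Set (CrMap m M r)} {𝒲 : Set (CrFun 𝔠 r ℝ)}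

namespace IsCoveringFamily

attribute [local instance] CrFun.normedSpaceReal

variable (h : IsCoveringFamily d ℱ) (hr : 1 ≤ r) {εφ κ C : ℝ} {ι : Type*} {𝓁 : Filter ι}
  {θ : ι → ProbabilityMeasure (Param ℱ 𝒲)} {θ₀ : ProbabilityMeasure (Param ℱ 𝒲)}

theorem tendsto_mass [Nonempty M] (hθ : Tendsto θ 𝓁 (𝓝 θ₀))
    (hC : ∀ a, ∀ᵐ p ∂(θ a : Measure (Param ℱ 𝒲)), ∀ x, |p.pot x| ≤ C)
    (hC₀ : ∀ᵐ p ∂(θ₀ : Measure (Param ℱ 𝒲)), ∀ x, |p.pot x| ≤ C) :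
    Tendsto (fun a => mass d (θ a : Measure (Param ℱ 𝒲))) 𝓁 (𝓝 (mass d (θ₀ : Measure (Param ℱ 𝒲)))) := by
  have h1 : ∀ p : Param ℱ 𝒲, (∀ x, |p.pot x| ≤ C) → ‖(d : ℝ) * Real.exp p.potMin‖
      ≤ d * Real.exp C := fun p hp => by
    rw [norm_mul, Real.norm_natCast, Real.norm_eq_abs, Real.abs_exp]
    gcongr
    exact (le_abs_self _).trans (abs_potMin_le hp)
  exact tendsto_bochner_integral_of_ae hθ
    (continuous_const.mul (Real.continuous_exp.comp Param.continuous_potMin))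
    (Eventually.of_forall fun a => (hC a).mono h1) (hC₀.mono h1)

theorem tendsto_normalizedCr [Nonempty M] (hθ : Tendsto θ 𝓁 (𝓝 θ₀))
    (hC : ∀ a, ∀ᵐ p ∂(θ a : Measure (Param ℱ 𝒲)), h.IsBounded hr 𝕜 εφ κ C p)
    (hC₀ : ∀ᵐ p ∂(θ₀ : Measure (Param ℱ 𝒲)), h.IsBounded hr 𝕜 εφ κ C p) (g : CrFun 𝔠 r 𝕜) :
    Tendsto (fun a => h.normalizedCr hr (hC a) g) 𝓁 (𝓝 (h.normalizedCr hr hC₀ g)) := by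
  have h1 : Tendsto (fun a => h.integratedCr hr (hC a) g) 𝓁 (𝓝 (h.integratedCr hr hC₀ g)) :=
    tendsto_bochner_integral_of_ae hθ (h.continuous_transferCLM hr g) (R := C * ‖g‖)
      (Eventually.of_forall fun a => (hC a).mono fun p hp => hp.norm_le g)
      (hC₀.mono fun p hp => hp.norm_le g)
  have h2 := tendsto_mass (d := d) hθ (fun a => (hC a).mono fun p hp => hp.pot_le)
    (hC₀.mono fun p hp => hp.pot_le)
  have h3 := mass_pos h.pos (hC₀.mono fun p hp => hp.pot_le)
  exact (((RCLike.continuous_ofReal (K := 𝕜)).tendsto _).comp (h2.inv₀ h3.ne')).smul h1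

/-- The measures whose transfer operators are bounded by `C`. -/
def boundedMeasures (h : IsCoveringFamily d ℱ) (hr : 1 ≤ r) (𝒲 : Set (CrFun 𝔠 r ℝ)) (εφ κ C : ℝ) :
    Set (ProbabilityMeasure (Param ℱ 𝒲)) :=
  {θ | (∀ᵐ p ∂(θ : Measure (Param ℱ 𝒲)), h.IsBounded hr ℝ εφ κ C p) ∧
    ∀ᵐ p ∂(θ : Measure (Param ℱ 𝒲)), h.IsBounded hr ℂ εφ κ C p}

/-- The growth of `T ^ n 1` at one point determines `l`, and the uniform rate of convergence
determines `u`; both bounds hold with the same constants for all measures in the set. The eigenvalue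
of the original operator is `mass` times `l`. Outside the set the functions are given the value 0.
-/
theorem exists_continuousOn_leading [Nonempty M] [MeasurableSpace M] [BorelSpace M]
    (hM : IsLengthManifold m M) (h : IsCoveringFamily d ℱ)
    (hr : 1 ≤ r) {b : ℝ} (hκ : 0 < κ) (hκ1 : Real.exp εφ * (κ / d) < 1) (hC0 : 0 ≤ C) (hb : 0 ≤ b)
    (hpair : ∀ p : Param ℱ 𝒲, HasPairing d κ p.map)
    (hlip : ∀ (p : Param ℱ 𝒲) (x y : M), |p.pot x - p.pot y| ≤ b * dist x y)
    (hosc : ∀ (p : Param ℱ 𝒲) (x : M), p.pot x ≤ p.potMin + εφ) :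
    ∃ (l : ProbabilityMeasure (Param ℱ 𝒲) → ℝ) (u : ProbabilityMeasure (Param ℱ 𝒲) → CrFun 𝔠 r ℝ),
      (∀ θ ∈ h.boundedMeasures hr 𝒲 εφ κ C, HasLeadingData
        (integratedTransfer (θ : Measure (Param ℱ 𝒲)))
        (integratedTransfer (θ : Measure (Param ℱ 𝒲))) (l θ) (u θ)) ∧
      ContinuousOn l (h.boundedMeasures hr 𝒲 εφ κ C) ∧
      ContinuousOn u (h.boundedMeasures hr 𝒲 εφ κ C) := by
  classical
  obtain ⟨H, K, c, hH, -, hc, hc1, hlead⟩ :=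
    h.exists_leading hM hr hκ hκ1 hC0 hb hpair hlip hosc
  choose l u hl hdata hgrow hconv using
    fun θ : h.boundedMeasures hr 𝒲 εφ κ C => hlead θ.1 θ.2.1 θ.2.2
  have hA : ∀ (θ₀ : h.boundedMeasures hr 𝒲 εφ κ C) (g : CrFun 𝔠 r ℝ),
      Tendsto (fun θ : h.boundedMeasures hr 𝒲 εφ κ C => h.normalizedCr hr θ.2.1 g) (𝓝 θ₀)
        (𝓝 (h.normalizedCr hr θ₀.2.1 g)) := fun θ₀ g =>
    h.tendsto_normalizedCr hr (continuous_subtype_val.tendsto θ₀) (fun θ => θ.2.1) θ₀.2.1 g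
  have hbd : ∀ (θ : h.boundedMeasures hr 𝒲 εφ κ C) (g : CrFun 𝔠 r ℝ),
      ‖h.normalizedCr hr θ.2.1 g‖ ≤ Real.exp C * C * ‖g‖ := fun θ g =>
    (h.isLasotaYorke hr θ.2.1).norm_le g
  have hlc : ∀ θ₀, Tendsto l (𝓝 θ₀) (𝓝 (l θ₀)) := by
    intro θ₀
    have x := Classical.arbitrary M
    exact tendsto_eigenvalue hH (Eventually.of_forall hbd) (hA θ₀) (e := CrFun.const 𝔠 r 1)
      (f := CrFun.evalCLM x) (Eventually.of_forall hl) (hl θ₀)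
      (Eventually.of_forall fun θ n => hgrow θ n x) fun n => hgrow θ₀ n x
  have huc : ∀ θ₀, Tendsto u (𝓝 θ₀) (𝓝 (u θ₀)) := by
    intro θ₀
    refine tendsto_eigenvector hc hc1 (C := Real.exp C * C)
      (A := fun θ : h.boundedMeasures hr 𝒲 εφ κ C => (l θ)⁻¹ • h.normalizedCr hr θ.2.1)
      (A₀ := (l θ₀)⁻¹ • h.normalizedCr hr θ₀.2.1) (Eventually.of_forall fun θ g => ?_)
      (fun g => ((hlc θ₀).inv₀ (one_pos.trans_le (hl θ₀)).ne').smul (hA θ₀ g))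
      (Eventually.of_forall hconv) (hconv θ₀)
    rw [smul_apply, norm_smul, norm_inv, Real.norm_eq_abs, abs_of_pos (one_pos.trans_le (hl θ))]
    exact (mul_le_of_le_one_left (norm_nonneg _) (inv_le_one_of_one_le₀ (hl θ))).trans (hbd θ g)
  have hmc : ∀ θ₀ : h.boundedMeasures hr 𝒲 εφ κ C,
      Tendsto (fun θ : h.boundedMeasures hr 𝒲 εφ κ C => mass d (θ.1 : Measure (Param ℱ 𝒲))) (𝓝 θ₀)
        (𝓝 (mass d (θ₀.1 : Measure (Param ℱ 𝒲)))) := fun θ₀ =>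
    tendsto_mass (continuous_subtype_val.tendsto θ₀)
      (fun θ => θ.2.1.mono fun p hp => hp.pot_le) (θ₀.2.1.mono fun p hp => hp.pot_le)
  refine ⟨fun θ => if hθ : θ ∈ h.boundedMeasures hr 𝒲 εφ κ C then
      mass d (θ : Measure (Param ℱ 𝒲)) * l ⟨θ, hθ⟩ else 0,
    fun θ => if hθ : θ ∈ h.boundedMeasures hr 𝒲 εφ κ C then u ⟨θ, hθ⟩ else 0, fun θ hθ => ?_, ?_, ?_⟩
  · simp only [dif_pos hθ]
    exact hdata ⟨θ, hθ⟩
  · rw [continuousOn_iff_continuous_domRestrict]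
    refine (continuous_iff_continuousAt.2 fun θ₀ => (hmc θ₀).mul (hlc θ₀)).congr fun θ => ?_
    simp [Set.domRestrict]
  · rw [continuousOn_iff_continuous_domRestrict]
    refine (continuous_iff_continuousAt.2 huc).congr fun θ => ?_
    simp [Set.domRestrict]

end IsCoveringFamily

end Continuity

end

section

/-! ### The space of pairs is hereditarily Lindelöf -/

section Cutoff

variable {m : ℕ} {M : Type*} [MetricSpace M] [CompactSpace M] [ChartedSpace (Eu m) M]
  [IsManifold (𝓡 m) ∞ M] {𝔠 : ChartCover m M} {r : ℕ} {𝕜 : Type} [RCLike 𝕜]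
  {ℱ : Set (CrMap m M r)} {𝒲 : Set (CrFun 𝔠 r ℝ)}

/-- Composition of a `C^r` function with a `C^r` map. -/
def CrFun.compMap (w : CrFun 𝔠 r ℝ) (f : CrMap m M r) : CrFun 𝔠 r ℝ :=
  ⟨fun x => w (f x), ContMDiff.comp w.2 f.2⟩

/-- Globally defined functions `χ`, `χ e₁`, …, `χ eₘ`, where `e` is a chart and `χ` is a cutoff
function that is one near `K`. -/
structure IsCutoff (e : OpenPartialHomeomorph M (Eu m)) (K : Set M) (χ : CrFun 𝔠 r ℝ)
    (ξ : Fin m → CrFun 𝔠 r ℝ) : Prop where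
  eq_zero : ∀ y ∉ e.source, χ y = 0
  eq_mul : ∀ y ∈ e.source, ∀ i, ξ i y = χ y * e y i
  eq_one : ∀ y ∈ K, ∀ᶠ z in 𝓝 y, χ z = 1

theorem exists_isCutoff (𝔠 : ChartCover m M) (r : ℕ) (j : Fin 𝔠.N) :
    ∃ (χ : CrFun 𝔠 r ℝ) (ξ : Fin m → CrFun 𝔠 r ℝ), IsCutoff (𝔠.chart j) (𝔠.K j) χ ξ := by
  classical
  set e := 𝔠.chart j
  obtain ⟨L, hL, hKL, hLe⟩ := exists_compact_between (𝔠.isCompact_K j) e.open_source (𝔠.K_subset j)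
  obtain ⟨χ, h1, h0, -⟩ := exists_contMDiffMap_one_nhds_of_subset_interior (n := r) (𝓡 m)
    (𝔠.isCompact_K j).isClosed hKL
  have hsm : ∀ i : Fin m, ContMDiff (𝓡 m) 𝓘(ℝ, ℝ) r fun y => χ y * e y i := by
    intro i y
    by_cases hy : y ∈ e.source
    · have h2 : ContMDiffAt (𝓡 m) (𝓡 m) r e y :=
        ((contMDiffOn_of_mem_maximalAtlas (𝔠.chart_mem j)).contMDiffAt
          (e.open_source.mem_nhds hy)).of_le (by exact_mod_cast le_top)
      have h3 : ContMDiffAt (𝓡 m) 𝓘(ℝ, ℝ) r (fun y => e y i) y :=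
        (EuclideanSpace.proj i : Eu m →L[ℝ] ℝ).contDiff.contDiffAt.comp_contMDiffAt h2
      exact χ.contMDiff.contMDiffAt.mul h3
    · refine contMDiffAt_const (c := (0 : ℝ)) |>.congr_of_eventuallyEq ?_
      filter_upwards [hL.isClosed.isOpen_compl.mem_nhds fun h => hy (hLe h)] with z hz
      rw [h0 z hz, zero_mul]
  refine ⟨⟨χ, χ.contMDiff⟩, fun i => ⟨fun y => χ y * e y i, hsm i⟩, fun y hy => ?_, fun _ _ _ => rfl,
    fun y hy => ?_⟩
  · exact h0 y fun h => hy (hLe h)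
  · exact eventually_nhdsSet_iff_forall.1 h1 y hy

theorem CrFun.tendsto_apply {ι : Type*} {l : Filter ι} {g : ι → CrFun 𝔠 r 𝕜} {g₀ : CrFun 𝔠 r 𝕜}
    (hg : Tendsto g l (𝓝 g₀)) {x : ι → M} {x₀ : M} (hx : Tendsto x l (𝓝 x₀)) :
    Tendsto (fun a => g a (x a)) l (𝓝 (g₀ x₀)) := by
  have h1 : Tendsto (fun a => g₀ (x a)) l (𝓝 (g₀ x₀)) := (g₀.continuous.tendsto x₀).comp hx
  refine h1.congr_dist ?_
  refine squeeze_zero (fun _ => dist_nonneg) (fun a => ?_) (tendsto_iff_dist_tendsto_zero.1 hg)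
  rw [dist_comm, dist_eq_norm, dist_eq_norm]
  exact (g a - g₀).norm_apply_le (x a)

theorem sum_smul_single (v : Eu m) : ∑ i, v i • EuclideanSpace.single i (1 : ℝ) = v := by
  ext k
  simp [Finset.sum_apply, Pi.single_apply]

variable {X : Type*} [TopologicalSpace X] {F : X → CrMap m M r}
  {χ : Fin 𝔠.N → CrFun 𝔠 r ℝ} {ξ : Fin 𝔠.N → Fin m → CrFun 𝔠 r ℝ}

/-- Where the cutoff is not zero, the point is in the chart domain and its coordinates are the
quotients `ξ / χ`, so the finitely many scalar functions recover the map. -/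
theorem tendsto_apply_of_cutoff (hχ : ∀ j, IsCutoff (𝔠.chart j) (𝔠.K j) (χ j) (ξ j))
    (hFχ : ∀ j, Continuous fun a => (χ j).compMap (F a))
    (hFξ : ∀ j i, Continuous fun a => (ξ j i).compMap (F a)) (a₀ : X) (x₀ : M) :
    Tendsto (fun a : X × M => F a.1 a.2) (𝓝 (a₀, x₀)) (𝓝 (F a₀ x₀)) := by
  obtain ⟨j, hj⟩ := mem_iUnion.1 (𝔠.cover.symm ▸ mem_univ (F a₀ x₀) : F a₀ x₀ ∈ ⋃ i, 𝔠.K i)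
  have hjs := 𝔠.K_subset j hj
  have hone : χ j (F a₀ x₀) = 1 := ((hχ j).eq_one _ hj).self_of_nhds
  have h1 : Tendsto (fun a : X × M => χ j (F a.1 a.2)) (𝓝 (a₀, x₀)) (𝓝 1) := by
    rw [← hone]
    exact CrFun.tendsto_apply (((hFχ j).comp continuous_fst).tendsto (a₀, x₀))
      (continuous_snd.tendsto (a₀, x₀))
  have h2 : ∀ i, Tendsto (fun a : X × M => ξ j i (F a.1 a.2)) (𝓝 (a₀, x₀))
      (𝓝 (𝔠.chart j (F a₀ x₀) i)) := by
    intro i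
    have h3 := (hχ j).eq_mul _ hjs i
    rw [hone, one_mul] at h3
    rw [← h3]
    exact CrFun.tendsto_apply (((hFξ j i).comp continuous_fst).tendsto (a₀, x₀))
      (continuous_snd.tendsto (a₀, x₀))
  have h4 : Tendsto (fun a : X × M => (χ j (F a.1 a.2))⁻¹ •
      ∑ i, ξ j i (F a.1 a.2) • EuclideanSpace.single i (1 : ℝ)) (𝓝 (a₀, x₀))
      (𝓝 (𝔠.chart j (F a₀ x₀))) := by
    have h5 := (h1.inv₀ one_ne_zero).smul
      (tendsto_finsetSum Finset.univ fun i _ => (h2 i).smul_const (EuclideanSpace.single i (1 : ℝ)))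
    rwa [inv_one, one_smul, sum_smul_single] at h5
  have h6 := ((𝔠.chart j).continuousAt_symm ((𝔠.chart j).map_source hjs)).tendsto.comp h4
  rw [(𝔠.chart j).left_inv hjs] at h6
  refine h6.congr' ?_
  filter_upwards [h1.eventually_ne one_ne_zero] with a ha
  have hs : F a.1 a.2 ∈ (𝔠.chart j).source := by
    by_contra hs
    exact ha ((hχ j).eq_zero _ hs)
  simp only [Function.comp_apply, (hχ j).eq_mul _ hs, mul_smul]
  rw [← Finset.smul_sum, sum_smul_single, smul_smul, inv_mul_cancel₀ ha, one_smul,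
    (𝔠.chart j).left_inv hs]

/-- Near points with `χ = 1` the map, read in charts, is a fixed change of charts composed with the
vector of the functions `ξ i ∘ F`, whose jets converge. -/
theorem jetTendsto_of_cutoff (hχ : ∀ j, IsCutoff (𝔠.chart j) (𝔠.K j) (χ j) (ξ j))
    (hFχ : ∀ j, Continuous fun a => (χ j).compMap (F a))
    (hFξ : ∀ j i, Continuous fun a => (ξ j i).compMap (F a)) (a₀ : X) {x₀ : M}
    {e e' : OpenPartialHomeomorph M (Eu m)}
    (he : e ∈ IsManifold.maximalAtlas (𝓡 m) ∞ M) (he' : e' ∈ IsManifold.maximalAtlas (𝓡 m) ∞ M)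
    (hx : x₀ ∈ e.source) (hx' : F a₀ x₀ ∈ e'.source) :
    JetTendsto (𝓝 (a₀, x₀)) r (fun a : X × M => e' ∘ F a.1 ∘ e.symm) (fun a => e a.2)
      (e' ∘ F a₀ ∘ e.symm) (e x₀) := by
  obtain ⟨j, hj⟩ := mem_iUnion.1 (𝔠.cover.symm ▸ mem_univ (F a₀ x₀) : F a₀ x₀ ∈ ⋃ i, 𝔠.K i)
  have hjs := 𝔠.K_subset j hj
  have ht := tendsto_apply_of_cutoff hχ hFχ hFξ a₀ x₀
  have h1 : JetTendsto (𝓝 (a₀, x₀)) r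
      (fun a : X × M => ∑ i, (fun t : ℝ => t • EuclideanSpace.single i (1 : ℝ)) ∘
        ((ξ j i).compMap (F a.1) ∘ e.symm)) (fun a => e a.2)
      (∑ i, (fun t : ℝ => t • EuclideanSpace.single i (1 : ℝ)) ∘
        ((ξ j i).compMap (F a₀) ∘ e.symm)) (e x₀) :=
    JetTendsto.sum _ ((e.continuousAt hx).tendsto.comp (continuous_snd.tendsto (a₀, x₀)))
      fun i _ => JetTendsto.contDiff_comp (contDiff_id.smul contDiff_const)
        (CrFun.jetTendsto (((hFξ j i).comp continuous_fst).tendsto (a₀, x₀))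
          (continuous_snd.tendsto (a₀, x₀)) he hx)
  have hgood : ∀ᶠ y in 𝓝 (F a₀ x₀), (∀ᶠ z in 𝓝 y, χ j z = 1) ∧ y ∈ e'.source :=
    (eventually_eventually_nhds.2 ((hχ j).eq_one _ hj)).and (e'.open_source.mem_nhds hx')
  have hkey : ∀ (a : X) (x : M), x ∈ e.source → (∀ᶠ z in 𝓝 (F a x), χ j z = 1) →
      F a x ∈ e'.source →
      (e' ∘ (𝔠.chart j).symm) ∘ (∑ i, (fun t : ℝ => t • EuclideanSpace.single i (1 : ℝ)) ∘
        ((ξ j i).compMap (F a) ∘ e.symm)) =ᶠ[𝓝 (e x)] e' ∘ F a ∘ e.symm := by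
    intro a x hxe hone _
    have h2 : Tendsto (fun z => F a (e.symm z)) (𝓝 (e x)) (𝓝 (F a x)) := by
      have h3 := (e.continuousAt_symm (e.map_source hxe)).tendsto
      rw [e.left_inv hxe] at h3
      exact ((F a).continuous.tendsto x).comp h3
    filter_upwards [h2.eventually hone] with z hz
    have hs : F a (e.symm z) ∈ (𝔠.chart j).source := by
      by_contra hs
      rw [(hχ j).eq_zero _ hs] at hz
      exact zero_ne_one hz
    have h4 : (∑ i, (fun t : ℝ => t • EuclideanSpace.single i (1 : ℝ)) ∘
        ((ξ j i).compMap (F a) ∘ e.symm)) z = 𝔠.chart j (F a (e.symm z)) := by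
      rw [Finset.sum_apply, ← sum_smul_single (𝔠.chart j (F a (e.symm z)))]
      refine Finset.sum_congr rfl fun i _ => ?_
      change ξ j i (F a (e.symm z)) • _ = _
      rw [(hχ j).eq_mul _ hs, hz, one_mul]
    simp only [Function.comp_apply, h4, (𝔠.chart j).left_inv hs]
  have hval : ∀ (a : X) (x : M), x ∈ e.source → χ j (F a x) = 1 →
      (∑ i, (fun t : ℝ => t • EuclideanSpace.single i (1 : ℝ)) ∘
        ((ξ j i).compMap (F a) ∘ e.symm)) (e x) = 𝔠.chart j (F a x) := by
    intro a x hxe hone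
    have hs : F a x ∈ (𝔠.chart j).source := by
      by_contra hs
      rw [(hχ j).eq_zero _ hs] at hone
      exact zero_ne_one hone
    rw [Finset.sum_apply, ← sum_smul_single (𝔠.chart j (F a x))]
    refine Finset.sum_congr rfl fun i _ => ?_
    change ξ j i (F a (e.symm (e x))) • _ = _
    rw [e.left_inv hxe, (hχ j).eq_mul _ hs, hone, one_mul]
  have hone₀ := (hχ j).eq_one _ hj
  have hev : ∀ᶠ a in 𝓝 (a₀, x₀), a.2 ∈ e.source ∧ (∀ᶠ z in 𝓝 (F a.1 a.2), χ j z = 1) ∧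
      F a.1 a.2 ∈ e'.source :=
    ((continuous_snd.tendsto (a₀, x₀)).eventually (e.open_source.mem_nhds hx)).and
      (ht.eventually hgood)
  have hc : ContDiffAt ℝ r (e' ∘ (𝔠.chart j).symm) (𝔠.chart j (F a₀ x₀)) :=
    contDiffAt_chart_change (𝔠.chart_mem j) he' hjs hx' r
  rw [← hval a₀ x₀ hx hone₀.self_of_nhds] at hc
  refine ((JetTendsto.const hc h1.tendsto_value).comp h1).congr ?_ (hkey a₀ x₀ hx hone₀ hx')
  filter_upwards [hev] with a ha using hkey a.1 a.2 ha.1 ha.2.1 ha.2.2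

/-- A family of `C^r` maps is continuous if the compositions with finitely many functions are. -/
theorem continuous_of_cutoff (hχ : ∀ j, IsCutoff (𝔠.chart j) (𝔠.K j) (χ j) (ξ j))
    (hFχ : ∀ j, Continuous fun a => (χ j).compMap (F a))
    (hFξ : ∀ j i, Continuous fun a => (ξ j i).compMap (F a)) : Continuous F := by
  rw [continuous_generateFrom_iff]
  rintro U ⟨f, e, e', K, δ, he, he', hK, hKe, hKf, hδ, rfl⟩
  rw [isOpen_iff_mem_nhds]
  rintro a₀ ⟨hmaps, hder⟩
  have hloc : ∀ x ∈ K, ∀ᶠ a in 𝓝 (a₀, x), a.2 ∈ K → F a.1 a.2 ∈ e'.source ∧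
      ∀ s ∈ Finset.range (r + 1), ‖iteratedFDeriv ℝ s (e' ∘ F a.1 ∘ e.symm) (e a.2)
        - iteratedFDeriv ℝ s (e' ∘ f ∘ e.symm) (e a.2)‖ < δ := by
    intro x hx
    have h1 := jetTendsto_of_cutoff hχ hFχ hFξ a₀ he he' (hKe hx) (hmaps hx)
    have h2 := tendsto_apply_of_cutoff hχ hFχ hFξ a₀ x
    have h3 : ContDiffAt ℝ r (e' ∘ f ∘ e.symm) (e x) :=
      f.contDiffAt_charts he he' (hKe hx) (hKf hx)
    have h4 : ∀ᶠ a in 𝓝 (a₀, x), ∀ s ∈ Finset.range (r + 1),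
        ‖iteratedFDeriv ℝ s (e' ∘ F a.1 ∘ e.symm) (e a.2)
        - iteratedFDeriv ℝ s (e' ∘ f ∘ e.symm) (e a.2)‖ < δ := by
      refine (eventually_all_finset _).2 fun s hs => ?_
      have hs' : s ≤ r := by simpa [Nat.lt_succ_iff] using hs
      have h5 : ContinuousAt (iteratedFDeriv ℝ s (e' ∘ f ∘ e.symm)) (e x) :=
        (h3.iteratedFDeriv_right (m := 0) (i := s) (by simpa using hs')).continuousAt
      have h6 := (h1.tendsto s hs').sub (h5.tendsto.comp
        ((e.continuousAt (hKe hx)).tendsto.comp (continuous_snd.tendsto (a₀, x))))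
      exact h6.norm.eventually_lt_const (hder s hs' x hx)
    filter_upwards [h2.eventually (e'.open_source.mem_nhds (hmaps hx)), h4] with a h5 h6 _
    exact ⟨h5, h6⟩
  have := hK.eventually_forall_of_forall_eventually
    (P := fun a x => x ∈ K → F a x ∈ e'.source ∧
      ∀ s ∈ Finset.range (r + 1), ‖iteratedFDeriv ℝ s (e' ∘ F a ∘ e.symm) (e x)
        - iteratedFDeriv ℝ s (e' ∘ f ∘ e.symm) (e x)‖ < δ) (x₀ := a₀) hloc
  filter_upwards [this] with a ha
  exact ⟨fun x hx => (ha x hx hx).1, fun s hs x hx =>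
    (ha x hx hx).2 s (Finset.mem_range.2 (Nat.lt_succ_of_le hs))⟩

theorem HereditarilyLindelofSpace.of_surjective {Y Z : Type*} [TopologicalSpace Y]
    [TopologicalSpace Z] [HereditarilyLindelofSpace Y] {g : Y → Z} (hg : Continuous g)
    (hs : Function.Surjective g) : HereditarilyLindelofSpace Z := by
  refine HereditarilyLindelofSpace.of_forall_isOpen fun s _ => ?_
  rw [← image_preimage_eq s hs]
  exact (HereditarilyLindelofSpace.isLindelof _).image hg

/-- The `C^r` topology on maps is generated by uncountably many sets, so countability needs an
argument. A pair is determined by finitely many `C^r` functions, collected in `J`, which take values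
in a second countable space. The inverse of `J` on its range is continuous, so the space of pairs is
a continuous image of a second countable one. This property ensures that the support of a measure
has full measure. -/
instance : HereditarilyLindelofSpace (Param ℱ 𝒲) := by
  choose χ ξ hχ using exists_isCutoff 𝔠 r
  let J : Param ℱ 𝒲 → (Fin 𝔠.N → CrFun 𝔠 r ℝ) × (Fin 𝔠.N → Fin m → CrFun 𝔠 r ℝ) × CrFun 𝔠 r ℝ :=
    fun p => (fun j => (χ j).compMap p.crMap, fun j i => (ξ j i).compMap p.crMap, p.crPot)
  have hJ : ∀ y : range J, J y.2.choose = y.1 := fun y => y.2.choose_spec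
  have h1 : Continuous fun y : range J => y.2.choose.crMap := by
    refine continuous_of_cutoff hχ (fun j => ?_) fun j i => ?_
    · have : (fun y : range J => (χ j).compMap y.2.choose.crMap) = fun y : range J => y.1.1 j :=
        funext fun y => congrFun (congrArg Prod.fst (hJ y)) j
      rw [this]
      fun_prop
    · have : (fun y : range J => (ξ j i).compMap y.2.choose.crMap)
          = fun y : range J => y.1.2.1 j i :=
        funext fun y => congrFun (congrFun (congrArg (fun z => z.2.1) (hJ y)) j) i
      rw [this]
      fun_prop
  have h2 : Continuous fun y : range J => y.2.choose.crPot := by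
    have : (fun y : range J => y.2.choose.crPot) = fun y : range J => y.1.2.2 :=
      funext fun y => congrArg (fun z => z.2.2) (hJ y)
    rw [this]
    fun_prop
  have h3 : Continuous fun y : range J => y.2.choose :=
    (h1.subtype_mk fun y => y.2.choose.1.2).prodMk (h2.subtype_mk fun y => y.2.choose.2.2)
  refine HereditarilyLindelofSpace.of_surjective h3 fun p => ⟨⟨J p, mem_range_self p⟩, ?_⟩
  set p' : Param ℱ 𝒲 := (mem_range_self p : J p ∈ range J).choose
  have hp : J p' = J p := (mem_range_self p : J p ∈ range J).choose_spec
  change p' = p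
  have hmap : p'.crMap = p.crMap := by
    refine Subtype.ext (funext fun x => ?_)
    change p'.crMap x = p.crMap x
    obtain ⟨j, hj⟩ := mem_iUnion.1 (𝔠.cover.symm ▸ mem_univ (p.crMap x) : p.crMap x ∈ ⋃ i, 𝔠.K i)
    have hone : χ j (p.crMap x) = 1 := ((hχ j).eq_one _ hj).self_of_nhds
    have h4 : χ j (p'.crMap x) = χ j (p.crMap x) :=
      congrFun (congrArg Subtype.val (congrFun (congrArg Prod.fst hp) j)) x
    have h5 : ∀ i, ξ j i (p'.crMap x) = ξ j i (p.crMap x) := fun i =>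
      congrFun (congrArg Subtype.val (congrFun (congrFun (congrArg (fun z => z.2.1) hp) j) i)) x
    have hs : p'.crMap x ∈ (𝔠.chart j).source := by
      by_contra hs
      rw [(hχ j).eq_zero _ hs, hone] at h4
      exact zero_ne_one h4
    refine (𝔠.chart j).injOn hs (𝔠.K_subset j hj) ?_
    ext i
    have h6 := h5 i
    rwa [(hχ j).eq_mul _ hs, (hχ j).eq_mul _ (𝔠.K_subset j hj), h4, hone, one_mul, one_mul] at h6
  have hpot : p'.crPot = p.crPot := congrArg (fun z => z.2.2) hp
  exact Prod.ext (Subtype.ext hmap) (Subtype.ext hpot)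

end Cutoff

end

section

/-! ### Random perturbations and the stability theorem -/

section Perturbation

variable {m : ℕ} {M : Type*} [MetricSpace M] [CompactSpace M] [ChartedSpace (Eu m) M]
  [IsManifold (𝓡 m) ∞ M] {𝔠 : ChartCover m M} {r d : ℕ}
  {ℱ : Set (CrMap m M r)} {𝒲 : Set (CrFun 𝔠 r ℝ)}

/-- Values at points and the potential separate pairs continuously. In particular singletons are
Borel sets, which is convenient for Dirac measures. -/
instance : T2Space (Param ℱ 𝒲) := by
  refine T2Space.of_injective_continuous (f := fun p : Param ℱ 𝒲 => (p.map, p.crPot))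
    (fun p p' hp => ?_) (Continuous.prodMk (continuous_pi fun x => ?_) Param.continuous_crPot)
  · exact Prod.ext (Subtype.ext (Subtype.ext (congrArg Prod.fst hp)))
      (Subtype.ext (congrArg Prod.snd hp))
  · exact continuous_iff_continuousAt.2 fun p₀ =>
      CrMap.tendsto_apply (Param.continuous_crMap.tendsto p₀) tendsto_const_nhds

theorem ae_mem_of_support_subset {μ : Measure (Param ℱ 𝒲)} {V : Set (Param ℱ 𝒲)}
    (hV : μ.support ⊆ V) : ∀ᵐ p ∂μ, p ∈ V :=
  mem_of_superset Measure.support_mem_ae hV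

/-- A random perturbation of `p₀` converges weakly to the Dirac measure at `p₀`. -/
theorem tendsto_diracProba {p₀ : Param ℱ 𝒲} {θ : ℝ → ProbabilityMeasure (Param ℱ 𝒲)}
    (hθ : IsRandomPerturbation p₀ θ) : Tendsto θ (𝓝[>] 0) (𝓝 (diracProba p₀)) := by
  obtain ⟨V, -, hmono, hsupp, -, hsmall⟩ := hθ
  rw [ProbabilityMeasure.tendsto_iff_forall_integral_tendsto]
  -- The neighbourhood is the set where the test function is close to its value at `p₀`; for small
  -- `ε` the whole support lies in it.
  intro f
  have h0 : ∫ p, f p ∂(diracProba p₀ : Measure (Param ℱ 𝒲)) = f p₀ := integral_dirac _ _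
  rw [h0, Metric.tendsto_nhds]
  intro η hη
  obtain ⟨ε₁, hε₁, hVU⟩ := hsmall {p | ‖f p - f p₀‖ < η / 2} (by
    have := Metric.tendsto_nhds.1 (f.continuous.tendsto p₀) (η / 2) (half_pos hη)
    simp only [dist_eq_norm] at this; exact this)
  filter_upwards [Ioc_mem_nhdsGT hε₁.1] with ε hε
  have hε1 : ε ∈ Ioc (0 : ℝ) 1 := ⟨hε.1, hε.2.trans hε₁.2⟩
  have hae : ∀ᵐ p ∂(θ ε : Measure (Param ℱ 𝒲)), ‖f p - f p₀‖ ≤ η / 2 :=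
    (ae_mem_of_support_subset (hsupp ε hε1)).mono fun p hp =>
      (hVU (hmono hε1 hε₁ hε.2 hp)).le
  have h1 : ∫ p, f p ∂(θ ε : Measure (Param ℱ 𝒲)) - f p₀
      = ∫ p, (f p - f p₀) ∂(θ ε : Measure (Param ℱ 𝒲)) := by
    rw [integral_sub (f.integrable _) (integrable_const _)]
    simp
  rw [dist_eq_norm, h1]
  refine (norm_integral_le_of_norm_le_const hae).trans_lt ?_
  simp only [probReal_univ, mul_one]
  exact half_lt_self hη

theorem integratedTransfer_diracProba {𝕜 : Type} [RCLike 𝕜] (p₀ : Param ℱ 𝒲) :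
    integratedTransfer (𝕜 := 𝕜) (diracProba p₀ : Measure (Param ℱ 𝒲)) = transfer p₀.map p₀.pot :=
  funext fun _ => funext fun _ => integral_dirac _ _

theorem CrFun.norm_derivAt_le_derivNorm {𝕜 : Type} [RCLike 𝕜] (g : CrFun 𝔠 r 𝕜) {i : Fin 𝔠.N}
    {s : ℕ} (hs : s ≤ r) {x : M} (hx : x ∈ 𝔠.K i) :
    ‖g.derivAt i s x‖ ≤ g.derivNorm ⟨s, Nat.lt_succ_of_le hs⟩ :=
  (ContinuousMap.norm_coe_le_norm
    (α := 𝔠.K i) (E := ContinuousMultilinearMap ℝ (fun _ : Fin s => Eu m) 𝕜)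
    (jet i ⟨s, Nat.lt_succ_of_le hs⟩ g) ⟨x, hx⟩).trans
    (norm_le_pi_norm (fun i => jet i ⟨s, Nat.lt_succ_of_le hs⟩ g) i)

theorem IsAdmissiblePotential.le_potMin_add {εφ εφ' : ℝ} {p : Param ℱ 𝒲}
    (hp : IsAdmissiblePotential εφ εφ' p.crPot) (x : M) : p.pot x ≤ p.potMin + εφ := by
  have h1 : p.pot x ≤ ⨆ x, p.pot x := le_ciSup p.bddAbove_pot x
  have h2 : (⨆ x, p.pot x) - p.potMin < εφ := hp.1
  linarith

namespace IsCoveringFamily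

/-- Uniform bounds hold near the unperturbed pair, and everywhere if the family is compact. -/
theorem exists_isBounded (hM : IsLengthManifold m M) (h : IsCoveringFamily d ℱ)
    (hr : 1 ≤ r) {εφ κ : ℝ} (hexp : ∀ p : Param ℱ 𝒲, HasExpansion d r κ p.map)
    (hosc : ∀ (p : Param ℱ 𝒲) (x : M), p.pot x ≤ p.potMin + εφ) (p₀ : Param ℱ 𝒲) :
    ∃ C, 0 ≤ C ∧ ∃ U ∈ 𝓝 p₀, (CompactSpace (Param ℱ 𝒲) → U = univ) ∧
      ∀ p ∈ U, h.IsBounded hr ℝ εφ κ C p ∧ h.IsBounded hr ℂ εφ κ C p := by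
  have hloc : ∀ p₀ : Param ℱ 𝒲, ∃ C, 0 ≤ C ∧ ∀ᶠ p in 𝓝 p₀,
      h.IsBounded hr ℝ εφ κ C p ∧ h.IsBounded hr ℂ εφ κ C p := by
    intro p₀
    obtain ⟨C₁, h1⟩ := exists_eventually_isBounded (𝕜 := ℝ) hM h hr hexp hosc p₀
    obtain ⟨C₂, h2⟩ := exists_eventually_isBounded (𝕜 := ℂ) hM h hr hexp hosc p₀
    refine ⟨max C₁ C₂, h1.self_of_nhds.nonneg.trans (le_max_left _ _), ?_⟩
    filter_upwards [h1, h2] with p h1 h2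
    exact ⟨h1.mono (le_max_left _ _), h2.mono (le_max_right _ _)⟩
  -- In the compact case the local bounds combine to a global one and `U` is the whole space, which
  -- later allows `ε₀ = 1`.
  by_cases hcomp : CompactSpace (Param ℱ 𝒲)
  · obtain ⟨C, hC0, hC⟩ := exists_forall_of_eventually (isCompact_univ (X := Param ℱ 𝒲))
      (P := fun C p => h.IsBounded hr ℝ εφ κ C p ∧ h.IsBounded hr ℂ εφ κ C p)
      (fun p C C' hCC hp => ⟨hp.1.mono hCC, hp.2.mono hCC⟩) fun p _ => by
        obtain ⟨C, -, hC⟩ := hloc p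
        exact ⟨C, nhdsWithin_le_nhds hC⟩
    exact ⟨C, hC0, univ, univ_mem, fun _ => rfl, hC⟩
  · obtain ⟨C, hC0, hC⟩ := hloc p₀
    exact ⟨C, hC0, _, hC, fun hc => absurd hc hcomp, fun p hp => hp⟩

end IsCoveringFamily

/-- Spectral stability for admissible families. -/
theorem exists_hasSpectralStability [Nonempty M] [MeasurableSpace M] [BorelSpace M]
    (hM : IsLengthManifold m M) (h : IsCoveringFamily d ℱ) (hr : 1 ≤ r) {εφ κ b : ℝ}
    (hκ : 0 < κ) (hκ1 : Real.exp εφ * (κ / d) < 1) (hb : 0 ≤ b)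
    (hexp : ∀ p : Param ℱ 𝒲, HasExpansion d r κ p.map)
    (hpair : ∀ p : Param ℱ 𝒲, HasPairing d κ p.map)
    (hlip : ∀ (p : Param ℱ 𝒲) (x y : M), |p.pot x - p.pot y| ≤ b * dist x y)
    (hosc : ∀ (p : Param ℱ 𝒲) (x : M), p.pot x ≤ p.potMin + εφ) {p₀ : Param ℱ 𝒲}
    {θ : ℝ → ProbabilityMeasure (Param ℱ 𝒲)} (hθ : IsRandomPerturbation p₀ θ) :
    ∃ ε₀ ∈ Ioc (0 : ℝ) 1, (CompactSpace (Param ℱ 𝒲) → ε₀ = 1) ∧ HasSpectralStability p₀ θ ε₀ := by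
  obtain ⟨C, hC0, U, hU, hUc, hUb⟩ := h.exists_isBounded hM hr hexp hosc p₀
  obtain ⟨l, u, hdata, hl, hu⟩ :=
    h.exists_continuousOn_leading hM hr hκ hκ1 hC0 hb hpair hlip hosc
  have hlim := tendsto_diracProba hθ
  obtain ⟨V, -, hmono, hsupp, -, hsmall⟩ := hθ
  obtain ⟨ε₀, hε₀, hε₀c, hVU⟩ : ∃ ε₀ ∈ Ioc (0 : ℝ) 1, (CompactSpace (Param ℱ 𝒲) → ε₀ = 1) ∧
      V ε₀ ⊆ U := by
    by_cases hcomp : CompactSpace (Param ℱ 𝒲)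
    · exact ⟨1, by simp, fun _ => rfl, by rw [hUc hcomp]; exact subset_univ _⟩
    · obtain ⟨ε₀, hε₀, hV⟩ := hsmall U hU
      exact ⟨ε₀, hε₀, fun hc => absurd hc hcomp, hV⟩
  -- The supports increase only within `V ε₀ ⊆ U`, so one constant `C` serves for all noise levels
  -- up to `ε₀`.
  have hgood : ∀ ε ∈ Ioc 0 ε₀, θ ε ∈ h.boundedMeasures hr 𝒲 εφ κ C := by
    intro ε hε
    have hε1 : ε ∈ Ioc (0 : ℝ) 1 := ⟨hε.1, hε.2.trans hε₀.2⟩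
    have hae := (ae_mem_of_support_subset (hsupp ε hε1)).mono fun p hp =>
      hUb p (hVU (hmono hε1 hε₀ hε.2 hp))
    exact ⟨hae.mono fun p hp => hp.1, hae.mono fun p hp => hp.2⟩
  have hgood₀ : diracProba p₀ ∈ h.boundedMeasures hr 𝒲 εφ κ C := by
    have h1 := hUb p₀ (mem_of_mem_nhds hU)
    refine ⟨?_, ?_⟩
    · change ∀ᵐ p ∂(Measure.dirac p₀), _
      rw [ae_dirac_eq]
      exact h1.1
    · change ∀ᵐ p ∂(Measure.dirac p₀), _
      rw [ae_dirac_eq]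
      exact h1.2
  have hlim' : Tendsto θ (𝓝[>] 0) (𝓝[h.boundedMeasures hr 𝒲 εφ κ C] (diracProba p₀)) := by
    refine tendsto_nhdsWithin_iff.2 ⟨hlim, ?_⟩
    filter_upwards [Ioc_mem_nhdsGT hε₀.1] with ε hε using hgood ε hε
  refine ⟨ε₀, hε₀, hε₀c, l (diracProba p₀), u (diracProba p₀), fun ε => l (θ ε),
    fun ε => u (θ ε), ?_, fun ε hε => ⟨fun g x => ?_, hdata _ (hgood ε hε)⟩, ?_, ?_,
    fun ε hε hc => ⟨?_, ?_⟩⟩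
  · have h1 := hdata _ hgood₀
    rwa [integratedTransfer_diracProba, integratedTransfer_diracProba] at h1
  · exact h.integrable_transfer hr ((hgood ε hε).1.mono fun p hp => hp.pot_le) g x
  · exact (hl _ hgood₀).tendsto.comp hlim'
  · exact (hu _ hgood₀).tendsto.comp hlim'
  · exact (hl _ (hgood ε hε)).comp hc hgood
  · exact (hu _ (hgood ε hε)).comp hc hgood

end Perturbation

end

end RandomSpectral

theorem mainTheorem6 {m : ℕ} {M : Type*} [MetricSpace M] [CompactSpace M] [ConnectedSpace M]
    [MeasurableSpace M] [BorelSpace M]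
    [ChartedSpace (RandomSpectral.Eu m) M] [IsManifold (𝓡 m) ∞ M]
    [Bundle.RiemannianBundle (fun x : M => TangentSpace (𝓡 m) x)]
    [IsContMDiffRiemannianBundle (𝓡 m) ∞ (RandomSpectral.Eu m)
      (fun x : M => TangentSpace (𝓡 m) x)]
    [IsRiemannianManifold (𝓡 m) M]
    (𝔠 : RandomSpectral.ChartCover m M) (r : ℕ) (hr : 1 ≤ r)
    (d q : ℕ) (hq : q < d) (σ L εφ εφ' : ℝ) (hσ : 1 < σ) (hL : 1 ≤ L) (hεφ : 0 < εφ)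
    (hεφ' : 0 < εφ')
    (hΞ : Real.exp εφ * ((q * L ^ r + (d - q) * σ⁻¹) / d) < 1)
    (ℱ : Set (RandomSpectral.CrMap m M r)) (𝒲 : Set (RandomSpectral.CrFun 𝔠 r ℝ))
    (hℱ : ∀ f ∈ ℱ, IsLocalDiffeomorph (𝓡 m) (𝓡 m) r f ∧
      RandomSpectral.IsAdmissibleMap d q σ L f)
    (h𝒲 : ∀ φ ∈ 𝒲, RandomSpectral.IsAdmissiblePotential εφ εφ' φ)
    (p₀ : RandomSpectral.Param ℱ 𝒲)
    (θ : ℝ → ProbabilityMeasure (RandomSpectral.Param ℱ 𝒲))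
    (hθ : RandomSpectral.IsRandomPerturbation p₀ θ) :
    ∃ ε₀ ∈ Ioc (0 : ℝ) 1, (CompactSpace (RandomSpectral.Param ℱ 𝒲) → ε₀ = 1) ∧
      RandomSpectral.HasSpectralStability p₀ θ ε₀ := by
  have hqd : (0 : ℝ) < d - q := sub_pos.2 (by exact_mod_cast hq)
  have hκ : 0 < q * L ^ r + (d - q) * σ⁻¹ := by positivity
  have hM := RandomSpectral.isLengthManifold m M
  have h : RandomSpectral.IsCoveringFamily d ℱ :=
    ⟨by omega, fun f hf => (hℱ f hf).1, fun f hf => (hℱ f hf).2.degree⟩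
  have hexp (p : RandomSpectral.Param ℱ 𝒲) :
      RandomSpectral.HasExpansion d r (q * L ^ r + (d - q) * σ⁻¹) p.map :=
    (hℱ _ p.1.2).2.exists_expansion hσ hL
  obtain ⟨K, hK0, hK⟩ := RandomSpectral.exists_lipschitz_bound hM 𝔠 hr ℝ
  -- The common Lipschitz constant of the potentials is `b = K εφ'`, from the bound on their first
  -- derivatives in (P').
  refine RandomSpectral.exists_hasSpectralStability hM h hr hκ hΞ (mul_nonneg hK0 hεφ'.le) hexp
    (fun p => ?_) (fun p => ?_) (fun p x => (h𝒲 _ p.2.2).le_potMin_add x) hθ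
  -- The matching of fibres uses the sum of the Lipschitz constants themselves, that is, the case `s
  -- = 1`.
  · obtain ⟨ℓ, -, hℓ, hsum⟩ := hexp p
    exact hM.hasPairing hr h.pos p.crMap (h.localDiffeo _ p.1.2) (h.degree _ p.1.2) hκ.le hℓ
      fun x b hb => by simpa using hsum x b hb 1 le_rfl hr
  · exact hK p.crPot εφ' hεφ'.le fun i x hx =>
      (RandomSpectral.CrFun.norm_derivAt_le_derivNorm _ hr hx).trans
        ((h𝒲 _ p.2.2).2 ⟨1, Nat.lt_succ_of_le hr⟩ le_rfl).le
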